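/- Throughout, definitions are made inside $\mathsf{RCA}_0$; $[0,1]_{\mathbb Q}=[0,1]\cap\mathbb Q$. A set $Z\subseteq[0,1]_{\mathbb Q}\times\mathbb Q$ is a *rational presentation* if (i) for every $p\in[0,1]_{\mathbb Q}$ there are $q,q'\in\mathbb Q$ with $(p,q)\in Z$ and $(p,q')\notin Z$, and (ii) for all $p\in[0,1]_{\mathbb Q}$ and rationals $q<q'$, $(p,q)\in Z$ implies $(p,q')\in Z$. It presents the function $g_Z:[0,1]_{\mathbb Q}\to\mathbb R$, $g_Z(p)=\inf\{q\in\mathbb Q:(p,q)\in Z\}$, and every function on $[0,1]$ extending $g_Z$. Functions of the form $g_Z$ are called rationally presented. A function $f$ on $[0,1]$ is of *bounded variation* if there is $k\in\mathbb N$ with $\sum_{i<n}|f(t_{i+1})-f(t_i)|\le k$ for every partition $0=t_0<t_1<\dots<t_n=1$; for functions on $[0,1]_{\mathbb Q}$ only partitions with rational points are considered. A *continuous* function $f:[0,1]\to\mathbb R$ is given by a code in the usual sense of second-order arithmetic. An *effectively uniformly continuous* function $f:[0,1]\to\mathbb R$ is given by a Cauchy name: a sequence $(f_s)_{s\in\mathbb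 N}$ of polygonal functions with rational breakpoints such that $\|f_s-f_r\|_\infty\le 2^{-s}$ for all $r>s$, with $f=\lim_s f_s$. For functions $f,g$ whose domains contain $[0,1]_{\mathbb Q}$, write $f\le^*_{\mathsf{slope}}g$ if $f(y)-f(x)\le g(y)-g(x)$ for all $x<y$ in $[0,1]_{\mathbb Q}$. **Theorem.** The following are equivalent over $\mathsf{RCA}_0$ (that is, in every model of $\mathsf{RCA}_0$). 1. $\mathsf{WKL}_0$. 2. $\mathsf{Jordan}_{\mathbb Q}$: for every rationally presented function $f:[0,1]_{\mathbb Q}\to\mathbb R$ of bounded variation there is a rationally presented non-decreasing function $g:[0,1]_{\mathbb Q}\to\mathbb R$ such that $f\le^*_{\mathsf{slope}}g$. 3. For every continuous function $f:[0,1]\to\mathbb R$ of bounded variation there is a rationally presented non-decreasing function $g:[0,1]_{\mathbb Q}\to\mathbb R$ such that $f\le^*_{\mathsf{slope}}g$. 4. For every effectively uniformly continuous function $f:[0,1]\to\mathbb R$ of bounded variation which has a rational presentation there is a rationally presented non-decreasing function $g:[0,1]_{\mathbb Q}\to\mathbb R$ such that $f\le^*_{\mathsf{slope}}g$. -/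

import Mathlib

/-! Structures for second-order arithmetic are pairs `(M, S)`: a set `M` of numbers with
`0, 1, +, *, <`, and a collection `S` of subsets of `M` over which the set variables range.
All quantifiers below range over numbers (elements of `M`) or over sets in `S`; functions and
sequences are quantified over as functions whose graph, coded by the pairing function, is in `S`. -/

namespace SOA

universe u

/-! ### The language and the system RCA₀ -/

/-- Numerical terms (variables are de Bruijn indices). -/
inductive NumTerm : Type
  | var (i : ℕ) : NumTerm
  | zero : NumTerm
  | one : NumTerm
  | add (s t : NumTerm) : NumTerm
  | mul (s t : NumTerm) : NumTerm

/-- `Σ⁰₀` formulas: all number quantifiers are bounded, there are no set quantifiers, free set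
variables are allowed. In `ball t φ`, that is `∀ x < t, φ`, the variable `x` is index `0` in `φ`
and does not occur in `t`. -/
inductive BddFormula : Type
  | eq (s t : NumTerm) : BddFormula
  | lt (s t : NumTerm) : BddFormula
  | mem (t : NumTerm) (X : ℕ) : BddFormula
  | neg (φ : BddFormula) : BddFormula
  | and (φ ψ : BddFormula) : BddFormula
  | ball (t : NumTerm) (φ : BddFormula) : BddFormula

section Language

variable {M : Type u} [Zero M] [One M] [Add M] [Mul M] [LT M]

/-- Assign `a` to variable `0` and shift the other assignments. -/
def push (a : M) (e : ℕ → M) : ℕ → M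
  | 0 => a
  | n + 1 => e n

/-- Value of a term. -/
def NumTerm.eval (e : ℕ → M) : NumTerm → M
  | .var i => e i
  | .zero => 0
  | .one => 1
  | .add s t => s.eval e + t.eval e
  | .mul s t => s.eval e * t.eval e

/-- Truth of a `Σ⁰₀` formula under the number assignment `e` and the set assignment `A`. -/
def BddFormula.Sat (A : ℕ → Set M) : BddFormula → (ℕ → M) → Prop
  | .eq s t, e => s.eval e = t.eval e
  | .lt s t, e => s.eval e < t.eval e
  | .mem t X, e => t.eval e ∈ A X
  | .neg φ, e => ¬ φ.Sat A e
  | .and φ ψ, e => φ.Sat A e ∧ ψ.Sat A e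
  | .ball t φ, e => ∀ a, a < t.eval e → φ.Sat A (push a e)

/-- The property of `n` defined by the `Σ⁰₁` formula `∃ y, φ(y, n)` with parameters `e`, `A`. -/
def Sigma1 (φ : BddFormula) (A : ℕ → Set M) (e : ℕ → M) (n : M) : Prop :=
  ∃ y, φ.Sat A (push y (push n e))

/-- The property of `n` defined by the `Π⁰₁` formula `∀ y, φ(y, n)` with parameters `e`, `A`. -/
def Pi1 (φ : BddFormula) (A : ℕ → Set M) (e : ℕ → M) (n : M) : Prop :=
  ∀ y, φ.Sat A (push y (push n e))

/-- `(M, S)` is a model of RCA₀: the basic axioms, `Σ⁰₁` induction and `Δ⁰₁` comprehension,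
with number parameters from `M` and set parameters from `S`. The range of the set variables
is non-empty, as for every structure of first-order logic. -/
structure RCA0 (S : Set (Set M)) : Prop where
  sets_nonempty : S.Nonempty
  succ_ne_zero : ∀ n : M, n + 1 ≠ 0
  succ_inj : ∀ m n : M, m + 1 = n + 1 → m = n
  add_zero : ∀ m : M, m + 0 = m
  add_succ : ∀ m n : M, m + (n + 1) = (m + n) + 1
  mul_zero : ∀ m : M, m * 0 = 0
  mul_succ : ∀ m n : M, m * (n + 1) = m * n + m
  not_lt_zero : ∀ m : M, ¬ m < 0
  lt_succ : ∀ m n : M, m < n + 1 ↔ m < n ∨ m = n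
  sigma1_induction : ∀ (φ : BddFormula) (A : ℕ → Set M) (e : ℕ → M), (∀ i, A i ∈ S) →
    Sigma1 φ A e 0 → (∀ n, Sigma1 φ A e n → Sigma1 φ A e (n + 1)) → ∀ n, Sigma1 φ A e n
  delta1_comprehension : ∀ (φ ψ : BddFormula) (A : ℕ → Set M) (e : ℕ → M), (∀ i, A i ∈ S) →
    (∀ n, Sigma1 φ A e n ↔ Pi1 ψ A e n) → {n | Sigma1 φ A e n} ∈ S

end Language

/-! ### Functions and sequences in the model -/

section Coding

variable {M : Type u} [One M] [Add M] [Mul M]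

/-- The pairing function `(a, b) ↦ (a + b)² + a`. -/
def pair (a b : M) : M := (a + b) * (a + b) + a

/-- The function `f` belongs to the model `(M, S)`, that is, its graph does. -/
def IsFun (S : Set (Set M)) (f : M → M) : Prop :=
  {z | ∃ n, z = pair n (f n)} ∈ S

/-- The function `f` of two variables belongs to the model `(M, S)`. -/
def IsFun₂ (S : Set (Set M)) (f : M → M → M) : Prop :=
  {z | ∃ i n, z = pair (pair i n) (f i n)} ∈ S

end Coding

/-! ### Weak König's lemma

A finite binary string is identified with the positive number whose binary expansion is `1`
followed by the string: the empty string is `1`, and the two one-digit extensions of the string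
`n` are `2n` and `2n + 1`. -/

section WKL

variable {M : Type u} [Zero M] [One M] [Add M] [Mul M] [LT M]

/-- `T` is a set of finite binary strings that is closed under initial segments. -/
def IsBinTree (T : Set M) : Prop :=
  (∀ n ∈ T, n ≠ 0) ∧ ∀ n, n ≠ 0 → (n + n ∈ T ∨ n + n + 1 ∈ T) → n ∈ T

/-- `T` is infinite, that is, unbounded. -/
def IsInfinite (T : Set M) : Prop := ∀ m, ∃ n ∈ T, m < n

/-- `c n` is the string of the first `n` digits of the characteristic function of `Z`. -/
def IsRestriction (Z : Set M) (c : M → M) : Prop :=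
  c 0 = 1 ∧ ∀ n, (n ∉ Z → c (n + 1) = c n + c n) ∧ (n ∈ Z → c (n + 1) = c n + c n + 1)

/-- The set `Z`, read as an infinite binary sequence, is a path of `T`. -/
def IsPath (S : Set (Set M)) (T Z : Set M) : Prop :=
  ∃ c, IsFun S c ∧ IsRestriction Z c ∧ ∀ n, c n ∈ T

/-- `(M, S)` is a model of WKL₀: RCA₀ plus "every infinite binary tree has a path". -/
def WKL0 (S : Set (Set M)) : Prop :=
  RCA0 S ∧ ∀ T ∈ S, IsBinTree T → IsInfinite T → ∃ Z ∈ S, IsPath S T Z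

end WKL

/-! ### Rational numbers of the model -/

/-- A representative of a rational number, namely of `(pos - neg) / (denPred + 1)`. -/
@[ext] structure Frac (M : Type u) where
  pos : M
  neg : M
  denPred : M

namespace Frac

variable {M : Type u} [Zero M] [One M] [Add M] [Mul M] [LT M]

instance : Zero (Frac M) := ⟨⟨0, 0, 0⟩⟩

instance : One (Frac M) := ⟨⟨1, 0, 0⟩⟩

/-- The number `n` as a rational number. -/
def ofNum (n : M) : Frac M := ⟨n, 0, 0⟩

instance : Add (Frac M) :=
  ⟨fun x y => ⟨x.pos * (y.denPred + 1) + y.pos * (x.denPred + 1),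
    x.neg * (y.denPred + 1) + y.neg * (x.denPred + 1),
    x.denPred * y.denPred + x.denPred + y.denPred⟩⟩

instance : Neg (Frac M) := ⟨fun x => ⟨x.neg, x.pos, x.denPred⟩⟩

instance : Sub (Frac M) := ⟨fun x y => x + -y⟩

instance : Mul (Frac M) :=
  ⟨fun x y => ⟨x.pos * y.pos + x.neg * y.neg, x.pos * y.neg + x.neg * y.pos,
    x.denPred * y.denPred + x.denPred + y.denPred⟩⟩

/-- The two representatives represent the same rational number. -/
def Eqv (x y : Frac M) : Prop :=
  x.pos * (y.denPred + 1) + y.neg * (x.denPred + 1) =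
    y.pos * (x.denPred + 1) + x.neg * (y.denPred + 1)

instance : LT (Frac M) :=
  ⟨fun x y => x.pos * (y.denPred + 1) + y.neg * (x.denPred + 1) <
    y.pos * (x.denPred + 1) + x.neg * (y.denPred + 1)⟩

instance : LE (Frac M) := ⟨fun x y => x < y ∨ Eqv x y⟩

open Classical in
/-- Absolute value. -/
noncomputable def abs (x : Frac M) : Frac M := if x.pos < x.neg then -x else x

/-- The number coding a representative. -/
def code (x : Frac M) : M := pair (pair x.pos x.neg) x.denPred

/-- `x` is in `[0,1]_ℚ`. -/
def InUnit (x : Frac M) : Prop := 0 ≤ x ∧ x ≤ 1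

end Frac

section Analysis

variable {M : Type u} [Zero M] [One M] [Add M] [Mul M] [LT M] (S : Set (Set M))

/-! ### Real numbers of the model

A real number is a sequence `(q_k)` of rational numbers in the model with
`|q_k - q_{k+i}| ≤ 2^{-k}` for all `k`, `i`. -/

/-- `d` is the function `n ↦ 2 ^ n - 1` of the model. -/
def IsTwoPowPred (d : M → M) : Prop :=
  IsFun S d ∧ d 0 = 0 ∧ ∀ n, d (n + 1) = d n + d n + 1

/-- The rational number `2 ^ (-n)`. (The function `n ↦ 2 ^ n - 1` exists and is unique in every
model of RCA₀.) -/
noncomputable def twoNegPow (n : M) : Frac M :=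
  ⟨1, 0, Classical.epsilon (IsTwoPowPred S) n⟩

/-- `x` is a real number of the model. -/
def IsReal (x : M → Frac M) : Prop :=
  IsFun S (fun k => (x k).code) ∧ ∀ k i, (x k - x (k + i)).abs ≤ twoNegPow S k

/-- `(x i)` is a sequence of real numbers that belongs to the model. -/
def IsRealSeq (x : M → M → Frac M) : Prop :=
  IsFun₂ S (fun i k => (x i k).code) ∧ ∀ i, IsReal S (x i)

/-- The order of real numbers: `x ≤ y` iff `x_k ≤ y_k + 2 · 2^{-k}` for all `k`. -/
def RLe (x y : M → Frac M) : Prop :=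
  ∀ k, x k ≤ y k + (twoNegPow S k + twoNegPow S k)

/-- `x < y` for real numbers. -/
def RLt (x y : M → Frac M) : Prop := ¬ RLe S y x

/-- Equality of real numbers. -/
def REq (x y : M → Frac M) : Prop := RLe S x y ∧ RLe S y x

/-- A rational number as a real number. -/
def rconst (q : Frac M) : M → Frac M := fun _ => q

/-- Sum of real numbers. -/
def radd (x y : M → Frac M) : M → Frac M := fun k => x (k + 1) + y (k + 1)

/-- Difference of real numbers. -/
def rsub (x y : M → Frac M) : M → Frac M := fun k => x (k + 1) - y (k + 1)

/-- Absolute value of a real number. -/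
noncomputable def rabs (x : M → Frac M) : M → Frac M := fun k => (x k).abs

/-- The real number `x` is in `[0,1]`. -/
def RInUnit (x : M → Frac M) : Prop :=
  IsReal S x ∧ RLe S (rconst 0) x ∧ RLe S x (rconst 1)

/-! ### Bounded variation -/

/-- `|y_1 - y_0| + ⋯ + |y_n - y_{n-1}| ≤ k`, for a sequence `(y_i)` of real numbers. The sum is
the last term of the sequence `v_0 = 0`, `v_{i+1} = v_i + |y_{i+1} - y_i|` of real numbers. -/
def VarSumLe (n : M) (y : M → M → Frac M) (k : M) : Prop :=
  ∀ v, IsRealSeq S v → REq S (v 0) (rconst 0) →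
    (∀ i, i < n → REq S (v (i + 1)) (radd (v i) (rabs (rsub (y (i + 1)) (y i))))) →
    RLe S (v n) (rconst (Frac.ofNum k))

/-- Bounded variation of a function `f : [0,1] → ℝ` with graph `V` (that is, `V x y` says
`f(x) = y` for real numbers `x`, `y`): some `k` bounds `V(f, Π)` for all partitions
`Π = {t_0 < ⋯ < t_n}` of `[0,1]`. -/
def IsBV (V : (M → Frac M) → (M → Frac M) → Prop) : Prop :=
  ∃ k : M, ∀ (n : M) (t y : M → M → Frac M), IsRealSeq S t → IsRealSeq S y →
    REq S (t 0) (rconst 0) → REq S (t n) (rconst 1) → (∀ i, i < n → RLt S (t i) (t (i + 1))) →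
    (∀ i, i < n ∨ i = n → V (t i) (y i)) → VarSumLe S n y k

/-- Bounded variation of a function `f : [0,1]_ℚ → ℝ` with graph `V`, through partitions with
rational points. -/
def IsBVRat (V : Frac M → (M → Frac M) → Prop) : Prop :=
  ∃ k : M, ∀ (n : M) (t : M → Frac M) (y : M → M → Frac M), IsFun S (fun i => (t i).code) → IsRealSeq S y →
    (t 0).Eqv 0 → (t n).Eqv 1 → (∀ i, i < n → t i < t (i + 1)) →
    (∀ i, i < n ∨ i = n → V (t i) (y i)) → VarSumLe S n y k

/-! ### Rational presentations -/

/-- The pair `(p, q)` of rational numbers belongs to `Z`. -/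
def PairMem (Z : Set M) (p q : Frac M) : Prop := pair p.code q.code ∈ Z

/-- `Z` is a rational presentation. The first clause says that `Z` is a set of pairs of rational
numbers, so that membership does not depend on the representatives. -/
structure IsRatPres (Z : Set M) : Prop where
  congr : ∀ p p' q q' : Frac M, p.InUnit → p.Eqv p' → q.Eqv q' → PairMem Z p q → PairMem Z p' q'
  exists_both : ∀ p : Frac M, p.InUnit → (∃ q, PairMem Z p q) ∧ ∃ q', ¬ PairMem Z p q'
  upward : ∀ p q q' : Frac M, p.InUnit → q < q' → PairMem Z p q → PairMem Z p q'

/-- The graph of the function `g_Z : [0,1]_ℚ → ℝ` presented by `Z`: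
`g_Z(p) = y` iff `y = inf {q : (p, q) ∈ Z}`. -/
def RatVal (Z : Set M) (p : Frac M) (y : M → Frac M) : Prop :=
  p.InUnit ∧ IsReal S y ∧ (∀ q, PairMem Z p q → RLe S y (rconst q)) ∧
    ∀ r : Frac M, (∀ q, PairMem Z p q → r ≤ q) → RLe S (rconst r) y

/-- The graph of the restriction to `[0,1]_ℚ` of the function with graph `V`. -/
def restrictRat (V : (M → Frac M) → (M → Frac M) → Prop) (p : Frac M) (y : M → Frac M) : Prop :=
  V (rconst p) y

/-- `Z` is a rational presentation of the function on `[0,1]` with graph `V`. -/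
def Presents (Z : Set M) (V : (M → Frac M) → (M → Frac M) → Prop) : Prop :=
  IsRatPres Z ∧ ∀ p : Frac M, p.InUnit → ∀ y, restrictRat V p y → RatVal S Z p y

/-- The function `[0,1]_ℚ → ℝ` with graph `V` is non-decreasing. -/
def NonDecreasing (V : Frac M → (M → Frac M) → Prop) : Prop :=
  ∀ x y : Frac M, x.InUnit → y.InUnit → x < y → ∀ a b, V x a → V y b → RLe S a b

/-- `f ≤*_slope g` for functions `f`, `g` on `[0,1]_ℚ` with graphs `V`, `W`. -/
def SlopeLe (V W : Frac M → (M → Frac M) → Prop) : Prop :=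
  ∀ x y : Frac M, x.InUnit → y.InUnit → x < y →
    ∀ a b c d, V x a → V y b → W x c → W y d → RLe S (rsub b a) (rsub d c)

/-- There is a rationally presented non-decreasing `g : [0,1]_ℚ → ℝ` with `f ≤*_slope g`, where
`f` is the function with graph `V`. -/
def HasJordan (V : Frac M → (M → Frac M) → Prop) : Prop :=
  ∃ G ∈ S, IsRatPres G ∧ NonDecreasing S (RatVal S G) ∧ SlopeLe S V (RatVal S G)

/-! ### Continuous functions on `[0,1]`

The usual codes of continuous functions in RCA₀: a set of quintuples `(n, a, r, b, s)`; such a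
quintuple says that the image of the open ball with centre `a` and radius `r` lies in the closed
ball with centre `b` and radius `s`. -/

/-- The quintuple `(n, a, r, b, s)` belongs to `Φ`. -/
def QuintMem (Φ : Set M) (n : M) (a r b s : Frac M) : Prop :=
  pair n (pair a.code (pair r.code (pair b.code s.code))) ∈ Φ

/-- `(a, r) Φ (b, s)`, where `a ∈ [0,1]_ℚ`, `b ∈ ℚ` and `r`, `s` are positive rationals. -/
def CodeRel (Φ : Set M) (a r b s : Frac M) : Prop :=
  a.InUnit ∧ 0 < r ∧ 0 < s ∧ ∃ n, QuintMem Φ n a r b s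

/-- `f(x) = y` for the function `f` coded by `Φ`. -/
def ContVal (Φ : Set M) (x y : M → Frac M) : Prop :=
  RInUnit S x ∧ IsReal S y ∧
    ∀ a r b s, CodeRel Φ a r b s → RLt S (rabs (rsub x (rconst a))) (rconst r) →
      RLe S (rabs (rsub y (rconst b))) (rconst s)

/-- `Φ` is a code of a (total) continuous function `[0,1] → ℝ`. -/
structure IsContCode (Φ : Set M) : Prop where
  congr : ∀ n, ∀ a a' r r' b b' s s' : Frac M, a.Eqv a' → r.Eqv r' → b.Eqv b' → s.Eqv s' →
    QuintMem Φ n a r b s → QuintMem Φ n a' r' b' s'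
  compatible : ∀ a r b s b' s' : Frac M, CodeRel Φ a r b s → CodeRel Φ a r b' s' →
    (b - b').abs ≤ s + s'
  shrink : ∀ a r b s a' r' : Frac M, CodeRel Φ a r b s → a'.InUnit → 0 < r' →
    (a - a').abs + r' < r → CodeRel Φ a' r' b s
  enlarge : ∀ a r b s b' s' : Frac M, CodeRel Φ a r b s →
    (b - b').abs + s < s' → CodeRel Φ a r b' s'
  total : ∀ x, RInUnit S x → ∀ ε : Frac M, 0 < ε →
    ∃ a r b s, CodeRel Φ a r b s ∧ RLt S (rabs (rsub x (rconst a))) (rconst r) ∧ s < ε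

/-! ### Effectively uniformly continuous functions on `[0,1]` -/

/-- Data for a sequence `(f_s)` of polygonal functions on `[0,1]`: the graph of `f_s` joins the
points `(node s i, height s i)`, `i = 0, …, len s`, by line segments. -/
structure PolygonSeq (M : Type u) where
  len : M → M
  node : M → M → Frac M
  height : M → M → Frac M

/-- The sequence of polygonal functions belongs to the model, and its breakpoints are
partitions of `[0,1]`. -/
structure IsPolygonSeq (P : PolygonSeq M) : Prop where
  len_mem : IsFun S P.len
  node_mem : IsFun₂ S (fun s i => (P.node s i).code)
  height_mem : IsFun₂ S (fun s i => (P.height s i).code)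
  node_zero : ∀ s, (P.node s 0).Eqv 0
  node_len : ∀ s, (P.node s (P.len s)).Eqv 1
  node_lt : ∀ s i, i < P.len s → P.node s i < P.node s (i + 1)

/-- The difference of two sequences of rational numbers tends to `0`. -/
def AsympEq (a b : M → Frac M) : Prop :=
  ∀ j, ∃ m, ∀ k, m < k → (a k - b k).abs ≤ twoNegPow S j

/-- `f_s(x) = w` for real numbers `x`, `w`: for some `i` with `x_i ≤ x ≤ x_{i+1}`,
`w (x_{i+1} - x_i) = u_i (x_{i+1} - x) + u_{i+1} (x - x_i)`,
where `x_i = node s i` and `u_i = height s i`. -/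
def PolyVal (P : PolygonSeq M) (s : M) (x w : M → Frac M) : Prop :=
  IsReal S x ∧ IsReal S w ∧ ∃ i, i < P.len s ∧
    RLe S (rconst (P.node s i)) x ∧ RLe S x (rconst (P.node s (i + 1))) ∧
    AsympEq S (fun k => w k * (P.node s (i + 1) - P.node s i))
      (fun k => P.height s i * (P.node s (i + 1) - x k) +
        P.height s (i + 1) * (x k - P.node s i))

/-- The sequence `(f_s)` is a Cauchy name: `‖f_s - f_r‖_∞ ≤ 2^{-s}` for all `r > s`. -/
def IsCauchyName (P : PolygonSeq M) : Prop :=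
  IsPolygonSeq S P ∧ ∀ s r, s < r → ∀ x, RInUnit S x → ∀ w w', PolyVal S P s x w →
    PolyVal S P r x w' → RLe S (rabs (rsub w w')) (rconst (twoNegPow S s))

/-- `f(x) = y` for the function `f = lim_s f_s` with Cauchy name `(f_s)`. -/
def CauchyVal (P : PolygonSeq M) (x y : M → Frac M) : Prop :=
  RInUnit S x ∧ IsReal S y ∧ ∀ s w, PolyVal S P s x w →
    RLe S (rabs (rsub w y)) (rconst (twoNegPow S s))

/-! ### The three forms of the Jordan decomposition theorem -/

/-- The principle `Jordan_ℚ`, for rationally presented functions of bounded variation. -/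
def JordanQ : Prop :=
  ∀ F ∈ S, IsRatPres F → IsBVRat S (RatVal S F) → HasJordan S (RatVal S F)

/-- The principle for continuous functions of bounded variation. -/
def JordanQCont : Prop :=
  ∀ Φ ∈ S, IsContCode S Φ → IsBV S (ContVal S Φ) → HasJordan S (restrictRat (ContVal S Φ))

/-- The principle for effectively uniformly continuous functions of bounded variation that have
a rational presentation. -/
def JordanQEffCont : Prop :=
  ∀ P : PolygonSeq M, IsCauchyName S P → IsBV S (CauchyVal S P) →
    (∃ Z ∈ S, Presents S Z (CauchyVal S P)) → HasJordan S (restrictRat (CauchyVal S P))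

end Analysis

end SOA

/-!
# The Jordan decomposition theorem and weak König's lemma

Inside a model `(M, S)` of `RCA₀`, the definable relations are handled semantically. `IsBdd`,
`IsSigma`, `IsDelta` and `IsDef` are classes of relations and functions on assignments that are
closed under the evident operations, so that `Σ⁰₁` induction (`sigma_induction`), `Δ⁰₁`
comprehension (`comprehension`), search (`exists_isDef₁`) and primitive recursion (`recVal`) become
applicable by instance inference. The numbers of the model form a discretely ordered semiring
(`Numbers`), its rational numbers an ordered field `Q M`, with finite sums `sumQ`.

*Majorants from weak König's lemma.* The principle is used as a compactness principle for sets of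
implications (`exists_of_finitely_satisfiable`). The unknown set is the set of all `(p, q)` with
`g(p) < q`; the conditions say that `g` is non-decreasing, bounded and majorizes the slopes of `f`.
Finitely many conditions mention only fractions whose denominators divide some `N!`, and they are
satisfied by the variation function of `f` along the multiples of `1 / N!`, computed from
sufficiently good approximations of `f`; it is bounded as `f` is of bounded variation
(`hasJordan_of_approx`). This applies to presented and to coded functions (`jordanQ_of_wkl`,
`jordanQCont_of_wkl`). The form for Cauchy names follows from either of the other two, since the
polygonal functions of a name are Lipschitz continuous and hence determined by their values at
rational points (`jordanQEffCont_of_jordanQ`, `jordanQEffCont_of_jordanQCont`).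

*Paths from majorants.* Given an infinite binary tree `T`, let `m_s` be the sum of the weights
`2 ^ (-σ)` of the strings `σ < s` whose extensions in `T` have the maximal length `s`; these masses
have a sum of at most `2`. Pick a string of the length `(s + 1)²` in `T`, and let `z_s` be a sawtooth
function on its dyadic interval with the variation `m_s`. The meshes are chosen so small that the
sum `f` of the functions `z_s` has a Cauchy name, and so that `z_s` vanishes at a given rational
number from some known `s` on, which makes `f` presentable (`IsSaw.isCauchyName`, `IsSaw.isBV`,
`IsSaw.exists_presents`). Let `g` be a non-decreasing majorant of the slopes of `f`. The intervals
shrink so fast that the slope of `z_s`, if `m_s ≥ 2 ^ (-s)`, dominates those of all `z_r` with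
`r < s`; as the later functions vanish at the mesh points, `f` increases on the left half of each
tooth, and `g` rises on the interval by `m_s / 4` at least (`IsSaw.mass_bound`).

For every `σ`, the increments of `g + id` on dyadic intervals, rounded to multiples of
`2 ^ (-σ) / 4`, are additive whole-number masses of strings (`IsMass`), and if `σ` dies at `s`, some
string in `T` of length at least `s` has positive mass. Either, for every `σ`, these masses vanish on
some level of the tree. Then `σ` does not die beyond that level, so that it is decidable which
strings have extensions of all lengths, and there is a path (`exists_path_of_decidable`). Or, for
some `σ`, strings of positive mass occur on all levels. Then let `B` be the maximal mass that occurs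
on all levels; from some level on, strings of mass at least `B` do not branch into two such
strings, so that a string on that level which has extensions of mass at least `B` on all levels
determines a path (`exists_path_of_mass`). The case distinction is made in the metatheory
(`exists_path_of_masses`).
-/

namespace SOA

set_option linter.unusedSectionVars false

universe u

/-! ### Definable relations -/

section Definability

variable {M : Type u} [Zero M] [One M] [Add M] [Mul M] [LT M]

/-- The functions of an assignment that are given by numerical terms with parameters from `M`. -/
inductive IsTerm : ((ℕ → M) → M) → Prop
  | var (i : ℕ) : IsTerm (fun e => e i)
  | const (c : M) : IsTerm (fun _ => c)
  | add {f g : (ℕ → M) → M} : IsTerm f → IsTerm g → IsTerm (fun e => f e + g e)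
  | mul {f g : (ℕ → M) → M} : IsTerm f → IsTerm g → IsTerm (fun e => f e * g e)

/-- The relations on assignments that are given by `Σ⁰₀` formulas with parameters from `M`
and `S`. In the clause for the bounded quantifier the bound variable is index `0`. -/
inductive IsBdd (S : Set (Set M)) : ((ℕ → M) → Prop) → Prop
  | eq {f g : (ℕ → M) → M} : IsTerm f → IsTerm g → IsBdd S (fun e => f e = g e)
  | lt {f g : (ℕ → M) → M} : IsTerm f → IsTerm g → IsBdd S (fun e => f e < g e)
  | mem {f : (ℕ → M) → M} {X : Set M} : IsTerm f → X ∈ S → IsBdd S (fun e => f e ∈ X)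
  | not {P : (ℕ → M) → Prop} : IsBdd S P → IsBdd S (fun e => ¬ P e)
  | and {P Q : (ℕ → M) → Prop} : IsBdd S P → IsBdd S Q → IsBdd S (fun e => P e ∧ Q e)
  | ball {f : (ℕ → M) → M} {P : M → (ℕ → M) → Prop} : IsTerm f →
      IsBdd S (fun e => P (e 0) (fun n => e (n + 1))) → IsBdd S (fun e => ∀ a, a < f e → P a e)

/-- Renaming of the variables of a term. -/
def NumTerm.rename (r : ℕ → ℕ) : NumTerm → NumTerm
  | .var i => .var (r i)
  | .zero => .zero
  | .one => .one
  | .add s t => .add (s.rename r) (t.rename r)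
  | .mul s t => .mul (s.rename r) (t.rename r)

/-- The action of a renaming under one quantifier. -/
def liftRename (r : ℕ → ℕ) : ℕ → ℕ
  | 0 => 0
  | n + 1 => r n + 1

/-- Renaming of the number variables (by `r`) and the set variables (by `q`) of a formula. -/
def BddFormula.rename (q : ℕ → ℕ) : (ℕ → ℕ) → BddFormula → BddFormula
  | r, .eq s t => .eq (s.rename r) (t.rename r)
  | r, .lt s t => .lt (s.rename r) (t.rename r)
  | r, .mem t X => .mem (t.rename r) (q X)
  | r, .neg φ => .neg (φ.rename q r)
  | r, .and φ ψ => .and (φ.rename q r) (ψ.rename q r)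
  | r, .ball t φ => .ball (t.rename r) (φ.rename q (liftRename r))

theorem NumTerm.eval_rename (r : ℕ → ℕ) (e : ℕ → M) (t : NumTerm) :
    (t.rename r).eval e = t.eval (fun i => e (r i)) := by
  induction t <;> simp_all [NumTerm.rename, NumTerm.eval]

theorem push_liftRename (r : ℕ → ℕ) (a : M) (e : ℕ → M) :
    (fun i => push a e (liftRename r i)) = push a (fun i => e (r i)) := by
  funext i; cases i <;> rfl

theorem BddFormula.sat_rename (q : ℕ → ℕ) (A : ℕ → Set M) (φ : BddFormula) :
    ∀ (r : ℕ → ℕ) (e : ℕ → M),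
      (φ.rename q r).Sat A e ↔ φ.Sat (fun i => A (q i)) (fun i => e (r i)) := by
  induction φ <;> intro r e <;>
    simp_all [BddFormula.rename, BddFormula.Sat, NumTerm.eval_rename, push_liftRename]

/-- The assignment that agrees with `e` below `k` and lists the parameters `p` from `k` on. -/
def mix (k : ℕ) (e p : ℕ → M) : ℕ → M := fun i => if i < k then e i else p (i - k)

theorem push_mix (k : ℕ) (a : M) (e p : ℕ → M) : mix (k + 1) (push a e) p = push a (mix k e p) := by
  funext i
  cases i with
  | zero => simp [mix, push]
  | succ i => simp [mix, push]

/-- The two sequences interleaved. -/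
def interleave {α : Type*} (p q : ℕ → α) : ℕ → α := fun i => if i % 2 = 0 then p (i / 2) else q (i / 2)

theorem interleave_left {α : Type*} (p q : ℕ → α) (i : ℕ) : interleave p q (2 * i) = p i := by
  simp [interleave]

theorem interleave_right {α : Type*} (p q : ℕ → α) (i : ℕ) : interleave p q (2 * i + 1) = q i := by
  have h1 : (2 * i + 1) % 2 = 1 := by omega
  have h2 : (2 * i + 1) / 2 = i := by omega
  simp [interleave, h1, h2]

/-- The renaming that sends the parameter number `i`, which is variable `k + i`, to the parameter
number `2 * i`. -/
def evenParam (k i : ℕ) : ℕ := if i < k then i else k + 2 * (i - k)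

/-- The renaming that sends the parameter number `i`, which is variable `k + i`, to the parameter
number `2 * i + 1`. -/
def oddParam (k i : ℕ) : ℕ := if i < k then i else k + (2 * (i - k) + 1)

theorem mix_left (k : ℕ) (e p q : ℕ → M) :
    (fun i => mix k e (interleave p q) (evenParam k i)) = mix k e p := by
  funext i
  by_cases h : i < k
  · simp [mix, evenParam, h]
  · simp [mix, evenParam, h, interleave_left]

theorem mix_right (k : ℕ) (e p q : ℕ → M) :
    (fun i => mix k e (interleave p q) (oddParam k i)) = mix k e q := by
  funext i
  by_cases h : i < k
  · simp [mix, oddParam, h]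
  · simp [mix, oddParam, h, interleave_right]

/-- The parameters of a definable function can be listed from any sufficiently large index on, so that
they do not collide with the variables in use. Lists of parameters are merged by interleaving. -/
theorem IsTerm.exists_term {f : (ℕ → M) → M} (hf : IsTerm f) :
    ∃ k₀, ∀ k, k₀ ≤ k → ∃ (t : NumTerm) (p : ℕ → M), ∀ e, f e = t.eval (mix k e p) := by
  induction hf with
  | var i =>
    refine ⟨i + 1, fun k hk => ⟨.var i, fun _ => 0, fun e => ?_⟩⟩
    simp [NumTerm.eval, mix, Nat.lt_of_succ_le hk]
  | const c =>
    exact ⟨0, fun k _ => ⟨.var k, fun _ => c, fun e => by simp [NumTerm.eval, mix]⟩⟩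
  | add _ _ ihf ihg =>
    obtain ⟨k₁, h₁⟩ := ihf
    obtain ⟨k₂, h₂⟩ := ihg
    refine ⟨max k₁ k₂, fun k hk => ?_⟩
    obtain ⟨s, p, hs⟩ := h₁ k (le_trans (le_max_left _ _) hk)
    obtain ⟨t, q, ht⟩ := h₂ k (le_trans (le_max_right _ _) hk)
    refine ⟨.add (s.rename (evenParam k)) (t.rename (oddParam k)), interleave p q, fun e => ?_⟩
    rw [NumTerm.eval, NumTerm.eval_rename, NumTerm.eval_rename, mix_left, mix_right]; simp only [hs, ht]
  | mul _ _ ihf ihg =>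
    obtain ⟨k₁, h₁⟩ := ihf
    obtain ⟨k₂, h₂⟩ := ihg
    refine ⟨max k₁ k₂, fun k hk => ?_⟩
    obtain ⟨s, p, hs⟩ := h₁ k (le_trans (le_max_left _ _) hk)
    obtain ⟨t, q, ht⟩ := h₂ k (le_trans (le_max_right _ _) hk)
    refine ⟨.mul (s.rename (evenParam k)) (t.rename (oddParam k)), interleave p q, fun e => ?_⟩
    rw [NumTerm.eval, NumTerm.eval_rename, NumTerm.eval_rename, mix_left, mix_right]; simp only [hs, ht]

/-- The analogue of `IsTerm.exists_term` for relations: a relation in `IsBdd S` is the truth of one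
formula whose parameters are listed from any sufficiently large index on. -/
theorem IsBdd.exists_formula {S : Set (Set M)} (hS : S.Nonempty) {P : (ℕ → M) → Prop}
    (hP : IsBdd S P) :
    ∃ k₀, ∀ k, k₀ ≤ k → ∃ (φ : BddFormula) (A : ℕ → Set M) (p : ℕ → M), (∀ i, A i ∈ S) ∧
      ∀ e, P e ↔ φ.Sat A (mix k e p) := by
  obtain ⟨X₀, hX₀⟩ := hS
  induction hP with
  | eq hf hg =>
    obtain ⟨k₁, h₁⟩ := hf.exists_term
    obtain ⟨k₂, h₂⟩ := hg.exists_term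
    refine ⟨max k₁ k₂, fun k hk => ?_⟩
    obtain ⟨s, p, hs⟩ := h₁ k (le_trans (le_max_left _ _) hk)
    obtain ⟨t, q, ht⟩ := h₂ k (le_trans (le_max_right _ _) hk)
    refine ⟨.eq (s.rename (evenParam k)) (t.rename (oddParam k)), fun _ => X₀, interleave p q, fun _ => hX₀, fun e => ?_⟩
    rw [BddFormula.Sat, NumTerm.eval_rename, NumTerm.eval_rename, mix_left, mix_right]; simp only [hs, ht]
  | lt hf hg =>
    obtain ⟨k₁, h₁⟩ := hf.exists_term
    obtain ⟨k₂, h₂⟩ := hg.exists_term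
    refine ⟨max k₁ k₂, fun k hk => ?_⟩
    obtain ⟨s, p, hs⟩ := h₁ k (le_trans (le_max_left _ _) hk)
    obtain ⟨t, q, ht⟩ := h₂ k (le_trans (le_max_right _ _) hk)
    refine ⟨.lt (s.rename (evenParam k)) (t.rename (oddParam k)), fun _ => X₀, interleave p q, fun _ => hX₀, fun e => ?_⟩
    rw [BddFormula.Sat, NumTerm.eval_rename, NumTerm.eval_rename, mix_left, mix_right]; simp only [hs, ht]
  | mem hf hX =>
    obtain ⟨k₁, h₁⟩ := hf.exists_term
    refine ⟨k₁, fun k hk => ?_⟩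
    obtain ⟨s, p, hs⟩ := h₁ k hk
    exact ⟨.mem s 0, fun _ => _, p, fun _ => hX, fun e => by simp only [BddFormula.Sat, hs]⟩
  | not _ ih =>
    obtain ⟨k₁, h₁⟩ := ih
    refine ⟨k₁, fun k hk => ?_⟩
    obtain ⟨φ, A, p, hA, hφ⟩ := h₁ k hk
    exact ⟨.neg φ, A, p, hA, fun e => by simp only [BddFormula.Sat, hφ]⟩
  | and _ _ ih₁ ih₂ =>
    obtain ⟨k₁, h₁⟩ := ih₁
    obtain ⟨k₂, h₂⟩ := ih₂
    refine ⟨max k₁ k₂, fun k hk => ?_⟩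
    obtain ⟨φ, A, p, hA, hφ⟩ := h₁ k (le_trans (le_max_left _ _) hk)
    obtain ⟨ψ, B, q, hB, hψ⟩ := h₂ k (le_trans (le_max_right _ _) hk)
    refine ⟨.and (φ.rename (fun i => 2 * i) (evenParam k))
      (ψ.rename (fun i => 2 * i + 1) (oddParam k)), interleave A B,
      interleave p q, fun i => ?_, fun e => ?_⟩
    · unfold interleave; split_ifs <;> simp [hA, hB]
    · rw [BddFormula.Sat, BddFormula.sat_rename, BddFormula.sat_rename, mix_left, mix_right]
      simp only [interleave_left, interleave_right, hφ, hψ]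
  | ball hf _ ih =>
    obtain ⟨k₁, h₁⟩ := hf.exists_term
    obtain ⟨k₂, h₂⟩ := ih
    refine ⟨max k₁ k₂, fun k hk => ?_⟩
    obtain ⟨s, p, hs⟩ := h₁ k (le_trans (le_max_left _ _) hk)
    obtain ⟨ψ, B, q, hB, hψ⟩ := h₂ (k + 1) (le_trans (le_max_right _ _) (Nat.le_succ_of_le hk))
    refine ⟨.ball (s.rename (evenParam k)) (ψ.rename id (liftRename (oddParam k))), B, interleave p q, hB, fun e => ?_⟩
    rw [BddFormula.Sat, NumTerm.eval_rename, mix_left]; simp only [hs]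
    refine forall₂_congr fun a _ => ?_
    rw [BddFormula.sat_rename, push_liftRename, mix_right, ← push_mix]
    exact hψ (push a e)

/-- The relations on assignments that are given by `Σ⁰₁` formulas with parameters. -/
class IsSigma (S : Set (Set M)) (P : (ℕ → M) → Prop) : Prop where
  exists_bdd : ∃ Q, IsBdd S Q ∧ ∀ e, P e ↔ ∃ y, Q (push y e)

theorem IsSigma.exists_formula {S : Set (Set M)} (hS : S.Nonempty) {P : (ℕ → M) → Prop}
    (hP : IsSigma S P) :
    ∃ k₀, ∀ k, k₀ ≤ k → ∃ (φ : BddFormula) (A : ℕ → Set M) (p : ℕ → M), (∀ i, A i ∈ S) ∧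
      ∀ n e, P (push n e) ↔ Sigma1 φ A (mix k e p) n := by
  obtain ⟨Q, hQ, hPQ⟩ := hP.exists_bdd
  obtain ⟨k₀, h⟩ := hQ.exists_formula hS
  refine ⟨k₀, fun k hk => ?_⟩
  obtain ⟨φ, A, p, hA, hφ⟩ := h (k + 2) (by omega)
  refine ⟨φ, A, p, hA, fun n e => ?_⟩
  rw [hPQ, Sigma1]
  refine exists_congr fun y => ?_
  rw [hφ, push_mix, push_mix]

theorem IsBdd.isSigma_exists {S : Set (Set M)} {P : M → (ℕ → M) → Prop}
    (hP : IsBdd S (fun e => P (e 0) (fun n => e (n + 1)))) : IsSigma S (fun e => ∃ a, P a e) :=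
  ⟨⟨_, hP, fun _ => Iff.rfl⟩⟩

theorem IsBdd.isSigma_fst {S : Set (Set M)} {P : M → Prop}
    (hP : IsBdd S (fun e => P (e 1))) : IsSigma S (fun e => P (e 0)) :=
  ⟨⟨_, hP, fun e => ⟨fun h => ⟨e 0, h⟩, fun ⟨_, h⟩ => h⟩⟩⟩

/-- `Σ⁰₁` induction. -/
theorem RCA0.sigma_induction {S : Set (Set M)} (hS : RCA0 S) {P : M → Prop}
    (hP : IsSigma S (fun e => P (e 0))) (zero : P 0) (succ : ∀ n, P n → P (n + 1)) (n : M) :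
    P n := by
  obtain ⟨k, h⟩ := hP.exists_formula hS.sets_nonempty
  obtain ⟨φ, A, p, hA, hφ⟩ := h k le_rfl
  have key := fun n => hφ n (fun _ => 0)
  simp only [push] at key
  refine (key n).2 (hS.sigma1_induction φ A _ hA ((key 0).1 zero) (fun n hn => ?_) n)
  exact (key _).1 (succ n ((key n).2 hn))

/-- `Δ⁰₁` comprehension. -/
theorem RCA0.comprehension {S : Set (Set M)} (hS : RCA0 S) {P : M → Prop}
    (hP : IsSigma S (fun e => P (e 0))) (hP' : IsSigma S (fun e => ¬ P (e 0))) :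
    {n | P n} ∈ S := by
  obtain ⟨k₁, h₁⟩ := hP.exists_formula hS.sets_nonempty
  obtain ⟨k₂, h₂⟩ := hP'.exists_formula hS.sets_nonempty
  obtain ⟨φ, A, p, hA, hφ⟩ := h₁ (max k₁ k₂) (le_max_left _ _)
  obtain ⟨ψ, B, q, hB, hψ⟩ := h₂ (max k₁ k₂) (le_max_right _ _)
  generalize max k₁ k₂ = k at *
  have key₁ := fun n => hφ n (fun _ => 0)
  have key₂ := fun n => hψ n (fun _ => 0)
  simp only [push] at key₁ key₂
  set m := mix k (fun _ => (0 : M)) (interleave p q) with hm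
  have hl := mix_left (M := M) k (fun _ => 0) p q
  have hr := mix_right (M := M) k (fun _ => 0) p q
  have e₁ : ∀ n, P n ↔ Sigma1 (φ.rename (fun i => 2 * i) (liftRename (liftRename (evenParam k))))
      (interleave A B) m n := fun n => by
    rw [key₁, Sigma1, Sigma1]
    refine exists_congr fun y => ?_
    rw [BddFormula.sat_rename, push_liftRename, push_liftRename]
    simp only [interleave_left, hm]
    rw [hl]
  have e₂ : ∀ n, P n ↔ Pi1 (.neg (ψ.rename (fun i => 2 * i + 1) (liftRename (liftRename (oddParam k)))))
      (interleave A B) m n := fun n => by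
    rw [← not_iff_not, key₂, Sigma1, Pi1, not_forall]
    refine exists_congr fun y => ?_
    rw [BddFormula.Sat, not_not, BddFormula.sat_rename, push_liftRename, push_liftRename]
    simp only [interleave_right, hm]
    rw [hr]
  have := hS.delta1_comprehension _ _ (interleave A B) m (fun i => by
    unfold interleave; split_ifs <;> simp [hA, hB]) (fun n => (e₁ n).symm.trans (e₂ n))
  have e : {n | P n} = {n | Sigma1 (φ.rename (fun i => 2 * i) (liftRename (liftRename (evenParam k))))
      (interleave A B) m n} := Set.ext fun n => e₁ n
  rw [e]; exact this

end Definability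

/-! ### The ordered semiring of numbers -/

namespace RCA0

variable {M : Type u} [Zero M] [One M] [Add M] [Mul M] [LT M] {S : Set (Set M)}

theorem bdd_induction (hS : RCA0 S) {P : M → Prop} (hP : IsBdd S (fun e => P (e 1))) (zero : P 0)
    (succ : ∀ n, P n → P (n + 1)) (n : M) : P n :=
  hS.sigma_induction hP.isSigma_fst zero succ n

theorem zero_add' (hS : RCA0 S) (n : M) : 0 + n = n := by
  refine hS.bdd_induction (P := fun n => 0 + n = n) ?_ (hS.add_zero 0) (fun n h => ?_) n
  · exact .eq (.add (.const _) (.var 1)) (.var 1)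
  · rw [hS.add_succ, h]

theorem succ_add' (hS : RCA0 S) (m n : M) : m + 1 + n = m + n + 1 := by
  refine hS.bdd_induction (P := fun n => m + 1 + n = m + n + 1) ?_ ?_ (fun n h => ?_) n
  · exact .eq (.add (.const _) (.var 1)) (.add (.add (.const _) (.var 1)) (.const _))
  · rw [hS.add_zero, hS.add_zero]
  · rw [hS.add_succ, h, hS.add_succ]

theorem add_comm' (hS : RCA0 S) (m n : M) : m + n = n + m := by
  refine hS.bdd_induction (P := fun n => m + n = n + m) ?_ ?_ (fun n h => ?_) n
  · exact .eq (.add (.const _) (.var 1)) (.add (.var 1) (.const _))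
  · rw [hS.add_zero, hS.zero_add']
  · rw [hS.add_succ, h, hS.succ_add']

theorem add_assoc' (hS : RCA0 S) (a b c : M) : a + b + c = a + (b + c) := by
  refine hS.bdd_induction (P := fun c => a + b + c = a + (b + c)) ?_ ?_ (fun n h => ?_) c
  · exact .eq (.add (.const _) (.var 1)) (.add (.const _) (.add (.const _) (.var 1)))
  · rw [hS.add_zero, hS.add_zero]
  · rw [hS.add_succ, h, hS.add_succ, hS.add_succ]

theorem zero_mul' (hS : RCA0 S) (n : M) : 0 * n = 0 := by
  refine hS.bdd_induction (P := fun n => 0 * n = 0) ?_ (hS.mul_zero 0) (fun n h => ?_) n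
  · exact .eq (.mul (.const _) (.var 1)) (.const _)
  · rw [hS.mul_succ, h, hS.add_zero]

theorem succ_mul' (hS : RCA0 S) (m n : M) : (m + 1) * n = m * n + n := by
  refine hS.bdd_induction (P := fun n => (m + 1) * n = m * n + n) ?_ ?_ (fun n h => ?_) n
  · exact .eq (.mul (.const _) (.var 1)) (.add (.mul (.const _) (.var 1)) (.var 1))
  · rw [hS.mul_zero, hS.mul_zero, hS.add_zero]
  · rw [hS.mul_succ, h, hS.mul_succ, hS.add_succ _ m, hS.add_succ _ n,
      hS.add_assoc' (m * n) n m, hS.add_comm' n m, ← hS.add_assoc']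

theorem mul_comm' (hS : RCA0 S) (m n : M) : m * n = n * m := by
  refine hS.bdd_induction (P := fun n => m * n = n * m) ?_ ?_ (fun n h => ?_) n
  · exact .eq (.mul (.const _) (.var 1)) (.mul (.var 1) (.const _))
  · rw [hS.mul_zero, hS.zero_mul']
  · rw [hS.mul_succ, h, hS.succ_mul']

theorem mul_add' (hS : RCA0 S) (a b c : M) : a * (b + c) = a * b + a * c := by
  refine hS.bdd_induction (P := fun c => a * (b + c) = a * b + a * c) ?_ ?_ (fun n h => ?_) c
  · exact .eq (.mul (.const _) (.add (.const _) (.var 1))) (.add (.const _) (.mul (.const _) (.var 1)))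
  · rw [hS.add_zero, hS.mul_zero, hS.add_zero]
  · rw [hS.add_succ, hS.mul_succ, h, hS.mul_succ, hS.add_assoc']

theorem mul_assoc' (hS : RCA0 S) (a b c : M) : a * b * c = a * (b * c) := by
  refine hS.bdd_induction (P := fun c => a * b * c = a * (b * c)) ?_ ?_ (fun n h => ?_) c
  · exact .eq (.mul (.const _) (.var 1)) (.mul (.const _) (.mul (.const _) (.var 1)))
  · rw [hS.mul_zero, hS.mul_zero, hS.mul_zero]
  · rw [hS.mul_succ, h, hS.mul_succ, hS.mul_add']

theorem mul_one' (hS : RCA0 S) (a : M) : a * 1 = a := by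
  have h := hS.mul_succ a 0
  rwa [hS.zero_add', hS.mul_zero, hS.zero_add'] at h

theorem add_right_cancel' (hS : RCA0 S) (a b c : M) : a + c = b + c → a = b := by
  have key : ¬ (a + c = b + c ∧ ¬ a = b) := by
    refine hS.bdd_induction (P := fun c => ¬ (a + c = b + c ∧ ¬ a = b)) ?_ ?_ (fun n h => ?_) c
    · exact .not (.and (.eq (.add (.const _) (.var 1)) (.add (.const _) (.var 1)))
        (.not (.eq (.const _) (.const _))))
    · rw [hS.add_zero, hS.add_zero]; tauto
    · rw [hS.add_succ, hS.add_succ]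
      exact fun ⟨h₁, h₂⟩ => h ⟨hS.succ_inj _ _ h₁, h₂⟩
  tauto

theorem eq_zero_or_succ (hS : RCA0 S) (n : M) : n = 0 ∨ ∃ k, n = k + 1 := by
  have key : ∃ k, ¬ (¬ n = 0 ∧ ¬ n = k + 1) := by
    refine hS.sigma_induction (P := fun n => ∃ k, ¬ (¬ n = 0 ∧ ¬ n = k + 1)) ?_ ⟨0, by simp⟩
      (fun n _ => ⟨n, by simp⟩) n
    refine IsBdd.isSigma_exists (P := fun k e => ¬ (¬ e 0 = 0 ∧ ¬ e 0 = k + 1)) ?_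
    exact .not (.and (.not (.eq (.var 1) (.const _)))
      (.not (.eq (.var 1) (.add (.var 0) (.const _)))))
  obtain ⟨k, hk⟩ := key
  by_cases h : n = 0
  · exact Or.inl h
  · exact Or.inr ⟨k, by tauto⟩

theorem lt_iff_exists (hS : RCA0 S) (m n : M) : m < n ↔ ∃ k, n = m + (k + 1) := by
  constructor
  · have key : ∃ k, ¬ (m < n ∧ ¬ n = m + (k + 1)) := by
      refine hS.sigma_induction (P := fun n => ∃ k, ¬ (m < n ∧ ¬ n = m + (k + 1))) ?_
        ⟨0, fun h => hS.not_lt_zero _ h.1⟩ (fun n ⟨k, hk⟩ => ?_) n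
      · refine IsBdd.isSigma_exists (P := fun k e => ¬ (m < e 0 ∧ ¬ e 0 = m + (k + 1))) ?_
        exact .not (.and (.lt (.const _) (.var 1))
          (.not (.eq (.var 1) (.add (.const _) (.add (.var 0) (.const _))))))
      · by_cases h : m < n
        · have h' : n = m + (k + 1) := by tauto
          refine ⟨k + 1, fun h'' => h''.2 ?_⟩
          rw [hS.add_succ m (k + 1), ← h']
        · refine ⟨0, fun h'' => h''.2 ?_⟩
          rcases (hS.lt_succ m n).1 h''.1 with h | h
          · contradiction
          · rw [hS.zero_add', h]
    obtain ⟨k, hk⟩ := key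
    exact fun h => ⟨k, by tauto⟩
  · rintro ⟨k, rfl⟩
    refine hS.bdd_induction (P := fun k => m < m + (k + 1)) ?_ ?_ (fun k hk => ?_) k
    · exact .lt (.const _) (.add (.const _) (.add (.var 1) (.const _)))
    · rw [hS.add_succ, hS.add_zero]
      exact (hS.lt_succ _ _).2 (Or.inr rfl)
    · rw [hS.add_succ m (k + 1)]
      exact (hS.lt_succ _ _).2 (Or.inl hk)

theorem lt_trichotomy' (hS : RCA0 S) (m n : M) : m < n ∨ m = n ∨ n < m := by
  have key : ¬ (¬ m < n ∧ (¬ m = n ∧ ¬ n < m)) := by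
    refine hS.bdd_induction (P := fun n => ¬ (¬ m < n ∧ (¬ m = n ∧ ¬ n < m))) ?_ ?_
      (fun n h h' => ?_) n
    · exact .not (.and (.not (.lt (.const _) (.var 1)))
        (.and (.not (.eq (.const _) (.var 1))) (.not (.lt (.var 1) (.const _)))))
    · rcases hS.eq_zero_or_succ m with h | ⟨k, h⟩
      · tauto
      · have : 0 < m := (hS.lt_iff_exists _ _).2 ⟨k, by rw [hS.zero_add', h]⟩
        tauto
    · obtain ⟨h₁, h₂, h₃⟩ := h'
      rw [hS.lt_succ] at h₁
      have h₄ : n < m := by tauto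
      obtain ⟨k, hk⟩ := (hS.lt_iff_exists _ _).1 h₄
      rcases hS.eq_zero_or_succ k with h | ⟨j, h⟩
      · exact h₂ (by rw [hk, h, hS.zero_add'])
      · refine h₃ ((hS.lt_iff_exists _ _).2 ⟨j, ?_⟩)
        rw [hk, h, hS.succ_add' n (j + 1), hS.add_succ n (j + 1)]
  tauto

theorem lt_irrefl' (hS : RCA0 S) (m : M) : ¬ m < m := by
  intro h
  obtain ⟨k, hk⟩ := (hS.lt_iff_exists _ _).1 h
  refine hS.succ_ne_zero k (hS.add_right_cancel' _ _ m ?_)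
  rw [hS.zero_add', hS.add_comm', ← hk]

theorem lt_trans' (hS : RCA0 S) {a b c : M} (h₁ : a < b) (h₂ : b < c) : a < c := by
  obtain ⟨j, rfl⟩ := (hS.lt_iff_exists _ _).1 h₁
  obtain ⟨k, rfl⟩ := (hS.lt_iff_exists _ _).1 h₂
  refine (hS.lt_iff_exists _ _).2 ⟨j + 1 + k, ?_⟩
  rw [hS.add_assoc', hS.add_succ (j + 1)]

/-- The numbers of a model of RCA₀ form a commutative semiring. -/
@[reducible] def commSemiring (hS : RCA0 S) : CommSemiring M where
  zero := 0
  one := 1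
  add := (· + ·)
  mul := (· * ·)
  add_assoc := hS.add_assoc'
  zero_add := hS.zero_add'
  add_zero := hS.add_zero
  add_comm := hS.add_comm'
  left_distrib := hS.mul_add'
  right_distrib a b c := by rw [hS.mul_comm', hS.mul_add', hS.mul_comm' c a, hS.mul_comm' c b]
  zero_mul := hS.zero_mul'
  mul_zero := hS.mul_zero
  mul_assoc := hS.mul_assoc'
  one_mul a := by rw [hS.mul_comm', hS.mul_one']
  mul_one := hS.mul_one'
  mul_comm := hS.mul_comm'
  nsmul := nsmulRec

/-- The numbers of a model of RCA₀ are linearly ordered. -/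
@[reducible] noncomputable def linearOrder (hS : RCA0 S) : LinearOrder M where
  le a b := a < b ∨ a = b
  lt := (· < ·)
  le_refl a := Or.inr rfl
  le_trans a b c := by
    rintro (h | rfl) (h' | rfl)
    · exact Or.inl (hS.lt_trans' h h')
    · exact Or.inl h
    · exact Or.inl h'
    · exact Or.inr rfl
  lt_iff_le_not_ge a b := by
    constructor
    · refine fun h => ⟨Or.inl h, ?_⟩
      rintro (h' | rfl)
      · exact hS.lt_irrefl' _ (hS.lt_trans' h h')
      · exact hS.lt_irrefl' _ h
    · rintro ⟨h | rfl, h'⟩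
      · exact h
      · exact absurd (Or.inr rfl) h'
  le_antisymm a b := by
    rintro (h | rfl) (h' | h')
    · exact absurd (hS.lt_trans' h h') (hS.lt_irrefl' _)
    · exact h'.symm
    · rfl
    · rfl
  le_total a b := by
    rcases hS.lt_trichotomy' a b with h | h | h
    · exact Or.inl (Or.inl h)
    · exact Or.inl (Or.inr h)
    · exact Or.inr (Or.inl h)
  toDecidableLE := Classical.decRel _

end RCA0

/-- The numbers of a model of RCA₀, as a discretely ordered semiring. -/
class Numbers (M : Type u) extends CommSemiring M, LinearOrder M, IsStrictOrderedRing M,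
    CanonicallyOrderedAdd M where
  lt_succ_iff : ∀ {a b : M}, a < b + 1 ↔ a ≤ b

theorem RCA0.add_lt_add_left' {M : Type u} [Zero M] [One M] [Add M] [Mul M] [LT M]
    {S : Set (Set M)} (hS : RCA0 S) {a b : M} (h : a < b) (c : M) : c + a < c + b := by
  obtain ⟨k, rfl⟩ := (hS.lt_iff_exists _ _).1 h
  exact (hS.lt_iff_exists _ _).2 ⟨k, by rw [hS.add_assoc']⟩

theorem RCA0.mul_lt_mul_left' {M : Type u} [Zero M] [One M] [Add M] [Mul M] [LT M]
    {S : Set (Set M)} (hS : RCA0 S) {a b c : M} (h : a < b) (hc : 0 < c) : c * a < c * b := by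
  obtain ⟨k, rfl⟩ := (hS.lt_iff_exists _ _).1 h
  obtain ⟨j, rfl⟩ := (hS.lt_iff_exists _ _).1 hc
  refine (hS.lt_iff_exists _ _).2 ⟨(j + 1) * k + j, ?_⟩
  rw [hS.mul_add', hS.zero_add', hS.mul_add', hS.mul_one', hS.add_assoc']

/-- The numbers of a model of RCA₀ form a discretely ordered semiring. -/
@[reducible] noncomputable def RCA0.numbers {M : Type u} [Zero M] [One M] [Add M] [Mul M] [LT M]
    {S : Set (Set M)} (hS : RCA0 S) : Numbers M :=
  { hS.commSemiring, hS.linearOrder with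
    add_le_add_left := fun a b h c => by
      rcases h with h | rfl
      · rw [hS.add_comm' a, hS.add_comm' b]
        exact Or.inl (hS.add_lt_add_left' h c)
      · exact Or.inr rfl
    le_of_add_le_add_left := fun a b c h => by
      rcases hS.lt_trichotomy' b c with h' | h' | h'
      · exact Or.inl h'
      · exact Or.inr h'
      · have h'' := hS.add_lt_add_left' h' a
        rcases h with h | h
        · exact absurd (hS.lt_trans' h h'') (hS.lt_irrefl' _)
        · rw [h] at h''
          exact absurd h'' (hS.lt_irrefl' _)
    zero_le_one := Or.inl ((hS.lt_iff_exists _ _).2 ⟨0, by rw [hS.zero_add', hS.zero_add']⟩)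
    exists_pair_ne := ⟨0, 1, fun h => hS.succ_ne_zero 0 (by rw [hS.zero_add']; exact h.symm)⟩
    mul_lt_mul_of_pos_left := fun a ha b c h => hS.mul_lt_mul_left' h ha
    mul_lt_mul_of_pos_right := fun a ha b c h => by
      have := hS.mul_lt_mul_left' h ha
      rwa [hS.mul_comm' a, hS.mul_comm' a] at this
    exists_add_of_le := fun {a b} h => by
      rcases h with h | rfl
      · obtain ⟨k, hk⟩ := (hS.lt_iff_exists _ _).1 h
        exact ⟨_, hk⟩
      · exact ⟨0, (hS.add_zero a).symm⟩
    le_self_add := fun a b => by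
      rcases hS.eq_zero_or_succ b with rfl | ⟨k, rfl⟩
      · exact Or.inr (hS.add_zero a).symm
      · exact Or.inl ((hS.lt_iff_exists _ _).2 ⟨k, rfl⟩)
    le_add_self := fun a b => by
      rw [hS.add_comm']
      rcases hS.eq_zero_or_succ b with rfl | ⟨k, rfl⟩
      · exact Or.inr (hS.add_zero a).symm
      · exact Or.inl ((hS.lt_iff_exists _ _).2 ⟨k, rfl⟩)
    lt_succ_iff := fun {a b} => hS.lt_succ a b }

/-- `(M, S)` is a model of RCA₀. -/
class Model {M : Type u} [Numbers M] (S : Set (Set M)) : Prop where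
  rca0 : RCA0 S

/-! ### Closure properties of the `Σ⁰₁` and `Δ⁰₁` relations -/

section Closure

variable {M : Type u} [Numbers M] {S : Set (Set M)}

theorem IsTerm.comp {f : (ℕ → M) → M} (hf : IsTerm f) {σ : (ℕ → M) → ℕ → M}
    (hσ : ∀ i, IsTerm (fun e => σ e i)) : IsTerm (fun e => f (σ e)) := by
  induction hf with
  | var i => exact hσ i
  | const c => exact .const c
  | add _ _ ihf ihg => exact .add ihf ihg
  | mul _ _ ihf ihg => exact .mul ihf ihg

theorem IsTerm.push {σ : (ℕ → M) → ℕ → M} (hσ : ∀ i, IsTerm (fun e => σ e i)) (i : ℕ) :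
    IsTerm (fun e => push (e 0) (σ (fun n => e (n + 1))) i) := by
  cases i with
  | zero => exact .var 0
  | succ i => exact (hσ i).comp (fun j => .var (j + 1))

theorem IsBdd.comp {P : (ℕ → M) → Prop} (hP : IsBdd S P) :
    ∀ {σ : (ℕ → M) → ℕ → M}, (∀ i, IsTerm (fun e => σ e i)) → IsBdd S (fun e => P (σ e)) := by
  induction hP with
  | eq hf hg => exact fun hσ => .eq (hf.comp hσ) (hg.comp hσ)
  | lt hf hg => exact fun hσ => .lt (hf.comp hσ) (hg.comp hσ)
  | mem hf hX => exact fun hσ => .mem (hf.comp hσ) hX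
  | not _ ih => exact fun hσ => .not (ih hσ)
  | and _ _ ih₁ ih₂ => exact fun hσ => .and (ih₁ hσ) (ih₂ hσ)
  | @ball f P hf _ ih =>
    exact fun {σ} hσ => .ball (P := fun a e => P a (σ e)) (hf.comp hσ) (ih (IsTerm.push hσ))

theorem IsSigma.comp {P : (ℕ → M) → Prop} (hP : IsSigma S P) {σ : (ℕ → M) → ℕ → M}
    (hσ : ∀ i, IsTerm (fun e => σ e i)) : IsSigma S (fun e => P (σ e)) := by
  obtain ⟨Q, hQ, hPQ⟩ := hP
  exact ⟨⟨_, hQ.comp (IsTerm.push hσ), fun e => by rw [hPQ]; rfl⟩⟩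

theorem IsSigma.congr {P Q : (ℕ → M) → Prop} (hP : IsSigma S P) (h : ∀ e, Q e ↔ P e) :
    IsSigma S Q := by
  obtain ⟨R, hR, hPR⟩ := hP
  exact ⟨⟨R, hR, fun e => (h e).trans (hPR e)⟩⟩

theorem IsBdd.isSigma {P : (ℕ → M) → Prop} (hP : IsBdd S P) : IsSigma S P :=
  ⟨⟨_, hP.comp (σ := fun e n => e (n + 1)) (fun i => .var (i + 1)),
    fun _ => ⟨fun h => ⟨0, h⟩, fun ⟨_, h⟩ => h⟩⟩⟩

theorem IsBdd.congr {P Q : (ℕ → M) → Prop} (hP : IsBdd S P) (h : ∀ e, Q e ↔ P e) :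
    IsBdd S Q := by
  have : Q = P := funext fun e => propext (h e)
  rwa [this]

theorem IsBdd.bex {f : (ℕ → M) → M} {P : M → (ℕ → M) → Prop} (hf : IsTerm f)
    (hP : IsBdd S (fun e => P (e 0) (fun n => e (n + 1)))) :
    IsBdd S (fun e => ∃ a, a < f e ∧ P a e) := by
  refine (IsBdd.not (.ball (P := fun a e => ¬ P a e) hf (.not hP))).congr fun e => ?_
  push Not
  rfl

instance IsSigma.ex {P : M → (ℕ → M) → Prop}
    [hP : IsSigma S (fun e => P (e 0) (fun n => e (n + 1)))] : IsSigma S (fun e => ∃ a, P a e) := by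
  obtain ⟨Q, hQ, hPQ⟩ := hP
  -- the two existential quantifiers are bounded by one
  refine ⟨⟨fun e => ∃ a, a < e 0 + 1 ∧ ∃ y, y < e 0 + 1 ∧ Q (push y (push a (fun n => e (n + 1)))),
    ?_, fun e => ?_⟩⟩
  · refine .bex (.add (.var 0) (.const 1)) (.bex (.add (.var 1) (.const 1)) (hQ.comp fun i => ?_))
    match i with
    | 0 => exact .var 0
    | 1 => exact .var 1
    | i + 2 => exact .var (i + 3)
  · have key : ∀ a, P a e ↔ ∃ y, Q (push y (push a e)) := fun a => hPQ (push a e)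
    simp only [key, Numbers.lt_succ_iff]
    constructor
    · rintro ⟨a, y, h⟩
      exact ⟨max a y, a, le_max_left _ _, y, le_max_right _ _, h⟩
    · rintro ⟨_, a, _, y, _, h⟩
      exact ⟨a, y, h⟩

instance IsSigma.and {P Q : (ℕ → M) → Prop} [hP : IsSigma S P] [hQ : IsSigma S Q] :
    IsSigma S (fun e => P e ∧ Q e) := by
  obtain ⟨P', hP', hPP'⟩ := hP
  obtain ⟨Q', hQ', hQQ'⟩ := hQ
  have h : IsSigma S (fun e : ℕ → M => ∃ a, ∃ b, P' (push a e) ∧ Q' (push b e)) := by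
    refine @IsSigma.ex _ _ _ _ (@IsSigma.ex _ _ _ _ (IsBdd.isSigma
      (.and (hP'.comp fun i => ?_) (hQ'.comp fun i => ?_)))) <;>
    match i with
    | 0 => exact .var _
    | i + 1 => exact .var (i + 2)
  refine h.congr fun e => ?_
  rw [hPP', hQQ']
  exact ⟨fun ⟨⟨a, ha⟩, ⟨b, hb⟩⟩ => ⟨a, b, ha, hb⟩, fun ⟨a, b, ha, hb⟩ => ⟨⟨a, ha⟩, ⟨b, hb⟩⟩⟩

instance IsSigma.or {P Q : (ℕ → M) → Prop} [hP : IsSigma S P] [hQ : IsSigma S Q] :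
    IsSigma S (fun e => P e ∨ Q e) := by
  obtain ⟨P', hP', hPP'⟩ := hP
  obtain ⟨Q', hQ', hQQ'⟩ := hQ
  refine ⟨⟨_, (IsBdd.not (.and (.not hP') (.not hQ'))), fun e => ?_⟩⟩
  rw [hPP', hQQ', ← exists_or]
  refine exists_congr fun a => ?_
  tauto

theorem le_of_lt_succ {a b : M} (h : a < b + 1) : a ≤ b := Numbers.lt_succ_iff.1 h

theorem lt_succ_self (a : M) : a < a + 1 := Numbers.lt_succ_iff.2 le_rfl

theorem succ_le_of_lt {a b : M} (h : a < b) : a + 1 ≤ b := by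
  by_contra h'
  exact absurd (le_of_lt_succ (not_le.1 h')) (not_le.2 h)

theorem lt_succ_cases {a b : M} (h : a < b + 1) : a < b ∨ a = b :=
  lt_or_eq_of_le (le_of_lt_succ h)

/-- `Σ⁰₁` induction. -/
theorem sigma_induction (S : Set (Set M)) [Model S] {P : M → Prop}
    [hP : IsSigma S (fun e => P (e 0))] (zero : P 0) (succ : ∀ n, P n → P (n + 1)) (n : M) : P n :=
  (Model.rca0 (S := S)).sigma_induction hP zero succ n

/-- The bounded universal quantifier in front of a `Σ⁰₁` formula, by `Σ⁰₁` collection. -/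
theorem IsSigma.ball_term [Model S] {f : (ℕ → M) → M} {P : M → (ℕ → M) → Prop} (hf : IsTerm f)
    (hP : IsSigma S (fun e => P (e 0) (fun n => e (n + 1)))) :
    IsSigma S (fun e => ∀ a, a < f e → P a e) := by
  obtain ⟨Q, hQ, hPQ⟩ := hP
  have key : ∀ a e, P a e ↔ ∃ y, Q (push y (push a e)) := fun a e => hPQ (push a e)
  have h₁ : IsBdd S (fun e => ∀ a, a < f (fun n => e (n + 1)) → ∃ y, y < e 0 ∧
      Q (push y (push a (fun n => e (n + 1))))) := by
    refine .ball (P := fun a e => ∃ y, y < e 0 ∧ Q (push y (push a (fun n => e (n + 1)))))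
      (hf.comp fun i => .var (i + 1)) (.bex (.var 1) (hQ.comp fun i => ?_))
    match i with
    | 0 => exact .var 0
    | 1 => exact .var 1
    | i + 2 => exact .var (i + 3)
  refine ⟨⟨_, h₁, fun e => ?_⟩⟩
  constructor
  · intro h
    have h₂ : ∀ n : M, ∃ b, ∀ a, a < n → a < f e → ∃ y, y < b ∧ Q (push y (push a e)) := by
      have : IsSigma S (fun e' : ℕ → M => ∃ b, ∀ a, a < e' 0 →
          a < f e → ∃ y, y < b ∧ Q (push y (push a e))) := by
        refine IsBdd.isSigma_exists (.ball (P := fun a e' => a < f e → ∃ y, y < e' 0 ∧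
          Q (push y (push a e))) (.var 1) ?_)
        refine IsBdd.congr (.not (.and (.lt (.var 0) (.const (f e)))
          (.not (.bex (P := fun y e' => Q (push y (push (e' 0) e))) (.var 1)
            (hQ.comp fun i => ?_))))) (fun e' => by
            simp only [not_and, not_not])
        match i with
        | 0 => exact .var 0
        | 1 => exact .var 1
        | i + 2 => exact .const (e i)
      refine sigma_induction S ⟨0, fun a ha => absurd ha not_lt_zero⟩ ?_
      rintro n ⟨b, hb⟩
      by_cases hn : n < f e
      · obtain ⟨y, hy⟩ := (key _ _).1 (h n hn)
        refine ⟨max b (y + 1), fun a ha ha' => ?_⟩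
        rcases lt_succ_cases ha with ha | rfl
        · obtain ⟨z, hz, hz'⟩ := hb a ha ha'
          exact ⟨z, lt_max_of_lt_left hz, hz'⟩
        · exact ⟨y, lt_max_of_lt_right (lt_succ_self y), hy⟩
      · refine ⟨b, fun a ha ha' => ?_⟩
        rcases lt_succ_cases ha with ha | rfl
        · exact hb a ha ha'
        · exact absurd ha' hn
    obtain ⟨b, hb⟩ := h₂ (f e)
    exact ⟨b, fun a ha => hb a ha ha⟩
  · rintro ⟨b, hb⟩ a ha
    obtain ⟨y, _, hy⟩ := hb a ha
    exact (key _ _).2 ⟨y, hy⟩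

/-- The relations on assignments that are `Δ⁰₁` with parameters. -/
class IsDelta (S : Set (Set M)) (P : (ℕ → M) → Prop) : Prop where
  pos : IsSigma S P
  neg : IsSigma S (fun e => ¬ P e)

/-- The functions of assignments whose graph is `Σ⁰₁` with parameters. -/
class IsDef (S : Set (Set M)) (f : (ℕ → M) → M) : Prop where
  graph : IsSigma S (fun e => e 0 = f (fun n => e (n + 1)))

instance IsSigma.of_isDelta {P : (ℕ → M) → Prop} [hP : IsDelta S P] : IsSigma S P := hP.pos

theorem IsTerm.isDef {f : (ℕ → M) → M} (hf : IsTerm f) : IsDef S f :=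
  ⟨(IsBdd.eq (.var 0) (hf.comp fun i => .var (i + 1))).isSigma⟩

instance IsDef.var (i : ℕ) : IsDef S (fun e => e i) := IsTerm.isDef (.var i)

instance IsDef.const (c : M) : IsDef S (fun _ => c) := IsTerm.isDef (.const c)

theorem IsDef.comp {f : (ℕ → M) → M} (hf : IsDef S f) {σ : (ℕ → M) → ℕ → M}
    (hσ : ∀ i, IsTerm (fun e => σ e i)) : IsDef S (fun e => f (σ e)) :=
  ⟨hf.graph.comp (IsTerm.push hσ)⟩

theorem IsDelta.comp {P : (ℕ → M) → Prop} (hP : IsDelta S P) {σ : (ℕ → M) → ℕ → M}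
    (hσ : ∀ i, IsTerm (fun e => σ e i)) : IsDelta S (fun e => P (σ e)) :=
  ⟨hP.pos.comp hσ, hP.neg.comp hσ⟩

theorem IsDelta.congr {P Q : (ℕ → M) → Prop} (hP : IsDelta S P) (h : ∀ e, Q e ↔ P e) :
    IsDelta S Q :=
  ⟨hP.pos.congr h, hP.neg.congr fun e => not_congr (h e)⟩

theorem IsSigma.subst {P : M → (ℕ → M) → Prop} {f : (ℕ → M) → M}
    (hP : IsSigma S (fun e => P (e 0) (fun n => e (n + 1)))) (hf : IsDef S f) :
    IsSigma S (fun e => P (f e) e) := by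
  have h₁ := hf.graph
  refine IsSigma.congr (P := fun e => ∃ a, a = f e ∧ P a e) inferInstance fun e => ?_
  simp

theorem IsDelta.subst {P : M → (ℕ → M) → Prop} {f : (ℕ → M) → M}
    (hP : IsDelta S (fun e => P (e 0) (fun n => e (n + 1)))) (hf : IsDef S f) :
    IsDelta S (fun e => P (f e) e) :=
  ⟨hP.pos.subst hf, IsSigma.subst (P := fun a e => ¬ P a e) hP.neg hf⟩

theorem IsDef.subst {F : M → (ℕ → M) → M} {f : (ℕ → M) → M}
    (hF : IsDef S (fun e => F (e 0) (fun n => e (n + 1)))) (hf : IsDef S f) :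
    IsDef S (fun e => F (f e) e) := by
  have h := hF.graph.comp (σ := fun e => push (e 1) (push (e 0) (fun n => e (n + 2)))) fun i => by
    match i with
    | 0 => exact .var 1
    | 1 => exact .var 0
    | i + 2 => exact .var (i + 2)
  have hf' := hf.comp (σ := fun e n => e (n + 1)) (fun i => .var (i + 1))
  exact ⟨IsSigma.subst (P := fun a e => e 0 = F a (fun n => e (n + 1))) h hf'⟩

theorem isDef_comp₁ {F : M → M} (hF : IsDef S (fun e => F (e 0))) (f : (ℕ → M) → M)
    [hf : IsDef S f] : IsDef S (fun e => F (f e)) :=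
  IsDef.subst (F := fun a _ => F a) hF hf

theorem isDef_comp₂ {F : M → M → M} (hF : IsDef S (fun e => F (e 0) (e 1))) (f g : (ℕ → M) → M)
    [hf : IsDef S f] [hg : IsDef S g] : IsDef S (fun e => F (f e) (g e)) := by
  refine IsDef.subst (F := fun a e => F a (g e)) ?_ hf
  refine IsDef.subst (F := fun b e => F (e 0) b) ?_ (hg.comp (σ := fun e n => e (n + 1))
    (fun i => .var (i + 1)))
  exact hF.comp (σ := fun e => push (e 1) (fun _ => e 0)) fun i => by
    cases i
    · exact .var 1
    · exact .var 0

instance IsDef.add {f g : (ℕ → M) → M} [hf : IsDef S f] [hg : IsDef S g] :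
    IsDef S (fun e => f e + g e) :=
  isDef_comp₂ (F := fun a b => a + b) (IsTerm.isDef (.add (.var 0) (.var 1))) f g

instance IsDef.mul {f g : (ℕ → M) → M} [hf : IsDef S f] [hg : IsDef S g] :
    IsDef S (fun e => f e * g e) :=
  isDef_comp₂ (F := fun a b => a * b) (IsTerm.isDef (.mul (.var 0) (.var 1))) f g

theorem isDelta_comp₁ {P : M → Prop} (hP : IsDelta S (fun e => P (e 0))) (f : (ℕ → M) → M)
    [hf : IsDef S f] : IsDelta S (fun e => P (f e)) :=
  IsDelta.subst (P := fun a _ => P a) hP hf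

theorem isDelta_comp₂ {P : M → M → Prop} (hP : IsDelta S (fun e => P (e 0) (e 1)))
    (f g : (ℕ → M) → M) [hf : IsDef S f] [hg : IsDef S g] : IsDelta S (fun e => P (f e) (g e)) := by
  refine IsDelta.subst (P := fun a e => P a (g e)) ?_ hf
  refine IsDelta.subst (P := fun b e => P (e 0) b) ?_ (hg.comp (σ := fun e n => e (n + 1))
    (fun i => .var (i + 1)))
  exact hP.comp (σ := fun e => push (e 1) (fun _ => e 0)) fun i => by
    cases i
    · exact .var 1
    · exact .var 0

instance IsDelta.not {P : (ℕ → M) → Prop} [hP : IsDelta S P] : IsDelta S (fun e => ¬ P e) :=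
  ⟨hP.neg, hP.pos.congr fun _ => not_not⟩

instance IsDelta.and {P Q : (ℕ → M) → Prop} [hP : IsDelta S P] [hQ : IsDelta S Q] :
    IsDelta S (fun e => P e ∧ Q e) := by
  have h₁ := hP.neg
  have h₂ := hQ.neg
  exact ⟨inferInstance, IsSigma.congr (P := fun e => ¬ P e ∨ ¬ Q e) inferInstance
    fun e => not_and_or⟩

instance IsDelta.or {P Q : (ℕ → M) → Prop} [hP : IsDelta S P] [hQ : IsDelta S Q] :
    IsDelta S (fun e => P e ∨ Q e) :=
  IsDelta.congr (P := fun e => ¬ (¬ P e ∧ ¬ Q e)) inferInstance fun e => by tauto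

instance IsDelta.imp {P Q : (ℕ → M) → Prop} [hP : IsDelta S P] [hQ : IsDelta S Q] :
    IsDelta S (fun e => P e → Q e) :=
  IsDelta.congr (P := fun e => ¬ P e ∨ Q e) inferInstance fun e => by tauto

theorem IsBdd.isDelta {P : (ℕ → M) → Prop} (hP : IsBdd S P) : IsDelta S P :=
  ⟨hP.isSigma, (IsBdd.not hP).isSigma⟩

instance IsDelta.lt {f g : (ℕ → M) → M} [hf : IsDef S f] [hg : IsDef S g] :
    IsDelta S (fun e => f e < g e) :=
  isDelta_comp₂ (P := fun a b => a < b) (IsBdd.lt (.var 0) (.var 1)).isDelta f g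

instance IsDelta.eq {f g : (ℕ → M) → M} [hf : IsDef S f] [hg : IsDef S g] :
    IsDelta S (fun e => f e = g e) :=
  isDelta_comp₂ (P := fun a b => a = b) (IsBdd.eq (.var 0) (.var 1)).isDelta f g

instance IsDelta.le {f g : (ℕ → M) → M} [hf : IsDef S f] [hg : IsDef S g] :
    IsDelta S (fun e => f e ≤ g e) :=
  IsDelta.congr (P := fun e => ¬ g e < f e) inferInstance fun _ => not_lt.symm

instance IsDelta.mem {f : (ℕ → M) → M} {X : Set M} [hX : Fact (X ∈ S)] [hf : IsDef S f] :
    IsDelta S (fun e => f e ∈ X) :=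
  isDelta_comp₁ (P := fun a => a ∈ X) (IsBdd.mem (.var 0) hX.out).isDelta f

instance IsSigma.ball_lt [Model S] {f : (ℕ → M) → M} {P : M → (ℕ → M) → Prop} [hf : IsDef S f]
    [hP : IsSigma S (fun e => P (e 0) (fun n => e (n + 1)))] :
    IsSigma S (fun e => ∀ a, a < f e → P a e) := by
  have h : IsSigma S (fun e => ∀ a, a < e 0 → P a (fun n => e (n + 1))) := by
    refine IsSigma.ball_term (.var 0) (hP.comp (σ := fun e => push (e 0) (fun n => e (n + 2)))
      fun i => ?_)
    cases i
    · exact .var 0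
    · exact .var _
  exact IsSigma.subst (P := fun b e => ∀ a, a < b → P a e) h hf

instance IsDelta.ball_lt [Model S] {f : (ℕ → M) → M} {P : M → (ℕ → M) → Prop} [hf : IsDef S f]
    [hP : IsDelta S (fun e => P (e 0) (fun n => e (n + 1)))] :
    IsDelta S (fun e => ∀ a, a < f e → P a e) := by
  have h := hP.neg
  have h' := hP.pos
  refine ⟨inferInstance, IsSigma.congr (P := fun e => ∃ a, a < f e ∧ ¬ P a e) ?_ fun e => ?_⟩
  · have hf' := hf.comp (σ := fun e n => e (n + 1)) (fun i => .var (i + 1))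
    exact inferInstance
  · push Not
    rfl

instance IsDelta.bex_lt [Model S] {f : (ℕ → M) → M} {P : M → (ℕ → M) → Prop} [hf : IsDef S f]
    [hP : IsDelta S (fun e => P (e 0) (fun n => e (n + 1)))] :
    IsDelta S (fun e => ∃ a, a < f e ∧ P a e) := by
  refine IsDelta.congr (P := fun e => ¬ ∀ a, a < f e → ¬ P a e) inferInstance fun e => ?_
  push Not
  rfl

instance IsDelta.bex_le [Model S] {f : (ℕ → M) → M} {P : M → (ℕ → M) → Prop} [hf : IsDef S f]
    [hP : IsDelta S (fun e => P (e 0) (fun n => e (n + 1)))] :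
    IsDelta S (fun e => ∃ a, a ≤ f e ∧ P a e) := by
  refine IsDelta.congr (P := fun e => ∃ a, a < f e + 1 ∧ P a e) inferInstance fun e => ?_
  simp only [Numbers.lt_succ_iff]

instance IsDelta.prop (p : Prop) : IsDelta S (fun _ : ℕ → M => p) := by
  by_cases h : p
  · exact IsDelta.congr (P := fun e => e 0 = e 0) inferInstance fun e => by simp [h]
  · exact IsDelta.congr (P := fun e => ¬ e 0 = e 0) inferInstance fun e => by simp [h]

instance IsDef.ite {p : (ℕ → M) → Prop} {f g : (ℕ → M) → M} [hp : IsDelta S p] [hf : IsDef S f]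
    [hg : IsDef S g] [∀ e, Decidable (p e)] : IsDef S (fun e => if p e then f e else g e) := by
  have hp' := hp.comp (σ := fun e n => e (n + 1)) (fun i => .var (i + 1))
  have h₁ := hf.graph
  have h₂ := hg.graph
  refine ⟨IsSigma.congr (P := fun e => (p (fun n => e (n + 1)) ∧ e 0 = f (fun n => e (n + 1))) ∨
    (¬ p (fun n => e (n + 1)) ∧ e 0 = g (fun n => e (n + 1)))) inferInstance fun e => ?_⟩
  split_ifs with h <;> simp [h]

/-- A function is definable if its graph is `Δ⁰₁`. -/
theorem IsDef.of_isDelta {f : (ℕ → M) → M}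
    (h : IsDelta S (fun e => e 0 = f (fun n => e (n + 1)))) : IsDef S f := ⟨h.pos⟩

/-- Fixing all variables but the first in a `Δ⁰₁` relation. -/
theorem IsDelta.specialize {P : M → (ℕ → M) → Prop}
    (hP : IsDelta S (fun e => P (e 0) (fun n => e (n + 1)))) (e : ℕ → M) :
    IsDelta S (fun e' => P (e' 0) e) :=
  hP.comp (σ := fun e' => push (e' 0) e) fun i => by
    cases i
    · exact .var 0
    · exact .const _

theorem IsDef.specialize₂ {F : M → M → (ℕ → M) → M}
    (hF : IsDef S (fun e => F (e 0) (e 1) (fun n => e (n + 2)))) (e : ℕ → M) :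
    IsDef S (fun e' => F (e' 0) (e' 1) e) :=
  hF.comp (σ := fun e' => push (e' 0) (push (e' 1) e)) fun i => by
    match i with
    | 0 => exact .var 0
    | 1 => exact .var 1
    | i + 2 => exact .const _

/-! ### Induction, search and comprehension -/

variable (S) [Model S]

/-- Induction for `Π⁰₁` properties, by `Σ⁰₁` induction downwards from a counterexample. -/
theorem pi_induction {P : M → Prop} [hP : IsSigma S (fun e => ¬ P (e 0))] (zero : P 0)
    (succ : ∀ n, P n → P (n + 1)) (n : M) : P n := by
  by_contra hn
  have key : ∀ m : M, ∃ j, (j + m = n ∧ ¬ P j) ∨ n < m := by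
    have hP' : IsSigma S (fun e => ¬ P (e 0)) := hP
    refine sigma_induction S ⟨n, Or.inl ⟨by simp, hn⟩⟩ ?_
    rintro m ⟨j, ⟨h₁, h₂⟩ | h⟩
    · rcases eq_or_ne j 0 with rfl | hj
      · exact absurd zero h₂
      · obtain ⟨k, rfl⟩ := exists_add_of_le (succ_le_of_lt (pos_iff_ne_zero.2 hj))
        refine ⟨k, Or.inl ⟨by rw [← h₁]; ring, fun h => h₂ ?_⟩⟩
        rw [zero_add, add_comm]
        exact succ k h
    · exact ⟨0, Or.inr (h.trans (lt_succ_self m))⟩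
  obtain ⟨j, ⟨h₁, h₂⟩ | h⟩ := key n
  · rw [add_eq_right] at h₁
    exact h₂ (h₁ ▸ zero)
  · exact lt_irrefl _ h

theorem delta_induction {P : M → Prop} [hP : IsDelta S (fun e => P (e 0))] (zero : P 0)
    (succ : ∀ n, P n → P (n + 1)) (n : M) : P n :=
  sigma_induction S zero succ n

/-- The least number principle. -/
theorem exists_least {P : M → Prop} [hP : IsDelta S (fun e => P (e 0))] (h : ∃ a, P a) :
    ∃ a, P a ∧ ∀ b, b < a → ¬ P b := by
  by_contra! hcon
  obtain ⟨a, ha⟩ := h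
  have key : ∀ n : M, ∀ b, b < n → ¬ P b := by
    have := hP.comp (σ := fun e _ => e 0) (fun _ => .var 0)
    refine delta_induction S (fun b hb => absurd hb not_lt_zero) fun n hn b hb => ?_
    rcases lt_succ_cases hb with hb | rfl
    · exact hn b hb
    · intro hP
      obtain ⟨c, hc, hc'⟩ := hcon _ hP
      exact hn c hc hc'
  exact key (a + 1) a (lt_succ_self a) ha

/-- The least number principle for `Π⁰₁` properties. -/
theorem exists_least_pi {P : M → Prop} [hP : IsSigma S (fun e => ¬ P (e 0))] (h : ∃ a, P a) :
    ∃ a, P a ∧ ∀ b, b < a → ¬ P b := by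
  by_contra! hcon
  obtain ⟨a, ha⟩ := h
  have key : ∀ n : M, ∀ b, b < n → ¬ P b := by
    have hP' : IsSigma S (fun e => ¬ P (e 0)) := hP
    refine sigma_induction S (fun b hb => absurd hb not_lt_zero) fun n hn b hb => ?_
    rcases lt_succ_cases hb with hb | rfl
    · exact hn b hb
    · intro hP
      obtain ⟨c, hc, hc'⟩ := hcon _ hP
      exact hn c hc hc'
  exact key (a + 1) a (lt_succ_self a) ha

variable {S}

open Classical in
/-- The least number with the property `P`. -/
noncomputable def least (P : M → Prop) : M :=
  if h : ∃ a, P a ∧ ∀ b, b < a → ¬ P b then h.choose else 0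

variable (S) in
theorem least_eq_iff {P : M → Prop} [hP : IsDelta S (fun e => P (e 0))] (h : ∃ a, P a) (a : M) :
    a = least P ↔ P a ∧ ∀ b, b < a → ¬ P b := by
  have h' := exists_least S h
  have h'' := h'.choose_spec
  rw [least, dif_pos h']
  constructor
  · rintro rfl
    exact h''
  · rintro ⟨h₁, h₂⟩
    refine le_antisymm (not_lt.1 fun h => h₂ _ h h''.1) (not_lt.1 fun h => h''.2 _ h h₁)

variable (S) in
theorem least_spec {P : M → Prop} [hP : IsDelta S (fun e => P (e 0))] (h : ∃ a, P a) :
    P (least P) :=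
  ((least_eq_iff S h _).1 rfl).1

variable (S) in
theorem least_le {P : M → Prop} [hP : IsDelta S (fun e => P (e 0))] {a : M} (h : P a) :
    least P ≤ a :=
  not_lt.1 fun h' => ((least_eq_iff S ⟨a, h⟩ _).1 rfl).2 a h' h

theorem IsDef.least {P : M → (ℕ → M) → Prop}
    (hP : IsDelta S (fun e => P (e 0) (fun n => e (n + 1)))) (h : ∀ e, ∃ a, P a e) :
    IsDef S (fun e => least (fun a => P a e)) := by
  have hP' : IsDelta S (fun e => P (e 0) (fun n => e (n + 2))) :=
    hP.comp (σ := fun e => push (e 0) (fun n => e (n + 2))) fun i => by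
      cases i
      · exact .var 0
      · exact .var _
  refine IsDef.of_isDelta (IsDelta.congr (P := fun e => P (e 0) (fun n => e (n + 1)) ∧
    ∀ b, b < e 0 → ¬ P b (fun n => e (n + 1))) inferInstance fun e => ?_)
  have := hP.specialize (fun n => e (n + 1))
  exact least_eq_iff S (h _) _

/-- Bounded search: the least `a ≤ n` such that `P a` or `a = n`. -/
noncomputable def bleast (n : M) (P : M → Prop) : M := least (fun a => P a ∨ n ≤ a)

instance IsDef.bleast {n : (ℕ → M) → M} {P : M → (ℕ → M) → Prop} [hn : IsDef S n]
    [hP : IsDelta S (fun e => P (e 0) (fun n => e (n + 1)))] :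
    IsDef S (fun e => bleast (n e) (fun a => P a e)) := by
  have hn' := hn.comp (σ := fun e n => e (n + 1)) (fun i => .var (i + 1))
  exact IsDef.least (P := fun a e => P a e ∨ n e ≤ a) inferInstance fun e => ⟨n e, Or.inr le_rfl⟩

theorem bleast_spec (S : Set (Set M)) [Model S] {P : M → Prop} [hP : IsDelta S (fun e => P (e 0))]
    {a n : M} (h : P a) (hn : a ≤ n) : P (bleast n P) ∧ bleast n P ≤ a := by
  have h₁ : bleast n P ≤ a := least_le S (Or.inl h)
  refine ⟨?_, h₁⟩
  rcases least_spec S (P := fun a => P a ∨ n ≤ a) ⟨a, Or.inl h⟩ with h₂ | h₂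
  · exact h₂
  · have h₃ : bleast n P = a := le_antisymm h₁ (hn.trans h₂)
    rwa [h₃]

/-- A `Σ⁰₁` relation that is total contains the graph of a definable function. -/
theorem exists_isDef_of_isSigma {P : M → (ℕ → M) → Prop}
    (hP : IsSigma S (fun e => P (e 0) (fun n => e (n + 1)))) (h : ∀ e, ∃ a, P a e) :
    ∃ f : (ℕ → M) → M, IsDef S f ∧ ∀ e, P (f e) e := by
  obtain ⟨Q, hQ, hPQ⟩ := hP
  have key : ∀ a e, P a e ↔ ∃ y, Q (push y (push a e)) := fun a e => hPQ (push a e)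
  have hQ' : IsDelta S (fun e => Q (push (e 0) (push (e 1) (fun n => e (n + 3))))) :=
    hQ.isDelta.comp fun i => by
      match i with
      | 0 => exact .var 0
      | 1 => exact .var 1
      | i + 2 => exact .var (i + 3)
  -- `z` bounds both the value and the witness
  have h₁ : IsDef S (fun e => least (fun z => ∃ a, a < z ∧ ∃ y, y < z ∧ Q (push y (push a e)))) := by
    refine IsDef.least (P := fun z e => ∃ a, a < z ∧ ∃ y, y < z ∧ Q (push y (push a e)))
      inferInstance fun e => ?_
    obtain ⟨a, ha⟩ := h e
    obtain ⟨y, hy⟩ := (key a e).1 ha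
    exact ⟨max a y + 1, a, Numbers.lt_succ_iff.2 (le_max_left _ _), y,
      Numbers.lt_succ_iff.2 (le_max_right _ _), hy⟩
  set z : (ℕ → M) → M := fun e => least (fun z => ∃ a, a < z ∧ ∃ y, y < z ∧ Q (push y (push a e)))
    with hz
  have hz' := h₁.comp (σ := fun e n => e (n + 1)) (fun i => .var (i + 1))
  have hspec : ∀ e, ∃ a, a < z e ∧ ∃ y, y < z e ∧ Q (push y (push a e)) := fun e => by
    have hQ₂ : IsDelta S (fun e' => Q (push (e' 0) (push (e' 1) e))) :=
      hQ.isDelta.comp fun i => by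
        match i with
        | 0 => exact .var 0
        | 1 => exact .var 1
        | i + 2 => exact .const _
    refine least_spec S (P := fun z => ∃ a, a < z ∧ ∃ y, y < z ∧ Q (push y (push a e))) ?_
    obtain ⟨a, ha⟩ := h e
    obtain ⟨y, hy⟩ := (key a e).1 ha
    exact ⟨max a y + 1, a, Numbers.lt_succ_iff.2 (le_max_left _ _), y,
      Numbers.lt_succ_iff.2 (le_max_right _ _), hy⟩
  have hQ₃ : IsDelta S (fun e => Q (push (e 0) (push (e 1) (fun n => e (n + 2))))) :=
    hQ.isDelta.comp fun i => by
      match i with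
      | 0 => exact .var 0
      | 1 => exact .var 1
      | i + 2 => exact .var (i + 2)
  have hz'' := h₁.comp (σ := fun e n => e (n + 1)) (fun i => .var (i + 1))
  refine ⟨fun e => bleast (z e) (fun a => ∃ y, y < z e ∧ Q (push y (push a e))), inferInstance,
    fun e => ?_⟩
  obtain ⟨a, ha, hy⟩ := hspec e
  have hQ₂ : IsDelta S (fun e' => Q (push (e' 0) (push (e' 1) e))) :=
    hQ.isDelta.comp fun i => by
      match i with
      | 0 => exact .var 0
      | 1 => exact .var 1
      | i + 2 => exact .const _
  obtain ⟨⟨y, _, h'⟩, _⟩ := bleast_spec S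
    (P := fun a => ∃ y, y < z e ∧ Q (push y (push a e))) (n := z e) hy ha.le
  exact (key _ _).2 ⟨y, h'⟩

/-- Unbounded search: a total `Σ⁰₁` relation has a definable selector. -/
theorem exists_isDef₁ (S : Set (Set M)) [Model S] {P : M → M → Prop}
    [hP : IsSigma S (fun e => P (e 0) (e 1))] (h : ∀ x, ∃ a, P a x) :
    ∃ f : M → M, IsDef S (fun e => f (e 0)) ∧ ∀ x, P (f x) x := by
  obtain ⟨f, hf, hf'⟩ := exists_isDef_of_isSigma (P := fun a e => P a (e 0)) hP fun e => h _
  exact ⟨fun x => f (fun _ => x), hf.comp (σ := fun e _ => e 0) (fun _ => .var 0),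
    fun x => hf' _⟩

theorem exists_isDef₂ (S : Set (Set M)) [Model S] {P : M → M → M → Prop}
    [hP : IsSigma S (fun e => P (e 0) (e 1) (e 2))] (h : ∀ x y, ∃ a, P a x y) :
    ∃ f : M → M → M, IsDef S (fun e => f (e 0) (e 1)) ∧ ∀ x y, P (f x y) x y := by
  obtain ⟨f, hf, hf'⟩ := exists_isDef_of_isSigma (P := fun a e => P a (e 0) (e 1)) hP fun e => h _ _
  refine ⟨fun x y => f (push x (fun _ => y)),
    hf.comp (σ := fun e => push (e 0) (fun _ => e 1)) (fun i => ?_), fun x y => hf' _⟩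
  cases i
  · exact .var 0
  · exact .var 1

/-- `Δ⁰₁` comprehension. -/
theorem comprehension (S : Set (Set M)) [Model S] {P : M → Prop}
    [hP : IsDelta S (fun e => P (e 0))] : {n | P n} ∈ S :=
  (Model.rca0 (S := S)).comprehension hP.pos hP.neg

end Closure

/-! ### Division, sequences and primitive recursion -/

section Recursion

variable {M : Type u} [Numbers M] {S : Set (Set M)}

instance IsSigma.imp {P Q : (ℕ → M) → Prop} [hP : IsDelta S P] [hQ : IsSigma S Q] :
    IsSigma S (fun e => P e → Q e) := by
  have := hP.neg
  exact IsSigma.congr (P := fun e => ¬ P e ∨ Q e) inferInstance fun e => by tauto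

instance IsSigma.dvd {f g : (ℕ → M) → M} [hf : IsDef S f] [hg : IsDef S g] :
    IsSigma S (fun e => f e ∣ g e) := by
  have hf' := hf.comp (σ := fun e n => e (n + 1)) (fun i => .var (i + 1))
  have hg' := hg.comp (σ := fun e n => e (n + 1)) (fun i => .var (i + 1))
  exact IsSigma.ex (P := fun c e => g e = f e * c)

variable (S) in
theorem eq_zero_or_succ [Model S] (a : M) : a = 0 ∨ ∃ b, a = b + 1 :=
  (Model.rca0 (S := S)).eq_zero_or_succ a

/-- The quotient of the division of `a` by `b`. -/
noncomputable def quo (a b : M) : M := bleast a (fun q => a < (q + 1) * b)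

/-- The remainder of the division of `a` by `b`. -/
noncomputable def rmd (a b : M) : M := bleast a (fun r => a = quo a b * b + r)

instance IsDef.quo [Model S] {f g : (ℕ → M) → M} [hf : IsDef S f] [hg : IsDef S g] :
    IsDef S (fun e => quo (f e) (g e)) := by
  have : IsDef S (fun e : ℕ → M => SOA.quo (e 0) (e 1)) :=
    IsDef.bleast (P := fun q e => e 0 < (q + 1) * e 1)
  exact isDef_comp₂ this f g

instance IsDef.rmd [Model S] {f g : (ℕ → M) → M} [hf : IsDef S f] [hg : IsDef S g] :
    IsDef S (fun e => rmd (f e) (g e)) := by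
  have : IsDef S (fun e : ℕ → M => SOA.rmd (e 0) (e 1)) :=
    IsDef.bleast (P := fun r e => e 0 = SOA.quo (e 0) (e 1) * e 1 + r)
  exact isDef_comp₂ this f g

variable (S) in
theorem lt_quo_succ_mul [Model S] (a : M) {b : M} (hb : 0 < b) : a < (quo a b + 1) * b := by
  refine (bleast_spec S (P := fun q => a < (q + 1) * b) (a := a) ?_ le_rfl).1
  exact Numbers.lt_succ_iff.2 le_rfl |>.trans_le (le_mul_of_one_le_right zero_le
    (by simpa using succ_le_of_lt hb))

variable (S) in
theorem quo_mul_le [Model S] (a : M) {b : M} (hb : 0 < b) : quo a b * b ≤ a := by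
  by_contra! h
  rcases eq_zero_or_succ S (quo a b) with h' | ⟨q, h'⟩
  · rw [h', zero_mul] at h
    exact not_lt_zero h
  · rw [h'] at h
    rcases le_total q a with hq | hq
    · have := (bleast_spec S (P := fun q => a < (q + 1) * b) h hq).2
      change quo a b ≤ q at this
      rw [h'] at this
      exact absurd (lt_succ_self q) (not_lt.2 this)
    · have h₁ := (bleast_spec S (P := fun q => a < (q + 1) * b) (a := a) (n := a)
        ((Numbers.lt_succ_iff.2 le_rfl).trans_le (le_mul_of_one_le_right zero_le
          (by simpa using succ_le_of_lt hb))) le_rfl).2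
      change quo a b ≤ a at h₁
      rw [h'] at h₁
      exact absurd (lt_succ_self q) (not_lt.2 (h₁.trans hq))

variable (S) in
theorem quo_eq [Model S] {a b q r : M} (h : a = q * b + r) (hr : r < b) : quo a b = q := by
  have hb : 0 < b := pos_of_gt hr
  have h₁ := lt_quo_succ_mul S a hb
  have h₂ := quo_mul_le S a hb
  refine le_antisymm (not_lt.1 fun hlt => ?_) (not_lt.1 fun hlt => ?_)
  · have := (mul_le_mul_of_nonneg_right (succ_le_of_lt hlt) (zero_le (a := b))).trans h₂
    rw [add_mul, one_mul] at this
    grind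
  · have := h₁.trans_le (mul_le_mul_of_nonneg_right (succ_le_of_lt hlt) (zero_le (a := b)))
    have := zero_le (a := r)
    grind

variable (S) in
theorem quo_mul_add_rmd [Model S] (a : M) {b : M} (hb : 0 < b) : a = quo a b * b + rmd a b := by
  obtain ⟨r, hr⟩ := exists_add_of_le (quo_mul_le S a hb)
  exact (bleast_spec S (P := fun r => a = quo a b * b + r) hr
    (by conv_rhs => rw [hr]
        exact le_add_self)).1

variable (S) in
theorem rmd_lt [Model S] (a : M) {b : M} (hb : 0 < b) : rmd a b < b := by
  have h₁ := lt_quo_succ_mul S a hb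
  have h₂ := quo_mul_add_rmd S a hb
  rw [add_mul, one_mul] at h₁
  grind

variable (S) in
theorem rmd_eq [Model S] {a b q r : M} (h : a = q * b + r) (hr : r < b) : rmd a b = r := by
  have h₁ := quo_mul_add_rmd S a (pos_of_gt hr)
  rw [quo_eq S h hr] at h₁
  grind

/-- Gödel's beta function: the entry number `i` of the sequence coded by `c` and `d`. -/
noncomputable def beta (c d i : M) : M := rmd c (d * (i + 1) + 1)

instance IsDef.beta [Model S] {f g h : (ℕ → M) → M} [hf : IsDef S f] [hg : IsDef S g]
    [hh : IsDef S h] : IsDef S (fun e => beta (f e) (g e) (h e)) :=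
  IsDef.rmd (f := fun e => f e) (g := fun e => g e * (h e + 1) + 1)

/-- The moduli of the beta function are coprime. -/
theorem exists_beta_coprime [Model S] {D i j : M} (hD : 0 < D) (hij : i < j)
    (hdvd : ∀ t, t + i = j → t ∣ D) :
    ∃ U V, (D * (i + 1) + 1) * U = (D * (j + 1) + 1) * V + 1 := by
  obtain ⟨t, ht⟩ := exists_add_of_le hij.le
  obtain ⟨c, hc⟩ := hdvd t (by rw [ht, add_comm])
  have hc0 : 0 < c := by
    rcases eq_zero_or_succ S c with rfl | ⟨k, rfl⟩
    · simp [hc] at hD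
    · exact pos_of_gt (lt_succ_self k)
  have h1 : 0 < i + 1 := pos_of_gt (lt_succ_self i)
  have h2 : 0 < j + 1 := pos_of_gt (lt_succ_self j)
  obtain ⟨V₀, hV₀⟩ : ∃ V₀, (i + 1) * (j + 1) * c = V₀ + 1 :=
    (eq_zero_or_succ S _).resolve_left (mul_pos (mul_pos h1 h2) hc0).ne'
  obtain ⟨X, hX⟩ : ∃ X, (i + 1) * (i + 1) * c * D * (j + 1) = X + 1 :=
    (eq_zero_or_succ S _).resolve_left
      (mul_pos (mul_pos (mul_pos (mul_pos h1 h1) hc0) hD) h2).ne'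
  have key : (D * (j + 1) + 1) * ((i + 1) * (i + 1) * c) = (D * (i + 1) + 1) * V₀ + 1 := by
    have : (D * (j + 1) + 1) * ((i + 1) * (i + 1) * c) + D * (i + 1)
        = (D * (i + 1) + 1) * (V₀ + 1) := by
      rw [← hV₀, hc, ht]; ring
    grind
  refine ⟨V₀ * D * (j + 1), X, ?_⟩
  have : (D * (i + 1) + 1) * (V₀ * D * (j + 1)) + D * (j + 1)
      = (D * (j + 1) + 1) * (X + 1) := by
    rw [← hX]
    calc _ = ((D * (i + 1) + 1) * V₀ + 1) * (D * (j + 1)) := by ring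
      _ = _ := by rw [← key]; ring
  grind

/-- Every finite sequence of the model is coded by the beta function. -/
theorem exists_beta [Model S] {w : M → M} (hw : IsDef S (fun e => w (e 0))) (n : M) :
    ∃ c d, ∀ i, i < n → beta c d i = w i := by
  have hw' := isDef_comp₁ hw
  obtain ⟨u, hu⟩ : ∃ u, ∀ i, i < n → w i < u := by
    refine sigma_induction S (P := fun n => ∃ u, ∀ i, i < n → w i < u) ⟨0, by simp⟩ ?_ n
    rintro n ⟨u, hu⟩
    refine ⟨max u (w n + 1), fun i hi => ?_⟩
    rcases lt_succ_cases hi with hi | rfl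
    · exact lt_max_of_lt_left (hu i hi)
    · exact lt_max_of_lt_right (lt_succ_self _)
  obtain ⟨d₀, hd₀, hdvd⟩ : ∃ d : M, 0 < d ∧ ∀ i, i < n → i + 1 ∣ d := by
    refine sigma_induction S (P := fun n => ∃ d : M, 0 < d ∧ ∀ i, i < n → i + 1 ∣ d)
      ⟨1, by simp⟩ ?_ n
    rintro n ⟨d, hd, hd'⟩
    refine ⟨d * (n + 1), mul_pos hd (pos_of_gt (lt_succ_self n)), fun i hi => ?_⟩
    rcases lt_succ_cases hi with hi | rfl
    · exact (hd' i hi).mul_right _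
    · exact dvd_mul_left _ _
  obtain ⟨D, hD⟩ : ∃ D, D = d₀ * (u + 1) := ⟨_, rfl⟩
  have hD0 : 0 < D := hD ▸ mul_pos hd₀ (pos_of_gt (lt_succ_self u))
  have hDu : u ≤ D := by
    rw [hD]
    exact (lt_succ_self u).le.trans (le_mul_of_one_le_left zero_le (by simpa using succ_le_of_lt hd₀))
  have hlt : ∀ i, i < n → w i < D * (i + 1) + 1 := fun i hi => by
    refine ((hu i hi).trans_le hDu).trans_le ?_
    exact (le_mul_of_one_le_right zero_le le_add_self).trans (lt_succ_self _).le
  have hcop : ∀ i j, i < j → j < n → ∃ U V, (D * (i + 1) + 1) * U = (D * (j + 1) + 1) * V + 1 := by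
    intro i j hij hj
    refine exists_beta_coprime (S := S) hD0 hij fun t ht => ?_
    rcases eq_zero_or_succ S t with rfl | ⟨k, rfl⟩
    · rw [zero_add] at ht
      exact absurd hij ht.not_lt
    · rw [hD]
      refine (hdvd k (lt_of_lt_of_le (lt_succ_self k) ?_)).mul_right _
      exact (le_self_add.trans ht.le).trans hj.le
  have key : ∀ k : M, k ≤ n → ∃ m a, (∀ i, i < k → (D * (i + 1) + 1 ∣ m) ∧
      ∃ x, a = x * (D * (i + 1) + 1) + w i) ∧
      ∀ j, j < n → k ≤ j → ∃ U V, m * U = (D * (j + 1) + 1) * V + 1 := by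
    refine sigma_induction S (fun _ => ⟨1, 0, by simp, fun j _ _ => ⟨1, 0, by simp⟩⟩) ?_
    intro k ih hk
    obtain ⟨m, a, h₁, h₂⟩ := ih ((lt_succ_self k).le.trans hk)
    have hkn : k < n := (lt_succ_self k).trans_le hk
    obtain ⟨U, V, hUV⟩ := h₂ k hkn le_rfl
    refine ⟨m * (D * (k + 1) + 1), a + m * (U * (w k + a * (D * (k + 1)))), fun i hi => ?_,
      fun j hj hkj => ?_⟩
    · rcases lt_succ_cases hi with hi | rfl
      · obtain ⟨⟨y, hy⟩, ⟨x, hx⟩⟩ := h₁ i hi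
        refine ⟨(Dvd.intro y hy.symm).mul_right _,
          x + y * (U * (w k + a * (D * (k + 1)))), ?_⟩
        rw [hy]
        nth_rewrite 1 [hx]
        ring
      · refine ⟨dvd_mul_left _ _, a + V * (w i + a * (D * (i + 1))), ?_⟩
        rw [← mul_assoc, hUV]
        ring
    · obtain ⟨U₁, V₁, h₃⟩ := h₂ j hj ((lt_succ_self k).le.trans hkj)
      obtain ⟨U₂, V₂, h₄⟩ := hcop k j ((lt_succ_self k).trans_le hkj) hj
      refine ⟨U₁ * U₂, V₁ * ((D * (j + 1) + 1) * V₂ + 1) + V₂, ?_⟩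
      calc m * (D * (k + 1) + 1) * (U₁ * U₂) = (m * U₁) * ((D * (k + 1) + 1) * U₂) := by ring
        _ = _ := by rw [h₃, h₄]; ring
  obtain ⟨m, a, h, _⟩ := key n le_rfl
  refine ⟨a, D, fun i hi => ?_⟩
  obtain ⟨x, hx⟩ := (h i hi).2
  exact rmd_eq S hx (hlt i hi)

/-- The value at `n` of the function that is defined by primitive recursion from the value `a` at
`0` and the step function `h`. -/
noncomputable def recVal (a : M) (h : M → M → M) (n : M) : M :=
  Classical.epsilon fun v => ∃ c d, beta c d 0 = a ∧
    (∀ i, i < n → beta c d (i + 1) = h i (beta c d i)) ∧ v = beta c d n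

/-- The course of a primitive recursion is coded by values of the `β`-function. -/
theorem exists_recVal [Model S] (a : M) {h : M → M → M} (hh : IsDef S (fun e => h (e 0) (e 1)))
    (n : M) : ∃ c d, beta c d 0 = a ∧ ∀ i, i < n → beta c d (i + 1) = h i (beta c d i) := by
  have hh' := isDef_comp₂ hh
  refine sigma_induction S (P := fun n => ∃ c d, beta c d 0 = a ∧
    ∀ i, i < n → beta c d (i + 1) = h i (beta c d i)) ?_ ?_ n
  · obtain ⟨c, d, hcd⟩ := exists_beta (S := S) (w := fun _ => a) inferInstance 1
    exact ⟨c, d, hcd 0 zero_lt_one, by simp⟩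
  · rintro n ⟨c, d, h₀, h₁⟩
    classical
    obtain ⟨c', d', h'⟩ := exists_beta (S := S)
      (w := fun i => if i ≤ n then beta c d i else h n (beta c d n)) inferInstance (n + 1 + 1)
    have h'' : ∀ i, i ≤ n → beta c' d' i = beta c d i := fun i hi => by
      rw [h' i ((Numbers.lt_succ_iff.2 hi).trans (lt_succ_self _)), if_pos hi]
    refine ⟨c', d', by rw [h'' 0 zero_le, h₀], fun i hi => ?_⟩
    rcases lt_succ_cases hi with hi | rfl
    · rw [h'' i hi.le, h'' _ (succ_le_of_lt hi), h₁ i hi]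
    · rw [h'' i le_rfl, h' _ (lt_succ_self _), if_neg (not_le.2 (lt_succ_self i))]

/-- Two codes for the course of the same primitive recursion have the same values. -/
theorem beta_unique [Model S] {h : M → M → M} {n c d c' d' : M} (h₀ : beta c d 0 = beta c' d' 0)
    (h₁ : ∀ i, i < n → beta c d (i + 1) = h i (beta c d i))
    (h₂ : ∀ i, i < n → beta c' d' (i + 1) = h i (beta c' d' i)) (i : M) (hi : i ≤ n) :
    beta c d i = beta c' d' i := by
  revert hi
  refine delta_induction S (P := fun i => i ≤ n → beta c d i = beta c' d' i) (fun _ => h₀) ?_ i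
  intro i ih hi
  have hi' : i < n := (lt_succ_self i).trans_le hi
  rw [h₁ i hi', h₂ i hi', ih hi'.le]

/-- The graph of a function defined by primitive recursion is `Σ⁰₁`. -/
theorem eq_recVal_iff [Model S] (a : M) {h : M → M → M} (hh : IsDef S (fun e => h (e 0) (e 1)))
    (n v : M) : v = recVal a h n ↔ ∃ c d, beta c d 0 = a ∧
      (∀ i, i < n → beta c d (i + 1) = h i (beta c d i)) ∧ v = beta c d n := by
  have hex : ∃ v, ∃ c d, beta c d 0 = a ∧
      (∀ i, i < n → beta c d (i + 1) = h i (beta c d i)) ∧ v = beta c d n := by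
    obtain ⟨c, d, h₀, h₁⟩ := exists_recVal (S := S) a hh n
    exact ⟨_, c, d, h₀, h₁, rfl⟩
  have hspec := Classical.epsilon_spec hex
  constructor
  · intro hv
    rw [← recVal, ← hv] at hspec
    exact hspec
  · rintro ⟨c, d, h₀, h₁, rfl⟩
    obtain ⟨c', d', h₀', h₁', hv⟩ := hspec
    rw [recVal, hv]
    exact beta_unique (S := S) (h₀.trans h₀'.symm) h₁ h₁' n le_rfl

theorem recVal_zero [Model S] (a : M) {h : M → M → M} (hh : IsDef S (fun e => h (e 0) (e 1))) :
    recVal a h 0 = a := by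
  obtain ⟨c, d, h₀, _, hv⟩ := (eq_recVal_iff (S := S) a hh 0 _).1 rfl
  rw [hv, h₀]

theorem recVal_succ [Model S] (a : M) {h : M → M → M} (hh : IsDef S (fun e => h (e 0) (e 1)))
    (n : M) : recVal a h (n + 1) = h n (recVal a h n) := by
  obtain ⟨c, d, h₀, h₁, hv⟩ := (eq_recVal_iff (S := S) a hh (n + 1) _).1 rfl
  rw [hv, h₁ n (lt_succ_self n)]
  congr 1
  exact (eq_recVal_iff (S := S) a hh n _).2
    ⟨c, d, h₀, fun i hi => h₁ i (hi.trans (lt_succ_self n)), rfl⟩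

instance IsDef.recVal [Model S] {a n : (ℕ → M) → M} {h : M → M → (ℕ → M) → M} [ha : IsDef S a]
    [hn : IsDef S n] [hh : IsDef S (fun e => h (e 0) (e 1) (fun n => e (n + 2)))] :
    IsDef S (fun e => recVal (a e) (fun i v => h i v e) (n e)) := by
  have key : IsDef S (fun e => SOA.recVal (a (fun n => e (n + 1)))
      (fun i v => h i v (fun n => e (n + 1))) (e 0)) := by
    refine ⟨IsSigma.congr (P := fun e => ∃ c d, SOA.beta c d 0 = a (fun n => e (n + 2)) ∧
      (∀ i, i < e 1 → SOA.beta c d (i + 1) = h i (SOA.beta c d i) (fun n => e (n + 2))) ∧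
        e 0 = SOA.beta c d (e 1)) ?_ fun e => ?_⟩
    · have ha' : IsDef S (fun e => a (fun n => e (n + 4))) :=
        ha.comp (σ := fun e n => e (n + 4)) (fun i => .var (i + 4))
      have hh' : IsDef S (fun e : ℕ → M => h (e 0) (SOA.beta (e 2) (e 1) (e 0))
          (fun n => e (n + 5))) := by
        refine IsDef.subst (F := fun v e => h (e 0) v (fun n => e (n + 5))) ?_ inferInstance
        exact hh.comp (σ := fun e => push (e 1) (push (e 0) (fun n => e (n + 6)))) fun i => by
          match i with
          | 0 => exact .var _
          | 1 => exact .var _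
          | i + 2 => exact .var (i + 6)
      exact inferInstance
    · exact eq_recVal_iff (S := S) _ (IsDef.specialize₂ (F := h) hh _) _ _
  exact IsDef.subst (F := fun m e => SOA.recVal (a e) (fun i v => h i v e) m) key hn

end Recursion

/-! ### Powers of two, factorials and pairs -/

section Arithmetic

variable {M : Type u} [Numbers M] {S : Set (Set M)}

/-- The power `2 ^ n`. -/
noncomputable def pw (n : M) : M := recVal 1 (fun _ v => v + v) n

/-- The factorial of `n`. -/
noncomputable def fac (n : M) : M := recVal 1 (fun i v => v * (i + 1)) n

instance IsDef.pw [Model S] {f : (ℕ → M) → M} [hf : IsDef S f] : IsDef S (fun e => pw (f e)) :=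
  IsDef.recVal (h := fun _ v _ => v + v)

instance IsDef.fac [Model S] {f : (ℕ → M) → M} [hf : IsDef S f] : IsDef S (fun e => fac (f e)) :=
  IsDef.recVal (h := fun i v _ => v * (i + 1))

theorem pw_zero (S : Set (Set M)) [Model S] : pw (0 : M) = 1 := recVal_zero (S := S) _ inferInstance

theorem pw_succ (S : Set (Set M)) [Model S] (n : M) : pw (n + 1) = pw n + pw n := recVal_succ (S := S) _ inferInstance n

theorem fac_zero (S : Set (Set M)) [Model S] : fac (0 : M) = 1 := recVal_zero (S := S) _ inferInstance

theorem fac_succ (S : Set (Set M)) [Model S] (n : M) : fac (n + 1) = fac n * (n + 1) := recVal_succ (S := S) _ inferInstance n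

theorem pw_pos (S : Set (Set M)) [Model S] (n : M) : 0 < pw n := by
  refine delta_induction S (P := fun n => 0 < pw n) (by simp [pw_zero S]) (fun n hn => ?_) n
  rw [pw_succ S]
  exact add_pos hn hn

theorem fac_pos (S : Set (Set M)) [Model S] (n : M) : 0 < fac n := by
  refine delta_induction S (P := fun n => 0 < fac n) (by simp [fac_zero S]) (fun n hn => ?_) n
  rw [fac_succ S]
  exact mul_pos hn (pos_of_gt (lt_succ_self n))

theorem pw_add (S : Set (Set M)) [Model S] (m n : M) : pw (m + n) = pw m * pw n := by
  refine delta_induction S (P := fun n => pw (m + n) = pw m * pw n) (by simp [pw_zero S])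
    (fun n hn => ?_) n
  rw [← add_assoc, pw_succ S, pw_succ S, hn]
  ring

theorem lt_pw (S : Set (Set M)) [Model S] (n : M) : n < pw n := by
  refine delta_induction S (P := fun n => n < pw n) (by simp [pw_zero S]) (fun n hn => ?_) n
  rw [pw_succ S]
  exact add_lt_add_of_lt_of_le hn (by simpa using succ_le_of_lt (pw_pos S n))

theorem pw_le_pw (S : Set (Set M)) [Model S] {m n : M} (h : m ≤ n) : pw m ≤ pw n := by
  obtain ⟨k, rfl⟩ := exists_add_of_le h
  rw [pw_add S]
  exact le_mul_of_one_le_right zero_le (by simpa using succ_le_of_lt (pw_pos S k))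

theorem dvd_fac (S : Set (Set M)) [Model S] {d n : M} (hd : 0 < d) (h : d ≤ n) : d ∣ fac n := by
  obtain ⟨k, rfl⟩ := exists_add_of_le h
  refine sigma_induction S (P := fun k => d ∣ fac (d + k)) ?_ (fun n hn => ?_) k
  · obtain ⟨c, rfl⟩ := (eq_zero_or_succ S d).resolve_left hd.ne'
    rw [add_zero, fac_succ S]
    exact dvd_mul_left _ _
  · rw [← add_assoc, fac_succ S]
    exact hn.mul_right _

theorem fac_dvd_fac (S : Set (Set M)) [Model S] {m n : M} (h : m ≤ n) : fac m ∣ fac n := by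
  obtain ⟨k, rfl⟩ := exists_add_of_le h
  refine sigma_induction S (P := fun k => fac m ∣ fac (m + k)) (by simp) (fun n hn => ?_) k
  rw [← add_assoc, fac_succ S]
  exact hn.mul_right _

theorem pair_inj {a b c d : M} (h : pair a b = pair c d) : a = c ∧ b = d := by
  have key : ∀ a b c d : M, pair a b = pair c d → ¬ a + b < c + d := by
    intro a b c d h hlt
    unfold pair at h
    have h₁ := mul_le_mul' (succ_le_of_lt hlt) (succ_le_of_lt hlt)
    have h₂ := zero_le (a := b)
    have h₃ : (a + b + 1) * (a + b + 1) = (a + b) * (a + b) + (a + b) + (a + b) + 1 := by ring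
    have h₄ := zero_le (a := c)
    have h₅ := zero_le (a := a)
    rw [h₃] at h₁
    generalize (a + b) * (a + b) = X at h h₁
    generalize (c + d) * (c + d) = Y at h h₁
    have h₆ : X + a + (a + b + b + 1 + c) ≤ Y + c := by
      calc _ = X + (a + b) + (a + b) + 1 + c := by ring
        _ ≤ _ := add_le_add_left h₁ c
    rw [h] at h₆
    exact absurd ((lt_add_of_pos_right (Y + c) (by positivity)).trans_le h₆) (lt_irrefl _)
  have hs : a + b = c + d := le_antisymm (not_lt.1 (key _ _ _ _ h.symm)) (not_lt.1 (key _ _ _ _ h))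
  unfold pair at h
  rw [hs] at h
  have hac : a = c := add_left_cancel h
  exact ⟨hac, by rw [hac] at hs; exact add_left_cancel hs⟩

theorem le_pair_left (a b : M) : a ≤ pair a b := le_add_self

theorem le_pair_right (S : Set (Set M)) [Model S] (a b : M) : b ≤ pair a b := by
  unfold pair
  rcases eq_zero_or_succ S b with rfl | ⟨c, rfl⟩
  · exact zero_le
  · have : (c + 1) * 1 ≤ (a + (c + 1)) * (a + (c + 1)) :=
      mul_le_mul' le_add_self (le_add_self.trans le_add_self)
    rw [mul_one] at this
    exact this.trans le_self_add

/-- The first component of the pair `z`. -/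
noncomputable def pfst (z : M) : M := bleast z (fun a => ∃ b, b ≤ z ∧ z = pair a b)

/-- The second component of the pair `z`. -/
noncomputable def psnd (z : M) : M := bleast z (fun b => ∃ a, a ≤ z ∧ z = pair a b)

instance IsDef.pair {f g : (ℕ → M) → M} [hf : IsDef S f] [hg : IsDef S g] :
    IsDef S (fun e => pair (f e) (g e)) := by
  unfold SOA.pair
  infer_instance

instance IsDef.pfst [Model S] {f : (ℕ → M) → M} [hf : IsDef S f] : IsDef S (fun e => pfst (f e)) :=
  isDef_comp₁ (F := SOA.pfst) (IsDef.bleast (P := fun a e => ∃ b, b ≤ e 0 ∧ e 0 = SOA.pair a b)) f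

instance IsDef.psnd [Model S] {f : (ℕ → M) → M} [hf : IsDef S f] : IsDef S (fun e => psnd (f e)) :=
  isDef_comp₁ (F := SOA.psnd) (IsDef.bleast (P := fun b e => ∃ a, a ≤ e 0 ∧ e 0 = SOA.pair a b)) f

theorem pfst_pair (S : Set (Set M)) [Model S] (a b : M) : pfst (pair a b) = a := by
  obtain ⟨⟨c, _, h⟩, _⟩ := bleast_spec S (P := fun x => ∃ y, y ≤ pair a b ∧ pair a b = pair x y)
    ⟨b, le_pair_right S a b, rfl⟩ (le_pair_left a b)
  exact (pair_inj h).1.symm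

theorem psnd_pair (S : Set (Set M)) [Model S] (a b : M) : psnd (pair a b) = b := by
  obtain ⟨⟨c, _, h⟩, _⟩ := bleast_spec S (P := fun y => ∃ x, x ≤ pair a b ∧ pair a b = pair x y)
    ⟨a, le_pair_left a b, rfl⟩ (le_pair_right S a b)
  exact (pair_inj h).2.symm

end Arithmetic

/-! ### The ordered field of rational numbers of the model -/

section Rationals

variable {M : Type u} [Numbers M]

theorem cancel_mul_right {a b c : M} (hc : 0 < c) (h : a * c = b * c) : a = b :=
  mul_right_cancel₀ hc.ne' h

theorem succ_pos' (a : M) : 0 < a + 1 := pos_of_gt (lt_succ_self a)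

theorem Frac.eqv_refl (x : Frac M) : x.Eqv x := rfl

theorem Frac.Eqv.symm {x y : Frac M} (h : x.Eqv y) : y.Eqv x := by
  unfold Frac.Eqv at *
  exact h.symm

theorem Frac.Eqv.trans {x y z : Frac M} (h : x.Eqv y) (h' : y.Eqv z) : x.Eqv z := by
  unfold Frac.Eqv at *
  refine cancel_mul_right (succ_pos' y.denPred) ?_
  grind

instance fracSetoid (M : Type u) [Numbers M] : Setoid (Frac M) :=
  ⟨Frac.Eqv, Frac.eqv_refl, Frac.Eqv.symm, Frac.Eqv.trans⟩

/-- The rational numbers of the model: representatives up to equality of their values. -/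
def Q (M : Type u) [Numbers M] : Type u := Quotient (fracSetoid M)

/-- The rational number that is represented by `x`. -/
def val (x : Frac M) : Q M := Quotient.mk (fracSetoid M) x

theorem val_eq_val {x y : Frac M} : val x = val y ↔ x.Eqv y := Quotient.eq

theorem val_surjective (a : Q M) : ∃ x : Frac M, val x = a := Quotient.exists_rep a

namespace Q

instance : Zero (Q M) := ⟨val 0⟩

instance : One (Q M) := ⟨val 1⟩

instance : Add (Q M) := ⟨Quotient.map₂ (· + ·) fun x x' h y y' h' => by
  change Frac.Eqv _ _ at h h' ⊢
  simp only [Frac.Eqv, HAdd.hAdd, Add.add] at *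
  change (x.pos * (y.denPred + 1) + y.pos * (x.denPred + 1)) *
      (x'.denPred * y'.denPred + x'.denPred + y'.denPred + 1) +
      (x'.neg * (y'.denPred + 1) + y'.neg * (x'.denPred + 1)) *
      (x.denPred * y.denPred + x.denPred + y.denPred + 1) =
    (x'.pos * (y'.denPred + 1) + y'.pos * (x'.denPred + 1)) *
      (x.denPred * y.denPred + x.denPred + y.denPred + 1) +
      (x.neg * (y.denPred + 1) + y.neg * (x.denPred + 1)) *
      (x'.denPred * y'.denPred + x'.denPred + y'.denPred + 1)
  change x.pos * (x'.denPred + 1) + x'.neg * (x.denPred + 1) =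
    x'.pos * (x.denPred + 1) + x.neg * (x'.denPred + 1) at h
  change y.pos * (y'.denPred + 1) + y'.neg * (y.denPred + 1) =
    y'.pos * (y.denPred + 1) + y.neg * (y'.denPred + 1) at h'
  grind⟩

instance : Neg (Q M) := ⟨Quotient.map (- ·) fun x y h => by
  change Frac.Eqv _ _ at h ⊢
  change x.pos * (y.denPred + 1) + y.neg * (x.denPred + 1) =
    y.pos * (x.denPred + 1) + x.neg * (y.denPred + 1) at h
  change x.neg * (y.denPred + 1) + y.pos * (x.denPred + 1) =
    y.neg * (x.denPred + 1) + x.pos * (y.denPred + 1)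
  grind⟩

instance : Mul (Q M) := ⟨Quotient.map₂ (· * ·) fun x x' h y y' h' => by
  change Frac.Eqv _ _ at h h' ⊢
  change x.pos * (x'.denPred + 1) + x'.neg * (x.denPred + 1) =
    x'.pos * (x.denPred + 1) + x.neg * (x'.denPred + 1) at h
  change y.pos * (y'.denPred + 1) + y'.neg * (y.denPred + 1) =
    y'.pos * (y.denPred + 1) + y.neg * (y'.denPred + 1) at h'
  change (x.pos * y.pos + x.neg * y.neg) *
      (x'.denPred * y'.denPred + x'.denPred + y'.denPred + 1) +
      (x'.pos * y'.neg + x'.neg * y'.pos) * (x.denPred * y.denPred + x.denPred + y.denPred + 1) =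
    (x'.pos * y'.pos + x'.neg * y'.neg) * (x.denPred * y.denPred + x.denPred + y.denPred + 1) +
      (x.pos * y.neg + x.neg * y.pos) *
      (x'.denPred * y'.denPred + x'.denPred + y'.denPred + 1)
  grind⟩

end Q

theorem val_zero : val (0 : Frac M) = 0 := rfl

theorem val_one : val (1 : Frac M) = 1 := rfl

theorem val_add (x y : Frac M) : val (x + y) = val x + val y := rfl

theorem val_mul (x y : Frac M) : val (x * y) = val x * val y := rfl

theorem val_neg (x : Frac M) : val (-x) = -val x := rfl

theorem frac_zero : (0 : Frac M) = ⟨0, 0, 0⟩ := rfl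

theorem frac_one : (1 : Frac M) = ⟨1, 0, 0⟩ := rfl

theorem frac_add (x y : Frac M) : x + y = ⟨x.pos * (y.denPred + 1) + y.pos * (x.denPred + 1),
    x.neg * (y.denPred + 1) + y.neg * (x.denPred + 1),
    x.denPred * y.denPred + x.denPred + y.denPred⟩ := rfl

theorem frac_mul (x y : Frac M) : x * y =
    ⟨x.pos * y.pos + x.neg * y.neg, x.pos * y.neg + x.neg * y.pos,
    x.denPred * y.denPred + x.denPred + y.denPred⟩ := rfl

theorem frac_neg (x : Frac M) : -x = ⟨x.neg, x.pos, x.denPred⟩ := rfl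

/-- Proves an equation in `Q M` from the corresponding identity for representatives. -/
theorem Q.ind {p : Q M → Prop} (h : ∀ x, p (val x)) (a : Q M) : p a := Quotient.ind h a

namespace Q

instance : CommRing (Q M) where
  add_assoc := by
    refine Q.ind fun x => Q.ind fun y => Q.ind fun z => ?_
    simp only [← val_add, val_eq_val, Frac.Eqv, frac_add]
    ring
  zero_add := by
    refine Q.ind fun x => ?_
    simp only [← val_add, ← val_zero, val_eq_val, Frac.Eqv, frac_add, frac_zero]
    ring
  add_zero := by
    refine Q.ind fun x => ?_
    simp only [← val_add, ← val_zero, val_eq_val, Frac.Eqv, frac_add, frac_zero]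
    ring
  add_comm := by
    refine Q.ind fun x => Q.ind fun y => ?_
    simp only [← val_add, val_eq_val, Frac.Eqv, frac_add]
    ring
  neg_add_cancel := by
    refine Q.ind fun x => ?_
    simp only [← val_add, ← val_neg, ← val_zero, val_eq_val, Frac.Eqv, frac_add, frac_neg,
      frac_zero]
    ring
  mul_assoc := by
    refine Q.ind fun x => Q.ind fun y => Q.ind fun z => ?_
    simp only [← val_mul, val_eq_val, Frac.Eqv, frac_mul]
    ring
  mul_comm := by
    refine Q.ind fun x => Q.ind fun y => ?_
    simp only [← val_mul, val_eq_val, Frac.Eqv, frac_mul]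
    ring
  one_mul := by
    refine Q.ind fun x => ?_
    simp only [← val_mul, ← val_one, val_eq_val, Frac.Eqv, frac_mul, frac_one]
    ring
  mul_one := by
    refine Q.ind fun x => ?_
    simp only [← val_mul, ← val_one, val_eq_val, Frac.Eqv, frac_mul, frac_one]
    ring
  zero_mul := by
    refine Q.ind fun x => ?_
    simp only [← val_mul, ← val_zero, val_eq_val, Frac.Eqv, frac_mul, frac_zero]
    ring
  mul_zero := by
    refine Q.ind fun x => ?_
    simp only [← val_mul, ← val_zero, val_eq_val, Frac.Eqv, frac_mul, frac_zero]
    ring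
  left_distrib := by
    refine Q.ind fun x => Q.ind fun y => Q.ind fun z => ?_
    simp only [← val_mul, ← val_add, val_eq_val, Frac.Eqv, frac_mul, frac_add]
    ring
  right_distrib := by
    refine Q.ind fun x => Q.ind fun y => Q.ind fun z => ?_
    simp only [← val_mul, ← val_add, val_eq_val, Frac.Eqv, frac_mul, frac_add]
    ring
  nsmul := nsmulRec
  zsmul := zsmulRec

end Q

theorem val_sub (x y : Frac M) : val (x - y) = val x - val y := by
  rw [sub_eq_add_neg]
  rfl

theorem val_eq_zero {x : Frac M} : val x = 0 ↔ x.pos = x.neg := by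
  rw [← val_zero, val_eq_val]
  simp [Frac.Eqv, frac_zero]

theorem Q.isField : IsField (Q M) where
  exists_pair_ne := ⟨0, 1, by
    rw [← val_zero, ← val_one, Ne, val_eq_val]
    simp [Frac.Eqv, frac_zero, frac_one]⟩
  mul_comm := mul_comm
  mul_inv_cancel := by
    intro a
    refine Q.ind (p := fun a => a ≠ 0 → ∃ b, a * b = 1) (fun x hx => ?_) a
    rw [Ne, val_eq_zero] at hx
    rcases lt_or_gt_of_ne hx with h | h
    · obtain ⟨c, hc⟩ := exists_add_of_le (succ_le_of_lt h)
      refine ⟨val ⟨0, x.denPred + 1, c⟩, ?_⟩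
      rw [← val_mul, ← val_one, val_eq_val]
      simp only [Frac.Eqv, frac_mul, frac_one, hc]
      ring
    · obtain ⟨c, hc⟩ := exists_add_of_le (succ_le_of_lt h)
      refine ⟨val ⟨x.denPred + 1, 0, c⟩, ?_⟩
      rw [← val_mul, ← val_one, val_eq_val]
      simp only [Frac.Eqv, frac_mul, frac_one, hc]
      ring

noncomputable instance Q.instField : Field (Q M) := Q.isField.toField

/-- The non-negative rational numbers. -/
def Q.Nonneg (a : Q M) : Prop := Quotient.lift (fun x : Frac M => x.neg ≤ x.pos) (by
  have key : ∀ x y : Frac M, x.Eqv y → x.neg ≤ x.pos → y.neg ≤ y.pos := by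
    intro x y h hx
    unfold Frac.Eqv at h
    refine le_of_mul_le_mul_right (a := x.denPred + 1) ?_ (succ_pos' _)
    obtain ⟨c, hc⟩ := exists_add_of_le hx
    have : y.pos * (x.denPred + 1) = y.neg * (x.denPred + 1) + c * (y.denPred + 1) := by
      rw [hc] at h
      grind
    rw [this]
    exact le_self_add
  exact fun x y h => propext ⟨key x y h, key y x (Frac.Eqv.symm h)⟩) a

theorem nonneg_val {x : Frac M} : (val x).Nonneg ↔ x.neg ≤ x.pos := Iff.rfl

noncomputable instance Q.instLinearOrder : LinearOrder (Q M) where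
  le a b := (b - a).Nonneg
  le_refl := by
    refine Q.ind fun x => ?_
    rw [sub_self, ← val_zero, nonneg_val, frac_zero]
  le_trans := by
    refine Q.ind fun x => Q.ind fun y => Q.ind fun z => ?_
    intro h₁ h₂
    have : val z - val x = (val y - val x) + (val z - val y) := by ring
    rw [this]
    rw [← val_sub] at h₁ h₂ ⊢
    rw [← val_sub, ← val_add]
    rw [nonneg_val] at *
    exact add_le_add (mul_le_mul_of_nonneg_right h₁ zero_le)
      (mul_le_mul_of_nonneg_right h₂ zero_le)
  le_antisymm := by
    refine Q.ind fun x => Q.ind fun y => fun h₁ h₂ => ?_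
    have : (val y - val x) = -(val x - val y) := by ring
    rw [this] at h₁
    rw [← val_sub] at h₁ h₂
    rw [← val_neg, nonneg_val] at h₁
    rw [nonneg_val] at h₂
    refine sub_eq_zero.1 ?_
    rw [← val_sub, val_eq_zero]
    exact le_antisymm h₁ h₂
  le_total := by
    refine Q.ind fun x => Q.ind fun y => ?_
    have : (val y - val x) = -(val x - val y) := by ring
    rw [this]
    rw [← val_sub, ← val_neg, nonneg_val, nonneg_val]
    exact le_total _ _
  toDecidableLE := Classical.decRel _

theorem Q.le_def {a b : Q M} : a ≤ b ↔ (b - a).Nonneg := Iff.rfl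

instance : IsStrictOrderedRing (Q M) := by
  have : IsOrderedAddMonoid (Q M) := by
    have key : ∀ a b : Q M, a ≤ b → ∀ c, a + c ≤ b + c := fun a b h c => by
      rw [Q.le_def] at *
      simpa using h
    constructor
    · exact key
    · intro a b h c
      rw [add_comm c, add_comm c]
      exact key a b h c
  have : ZeroLEOneClass (Q M) := ⟨by
    rw [Q.le_def, sub_zero, ← val_one, nonneg_val, frac_one]
    exact zero_le⟩
  refine IsStrictOrderedRing.of_mul_pos fun a b ha hb => ?_
  refine lt_of_le_of_ne ?_ (mul_ne_zero ha.ne' hb.ne').symm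
  have h₁ := ha.le
  have h₂ := hb.le
  obtain ⟨x, rfl⟩ := val_surjective a
  obtain ⟨y, rfl⟩ := val_surjective b
  rw [Q.le_def, sub_zero] at *
  rw [← val_mul]
  rw [nonneg_val] at *
  obtain ⟨c, hc⟩ := exists_add_of_le h₁
  obtain ⟨d, hd⟩ := exists_add_of_le h₂
  change x.pos * y.neg + x.neg * y.pos ≤ x.pos * y.pos + x.neg * y.neg
  rw [hc, hd]
  calc _ ≤ (x.neg + c) * y.neg + x.neg * (y.neg + d) + c * d := le_self_add
    _ = _ := by ring

theorem val_le_val' {x y : Frac M} : val x ≤ val y ↔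
    x.pos * (y.denPred + 1) + y.neg * (x.denPred + 1) ≤
      y.pos * (x.denPred + 1) + x.neg * (y.denPred + 1) := by
  rw [Q.le_def, sub_eq_add_neg, ← val_neg, ← val_add, nonneg_val, frac_add, frac_neg]
  dsimp only
  rw [add_comm (y.neg * _)]

theorem val_lt_val {x y : Frac M} : val x < val y ↔ x < y := by
  rw [← not_le, val_le_val', not_le]
  exact Iff.rfl

theorem val_le_val {x y : Frac M} : val x ≤ val y ↔ x ≤ y := by
  rw [le_iff_lt_or_eq, val_lt_val, val_eq_val]
  exact Iff.rfl

theorem inUnit_iff {x : Frac M} : x.InUnit ↔ 0 ≤ val x ∧ val x ≤ 1 := by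
  rw [← val_zero, ← val_one, val_le_val, val_le_val]
  exact Iff.rfl

theorem val_abs (x : Frac M) : val x.abs = |val x| := by
  unfold Frac.abs
  split_ifs with h
  · rw [val_neg, abs_of_nonpos]
    rw [← val_zero, val_le_val', frac_zero]
    simpa using h.le
  · rw [abs_of_nonneg]
    rw [← val_zero, val_le_val', frac_zero]
    simpa using h

/-! ### Numbers as rational numbers -/

/-- The embedding of the numbers into the rational numbers. -/
def toQ : M →+* Q M where
  toFun n := val (Frac.ofNum n)
  map_one' := rfl
  map_zero' := rfl
  map_mul' a b := by
    rw [← val_mul, val_eq_val, frac_mul]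
    simp [Frac.Eqv, Frac.ofNum]
  map_add' a b := by
    rw [← val_add, val_eq_val, frac_add]
    simp [Frac.Eqv, Frac.ofNum]

theorem val_ofNum (n : M) : val (Frac.ofNum n) = toQ n := rfl

theorem toQ_le {a b : M} : toQ a ≤ toQ b ↔ a ≤ b := by
  rw [← val_ofNum, ← val_ofNum, val_le_val']
  simp [Frac.ofNum]

theorem toQ_lt {a b : M} : toQ a < toQ b ↔ a < b := by
  rw [← not_le, toQ_le, not_le]

theorem toQ_nonneg (a : M) : 0 ≤ toQ a := by
  rw [← map_zero toQ, toQ_le]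
  exact zero_le

theorem toQ_pos {a : M} : 0 < toQ a ↔ 0 < a := by
  rw [← map_zero toQ, toQ_lt]

theorem val_eq_div (x : Frac M) : val x = (toQ x.pos - toQ x.neg) / (toQ x.denPred + 1) := by
  have h : toQ x.denPred + 1 ≠ 0 := by
    have := toQ_nonneg x.denPred
    positivity
  rw [eq_div_iff h, ← map_one toQ, ← map_add, ← val_ofNum, ← val_ofNum, ← val_ofNum, ← val_mul,
    ← val_sub, val_eq_val]
  change Frac.Eqv _ (_ + -_)
  rw [frac_neg, frac_add, frac_mul]
  simp only [Frac.Eqv, Frac.ofNum]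
  ring

theorem toQ_lt_add_one_iff {a b : M} : toQ a < toQ b + 1 ↔ toQ a ≤ toQ b := by
  rw [← map_one toQ, ← map_add, toQ_lt, toQ_le, Numbers.lt_succ_iff]

theorem exists_lt_toQ (a : Q M) : ∃ n : M, a < toQ n := by
  obtain ⟨x, rfl⟩ := val_surjective a
  refine ⟨x.pos + 1, ?_⟩
  have h : 0 < toQ x.denPred + 1 := by
    have := toQ_nonneg x.denPred
    positivity
  rw [val_eq_div, div_lt_iff₀ h, map_add, map_one]
  nlinarith [toQ_nonneg x.denPred, toQ_nonneg x.neg, toQ_nonneg x.pos]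

end Rationals

/-! ### Definable functions with rational values -/

section DefinableRationals

variable {M : Type u} [Numbers M] {S : Set (Set M)}

theorem isFun_iff [Model S] {f : M → M} : IsFun S f ↔ IsDef S (fun e => f (e 0)) := by
  constructor
  · intro h
    have : Fact ({z | ∃ n, z = pair n (f n)} ∈ S) := ⟨h⟩
    refine IsDef.of_isDelta (IsDelta.congr
      (P := fun e => pair (e 1) (e 0) ∈ {z | ∃ n, z = pair n (f n)}) inferInstance fun e => ?_)
    constructor
    · intro h
      exact ⟨e 1, by rw [h]⟩
    · rintro ⟨n, h⟩
      obtain ⟨h₁, h₂⟩ := pair_inj h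
      rw [h₂, ← h₁]
  · intro h
    have := isDef_comp₁ h
    have : {z | ∃ n, z = pair n (f n)} = {z | ∃ n, n ≤ z ∧ z = pair n (f n)} := by
      ext z
      refine exists_congr fun n => (and_iff_right_of_imp ?_).symm
      rintro rfl
      exact le_pair_left _ _
    rw [IsFun, this]
    exact comprehension S

theorem isFun₂_iff [Model S] {f : M → M → M} :
    IsFun₂ S f ↔ IsDef S (fun e => f (e 0) (e 1)) := by
  constructor
  · intro h
    have : Fact ({z | ∃ i n, z = pair (pair i n) (f i n)} ∈ S) := ⟨h⟩
    refine IsDef.of_isDelta (IsDelta.congr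
      (P := fun e => pair (pair (e 1) (e 2)) (e 0) ∈ {z | ∃ i n, z = pair (pair i n) (f i n)})
      inferInstance fun e => ?_)
    constructor
    · intro h
      exact ⟨e 1, e 2, by rw [h]⟩
    · rintro ⟨i, n, h⟩
      obtain ⟨h₁, h₂⟩ := pair_inj h
      obtain ⟨h₃, h₄⟩ := pair_inj h₁
      rw [h₂, ← h₃, ← h₄]
  · intro h
    have := isDef_comp₂ h
    have : {z | ∃ i n, z = pair (pair i n) (f i n)} =
        {z | ∃ i, i ≤ z ∧ ∃ n, n ≤ z ∧ z = pair (pair i n) (f i n)} := by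
      ext z
      refine exists_congr fun i => ?_
      constructor
      · rintro ⟨n, rfl⟩
        exact ⟨(le_pair_left _ _).trans (le_pair_left _ _), n,
          (le_pair_right S _ _).trans (le_pair_left _ _), rfl⟩
      · rintro ⟨_, n, _, h⟩
        exact ⟨n, h⟩
    rw [IsFun₂, this]
    exact comprehension S

/-- The representative with the code `c`. -/
noncomputable def decode (c : M) : Frac M := ⟨pfst (pfst c), psnd (pfst c), psnd c⟩

theorem decode_code (S : Set (Set M)) [Model S] (x : Frac M) : decode x.code = x := by
  simp [decode, Frac.code, pfst_pair S, psnd_pair S]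

/-- The rational number with the code `c`. -/
noncomputable def qdec (c : M) : Q M := val (decode c)

theorem qdec_code (S : Set (Set M)) [Model S] (x : Frac M) : qdec x.code = val x := by
  rw [qdec, decode_code S]

/-- The functions of assignments with values in the rational numbers that are computed, through
representatives, by definable functions. -/
class IsDefQ (S : Set (Set M)) (F : (ℕ → M) → Q M) : Prop where
  exists_rep : ∃ p n d : (ℕ → M) → M, IsDef S p ∧ IsDef S n ∧ IsDef S d ∧
    ∀ e, F e = val ⟨p e, n e, d e⟩

theorem IsDefQ.of_rep {p n d : (ℕ → M) → M} [hp : IsDef S p] [hn : IsDef S n] [hd : IsDef S d] :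
    IsDefQ S (fun e => val ⟨p e, n e, d e⟩) := ⟨p, n, d, hp, hn, hd, fun _ => rfl⟩

theorem IsDefQ.congr {F G : (ℕ → M) → Q M} (hF : IsDefQ S F) (h : ∀ e, G e = F e) :
    IsDefQ S G := by
  rwa [funext h]

theorem IsDefQ.comp {f : (ℕ → M) → Q M} (hf : IsDefQ S f) {σ : (ℕ → M) → ℕ → M}
    (hσ : ∀ i, IsTerm (fun e => σ e i)) : IsDefQ S (fun e => f (σ e)) := by
  obtain ⟨p, n, d, hp, hn, hd, h⟩ := hf
  exact ⟨_, _, _, hp.comp hσ, hn.comp hσ, hd.comp hσ, fun e => h _⟩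

instance IsDefQ.const (a : Q M) : IsDefQ S (fun _ => a) := by
  obtain ⟨x, rfl⟩ := val_surjective a
  exact IsDefQ.of_rep (p := fun _ => x.pos) (n := fun _ => x.neg) (d := fun _ => x.denPred)

instance IsDefQ.toQ {f : (ℕ → M) → M} [hf : IsDef S f] : IsDefQ S (fun e => toQ (f e)) :=
  IsDefQ.of_rep (p := f) (n := fun _ => 0) (d := fun _ => 0)

instance IsDefQ.add {F G : (ℕ → M) → Q M} [hF : IsDefQ S F] [hG : IsDefQ S G] :
    IsDefQ S (fun e => F e + G e) := by
  obtain ⟨p, n, d, hp, hn, hd, h⟩ := hF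
  obtain ⟨p', n', d', hp', hn', hd', h'⟩ := hG
  refine ⟨fun e => p e * (d' e + 1) + p' e * (d e + 1), fun e => n e * (d' e + 1) + n' e * (d e + 1),
    fun e => d e * d' e + d e + d' e, inferInstance, inferInstance, inferInstance, fun e => ?_⟩
  rw [h, h', ← val_add]
  rfl

instance IsDefQ.mul {F G : (ℕ → M) → Q M} [hF : IsDefQ S F] [hG : IsDefQ S G] :
    IsDefQ S (fun e => F e * G e) := by
  obtain ⟨p, n, d, hp, hn, hd, h⟩ := hF
  obtain ⟨p', n', d', hp', hn', hd', h'⟩ := hG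
  refine ⟨fun e => p e * p' e + n e * n' e, fun e => p e * n' e + n e * p' e,
    fun e => d e * d' e + d e + d' e, inferInstance, inferInstance, inferInstance, fun e => ?_⟩
  rw [h, h', ← val_mul]
  rfl

instance IsDefQ.neg {F : (ℕ → M) → Q M} [hF : IsDefQ S F] : IsDefQ S (fun e => -F e) := by
  obtain ⟨p, n, d, hp, hn, hd, h⟩ := hF
  exact ⟨n, p, d, hn, hp, hd, fun e => by rw [h, ← val_neg]; rfl⟩

instance IsDefQ.sub {F G : (ℕ → M) → Q M} [hF : IsDefQ S F] [hG : IsDefQ S G] :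
    IsDefQ S (fun e => F e - G e) :=
  IsDefQ.congr (F := fun e => F e + -G e) inferInstance fun _ => sub_eq_add_neg _ _

instance IsDefQ.inv [Model S] {F : (ℕ → M) → Q M} [hF : IsDefQ S F] :
    IsDefQ S (fun e => (F e)⁻¹) := by
  classical
  obtain ⟨p, n, d, hp, hn, hd, h⟩ := hF
  -- the number `c` with `pos = neg + c + 1` or `neg = pos + c + 1`
  have hc : ∀ a b : M, a < b → b = a + bleast b (fun c => b = a + c + 1) + 1 := by
    intro a b hab
    obtain ⟨c, hc⟩ := exists_add_of_le (succ_le_of_lt hab)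
    have hc' : b = a + c + 1 := by rw [hc]; ring
    refine (bleast_spec S (P := fun c => b = a + c + 1) hc' ?_).1
    rw [hc']
    exact le_add_self.trans le_self_add
  refine ⟨fun e => if p e < n e then 0 else if n e < p e then d e + 1 else 0,
    fun e => if p e < n e then d e + 1 else 0,
    fun e => if p e < n e then bleast (n e) (fun c => n e = p e + c + 1) else
      bleast (p e) (fun c => p e = n e + c + 1), ?_, ?_, ?_, fun e => ?_⟩
  · infer_instance
  · infer_instance
  · have hp' := hp.comp (σ := fun e n => e (n + 1)) (fun i => .var (i + 1))
    have hn' := hn.comp (σ := fun e n => e (n + 1)) (fun i => .var (i + 1))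
    infer_instance
  · have hd0 : SOA.toQ (d e) + 1 ≠ 0 := by
      have := toQ_nonneg (d e)
      positivity
    rw [h, val_eq_div, val_eq_div]
    dsimp only
    rcases lt_trichotomy (p e) (n e) with hlt | heq | hgt
    · rw [if_pos hlt, if_pos hlt, if_pos hlt]
      have h₁ := hc _ _ hlt
      generalize bleast (n e) (fun c => n e = p e + c + 1) = c at h₁
      have hc0 : SOA.toQ c + 1 ≠ 0 := by
        have := toQ_nonneg c
        positivity
      rw [h₁, map_add, map_add, map_add, map_one, map_zero, inv_div, div_eq_div_iff _ hc0]
      · ring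
      · have : SOA.toQ (p e) - (SOA.toQ (p e) + SOA.toQ c + 1) = -(SOA.toQ c + 1) := by ring
        rw [this]
        exact neg_ne_zero.2 hc0
    · rw [if_neg heq.not_lt, if_neg heq.not_gt, if_neg heq.not_lt]
      simp [heq]
    · rw [if_neg hgt.not_gt, if_pos hgt, if_neg hgt.not_gt, if_neg hgt.not_gt]
      have h₁ := hc _ _ hgt
      generalize bleast (p e) (fun c => p e = n e + c + 1) = c at h₁
      have hc0 : SOA.toQ c + 1 ≠ 0 := by
        have := toQ_nonneg c
        positivity
      rw [h₁, map_add, map_add, map_add, map_one, map_zero, inv_div, div_eq_div_iff _ hc0]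
      · ring
      · have : SOA.toQ (n e) + SOA.toQ c + 1 - SOA.toQ (n e) = SOA.toQ c + 1 := by ring
        rw [this]
        exact hc0

instance IsDefQ.div [Model S] {F G : (ℕ → M) → Q M} [hF : IsDefQ S F] [hG : IsDefQ S G] :
    IsDefQ S (fun e => F e / G e) :=
  IsDefQ.congr (F := fun e => F e * (G e)⁻¹) inferInstance fun _ => div_eq_mul_inv _ _

instance IsDelta.leQ {F G : (ℕ → M) → Q M} [hF : IsDefQ S F] [hG : IsDefQ S G] :
    IsDelta S (fun e => F e ≤ G e) := by
  obtain ⟨p, n, d, hp, hn, hd, h⟩ := hF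
  obtain ⟨p', n', d', hp', hn', hd', h'⟩ := hG
  exact IsDelta.congr (P := fun e => p e * (d' e + 1) + n' e * (d e + 1) ≤
    p' e * (d e + 1) + n e * (d' e + 1)) inferInstance fun e => by rw [h, h', val_le_val']

instance IsDelta.ltQ {F G : (ℕ → M) → Q M} [hF : IsDefQ S F] [hG : IsDefQ S G] :
    IsDelta S (fun e => F e < G e) :=
  IsDelta.congr (P := fun e => ¬ G e ≤ F e) inferInstance fun _ => not_le.symm

instance IsDelta.eqQ {F G : (ℕ → M) → Q M} [hF : IsDefQ S F] [hG : IsDefQ S G] :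
    IsDelta S (fun e => F e = G e) :=
  IsDelta.congr (P := fun e => F e ≤ G e ∧ G e ≤ F e) inferInstance fun _ => le_antisymm_iff

instance IsDefQ.ite {p : (ℕ → M) → Prop} {F G : (ℕ → M) → Q M} [hp : IsDelta S p]
    [hF : IsDefQ S F] [hG : IsDefQ S G] [∀ e, Decidable (p e)] :
    IsDefQ S (fun e => if p e then F e else G e) := by
  obtain ⟨a, n, d, ha, hn, hd, h⟩ := hF
  obtain ⟨a', n', d', ha', hn', hd', h'⟩ := hG
  refine ⟨fun e => if p e then a e else a' e, fun e => if p e then n e else n' e,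
    fun e => if p e then d e else d' e, inferInstance, inferInstance, inferInstance, fun e => ?_⟩
  by_cases hpe : p e
  · simp only [if_pos hpe, h]
  · simp only [if_neg hpe, h']

instance IsDefQ.abs {F : (ℕ → M) → Q M} [hF : IsDefQ S F] : IsDefQ S (fun e => |F e|) := by
  classical
  exact IsDefQ.congr (F := fun e => if 0 ≤ F e then F e else -F e) inferInstance fun e => by
    split_ifs with h
    · exact abs_of_nonneg h
    · exact abs_of_neg (not_le.1 h)

instance IsDefQ.max {F G : (ℕ → M) → Q M} [hF : IsDefQ S F] [hG : IsDefQ S G] :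
    IsDefQ S (fun e => Max.max (F e) (G e)) := by
  classical
  exact IsDefQ.congr (F := fun e => if F e ≤ G e then G e else F e) inferInstance
    fun e => max_def _ _

instance IsDefQ.min {F G : (ℕ → M) → Q M} [hF : IsDefQ S F] [hG : IsDefQ S G] :
    IsDefQ S (fun e => Min.min (F e) (G e)) := by
  classical
  exact IsDefQ.congr (F := fun e => if F e ≤ G e then F e else G e) inferInstance
    fun e => min_def _ _

instance IsDefQ.qdec [Model S] {f : (ℕ → M) → M} [hf : IsDef S f] :
    IsDefQ S (fun e => qdec (f e)) :=
  IsDefQ.of_rep (p := fun e => pfst (pfst (f e))) (n := fun e => psnd (pfst (f e)))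
    (d := fun e => psnd (f e))

/-- The least code of the rational number `a`. -/
noncomputable def qcode (a : Q M) : M := least (fun c => qdec c = a)

theorem qdec_qcode (S : Set (Set M)) [Model S] (a : Q M) : qdec (qcode a) = a := by
  refine least_spec S (P := fun c => qdec c = a) ?_
  obtain ⟨x, rfl⟩ := val_surjective a
  exact ⟨x.code, qdec_code S x⟩

instance IsDef.qcode [Model S] {F : (ℕ → M) → Q M} [hF : IsDefQ S F] :
    IsDef S (fun e => qcode (F e)) := by
  have hF' := hF.comp (σ := fun e n => e (n + 1)) (fun i => .var (i + 1))
  exact IsDef.least (P := fun c e => SOA.qdec c = F e) inferInstance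
    fun e => ⟨SOA.qcode (F e), qdec_qcode S _⟩

theorem IsDefQ.of_qcode [Model S] {F : (ℕ → M) → Q M} (h : IsDef S (fun e => SOA.qcode (F e))) :
    IsDefQ S F :=
  IsDefQ.congr (F := fun e => SOA.qdec (SOA.qcode (F e))) inferInstance
    fun _ => (qdec_qcode S _).symm

/-- The representative of `a` with the least code. -/
noncomputable def qrep (a : Q M) : Frac M := decode (qcode a)

theorem val_qrep (S : Set (Set M)) [Model S] (a : Q M) : val (qrep a) = a := qdec_qcode S a

instance IsDef.qrep_code [Model S] {F : (ℕ → M) → Q M} [hF : IsDefQ S F] :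
    IsDef S (fun e => (qrep (F e)).code) := by
  unfold Frac.code qrep decode
  infer_instance

theorem isDefQ_comp₁ [Model S] {F : M → Q M} (hF : IsDefQ S (fun e => F (e 0))) (f : (ℕ → M) → M)
    [hf : IsDef S f] : IsDefQ S (fun e => F (f e)) :=
  .of_qcode (isDef_comp₁ (F := fun a => qcode (F a)) inferInstance f)

theorem isDefQ_comp₂ [Model S] {F : M → M → Q M} (hF : IsDefQ S (fun e => F (e 0) (e 1)))
    (f g : (ℕ → M) → M) [hf : IsDef S f] [hg : IsDef S g] : IsDefQ S (fun e => F (f e) (g e)) :=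
  .of_qcode (isDef_comp₂ (F := fun a b => qcode (F a b)) inferInstance f g)

/-- A function of the model that enumerates codes of representatives gives a definable function
with rational values. -/
theorem isDefQ_of_isFun [Model S] {x : M → Frac M} (h : IsFun S (fun k => (x k).code)) :
    IsDefQ S (fun e => val (x (e 0))) := by
  have := isFun_iff.1 h
  exact IsDefQ.congr (F := fun e => qdec (x (e 0)).code) inferInstance
    fun e => (qdec_code S _).symm

theorem isDefQ_of_isFun₂ [Model S] {x : M → M → Frac M} (h : IsFun₂ S (fun i k => (x i k).code)) :
    IsDefQ S (fun e => val (x (e 0) (e 1))) := by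
  have := isFun₂_iff.1 h
  exact IsDefQ.congr (F := fun e => qdec (x (e 0) (e 1)).code) inferInstance
    fun e => (qdec_code S _).symm

theorem isFun_qrep [Model S] {F : M → Q M} (hF : IsDefQ S (fun e => F (e 0))) :
    IsFun S (fun k => (qrep (F k)).code) := isFun_iff.2 inferInstance

theorem isFun₂_qrep [Model S] {F : M → M → Q M} (hF : IsDefQ S (fun e => F (e 0) (e 1))) :
    IsFun₂ S (fun i k => (qrep (F i k)).code) := isFun₂_iff.2 inferInstance

/-! ### Sums, powers of `1/2` and integer parts -/

/-- The function with rational values that is defined by primitive recursion from the value `a`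
at `0` and the step function `h`. -/
noncomputable def recQ (a : Q M) (h : M → Q M → Q M) (n : M) : Q M :=
  qdec (recVal (qcode a) (fun i v => qcode (h i (qdec v))) n)

theorem recQ_zero [Model S] (a : Q M) {h : M → Q M → Q M}
    (hh : IsDefQ S (fun e => h (e 0) (qdec (e 1)))) : recQ a h 0 = a := by
  rw [recQ, recVal_zero (S := S) _ inferInstance, qdec_qcode S]

theorem recQ_succ [Model S] (a : Q M) {h : M → Q M → Q M}
    (hh : IsDefQ S (fun e => h (e 0) (qdec (e 1)))) (n : M) :
    recQ a h (n + 1) = h n (recQ a h n) := by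
  rw [recQ, recVal_succ (S := S) _ inferInstance, qdec_qcode S]
  rfl

instance IsDefQ.recQ [Model S] {a : (ℕ → M) → Q M} {n : (ℕ → M) → M}
    {h : M → Q M → (ℕ → M) → Q M} [ha : IsDefQ S a] [hn : IsDef S n]
    [hh : IsDefQ S (fun e => h (e 0) (SOA.qdec (e 1)) (fun n => e (n + 2)))] :
    IsDefQ S (fun e => recQ (a e) (fun i v => h i v e) (n e)) := by
  have : IsDef S (fun e => SOA.recVal (SOA.qcode (a e))
      (fun i v => SOA.qcode (h i (SOA.qdec v) e)) (n e)) :=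
    IsDef.recVal (h := fun i v e => SOA.qcode (h i (SOA.qdec v) e))
  exact IsDefQ.qdec

/-- The sum `F 0 + ⋯ + F (n - 1)`. -/
noncomputable def sumQ (n : M) (F : M → Q M) : Q M := recQ 0 (fun i v => v + F i) n

instance IsDefQ.sumQ [Model S] {F : M → (ℕ → M) → Q M} {n : (ℕ → M) → M} [hn : IsDef S n]
    [hF : IsDefQ S (fun e => F (e 0) (fun n => e (n + 1)))] :
    IsDefQ S (fun e => sumQ (n e) (fun i => F i e)) := by
  have : IsDefQ S (fun e => F (e 0) (fun n => e (n + 2))) :=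
    hF.comp (σ := fun e => push (e 0) (fun n => e (n + 2))) fun i => by
      cases i
      · exact .var 0
      · exact .var _
  exact IsDefQ.recQ (h := fun i v e => v + F i e)

section Sum

variable {F G : M → Q M}

theorem sumQ_zero [Model S] (hF : IsDefQ S (fun e => F (e 0))) : sumQ 0 F = 0 :=
  recQ_zero (S := S) _ inferInstance

theorem sumQ_succ [Model S] (hF : IsDefQ S (fun e => F (e 0))) (n : M) :
    sumQ (n + 1) F = sumQ n F + F n :=
  recQ_succ (S := S) _ inferInstance _

theorem sumQ_le_sumQ [Model S] (hF : IsDefQ S (fun e => F (e 0)))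
    (hG : IsDefQ S (fun e => G (e 0))) (n : M) (h : ∀ i, i < n → F i ≤ G i) :
    sumQ n F ≤ sumQ n G := by
  have := isDefQ_comp₁ hF
  have := isDefQ_comp₁ hG
  have key : ∀ m, m ≤ n → sumQ m F ≤ sumQ m G := by
    refine delta_induction S (fun _ => by rw [sumQ_zero hF, sumQ_zero hG]) fun m ih hm => ?_
    rw [sumQ_succ hF, sumQ_succ hG]
    have hm' := (lt_succ_self m).trans_le hm
    exact add_le_add (ih hm'.le) (h m hm')
  exact key n le_rfl

theorem sumQ_congr [Model S] (hF : IsDefQ S (fun e => F (e 0)))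
    (hG : IsDefQ S (fun e => G (e 0))) (n : M) (h : ∀ i, i < n → F i = G i) :
    sumQ n F = sumQ n G :=
  le_antisymm (sumQ_le_sumQ hF hG n fun i hi => (h i hi).le)
    (sumQ_le_sumQ hG hF n fun i hi => (h i hi).ge)

theorem sumQ_add [Model S] (hF : IsDefQ S (fun e => F (e 0)))
    (hG : IsDefQ S (fun e => G (e 0))) (n : M) :
    sumQ n (fun i => F i + G i) = sumQ n F + sumQ n G := by
  have := isDefQ_comp₁ hF
  have := isDefQ_comp₁ hG
  refine delta_induction S (P := fun n => sumQ n (fun i => F i + G i) = sumQ n F + sumQ n G)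
    ?_ (fun m ih => ?_) n
  · rw [sumQ_zero (S := S) inferInstance, sumQ_zero hF, sumQ_zero hG, add_zero]
  · rw [sumQ_succ (S := S) inferInstance, sumQ_succ hF, sumQ_succ hG, ih]
    ring

theorem sumQ_mul [Model S] (hF : IsDefQ S (fun e => F (e 0))) (a : Q M) (n : M) :
    sumQ n (fun i => F i * a) = sumQ n F * a := by
  have := isDefQ_comp₁ hF
  refine delta_induction S (P := fun n => sumQ n (fun i => F i * a) = sumQ n F * a)
    ?_ (fun m ih => ?_) n
  · rw [sumQ_zero (S := S) inferInstance, sumQ_zero hF, zero_mul]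
  · rw [sumQ_succ (S := S) inferInstance, sumQ_succ hF, ih]
    ring

theorem sumQ_nonneg [Model S] (hF : IsDefQ S (fun e => F (e 0))) (n : M)
    (h : ∀ i, i < n → 0 ≤ F i) : 0 ≤ sumQ n F := by
  have := sumQ_le_sumQ (F := fun _ => 0) inferInstance hF n h
  have h₀ := sumQ_mul (S := S) (F := fun _ => (0 : Q M)) inferInstance 0 n
  simp only [mul_zero] at h₀
  rwa [h₀] at this

theorem sumQ_mono [Model S] (hF : IsDefQ S (fun e => F (e 0))) {m n : M} (hmn : m ≤ n)
    (h : ∀ i, m ≤ i → i < n → 0 ≤ F i) : sumQ m F ≤ sumQ n F := by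
  have := isDefQ_comp₁ hF
  obtain ⟨k, rfl⟩ := exists_add_of_le hmn
  have key : ∀ j, j ≤ k → sumQ m F ≤ sumQ (m + j) F := by
    refine delta_induction S (fun _ => by rw [add_zero]) fun j ih hj => ?_
    rw [← add_assoc, sumQ_succ hF]
    have hj' := (lt_succ_self j).trans_le hj
    exact (ih hj'.le).trans (le_add_of_nonneg_right (h _ le_self_add (by simpa using hj')))
  exact key k le_rfl

theorem abs_sumQ_le [Model S] (hF : IsDefQ S (fun e => F (e 0))) (n : M) :
    |sumQ n F| ≤ sumQ n (fun i => |F i|) := by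
  have := isDefQ_comp₁ hF
  refine delta_induction S (P := fun n => |sumQ n F| ≤ sumQ n (fun i => |F i|)) ?_ (fun m ih => ?_) n
  · rw [sumQ_zero hF, sumQ_zero (S := S) inferInstance, abs_zero]
  · rw [sumQ_succ hF, sumQ_succ (S := S) inferInstance]
    exact (abs_add_le _ _).trans (by gcongr)

end Sum

/-- The rational number `2 ^ (-n)`. -/
noncomputable def tw (n : M) : Q M := (toQ (pw n))⁻¹

instance IsDefQ.tw [Model S] {f : (ℕ → M) → M} [hf : IsDef S f] : IsDefQ S (fun e => tw (f e)) :=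
  IsDefQ.inv (F := fun e => SOA.toQ (pw (f e)))

theorem tw_zero (S : Set (Set M)) [Model S] : tw (0 : M) = 1 := by
  rw [tw, pw_zero S, map_one, inv_one]

theorem tw_succ (S : Set (Set M)) [Model S] (n : M) : tw (n + 1) = tw n / 2 := by
  rw [tw, pw_succ S, map_add, tw, ← two_mul, mul_inv, div_eq_mul_inv, mul_comm]

theorem tw_pos (S : Set (Set M)) [Model S] (n : M) : 0 < tw n :=
  inv_pos.2 (toQ_pos.2 (pw_pos S n))

theorem tw_add (S : Set (Set M)) [Model S] (m n : M) : tw (m + n) = tw m * tw n := by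
  rw [tw, pw_add S, map_mul, mul_inv, tw, tw]

theorem tw_le_tw (S : Set (Set M)) [Model S] {m n : M} (h : m ≤ n) : tw n ≤ tw m :=
  inv_anti₀ (toQ_pos.2 (pw_pos S m)) (toQ_le.2 (pw_le_pw S h))

theorem tw_le_one (S : Set (Set M)) [Model S] (n : M) : tw n ≤ 1 := by
  rw [← tw_zero S]
  exact tw_le_tw S zero_le

theorem exists_tw_lt (S : Set (Set M)) [Model S] {ε : Q M} (hε : 0 < ε) : ∃ n, tw n < ε := by
  obtain ⟨n, hn⟩ := exists_lt_toQ ε⁻¹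
  exact ⟨n, inv_lt_of_inv_lt₀ hε (hn.trans (toQ_lt.2 (lt_pw S n)))⟩

theorem val_twoNegPow [Model S] (n : M) : val (twoNegPow S n) = tw n := by
  have hex : ∃ d : M → M, IsTwoPowPred S d := by
    obtain ⟨d, hd, hd'⟩ := exists_isDef₁ S (P := fun d n => d + 1 = pw n) fun n => by
      obtain ⟨c, hc⟩ := (eq_zero_or_succ S (pw n)).resolve_left (pw_pos S n).ne'
      exact ⟨c, hc.symm⟩
    refine ⟨d, isFun_iff.2 hd, add_right_cancel (b := 1) ?_, fun n => add_right_cancel (b := 1) ?_⟩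
    · rw [hd', pw_zero S, zero_add]
    · rw [hd', pw_succ S, ← hd']
      ring
  have hd := Classical.epsilon_spec hex
  have key : ∀ n : M, Classical.epsilon (IsTwoPowPred S) n + 1 = pw n := by
    have := isDef_comp₁ (isFun_iff.1 hd.1)
    refine delta_induction S ?_ fun n ih => ?_
    · rw [hd.2.1, pw_zero S, zero_add]
    · rw [hd.2.2, pw_succ S, ← ih]
      ring
  rw [twoNegPow, val_eq_div, tw, ← key]
  simp

/-- The integer part of `a`, or `0` if `a` is negative. -/
noncomputable def floorQ (a : Q M) : M := least (fun n => a < toQ n + 1)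

instance IsDef.floorQ [Model S] {F : (ℕ → M) → Q M} [hF : IsDefQ S F] :
    IsDef S (fun e => floorQ (F e)) := by
  have hF' := hF.comp (σ := fun e n => e (n + 1)) (fun i => .var (i + 1))
  refine IsDef.least (P := fun n e => F e < SOA.toQ n + 1) inferInstance fun e => ?_
  obtain ⟨n, hn⟩ := exists_lt_toQ (F e)
  exact ⟨n, hn.trans (lt_add_one _)⟩

theorem lt_floorQ_add_one (S : Set (Set M)) [Model S] (a : Q M) : a < toQ (floorQ a) + 1 := by
  refine least_spec S (P := fun n => a < toQ n + 1) ?_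
  obtain ⟨n, hn⟩ := exists_lt_toQ a
  exact ⟨n, hn.trans (lt_add_one _)⟩

theorem floorQ_le (S : Set (Set M)) [Model S] {a : Q M} (ha : 0 ≤ a) : toQ (floorQ a) ≤ a := by
  rcases eq_zero_or_succ S (floorQ a) with h | ⟨m, h⟩
  · rwa [h, map_zero]
  · rw [h]
    by_contra! hlt
    have : floorQ a ≤ m := least_le S (P := fun n => a < toQ n + 1) (by
      rwa [map_add, map_one] at hlt)
    rw [h] at this
    exact absurd (lt_succ_self m) (not_lt.2 this)

theorem floorQ_eq (S : Set (Set M)) [Model S] {a : Q M} {n : M} (h : toQ n ≤ a)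
    (h' : a < toQ n + 1) : floorQ a = n := by
  have h₁ := floorQ_le S ((toQ_nonneg n).trans h)
  have h₂ := lt_floorQ_add_one S a
  refine le_antisymm (toQ_le.1 ?_) (toQ_le.1 ?_)
  · exact toQ_lt_add_one_iff.1 (h₁.trans_lt h')
  · exact toQ_lt_add_one_iff.1 (h.trans_lt h₂)

end DefinableRationals

/-! ### Real numbers of the model -/

section Reals

variable {M : Type u} [Numbers M] {S : Set (Set M)}

theorem le_of_forall_tw (S : Set (Set M)) [Model S] {a b : Q M} (C : Q M)
    (h : ∀ k, a ≤ b + C * tw k) : a ≤ b := by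
  by_contra! hlt
  have hC : 0 < |C| + 1 := by positivity
  obtain ⟨k, hk⟩ := exists_tw_lt S (div_pos (sub_pos.2 hlt) hC)
  rw [lt_div_iff₀ hC] at hk
  have h₁ := h k
  have h₂ := tw_pos S k
  have h₃ : C * tw k ≤ |C| * tw k := mul_le_mul_of_nonneg_right (le_abs_self C) h₂.le
  nlinarith

theorem rLe_iff [Model S] {x y : M → Frac M} :
    RLe S x y ↔ ∀ k, val (x k) ≤ val (y k) + 2 * tw k := by
  refine forall_congr' fun k => ?_
  rw [← val_le_val, val_add, val_add, val_twoNegPow, two_mul]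

theorem isReal_iff [Model S] {x : M → Frac M} : IsReal S x ↔
    IsFun S (fun k => (x k).code) ∧ ∀ k i, |val (x k) - val (x (k + i))| ≤ tw k := by
  refine and_congr Iff.rfl (forall_congr' fun k => forall_congr' fun i => ?_)
  rw [← val_le_val, val_abs, val_sub, val_twoNegPow]

theorem IsReal.isDefQ [Model S] {x : M → Frac M} (hx : IsReal S x) :
    IsDefQ S (fun e => val (x (e 0))) := isDefQ_of_isFun hx.1

theorem IsReal.abs_sub_le [Model S] {x : M → Frac M} (hx : IsReal S x) {k l : M} (h : k ≤ l) :
    |val (x k) - val (x l)| ≤ tw k := by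
  obtain ⟨i, rfl⟩ := exists_add_of_le h
  exact (isReal_iff.1 hx).2 k i

theorem IsReal.le_add [Model S] {x : M → Frac M} (hx : IsReal S x) {k l : M} (h : k ≤ l) :
    val (x k) ≤ val (x l) + tw k := by
  linarith [(abs_le.1 (hx.abs_sub_le h)).2]

theorem IsReal.sub_le [Model S] {x : M → Frac M} (hx : IsReal S x) {k l : M} (h : k ≤ l) :
    val (x l) ≤ val (x k) + tw k := by
  linarith [(abs_le.1 (hx.abs_sub_le h)).1]

/-- To compare two real numbers it suffices to compare late approximations up to a constant
multiple of the precision. -/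
theorem rLe_of_approx [Model S] {x y : M → Frac M} (hx : IsReal S x) (hy : IsReal S y) {C : Q M}
    (hC : 0 ≤ C) (h : ∀ k, ∃ l, k ≤ l ∧ val (x l) ≤ val (y l) + C * tw k) : RLe S x y := by
  rw [rLe_iff]
  intro k
  refine le_of_forall_tw S C fun j => ?_
  obtain ⟨l, hl, h⟩ := h (k + j)
  have h₁ := hx.le_add (le_self_add.trans hl)
  have h₂ := hy.sub_le (le_self_add.trans hl)
  have h₃ := mul_le_mul_of_nonneg_left (tw_le_tw S (le_add_self : j ≤ k + j)) hC
  linarith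

theorem rLe_rconst_iff [Model S] {x : M → Frac M} (hx : IsReal S x) (q : Frac M) :
    RLe S x (rconst q) ↔ ∀ k, val (x k) ≤ val q + tw k := by
  rw [rLe_iff]
  refine ⟨fun h k => le_of_forall_tw S 2 fun j => ?_, fun h k => ?_⟩
  · have h₁ := hx.le_add (le_self_add : k ≤ k + j)
    have h₂ := h (k + j)
    have h₃ := tw_le_tw S (le_add_self : j ≤ k + j)
    unfold rconst at h₂
    linarith
  · have := tw_pos S k
    unfold rconst
    linarith [h k]

theorem rconst_rLe_iff [Model S] {x : M → Frac M} (hx : IsReal S x) (q : Frac M) :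
    RLe S (rconst q) x ↔ ∀ k, val q ≤ val (x k) + tw k := by
  rw [rLe_iff]
  refine ⟨fun h k => le_of_forall_tw S 2 fun j => ?_, fun h k => ?_⟩
  · have h₁ := hx.sub_le (le_self_add : k ≤ k + j)
    have h₂ := h (k + j)
    have h₃ := tw_le_tw S (le_add_self : j ≤ k + j)
    unfold rconst at h₂
    linarith
  · have := tw_pos S k
    unfold rconst
    linarith [h k]

theorem rLt_iff [Model S] {x y : M → Frac M} :
    RLt S x y ↔ ∃ k, val (x k) + 2 * tw k < val (y k) := by
  rw [RLt, rLe_iff]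
  push Not
  rfl

theorem isReal_of_isDefQ [Model S] {x : M → Q M} (hx : IsDefQ S (fun e => x (e 0)))
    (h : ∀ k i, |x k - x (k + i)| ≤ tw k) : IsReal S (fun k => qrep (x k)) := by
  rw [isReal_iff]
  exact ⟨isFun_qrep hx, fun k i => by rw [val_qrep S, val_qrep S]; exact h k i⟩

theorem isReal_rconst [Model S] (q : Frac M) : IsReal S (rconst q) := by
  rw [isReal_iff]
  exact ⟨isFun_iff.2 (IsDef.const q.code), fun k i => by simpa [rconst] using (tw_pos S k).le⟩

theorem isFun_code [Model S] {p n d : M → M} (hp : IsDef S (fun e => p (e 0)))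
    (hn : IsDef S (fun e => n (e 0))) (hd : IsDef S (fun e => d (e 0))) :
    IsFun S (fun k => (Frac.mk (p k) (n k) (d k)).code) := by
  rw [isFun_iff]
  unfold Frac.code
  infer_instance

/-- The components of a definable sequence of representatives. -/
theorem IsReal.components [Model S] {x : M → Frac M} (hx : IsReal S x) :
    IsDef S (fun e => (x (e 0)).pos) ∧ IsDef S (fun e => (x (e 0)).neg) ∧
      IsDef S (fun e => (x (e 0)).denPred) := by
  have := isFun_iff.1 hx.1
  have h : ∀ k, x k = decode (x k).code := fun k => (decode_code S _).symm
  have h₁ : (fun e : ℕ → M => (x (e 0)).pos) = fun e => pfst (pfst (x (e 0)).code) :=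
    funext fun e => congrArg Frac.pos (h (e 0))
  have h₂ : (fun e : ℕ → M => (x (e 0)).neg) = fun e => psnd (pfst (x (e 0)).code) :=
    funext fun e => congrArg Frac.neg (h (e 0))
  have h₃ : (fun e : ℕ → M => (x (e 0)).denPred) = fun e => psnd (x (e 0)).code :=
    funext fun e => congrArg Frac.denPred (h (e 0))
  rw [h₁, h₂, h₃]
  exact ⟨inferInstance, inferInstance, inferInstance⟩

theorem isReal_rsub [Model S] {x y : M → Frac M} (hx : IsReal S x) (hy : IsReal S y) :
    IsReal S (rsub x y) := by
  obtain ⟨h₁, h₂, h₃⟩ := hx.components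
  obtain ⟨h₄, h₅, h₆⟩ := hy.components
  have i₁ := isDef_comp₁ (F := fun k => (x k).pos) h₁
  have i₂ := isDef_comp₁ (F := fun k => (x k).neg) h₂
  have i₃ := isDef_comp₁ (F := fun k => (x k).denPred) h₃
  have i₄ := isDef_comp₁ (F := fun k => (y k).pos) h₄
  have i₅ := isDef_comp₁ (F := fun k => (y k).neg) h₅
  have i₆ := isDef_comp₁ (F := fun k => (y k).denPred) h₆
  rw [isReal_iff]
  refine ⟨isFun_code inferInstance inferInstance inferInstance, fun k i => ?_⟩
  have h₇ := abs_le.1 (hx.abs_sub_le (le_self_add : k + 1 ≤ k + 1 + i))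
  have h₈ := abs_le.1 (hy.abs_sub_le (le_self_add : k + 1 ≤ k + 1 + i))
  rw [tw_succ S, add_right_comm] at h₇ h₈
  simp only [rsub, val_sub]
  exact abs_le.2 ⟨by linarith [h₇.1, h₈.2], by linarith [h₇.2, h₈.1]⟩

theorem isReal_rabs [Model S] {x : M → Frac M} (hx : IsReal S x) : IsReal S (rabs x) := by
  classical
  obtain ⟨h₁, h₂, h₃⟩ := hx.components
  have i₁ := isDef_comp₁ (F := fun k => (x k).pos) h₁
  have i₂ := isDef_comp₁ (F := fun k => (x k).neg) h₂
  rw [isReal_iff]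
  constructor
  · have : rabs x = fun k => ⟨if (x k).pos < (x k).neg then (x k).neg else (x k).pos,
        if (x k).pos < (x k).neg then (x k).pos else (x k).neg, (x k).denPred⟩ := by
      funext k
      simp only [rabs, Frac.abs, frac_neg]
      split_ifs <;> rfl
    rw [this]
    exact isFun_code inferInstance inferInstance h₃
  · intro k i
    simp only [rabs, val_abs]
    exact (abs_abs_sub_abs_le _ _).trans ((isReal_iff.1 hx).2 k i)

theorem val_radd (x y : M → Frac M) (k : M) :
    val (radd x y k) = val (x (k + 1)) + val (y (k + 1)) := val_add _ _

theorem val_rsub (x y : M → Frac M) (k : M) :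
    val (rsub x y k) = val (x (k + 1)) - val (y (k + 1)) := val_sub _ _

theorem val_rabs (x : M → Frac M) (k : M) : val (rabs x k) = |val (x k)| := val_abs _

theorem val_rconst (q : Frac M) (k : M) : val (rconst q k) = val q := rfl

theorem rInUnit_rconst [Model S] {p : Frac M} (hp : p.InUnit) : RInUnit S (rconst p) := by
  rw [inUnit_iff] at hp
  refine ⟨isReal_rconst p, ?_, ?_⟩ <;> rw [rLe_iff] <;> intro k <;> have := tw_pos S k
  · simp only [val_rconst, val_zero]
    linarith [hp.1]
  · simp only [val_rconst, val_one]
    linarith [hp.2]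

/-! ### Rational presentations -/

/-- Membership in a set of pairs of rational numbers, through canonical representatives. -/
def QMem (Z : Set M) (p q : Q M) : Prop := PairMem Z (qrep p) (qrep q)

instance IsDelta.qMem [Model S] {Z : Set M} [hZ : Fact (Z ∈ S)] {F G : (ℕ → M) → Q M}
    [hF : IsDefQ S F] [hG : IsDefQ S G] : IsDelta S (fun e => QMem Z (F e) (G e)) := by
  unfold QMem PairMem
  infer_instance

section Presentation

variable {Z : Set M}

theorem IsRatPres.pairMem_iff [Model S] (hZ : IsRatPres Z) {p : Frac M} (hp : p.InUnit)
    (q : Frac M) : PairMem Z p q ↔ QMem Z (val p) (val q) := by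
  have h₁ : p.Eqv (qrep (val p)) := val_eq_val.1 (val_qrep S _).symm
  have h₂ : q.Eqv (qrep (val q)) := val_eq_val.1 (val_qrep S _).symm
  have hp' : (qrep (val p)).InUnit := by
    rw [inUnit_iff, val_qrep S]
    exact inUnit_iff.1 hp
  exact ⟨hZ.congr _ _ _ _ hp h₁ h₂, hZ.congr _ _ _ _ hp' h₁.symm h₂.symm⟩

theorem inUnit_qrep [Model S] {p : Q M} (h₀ : 0 ≤ p) (h₁ : p ≤ 1) : (qrep p).InUnit := by
  rw [inUnit_iff, val_qrep S]
  exact ⟨h₀, h₁⟩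

theorem IsRatPres.qMem_of_le [Model S] (hZ : IsRatPres Z) {p : Q M} (h₀ : 0 ≤ p) (h₁ : p ≤ 1)
    {q q' : Q M} (hq : q ≤ q') (h : QMem Z p q) : QMem Z p q' := by
  rcases hq.lt_or_eq with hlt | rfl
  · exact hZ.upward _ _ _ (inUnit_qrep (S := S) h₀ h₁)
      (by rwa [← val_lt_val, val_qrep S, val_qrep S]) h
  · exact h

theorem IsRatPres.exists_qMem [Model S] (hZ : IsRatPres Z) {p : Q M} (h₀ : 0 ≤ p) (h₁ : p ≤ 1) :
    (∃ q, QMem Z p q) ∧ ∃ q, ¬ QMem Z p q := by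
  have hp := inUnit_qrep (S := S) h₀ h₁
  obtain ⟨⟨q, hq⟩, ⟨q', hq'⟩⟩ := hZ.exists_both _ hp
  rw [hZ.pairMem_iff (S := S) hp, val_qrep S] at hq hq'
  exact ⟨⟨_, hq⟩, ⟨_, hq'⟩⟩

theorem RatVal.le_of_qMem [Model S] (hZ : IsRatPres Z) {p : Frac M} {y : M → Frac M}
    (h : RatVal S Z p y) {q : Q M} (hq : QMem Z (val p) q) (k : M) : val (y k) ≤ q + tw k := by
  have := (rLe_rconst_iff h.2.1 (qrep q)).1 (h.2.2.1 (qrep q) (by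
    rwa [hZ.pairMem_iff (S := S) h.1, val_qrep S])) k
  rwa [val_qrep S] at this

theorem RatVal.le_of_not_qMem [Model S] (hZ : IsRatPres Z) {p : Frac M} {y : M → Frac M}
    (h : RatVal S Z p y) {q : Q M} (hq : ¬ QMem Z (val p) q) (k : M) :
    q ≤ val (y k) + tw k := by
  have := (rconst_rLe_iff h.2.1 (qrep q)).1 (h.2.2.2 (qrep q) fun q' hq' => ?_) k
  · rwa [val_qrep S] at this
  · rw [← val_le_val, val_qrep S]
    rw [hZ.pairMem_iff (S := S) h.1] at hq'
    have hp := inUnit_iff.1 h.1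
    exact le_of_not_gt fun hlt => hq (hZ.qMem_of_le (S := S) hp.1 hp.2 hlt.le hq')

/-- A real number that is compatible with the cut of `Z` at `p` is the value at `p` of the function
that is presented by `Z`. -/
theorem ratVal_of_approx [Model S] (hZ : IsRatPres Z) {p : Frac M} (hp : p.InUnit)
    {y : M → Frac M} (hy : IsReal S y) (h₁ : ∀ q k, QMem Z (val p) q → val (y k) ≤ q + 2 * tw k)
    (h₂ : ∀ k, ∃ q, QMem Z (val p) q ∧ q ≤ val (y k) + 2 * tw k) : RatVal S Z p y := by
  refine ⟨hp, hy, fun q hq => ?_, fun r hr => ?_⟩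
  · rw [hZ.pairMem_iff (S := S) hp] at hq
    rw [rLe_iff]
    exact fun k => h₁ _ k hq
  · rw [rLe_iff]
    intro k
    obtain ⟨q, hq, hq'⟩ := h₂ k
    rw [← val_qrep S q, ← hZ.pairMem_iff (S := S) hp] at hq
    have := val_le_val.2 (hr _ hq)
    rw [val_qrep S] at this
    exact this.trans hq'

end Presentation

end Reals

/-! ### Binary strings -/

section Strings

variable {M : Type u} [Numbers M] {S : Set (Set M)}

/-- Truncated subtraction. -/
noncomputable def msub (a b : M) : M := bleast a (fun c => a ≤ b + c)

instance IsDef.msub [Model S] {f g : (ℕ → M) → M} [hf : IsDef S f] [hg : IsDef S g] :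
    IsDef S (fun e => msub (f e) (g e)) :=
  isDef_comp₂ (F := SOA.msub) (IsDef.bleast (P := fun c e => e 0 ≤ e 1 + c)) f g

theorem msub_add (S : Set (Set M)) [Model S] {a b : M} (h : b ≤ a) : msub a b + b = a := by
  obtain ⟨c, hc⟩ := exists_add_of_le h
  have hc' : c ≤ a := by
    rw [hc]
    exact le_add_self
  obtain ⟨h₁, h₂⟩ := bleast_spec S (P := fun c => a ≤ b + c) hc.le hc'
  refine le_antisymm ?_ (by rw [add_comm]; exact h₁)
  calc _ ≤ c + b := add_le_add h₂ le_rfl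
    _ = a := by rw [hc, add_comm]

theorem add_msub (S : Set (Set M)) [Model S] (a b : M) : msub (a + b) b = a :=
  add_right_cancel (msub_add S le_add_self)

theorem quo_quo (S : Set (Set M)) [Model S] (a : M) {b c : M} (hb : 0 < b) (hc : 0 < c) :
    quo (quo a b) c = quo a (b * c) := by
  have h₁ := quo_mul_add_rmd S a hb
  have h₂ := quo_mul_add_rmd S (quo a b) hc
  have h₃ := rmd_lt S a hb
  have h₄ := rmd_lt S (quo a b) hc
  symm
  refine quo_eq S (r := rmd (quo a b) c * b + rmd a b) ?_ ?_
  · calc a = quo a b * b + rmd a b := h₁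
      _ = (quo (quo a b) c * c + rmd (quo a b) c) * b + rmd a b := by rw [← h₂]
      _ = _ := by ring
  · calc rmd (quo a b) c * b + rmd a b < rmd (quo a b) c * b + b := by gcongr
      _ = (rmd (quo a b) c + 1) * b := by ring
      _ ≤ c * b := mul_le_mul_of_nonneg_right (succ_le_of_lt h₄) zero_le
      _ = b * c := mul_comm _ _

theorem quo_one (S : Set (Set M)) [Model S] (a : M) : quo a 1 = a :=
  quo_eq S (r := 0) (by simp) (by simp)

/-- The number of digits of the string `σ`. -/
noncomputable def len (σ : M) : M := least (fun ℓ => σ < pw (ℓ + 1))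

/-- The string `σ` without its last `d` digits. -/
noncomputable def drop (d σ : M) : M := quo σ (pw d)

instance IsDef.len [Model S] {f : (ℕ → M) → M} [hf : IsDef S f] : IsDef S (fun e => len (f e)) := by
  have : IsDef S (fun e : ℕ → M => SOA.len (e 0)) :=
    IsDef.least (P := fun ℓ e => e 0 < SOA.pw (ℓ + 1)) inferInstance fun e =>
      ⟨e 0, (lt_pw S _).trans_le (pw_le_pw S le_self_add)⟩
  exact isDef_comp₁ this f

instance IsDef.drop [Model S] {f g : (ℕ → M) → M} [hf : IsDef S f] [hg : IsDef S g] :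
    IsDef S (fun e => drop (f e) (g e)) := by
  unfold SOA.drop
  infer_instance

theorem lt_pw_len (S : Set (Set M)) [Model S] (σ : M) : σ < pw (len σ + 1) :=
  least_spec S (P := fun ℓ => σ < pw (ℓ + 1))
    ⟨σ, (lt_pw S _).trans_le (pw_le_pw S le_self_add)⟩

theorem pw_len_le (S : Set (Set M)) [Model S] {σ : M} (hσ : σ ≠ 0) : pw (len σ) ≤ σ := by
  rcases eq_zero_or_succ S (len σ) with h | ⟨m, h⟩
  · rw [h, pw_zero S]
    simpa using succ_le_of_lt (pos_iff_ne_zero.2 hσ)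
  · by_contra! hlt
    rw [h] at hlt
    have h₁ : len σ ≤ m := least_le S (P := fun ℓ => σ < pw (ℓ + 1)) hlt
    rw [h] at h₁
    exact absurd (lt_succ_self m) (not_lt.2 h₁)

theorem pw_lt_pw (S : Set (Set M)) [Model S] {m n : M} (h : m < n) : pw m < pw n := by
  refine lt_of_lt_of_le ?_ (pw_le_pw S (succ_le_of_lt h))
  rw [pw_succ S]
  exact lt_add_of_pos_right _ (pw_pos S m)

theorem lt_of_pw_lt_pw (S : Set (Set M)) [Model S] {m n : M} (h : pw m < pw n) : m < n :=
  not_le.1 fun h' => absurd h (not_lt.2 (pw_le_pw S h'))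

theorem len_eq (S : Set (Set M)) [Model S] {σ n : M} (h₁ : pw n ≤ σ) (h₂ : σ < pw (n + 1)) :
    len σ = n := by
  have hσ : σ ≠ 0 := ((pw_pos S n).trans_le h₁).ne'
  refine le_antisymm (le_of_lt_succ ?_) (le_of_lt_succ ?_)
  · exact lt_of_pw_lt_pw S ((pw_len_le S hσ).trans_lt h₂)
  · exact lt_of_pw_lt_pw S (h₁.trans_lt (lt_pw_len S σ))

theorem drop_zero (S : Set (Set M)) [Model S] (σ : M) : drop 0 σ = σ := by
  rw [drop, pw_zero S, quo_one S]

theorem drop_drop (S : Set (Set M)) [Model S] (c d σ : M) : drop d (drop c σ) = drop (c + d) σ := by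
  rw [drop, drop, drop, quo_quo S σ (pw_pos S c) (pw_pos S d), pw_add S]

theorem pw_le_drop (S : Set (Set M)) [Model S] {n d σ : M} (h : pw (n + d) ≤ σ) :
    pw n ≤ drop d σ := by
  refine le_of_lt_succ (lt_of_mul_lt_mul_right ?_ (zero_le (a := pw d)))
  rw [← pw_add S]
  exact h.trans_lt (lt_quo_succ_mul S σ (pw_pos S d))

theorem drop_lt_pw (S : Set (Set M)) [Model S] {n d σ : M} (h : σ < pw (n + d)) :
    drop d σ < pw n := by
  refine lt_of_mul_lt_mul_right ?_ (zero_le (a := pw d))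
  rw [← pw_add S]
  exact (quo_mul_le S σ (pw_pos S d)).trans_lt h

theorem len_drop (S : Set (Set M)) [Model S] {σ d : M} (hσ : σ ≠ 0) (hd : d ≤ len σ) :
    len (drop d σ) + d = len σ := by
  obtain ⟨n, hn⟩ := exists_add_of_le hd
  have h₁ := pw_len_le S hσ
  have h₂ := lt_pw_len S σ
  rw [hn, add_comm d] at h₁ h₂
  rw [add_right_comm] at h₂
  rw [len_eq S (pw_le_drop S h₁) (drop_lt_pw S h₂), hn, add_comm]

theorem drop_ne_zero (S : Set (Set M)) [Model S] {σ d : M} (hσ : σ ≠ 0) (hd : d ≤ len σ) :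
    drop d σ ≠ 0 := by
  obtain ⟨n, hn⟩ := exists_add_of_le hd
  have h₁ := pw_len_le S hσ
  rw [hn, add_comm d] at h₁
  exact ((pw_pos S n).trans_le (pw_le_drop S h₁)).ne'

theorem drop_one_double (S : Set (Set M)) [Model S] (σ : M) : drop 1 (σ + σ) = σ := by
  have : pw (1 : M) = 1 + 1 := by rw [← zero_add (1 : M), pw_succ S, pw_zero S, zero_add]
  rw [drop, this]
  exact quo_eq S (r := 0) (by ring) (by simp)

theorem drop_one_double_succ (S : Set (Set M)) [Model S] (σ : M) : drop 1 (σ + σ + 1) = σ := by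
  have : pw (1 : M) = 1 + 1 := by rw [← zero_add (1 : M), pw_succ S, pw_zero S, zero_add]
  rw [drop, this]
  exact quo_eq S (r := 1) (by ring) (lt_succ_self _)

/-- A string is one of the two extensions by one digit of the string without its last digit. -/
theorem eq_double_drop (S : Set (Set M)) [Model S] (σ : M) :
    σ = drop 1 σ + drop 1 σ ∨ σ = drop 1 σ + drop 1 σ + 1 := by
  have h2 : pw (1 : M) = 1 + 1 := by rw [← zero_add (1 : M), pw_succ S, pw_zero S, zero_add]
  have h₁ := quo_mul_add_rmd S σ (pw_pos S 1)
  have h₂ := rmd_lt S σ (pw_pos S 1)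
  rw [h2] at h₁ h₂
  unfold drop
  rw [h2]
  rcases lt_succ_cases h₂ with h | h
  · have h₀ : rmd σ (1 + 1) = 0 := by
      rw [← zero_add (1 : M)] at h
      exact le_antisymm (le_of_lt_succ (by rwa [zero_add] at h ⊢)) zero_le
    left
    calc σ = _ := h₁
      _ = _ := by rw [h₀]; ring
  · right
    calc σ = _ := h₁
      _ = _ := by rw [h]; ring

theorem double_ne_double_succ (a b : M) : a + a ≠ b + b + 1 := by
  intro h
  rcases le_or_gt a b with hab | hab
  · have := add_le_add hab hab
    rw [h] at this
    exact absurd (lt_succ_self _) (not_lt.2 this)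
  · have := add_le_add (succ_le_of_lt hab) (succ_le_of_lt hab)
    rw [h] at this
    have h' : b + 1 + (b + 1) = b + b + 1 + 1 := by ring
    rw [h'] at this
    exact absurd (lt_succ_self _) (not_lt.2 this)

/-- The last digit of the string `σ` is `1`. -/
def IsOdd (σ : M) : Prop := σ = drop 1 σ + drop 1 σ + 1

instance IsDelta.isOdd [Model S] {f : (ℕ → M) → M} [hf : IsDef S f] :
    IsDelta S (fun e => IsOdd (f e)) := by
  unfold SOA.IsOdd
  infer_instance

/-- The digit number `i` of the string `σ` is `1`. -/
def Digit (σ i : M) : Prop := IsOdd (drop (msub (len σ) (i + 1)) σ)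

instance IsDelta.digit [Model S] {f g : (ℕ → M) → M} [hf : IsDef S f] [hg : IsDef S g] :
    IsDelta S (fun e => Digit (f e) (g e)) := by
  unfold SOA.Digit
  infer_instance

theorem digit_drop (S : Set (Set M)) [Model S] {σ i : M} (hσ : σ ≠ 0) (h : 1 ≤ len σ)
    (hi : i < len (drop 1 σ)) : Digit (drop 1 σ) i ↔ Digit σ i := by
  have h₁ := len_drop S hσ h
  obtain ⟨d, hd⟩ := exists_add_of_le (succ_le_of_lt hi)
  have h₂ : msub (len (drop 1 σ)) (i + 1) = d := by
    rw [hd, add_comm, add_msub S]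
  have h₃ : msub (len σ) (i + 1) = 1 + d := by
    rw [← h₁, hd]
    have : i + 1 + d + 1 = 1 + d + (i + 1) := by ring
    rw [this, add_msub S]
  rw [Digit, Digit, h₂, h₃, drop_drop S]

section Restriction

variable {Z : M → Prop} {c : M → M}

/-- If the strings `c n` are the initial segments of an infinite binary sequence, `c n` has the
length `n`. -/
theorem restriction_bounds [Model S] (hc : IsDef S (fun e => c (e 0))) (h₀ : c 0 = 1)
    (h₁ : ∀ n, c (n + 1) = c n + c n ∨ c (n + 1) = c n + c n + 1) (n : M) :
    pw n ≤ c n ∧ c n < pw (n + 1) := by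
  have := isDef_comp₁ hc
  refine delta_induction S (P := fun n => pw n ≤ c n ∧ c n < pw (n + 1)) ?_ (fun n ih => ?_) n
  · rw [h₀, pw_succ S, pw_zero S]
    exact ⟨le_rfl, lt_succ_self _⟩
  · have h₂ := add_le_add ih.1 ih.1
    have h₃ := add_le_add (succ_le_of_lt ih.2) (succ_le_of_lt ih.2)
    rw [pw_succ S n, pw_succ S (n + 1)]
    have h₄ : c n + 1 + (c n + 1) = c n + c n + 1 + 1 := by ring
    rw [h₄] at h₃
    have h₅ := (lt_succ_self _).trans_le h₃
    rcases h₁ n with h | h <;> rw [h]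
    · exact ⟨h₂, (lt_succ_self _).trans h₅⟩
    · exact ⟨h₂.trans le_self_add, h₅⟩

theorem drop_restriction [Model S] (hc : IsDef S (fun e => c (e 0)))
    (h₁ : ∀ n, c (n + 1) = c n + c n ∨ c (n + 1) = c n + c n + 1) (n d : M) :
    drop d (c (n + d)) = c n := by
  have := isDef_comp₁ hc
  refine delta_induction S (P := fun d => drop d (c (n + d)) = c n) ?_ (fun d ih => ?_) d
  · rw [add_zero, drop_zero S]
  · rw [add_comm d 1, ← drop_drop S, ← ih]
    congr 1
    have : n + (1 + d) = n + d + 1 := by ring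
    rw [this]
    rcases h₁ (n + d) with h | h <;> rw [h]
    · exact drop_one_double S _
    · exact drop_one_double_succ S _

theorem digit_restriction [Model S] (hc : IsDef S (fun e => c (e 0))) (h₀ : c 0 = 1)
    (h₁ : ∀ n, (¬ Z n → c (n + 1) = c n + c n) ∧ (Z n → c (n + 1) = c n + c n + 1)) {n x : M}
    (hx : x < n) : Digit (c n) x ↔ Z x := by
  have h₂ : ∀ n, c (n + 1) = c n + c n ∨ c (n + 1) = c n + c n + 1 := fun n => by
    by_cases hn : Z n
    · exact Or.inr ((h₁ n).2 hn)
    · exact Or.inl ((h₁ n).1 hn)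
  obtain ⟨h₃, h₄⟩ := restriction_bounds hc h₀ h₂ n
  obtain ⟨d, rfl⟩ := exists_add_of_le (succ_le_of_lt hx)
  rw [Digit, len_eq S h₃ h₄, add_comm (x + 1) d, add_msub S, add_comm d, drop_restriction hc h₂]
  by_cases hx' : Z x
  · rw [(h₁ x).2 hx', IsOdd, drop_one_double_succ S]
    simp [hx']
  · rw [(h₁ x).1 hx', IsOdd, drop_one_double S]
    simp only [hx', iff_false]
    exact double_ne_double_succ _ _

end Restriction

theorem isDelta_comp₃ {P : M → M → M → Prop} (hP : IsDelta S (fun e => P (e 0) (e 1) (e 2)))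
    (f g h : (ℕ → M) → M) [hf : IsDef S f] [hg : IsDef S g] [hh : IsDef S h] :
    IsDelta S (fun e => P (f e) (g e) (h e)) := by
  have key : ∀ a b : ℕ, IsDelta S (fun e => P (e a) (e b) (h e)) := fun a b => by
    refine IsDelta.subst (P := fun c e => P (e a) (e b) c) ?_ hh
    exact hP.comp (σ := fun e => push (e (a + 1)) (push (e (b + 1)) (fun _ => e 0))) fun i => by
      match i with
      | 0 => exact .var _
      | 1 => exact .var _
      | i + 2 => exact .var 0
  refine IsDelta.subst (P := fun a e => P a (g e) (h e)) ?_ hf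
  refine IsDelta.subst (P := fun b e => P (e 0) b (h (fun n => e (n + 1)))) ?_
    (hg.comp (σ := fun e n => e (n + 1)) (fun i => .var (i + 1)))
  refine IsDelta.subst (P := fun c e => P (e 1) (e 0) c) ?_
    (hh.comp (σ := fun e n => e (n + 2)) (fun i => .var (i + 2)))
  exact hP.comp (σ := fun e => push (e 2) (push (e 1) (fun _ => e 0))) fun i => by
    match i with
    | 0 => exact .var _
    | 1 => exact .var _
    | i + 2 => exact .var 0

/-! ### Compactness -/

/-- Weak König's lemma as a compactness principle: there is a set `Z` that contains the numbers in
`U`, omits those in `V` and respects the implications in `E`, as soon as any finite part of these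
conditions can be satisfied. -/
theorem exists_of_finitely_satisfiable (hW : WKL0 S) [Model S] {E : M → M → M → Prop}
    {U V : M → Prop} (hE : IsDelta S (fun e => E (e 0) (e 1) (e 2)))
    (hU : IsDelta S (fun e => U (e 0))) (hV : IsDelta S (fun e => V (e 0)))
    (h : ∀ N, ∃ Y : M → Prop, IsDelta S (fun e => Y (e 0)) ∧
      (∀ i x y, i < N → x < N → y < N → E i x y → Y x → Y y) ∧
      (∀ x, x < N → U x → Y x) ∧ ∀ x, x < N → V x → ¬ Y x) :
    ∃ Z ∈ S, (∀ i x y, E i x y → x ∈ Z → y ∈ Z) ∧ (∀ x, U x → x ∈ Z) ∧ ∀ x, V x → x ∉ Z := by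
  classical
  have := isDelta_comp₃ hE
  have := isDelta_comp₁ hU
  have := isDelta_comp₁ hV
  obtain ⟨T, hT⟩ : ∃ T : Set M, T = {σ | σ ≠ 0 ∧
      (∀ i, i < len σ → ∀ x, x < len σ → ∀ y, y < len σ → E i x y → Digit σ x → Digit σ y) ∧
      (∀ x, x < len σ → U x → Digit σ x) ∧ ∀ x, x < len σ → V x → ¬ Digit σ x} := ⟨_, rfl⟩
  have hTS : T ∈ S := by
    rw [hT]
    exact comprehension S
  have htree : IsBinTree T := by
    rw [hT]
    refine ⟨fun n hn => hn.1, fun n hn hmem => ?_⟩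
    obtain ⟨σ, hσ, hσn⟩ : ∃ σ, (σ ≠ 0 ∧
        (∀ i, i < len σ → ∀ x, x < len σ → ∀ y, y < len σ → E i x y → Digit σ x → Digit σ y) ∧
        (∀ x, x < len σ → U x → Digit σ x) ∧ ∀ x, x < len σ → V x → ¬ Digit σ x) ∧
        drop 1 σ = n := by
      rcases hmem with h | h
      · exact ⟨_, h, drop_one_double S n⟩
      · exact ⟨_, h, drop_one_double_succ S n⟩
    obtain ⟨h₀, h₁, h₂, h₃⟩ := hσ
    have hlen : 1 ≤ len σ := by
      by_contra! hlt
      have : len σ = 0 := le_antisymm (le_of_lt_succ (by rwa [zero_add])) zero_le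
      have hlt := lt_pw_len S σ
      rw [this] at hlt
      have h4 := drop_lt_pw S (n := 0) (d := 1) hlt
      rw [hσn, pw_zero S] at h4
      exact hn (le_antisymm (le_of_lt_succ (by rwa [zero_add])) zero_le)
    have h₄ := len_drop S h₀ hlen
    subst hσn
    have h₅ : ∀ x, x < len (drop 1 σ) → x < len σ := fun x hx => by
      rw [← h₄]
      exact hx.trans (lt_succ_self _)
    refine ⟨hn, fun i hi x hx y hy => ?_, fun x hx => ?_, fun x hx => ?_⟩
    · rw [digit_drop S h₀ hlen hx, digit_drop S h₀ hlen hy]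
      exact h₁ i (h₅ i hi) x (h₅ x hx) y (h₅ y hy)
    · rw [digit_drop S h₀ hlen hx]
      exact h₂ x (h₅ x hx)
    · rw [digit_drop S h₀ hlen hx]
      exact h₃ x (h₅ x hx)
  have hinf : IsInfinite T := by
    intro N
    obtain ⟨Y, hY, h₁, h₂, h₃⟩ := h N
    have := isDelta_comp₁ hY
    have hstep : IsDef S (fun e => (fun i v => if Y i then v + v + 1 else v + v) (e 0) (e 1)) :=
      IsDef.ite (p := fun e => Y (e 0)) (f := fun e => e 1 + e 1 + 1) (g := fun e => e 1 + e 1)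
    obtain ⟨c, hc⟩ : ∃ c : M → M,
        c = recVal 1 (fun i v => if Y i then v + v + 1 else v + v) := ⟨_, rfl⟩
    have hcd : IsDef S (fun e => c (e 0)) := by
      have h' : IsDef S (fun e : ℕ → M => if Y (e 0) then e 1 + e 1 + 1 else e 1 + e 1) := hstep
      rw [hc]
      exact IsDef.recVal (a := fun _ => 1) (n := fun e => e 0)
        (h := fun i v _ => if Y i then v + v + 1 else v + v)
    have hc0 : c 0 = 1 := by
      rw [hc]
      exact recVal_zero (S := S) _ hstep
    have hcs : ∀ n, (¬ Y n → c (n + 1) = c n + c n) ∧ (Y n → c (n + 1) = c n + c n + 1) := by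
      intro n
      rw [hc, recVal_succ (S := S) _ hstep]
      exact ⟨fun h => if_neg h, fun h => if_pos h⟩
    have hcs' : ∀ n, c (n + 1) = c n + c n ∨ c (n + 1) = c n + c n + 1 := fun n => by
      by_cases hn : Y n
      · exact Or.inr ((hcs n).2 hn)
      · exact Or.inl ((hcs n).1 hn)
    obtain ⟨h₄, h₅⟩ := restriction_bounds hcd hc0 hcs' N
    refine ⟨c N, ?_, (lt_pw S N).trans_le h₄⟩
    have hdig : ∀ x, x < N → (Digit (c N) x ↔ Y x) := fun x hx => digit_restriction hcd hc0 hcs hx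
    rw [hT]
    refine ⟨((pw_pos S N).trans_le h₄).ne', ?_⟩
    rw [len_eq S h₄ h₅]
    refine ⟨fun i hi x hx y hy => ?_, fun x hx => ?_, fun x hx => ?_⟩
    · rw [hdig x hx, hdig y hy]
      exact h₁ i x y hi hx hy
    · rw [hdig x hx]
      exact h₂ x hx
    · rw [hdig x hx]
      exact h₃ x hx
  obtain ⟨Z, hZ, c, hc, ⟨hc0, hcs⟩, hcT⟩ := hW.2 T hTS htree hinf
  rw [isFun_iff] at hc
  have hdig : ∀ {n x}, x < n → (Digit (c n) x ↔ x ∈ Z) := fun hx => digit_restriction hc hc0 hcs hx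
  have hcs' : ∀ n, c (n + 1) = c n + c n ∨ c (n + 1) = c n + c n + 1 := fun n => by
    by_cases hn : n ∈ Z
    · exact Or.inr ((hcs n).2 hn)
    · exact Or.inl ((hcs n).1 hn)
  have hlen : ∀ n, len (c n) = n := fun n => by
    obtain ⟨h₄, h₅⟩ := restriction_bounds hc hc0 hcs' n
    exact len_eq S h₄ h₅
  rw [hT] at hcT
  refine ⟨Z, hZ, fun i x y hE hx => ?_, fun x hx => ?_, fun x hx => ?_⟩
  · obtain ⟨n, hn⟩ : ∃ n, n = max i (max x y) + 1 := ⟨_, rfl⟩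
    have hi : i < n := hn ▸ Numbers.lt_succ_iff.2 (le_max_left _ _)
    have hx' : x < n := hn ▸ Numbers.lt_succ_iff.2 (le_max_of_le_right (le_max_left _ _))
    have hy' : y < n := hn ▸ Numbers.lt_succ_iff.2 (le_max_of_le_right (le_max_right _ _))
    have := (hcT n).2.1
    rw [hlen] at this
    exact (hdig hy').1 (this i hi x hx' y hy' hE ((hdig hx').2 hx))
  · have := (hcT (x + 1)).2.2.1
    rw [hlen] at this
    exact (hdig (lt_succ_self x)).1 (this x (lt_succ_self x) hx)
  · have := (hcT (x + 1)).2.2.2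
    rw [hlen] at this
    exact fun h => this x (lt_succ_self x) hx ((hdig (lt_succ_self x)).2 h)

end Strings

/-! ### Majorants from weak König's lemma -/

section Majorant

variable {M : Type u} [Numbers M] {S : Set (Set M)}

theorem isDefQ_compQ [Model S] {F : Q M → M → Q M}
    (hF : IsDefQ S (fun e => F (qdec (e 0)) (e 1))) (f : (ℕ → M) → Q M) (g : (ℕ → M) → M)
    [hf : IsDefQ S f] [hg : IsDef S g] : IsDefQ S (fun e => F (f e) (g e)) :=
  (isDefQ_comp₂ (F := fun a b => F (qdec a) b) hF (fun e => qcode (f e)) g).congr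
    fun e => by simp only [qdec_qcode S]

/-- The variation of `F` between two indices bounds the difference of the values. -/
theorem abs_sub_le_sumQ [Model S] {F : M → Q M} (hF : IsDefQ S (fun e => F (e 0))) {i j : M}
    (h : i ≤ j) : |F j - F i| ≤
      sumQ j (fun k => |F (k + 1) - F k|) - sumQ i (fun k => |F (k + 1) - F k|) := by
  have := isDefQ_comp₁ hF
  obtain ⟨d, rfl⟩ := exists_add_of_le h
  refine delta_induction S (P := fun d => |F (i + d) - F i| ≤
    sumQ (i + d) (fun k => |F (k + 1) - F k|) - sumQ i (fun k => |F (k + 1) - F k|))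
    (by simp) (fun d ih => ?_) d
  rw [← add_assoc, sumQ_succ (S := S) inferInstance]
  have := abs_add_le (F (i + d + 1) - F (i + d)) (F (i + d) - F i)
  rw [sub_add_sub_cancel] at this
  linarith

theorem bleast_le (S : Set (Set M)) [Model S] {P : M → Prop} [hP : IsDelta S (fun e => P (e 0))]
    (n : M) : bleast n P ≤ n :=
  least_le S (P := fun a => P a ∨ n ≤ a) (Or.inr le_rfl)

theorem pfst_le (S : Set (Set M)) [Model S] (z : M) : pfst z ≤ z :=
  bleast_le S (P := fun a => ∃ b, b ≤ z ∧ z = pair a b) z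

theorem psnd_le (S : Set (Set M)) [Model S] (z : M) : psnd z ≤ z :=
  bleast_le S (P := fun b => ∃ a, a ≤ z ∧ z = pair a b) z

/-- A rational number in the unit interval whose code is less than `n` is a multiple of
`1 / n!`. -/
theorem exists_eq_div_fac (S : Set (Set M)) [Model S] {c n : M} (hc : c < n) (h₀ : 0 ≤ qdec c) :
    ∃ i, qdec c = toQ i / toQ (fac n) := by
  have hd : psnd c + 1 ≤ n := succ_le_of_lt ((psnd_le S c).trans_lt hc)
  obtain ⟨m, hm⟩ := dvd_fac S (succ_pos' _) hd
  have hn := toQ_pos.2 (fac_pos S n)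
  rw [qdec, decode, val_eq_div] at *
  dsimp only at *
  have hpos : 0 < toQ (psnd c) + 1 := by
    have := toQ_nonneg (psnd c)
    positivity
  have h₁ : toQ (psnd (pfst c)) ≤ toQ (pfst (pfst c)) := by
    by_contra! hlt
    exact absurd h₀ (not_le.2 (div_neg_of_neg_of_pos (sub_neg.2 hlt) hpos))
  obtain ⟨k, hk⟩ := exists_add_of_le (toQ_le.1 h₁)
  refine ⟨k * m, ?_⟩
  rw [div_eq_div_iff hpos.ne' hn.ne', hm, hk]
  simp only [map_mul, map_add, map_one]
  ring

/-- Weak König's lemma gives a non-decreasing rationally presented `g` that majorizes the slopes of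
a function whose values have the approximations `Y` and whose variation on all equidistant
partitions is bounded by `c`. -/
theorem hasJordan_of_approx (hW : WKL0 S) [Model S] {V : Frac M → (M → Frac M) → Prop}
    {Y : Q M → M → Q M} (hY : IsDefQ S (fun e => Y (qdec (e 0)) (e 1)))
    (hY₁ : ∀ p k i, 0 ≤ p → p ≤ 1 → |Y p k - Y p (k + i)| ≤ tw k) (c : M)
    (hbv : ∀ n, 0 < n → ∀ K, ∃ l, K ≤ l ∧
      sumQ n (fun j => |Y (toQ (j + 1) / toQ n) l - Y (toQ j / toQ n) l|) ≤ toQ c)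
    (hV : ∀ p y, p.InUnit → V p y → IsReal S y ∧ ∀ k, |val (y k) - Y (val p) k| ≤ 4 * tw k) :
    HasJordan S V := by
  have hY' := isDefQ_compQ hY
  obtain ⟨a, ha⟩ : ∃ a : M → Q M, a = fun x => qdec (pfst x) := ⟨_, rfl⟩
  obtain ⟨b, hb⟩ : ∃ b : M → Q M, b = fun x => qdec (psnd x) := ⟨_, rfl⟩
  have had : IsDefQ S (fun e => a (e 0)) := by
    rw [ha]
    infer_instance
  have hbd : IsDefQ S (fun e => b (e 0)) := by
    rw [hb]
    infer_instance
  have := isDefQ_comp₁ had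
  have := isDefQ_comp₁ hbd
  obtain ⟨Z, hZ, hE, hU, hV'⟩ := exists_of_finitely_satisfiable hW
    (E := fun i x y => (a x = a y ∧ b x ≤ b y) ∨ (0 ≤ a y ∧ a y < a x ∧ a x ≤ 1 ∧
      (b x = b y ∨ b x - b y < Y (a x) i - Y (a y) i - 2 * tw i)))
    (U := fun x => 0 ≤ a x ∧ a x ≤ 1 ∧ toQ c < b x)
    (V := fun x => 0 ≤ a x ∧ a x ≤ 1 ∧ b x < 0) inferInstance inferInstance inferInstance (by
      intro N
      have hN := toQ_pos.2 (fac_pos S N)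
      obtain ⟨l, hl, hlc⟩ := hbv (fac N) (fac_pos S N) N
      obtain ⟨F, hF⟩ : ∃ F : M → Q M, F = fun j => Y (toQ j / toQ (fac N)) l := ⟨_, rfl⟩
      have hFd : IsDefQ S (fun e => F (e 0)) := by
        rw [hF]
        infer_instance
      have hFd' := isDefQ_comp₁ hFd
      obtain ⟨g, hg⟩ : ∃ g : M → Q M, g = fun i => sumQ i (fun k => |F (k + 1) - F k|) := ⟨_, rfl⟩
      have hgd : IsDefQ S (fun e => g (e 0)) := by
        rw [hg]
        infer_instance
      have := isDefQ_comp₁ hgd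
      have hgF : ∀ {i j}, i ≤ j → |F j - F i| ≤ g j - g i := fun h => by
        rw [hg]
        exact abs_sub_le_sumQ hFd h
      have hg0 : g 0 = 0 := by
        rw [hg]
        exact sumQ_zero (S := S) inferInstance
      have hgc : g (fac N) ≤ toQ c := by
        rw [hg, hF]
        exact hlc
      have hgm : ∀ {i j}, i ≤ j → g i ≤ g j := fun h =>
        sub_nonneg.1 ((abs_nonneg _).trans (hgF h))
      have hx : ∀ x, x < N → 0 ≤ a x → ∃ i, a x = toQ i / toQ (fac N) ∧
          floorQ (a x * toQ (fac N)) = i := by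
        intro x hx h₀
        rw [ha] at h₀ ⊢
        obtain ⟨i, hi⟩ := exists_eq_div_fac S ((pfst_le S x).trans_lt hx) h₀
        refine ⟨i, hi, ?_⟩
        dsimp only
        rw [hi, div_mul_cancel₀ _ hN.ne']
        exact floorQ_eq S le_rfl (lt_add_one _)
      refine ⟨fun x => g (floorQ (a x * toQ (fac N))) < b x, inferInstance, ?_, ?_, ?_⟩
      · rintro i x y hi hxN hyN (⟨h₁, h₂⟩ | ⟨h₁, h₂, h₃, h₄⟩) h
        · rw [← h₁]
          exact h.trans_le h₂
        · obtain ⟨j, hj, hj'⟩ := hx x hxN (h₁.trans h₂.le)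
          obtain ⟨j₀, hj₀, hj₀'⟩ := hx y hyN h₁
          rw [hj'] at h
          rw [hj₀']
          have hjj : j₀ ≤ j := by
            rw [hj, hj₀, div_lt_div_iff_of_pos_right hN, toQ_lt] at h₂
            exact h₂.le
          rcases h₄ with h₄ | h₄
          · exact (hgm hjj).trans_lt (h.trans_le h₄.le)
          · have h₅ := hgF hjj
            have h₆ : F j = Y (a x) l := by rw [hF, hj]
            have h₇ : F j₀ = Y (a y) l := by rw [hF, hj₀]
            rw [h₆, h₇] at h₅
            obtain ⟨d, rfl⟩ := exists_add_of_le (hi.le.trans hl)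
            have h₈ := abs_le.1 (hY₁ (a x) i d (h₁.trans h₂.le) h₃)
            have h₉ := abs_le.1 (hY₁ (a y) i d h₁ (h₂.le.trans h₃))
            have h₁₀ := (abs_le.1 h₅).2
            linarith [h₈.2, h₉.1]
      · rintro x hxN ⟨h₀, h₁, h₂⟩
        obtain ⟨j, hj, hj'⟩ := hx x hxN h₀
        rw [hj']
        refine ((hgm ?_).trans hgc).trans_lt h₂
        rwa [hj, div_le_one hN, toQ_le] at h₁
      · rintro x hxN ⟨h₀, h₁, h₂⟩
        obtain ⟨j, hj, hj'⟩ := hx x hxN h₀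
        change ¬ g (floorQ (a x * toQ (fac N))) < b x
        rw [hj', not_lt]
        refine h₂.le.trans ?_
        rw [← hg0]
        exact hgm zero_le)
  have := Fact.mk hZ
  obtain ⟨R, hR⟩ : ∃ R : Q M → Q M → Prop, R = fun p q => pair (qcode p) (qcode q) ∈ Z := ⟨_, rfl⟩
  have haR : ∀ p q : Q M, a (pair (qcode p) (qcode q)) = p := fun p q => by
    rw [ha]
    simp only [pfst_pair S, qdec_qcode S]
  have hbR : ∀ p q : Q M, b (pair (qcode p) (qcode q)) = q := fun p q => by
    rw [hb]
    simp only [psnd_pair S, qdec_qcode S]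
  obtain ⟨G, hG⟩ : ∃ G : Set M, G = {z | R (qdec (pfst z)) (qdec (psnd z))} := ⟨_, rfl⟩
  have hGS : G ∈ S := by
    rw [hG, hR]
    exact comprehension S
  have hGR : ∀ p q : Frac M, PairMem G p q ↔ R (val p) (val q) := fun p q => by
    rw [PairMem, hG, Set.mem_ofPred_eq, pfst_pair S, psnd_pair S, qdec_code S, qdec_code S]
  have hQR : ∀ p q : Q M, QMem G p q ↔ R p q := fun p q => by
    rw [QMem, hGR, val_qrep S, val_qrep S]
  have hup : ∀ p q q' : Q M, q ≤ q' → R p q → R p q' := fun p q q' h hq => by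
    rw [hR] at hq ⊢
    exact hE 0 _ _ (Or.inl ⟨by rw [haR, haR], by rwa [hbR, hbR]⟩) hq
  have hpres : IsRatPres G := by
    refine ⟨fun p p' q q' _ h₁ h₂ h => ?_, fun p hp => ⟨⟨qrep (toQ c + 1), ?_⟩, qrep (-1), ?_⟩,
      fun p q q' _ h₁ h => ?_⟩
    · rw [hGR] at h ⊢
      rwa [← val_eq_val.2 h₁, ← val_eq_val.2 h₂]
    · rw [inUnit_iff] at hp
      rw [hGR, hR, val_qrep S]
      exact hU _ ⟨by rw [haR]; exact hp.1, by rw [haR]; exact hp.2, by rw [hbR]; linarith⟩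
    · rw [inUnit_iff] at hp
      rw [hGR, hR, val_qrep S]
      exact hV' _ ⟨by rw [haR]; exact hp.1, by rw [haR]; exact hp.2, by rw [hbR]; linarith⟩
    · rw [hGR] at h ⊢
      exact hup _ _ _ (val_lt_val.2 h₁).le h
  refine ⟨G, hGS, hpres, ?_, ?_⟩
  · intro x y hx hy hxy u v hu hv
    have hx' := inUnit_iff.1 hx
    have hy' := inUnit_iff.1 hy
    refine rLe_of_approx (C := 3) hu.2.1 hv.2.1 (by norm_num) fun k => ⟨k, le_rfl, ?_⟩
    have h₁ : QMem G (val y) (val (v k) + 2 * tw k) := by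
      by_contra h
      have := hv.le_of_not_qMem hpres h k
      linarith [tw_pos S k]
    have h₂ : QMem G (val x) (val (v k) + 2 * tw k) := by
      rw [hQR, hR] at h₁ ⊢
      refine hE 0 _ _ (Or.inr ?_) h₁
      simp only [haR, hbR]
      exact ⟨hx'.1, val_lt_val.2 hxy, hy'.2, Or.inl trivial⟩
    have := hu.le_of_qMem hpres h₂ k
    linarith
  · intro x y hx hy hxy u v w z hu hv hw hz
    have hx' := inUnit_iff.1 hx
    have hy' := inUnit_iff.1 hy
    obtain ⟨hu, hu'⟩ := hV _ _ hx hu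
    obtain ⟨hv, hv'⟩ := hV _ _ hy hv
    refine rLe_of_approx (C := 14) (isReal_rsub hv hu) (isReal_rsub hz.2.1 hw.2.1) (by norm_num)
      fun k => ⟨k, le_rfl, ?_⟩
    rw [val_rsub, val_rsub]
    have hk : tw (k + 1) = tw k / 2 := tw_succ S k
    generalize k + 1 = j at *
    have htw := tw_pos S k
    have h₁ : QMem G (val y) (val (z j) + 2 * tw j) := by
      by_contra h
      have := hz.le_of_not_qMem hpres h j
      linarith
    have h₂ : ¬ QMem G (val x) (val (w j) - 2 * tw j) := fun h => by
      have := hw.le_of_qMem hpres h j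
      linarith
    have h₃ : ¬ (val (z j) + 2 * tw j - (val (w j) - 2 * tw j) <
        Y (val y) j - Y (val x) j - 2 * tw j) := by
      intro hlt
      refine h₂ ?_
      rw [hQR, hR] at h₁ ⊢
      refine hE j _ _ (Or.inr ?_) h₁
      simp only [haR, hbR]
      exact ⟨hx'.1, val_lt_val.2 hxy, hy'.2, Or.inr hlt⟩
    have h₄ := abs_le.1 (hu' j)
    have h₅ := abs_le.1 (hv' j)
    linarith [h₄.1, h₅.2]

end Majorant

/-! ### Variation along partitions -/

section Variation

variable {M : Type u} [Numbers M] {S : Set (Set M)}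

theorem abs_sumQ_sub_sumQ_le [Model S] {F G : M → Q M} (hF : IsDefQ S (fun e => F (e 0)))
    (hG : IsDefQ S (fun e => G (e 0))) (n : M) {C : Q M} (h : ∀ i, i < n → |F i - G i| ≤ C) :
    |sumQ n F - sumQ n G| ≤ toQ n * C := by
  have := isDefQ_comp₁ hF
  have := isDefQ_comp₁ hG
  have key : ∀ m, m ≤ n → |sumQ m F - sumQ m G| ≤ toQ m * C := by
    refine delta_induction S (fun _ => by simp [sumQ_zero hF, sumQ_zero hG]) fun m ih hm => ?_
    rw [sumQ_succ hF, sumQ_succ hG, map_add, map_one]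
    have hm' := (lt_succ_self m).trans_le hm
    have h₁ := abs_le.1 (ih hm'.le)
    have h₂ := abs_le.1 (h m hm')
    exact abs_le.2 ⟨by linarith [h₁.1, h₂.1], by linarith [h₁.2, h₂.2]⟩
  exact key n le_rfl

theorem toQ_mul_tw_le (S : Set (Set M)) [Model S] (n : M) : toQ n * tw n ≤ 1 := by
  rw [tw, ← div_eq_mul_inv, div_le_one (toQ_pos.2 (pw_pos S n)), toQ_le]
  exact (lt_pw S n).le

/-- If the variation of a sequence of real numbers is bounded by `c`, then late approximations of
its members have a variation that is almost bounded by `c`. -/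
theorem VarSumLe.sumQ_le [Model S] {n c : M} {y : M → M → Frac M} (h : VarSumLe S n y c)
    (hy : IsRealSeq S y) (k : M) :
    sumQ n (fun j => |val (y (j + 1) (k + n + 1 + 1)) - val (y j (k + n + 1 + 1))|) ≤
      toQ c + tw k := by
  have hyd := isDefQ_of_isFun₂ hy.1
  have hyd' := isDefQ_comp₂ (F := fun i k => val (y i k)) hyd
  -- the partial sums, with a precision that compensates the number of summands
  obtain ⟨v, hv⟩ : ∃ v : M → M → Q M, v = fun i k =>
      sumQ i (fun j => |val (y (j + 1) (k + i + 1 + 1)) - val (y j (k + i + 1 + 1))|) := ⟨_, rfl⟩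
  have hvd : IsDefQ S (fun e => v (e 0) (e 1)) := by
    rw [hv]
    infer_instance
  have hvd' := isDefQ_comp₂ hvd
  have hreal : ∀ i, IsReal S (fun k => qrep (v i k)) := by
    intro i
    refine isReal_of_isDefQ inferInstance fun k l => ?_
    rw [hv]
    refine (abs_sumQ_sub_sumQ_le (S := S) inferInstance inferInstance i
      (C := tw (k + i + 1)) fun j _ => ?_).trans ?_
    · refine (abs_abs_sub_abs_le _ _).trans ?_
      have hle : k + i + 1 + 1 ≤ k + l + i + 1 + 1 := by
        gcongr
        exact le_self_add
      have h₁ := abs_le.1 ((hy.2 j).abs_sub_le hle)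
      have h₂ := abs_le.1 ((hy.2 (j + 1)).abs_sub_le hle)
      rw [tw_succ S] at h₁ h₂
      exact abs_le.2 ⟨by linarith [h₁.2, h₂.1], by linarith [h₁.1, h₂.2]⟩
    · rw [tw_succ S, tw_add S]
      have h₁ := mul_le_mul_of_nonneg_left (toQ_mul_tw_le S i) (tw_pos S k).le
      have h₂ := mul_nonneg (tw_pos S k).le (mul_nonneg (toQ_nonneg i) (tw_pos S i).le)
      calc toQ i * (tw k * tw i / 2) = tw k * (toQ i * tw i) / 2 := by ring
        _ ≤ tw k := by linarith
  have := h (fun i k => qrep (v i k)) ⟨isFun₂_qrep hvd, hreal⟩ ?_ ?_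
  · have := (rLe_rconst_iff (hreal n) _).1 this k
    rw [val_qrep S, val_ofNum, hv] at this
    exact this
  · have h0 : ∀ k, v 0 k = 0 := fun k => by
      rw [hv]
      exact sumQ_zero (S := S) inferInstance
    constructor <;> rw [rLe_iff] <;> intro k <;> rw [val_qrep S, h0, val_rconst, val_zero] <;>
      linarith [tw_pos S k]
  · intro i _
    have key : ∀ k, |v (i + 1) k - (v i (k + 1) +
        |val (y (i + 1) (k + 1 + 1)) - val (y i (k + 1 + 1))|)| ≤ 2 * tw k := by
      intro k
      have h₁ : v (i + 1) k = v i (k + 1) + |val (y (i + 1) (k + (i + 1) + 1 + 1)) -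
          val (y i (k + (i + 1) + 1 + 1))| := by
        rw [hv]
        dsimp only
        rw [sumQ_succ (S := S) inferInstance]
        have : k + (i + 1) = k + 1 + i := by ring
        rw [this]
      rw [h₁, add_sub_add_left_eq_sub]
      refine (abs_abs_sub_abs_le _ _).trans ?_
      have hle : k + 1 + 1 ≤ k + (i + 1) + 1 + 1 :=
        add_le_add_left (add_le_add_left (le_self_add : k ≤ k + (i + 1)) 1) 1
      have h₂ := abs_le.1 ((hy.2 i).abs_sub_le hle)
      have h₃ := abs_le.1 ((hy.2 (i + 1)).abs_sub_le hle)
      rw [tw_succ S, tw_succ S] at h₂ h₃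
      have := tw_pos S k
      exact abs_le.2 ⟨by linarith [h₂.1, h₃.2], by linarith [h₂.2, h₃.1]⟩
    constructor <;> rw [rLe_iff] <;> intro k <;>
      rw [val_radd, val_rabs, val_rsub, val_qrep S, val_qrep S] <;> have h₁ := abs_le.1 (key k)
    · linarith [h₁.2]
    · linarith [h₁.1]

theorem IsBV.isBVRat [Model S] {V : (M → Frac M) → (M → Frac M) → Prop} (h : IsBV S V) :
    IsBVRat S (restrictRat V) := by
  obtain ⟨c, h⟩ := h
  refine ⟨c, fun n t y ht hy h₀ h₁ hlt hV => ?_⟩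
  have ht' := isFun_iff.1 ht
  have htd := isDefQ_of_isFun ht
  refine h n (fun i => rconst (t i)) y ⟨isFun₂_iff.2 ?_, fun i => isReal_rconst _⟩ hy ?_ ?_
    (fun i hi => ?_) hV
  · exact ht'
  · have := val_eq_val.2 h₀
    constructor <;> rw [rLe_iff] <;> intro k <;> rw [val_rconst, val_rconst, this] <;>
      linarith [tw_pos S k]
  · have := val_eq_val.2 h₁
    constructor <;> rw [rLe_iff] <;> intro k <;> rw [val_rconst, val_rconst, this] <;>
      linarith [tw_pos S k]
  · have h₂ := val_lt_val.2 (hlt i hi)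
    obtain ⟨k, hk⟩ := exists_tw_lt S (half_pos (sub_pos.2 h₂))
    rw [rLt_iff]
    refine ⟨k, ?_⟩
    rw [val_rconst, val_rconst]
    linarith

/-- Weak König's lemma gives the decomposition of a function of bounded variation whose values at
rational points are uniformly computed by `Y`. -/
theorem hasJordan_of_isBVRat (hW : WKL0 S) [Model S] {V : Frac M → (M → Frac M) → Prop}
    {Y : Q M → M → Q M} (hY : IsDefQ S (fun e => Y (qdec (e 0)) (e 1)))
    (hY₁ : ∀ p k i, 0 ≤ p → p ≤ 1 → |Y p k - Y p (k + i)| ≤ tw k) (hbv : IsBVRat S V)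
    (hVY : ∀ p : Frac M, p.InUnit → V p (fun k => qrep (Y (val p) k)))
    (hV : ∀ p y, p.InUnit → V p y → IsReal S y ∧ ∀ k, |val (y k) - Y (val p) k| ≤ 4 * tw k) :
    HasJordan S V := by
  have hY' := isDefQ_compQ hY
  obtain ⟨c, hc⟩ := hbv
  refine hasJordan_of_approx hW hY hY₁ (c + 1) (fun n hn K => ?_) hV
  have hn' := toQ_pos.2 hn
  have hunit : ∀ i, 0 ≤ min 1 (toQ i / toQ n) ∧ min 1 (toQ i / toQ n) ≤ 1 := fun i =>
    ⟨le_min zero_le_one (div_nonneg (toQ_nonneg i) hn'.le), min_le_left _ _⟩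
  have hmin : ∀ i, i ≤ n → min 1 (toQ i / toQ n) = toQ i / toQ n := fun i hi =>
    min_eq_right ((div_le_one hn').2 (toQ_le.2 hi))
  have hreal : IsRealSeq S (fun i k => qrep (Y (min 1 (toQ i / toQ n)) k)) :=
    ⟨isFun₂_qrep inferInstance, fun i => isReal_of_isDefQ inferInstance
      fun k l => hY₁ _ k l (hunit i).1 (hunit i).2⟩
  have h := hc n (fun i => qrep (toQ i / toQ n)) _ (isFun_qrep inferInstance) hreal ?_ ?_ ?_ ?_
  · refine ⟨K + n + 1 + 1, le_self_add.trans (le_self_add.trans le_self_add), ?_⟩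
    have h₁ := h.sumQ_le hreal K
    have h₂ : sumQ n (fun j => |Y (toQ (j + 1) / toQ n) (K + n + 1 + 1) -
        Y (toQ j / toQ n) (K + n + 1 + 1)|) = sumQ n (fun j =>
        |val (qrep (Y (min 1 (toQ (j + 1) / toQ n)) (K + n + 1 + 1))) -
        val (qrep (Y (min 1 (toQ j / toQ n)) (K + n + 1 + 1)))|) := by
      simp only [val_qrep S]
      refine sumQ_congr (S := S) inferInstance inferInstance n fun j hj => ?_
      rw [hmin _ hj.le, hmin _ (succ_le_of_lt hj)]
    rw [h₂, map_add, map_one]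
    linarith [tw_le_one S K]
  · rw [← val_eq_val, val_qrep S, val_zero, map_zero, zero_div]
  · rw [← val_eq_val, val_qrep S, val_one, div_self hn'.ne']
  · intro i _
    rw [← val_lt_val, val_qrep S, val_qrep S, div_lt_div_iff_of_pos_right hn', toQ_lt]
    exact lt_succ_self i
  · intro i hi
    have hi : i ≤ n := hi.elim le_of_lt le_of_eq
    have := hVY (qrep (toQ i / toQ n)) (by
      rw [← hmin i hi]
      exact inUnit_qrep (S := S) (hunit i).1 (hunit i).2)
    simp only [val_qrep S] at this
    simp only [hmin i hi]
    exact this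

/-! ### Rationally presented functions -/

/-- The values of a rationally presented function have uniformly computable approximations. -/
theorem IsRatPres.exists_approx [Model S] {Z : Set M} (hpres : IsRatPres Z) (hZ : Z ∈ S) :
    ∃ Y : Q M → M → Q M, IsDefQ S (fun e => Y (qdec (e 0)) (e 1)) ∧
      (∀ p k, 0 ≤ p → p ≤ 1 → ¬ QMem Z p (Y p k) ∧ QMem Z p (Y p k + tw k)) ∧
      (∀ p k i, 0 ≤ p → p ≤ 1 → |Y p k - Y p (k + i)| ≤ tw k) ∧
      ∀ p : Frac M, p.InUnit → RatVal S Z p (fun k => qrep (Y (val p) k)) := by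
  have := Fact.mk hZ
  obtain ⟨f, hf, hf'⟩ := exists_isDef₂ S (P := fun a c k => 0 ≤ qdec c ∧ qdec c ≤ 1 →
      ¬ QMem Z (qdec c) (qdec a) ∧ QMem Z (qdec c) (qdec a + tw k)) (by
    intro c k
    by_cases h : 0 ≤ qdec c ∧ qdec c ≤ 1
    · obtain ⟨⟨q, hq⟩, ⟨q', hq'⟩⟩ := hpres.exists_qMem (S := S) h.1 h.2
      obtain ⟨n, hn⟩ := exists_lt_toQ ((q - q') / tw k)
      rw [div_lt_iff₀ (tw_pos S k)] at hn
      have hex : QMem Z (qdec c) (q' + toQ n * tw k) :=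
        hpres.qMem_of_le (S := S) h.1 h.2 (by linarith) hq
      obtain ⟨i, hi, hi'⟩ := exists_least S (P := fun i => QMem Z (qdec c) (q' + toQ i * tw k))
        ⟨n, hex⟩
      rcases eq_zero_or_succ S i with rfl | ⟨i, rfl⟩
      · rw [map_zero, zero_mul, add_zero] at hi
        exact absurd hi hq'
      · refine ⟨qcode (q' + toQ i * tw k), fun _ => ?_⟩
        rw [qdec_qcode S]
        refine ⟨hi' i (lt_succ_self i), ?_⟩
        rw [map_add, map_one] at hi
        have : q' + toQ i * tw k + tw k = q' + (toQ i + 1) * tw k := by ring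
        rwa [this]
    · exact ⟨0, fun h' => absurd h' h⟩)
  have := isDef_comp₂ hf
  obtain ⟨Y, hY⟩ : ∃ Y : Q M → M → Q M, Y = fun p k => qdec (f (qcode p) k) := ⟨_, rfl⟩
  have hYs : ∀ p k, 0 ≤ p → p ≤ 1 → ¬ QMem Z p (Y p k) ∧ QMem Z p (Y p k + tw k) := by
    intro p k h₀ h₁
    have := hf' (qcode p) k
    rw [qdec_qcode S] at this
    rw [hY]
    exact this ⟨h₀, h₁⟩
  have hYd : IsDefQ S (fun e => Y (qdec (e 0)) (e 1)) := by
    rw [hY]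
    infer_instance
  have hYd' := isDefQ_compQ hYd
  have hY₁ : ∀ p k i, 0 ≤ p → p ≤ 1 → |Y p k - Y p (k + i)| ≤ tw k := by
    intro p k i h₀ h₁
    have h₂ := hYs p k h₀ h₁
    have h₃ := hYs p (k + i) h₀ h₁
    have h₄ := not_le.1 fun h => h₃.1 (hpres.qMem_of_le (S := S) h₀ h₁ h h₂.2)
    have h₅ := not_le.1 fun h => h₂.1 (hpres.qMem_of_le (S := S) h₀ h₁ h h₃.2)
    have h₆ := tw_le_tw S (le_self_add : k ≤ k + i)
    exact abs_le.2 ⟨by linarith, by linarith⟩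
  refine ⟨Y, hYd, hYs, hY₁, fun p hp => ?_⟩
  have hp' := inUnit_iff.1 hp
  refine ratVal_of_approx hpres hp (isReal_of_isDefQ inferInstance
    fun k l => hY₁ _ k l hp'.1 hp'.2) (fun q k hq => ?_) fun k => ?_
  · rw [val_qrep S]
    have h₁ := not_le.1 fun h => (hYs _ k hp'.1 hp'.2).1 (hpres.qMem_of_le (S := S) hp'.1 hp'.2 h hq)
    linarith [tw_pos S k]
  · refine ⟨_, (hYs _ k hp'.1 hp'.2).2, ?_⟩
    rw [val_qrep S]
    linarith [tw_pos S k]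

theorem jordanQ_of_wkl (hW : WKL0 S) [Model S] : JordanQ S := by
  intro Z hZ hpres hbv
  obtain ⟨Y, hYd, hYs, hY₁, hY₂⟩ := hpres.exists_approx hZ
  refine hasJordan_of_isBVRat hW hYd hY₁ hbv hY₂ fun p y hp hy => ⟨hy.2.1, fun k => ?_⟩
  have hp' := inUnit_iff.1 hp
  obtain ⟨h₁, h₂⟩ := hYs _ k hp'.1 hp'.2
  have h₃ := hy.le_of_qMem hpres h₂ k
  have h₄ := hy.le_of_not_qMem hpres h₁ k
  have := tw_pos S k
  exact abs_le.2 ⟨by linarith, by linarith⟩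

/-! ### Continuous functions -/

/-- The relation `(a, r) Φ (b, s)` for rational numbers. -/
def CodeRelQ (Φ : Set M) (a r b s : Q M) : Prop := CodeRel Φ (qrep a) (qrep r) (qrep b) (qrep s)

theorem codeRelQ_iff [Model S] {Φ : Set M} (hΦ : IsContCode S Φ) {a r b s : Frac M} :
    CodeRelQ Φ (val a) (val r) (val b) (val s) ↔ CodeRel Φ a r b s := by
  have e : ∀ x : Frac M, (qrep (val x)).Eqv x := fun x => val_eq_val.1 (val_qrep S _)
  unfold CodeRelQ CodeRel
  rw [inUnit_iff, inUnit_iff, ← val_lt_val, ← val_lt_val, ← val_lt_val, ← val_lt_val, val_qrep S,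
    val_qrep S, val_qrep S]
  have : (∃ n, QuintMem Φ n (qrep (val a)) (qrep (val r)) (qrep (val b)) (qrep (val s))) ↔
      ∃ n, QuintMem Φ n a r b s := exists_congr fun n =>
    ⟨hΦ.congr _ _ _ _ _ _ _ _ _ (e a) (e r) (e b) (e s),
      hΦ.congr _ _ _ _ _ _ _ _ _ (e a).symm (e r).symm (e b).symm (e s).symm⟩
  rw [this]

theorem rLt_rconst_iff [Model S] {x : M → Frac M} {q : Q M} (hx : ∀ k, val (x k) = q)
    {r : Frac M} : RLt S x (rconst r) ↔ q < val r := by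
  rw [rLt_iff]
  constructor
  · rintro ⟨k, hk⟩
    rw [hx, val_rconst] at hk
    linarith [tw_pos S k]
  · intro h
    obtain ⟨k, hk⟩ := exists_tw_lt S (half_pos (sub_pos.2 h))
    refine ⟨k, ?_⟩
    rw [hx, val_rconst]
    linarith

/-- The approximations required by `hasJordan_of_approx` are found by a search in the code of the
continuous function for balls around `p` whose values are sufficiently precise. -/
theorem jordanQCont_of_wkl (hW : WKL0 S) [Model S] : JordanQCont S := by
  intro Φ hΦS hΦ hbv
  have := Fact.mk hΦS
  -- shrinking a ball to a ball around one of its points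
  have hshrink : ∀ {a r b s p : Frac M}, CodeRel Φ a r b s → p.InUnit → |val p - val a| < val r →
      ∃ δ : Q M, 0 < δ ∧ ∀ r' : Frac M, 0 < val r' → val r' < δ → CodeRel Φ p r' b s := by
    intro a r b s p h hp hpa
    refine ⟨val r - |val p - val a|, sub_pos.2 hpa, fun r' h₀ h₁ => ?_⟩
    refine hΦ.shrink _ _ _ _ _ _ h hp (val_lt_val.1 (by rwa [val_zero])) ?_
    rw [← val_lt_val, val_add, val_abs, val_sub, abs_sub_comm]
    linarith
  have hcompat : ∀ {a r b s a' r' b' s' p : Frac M}, CodeRel Φ a r b s → CodeRel Φ a' r' b' s' →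
      p.InUnit → |val p - val a| < val r → |val p - val a'| < val r' →
      |val b - val b'| ≤ val s + val s' := by
    intro a r b s a' r' b' s' p h h' hp hpa hpa'
    obtain ⟨δ, hδ, h₁⟩ := hshrink h hp hpa
    obtain ⟨δ', hδ', h₂⟩ := hshrink h' hp hpa'
    have h₃ : 0 < min δ δ' / 2 := half_pos (lt_min hδ hδ')
    have h₄ : min δ δ' / 2 < min δ δ' := half_lt_self (lt_min hδ hδ')
    obtain ⟨r₀, hr₀⟩ := val_surjective (min δ δ' / 2)
    rw [← hr₀] at h₃ h₄
    have := hΦ.compatible _ _ _ _ _ _ (h₁ r₀ h₃ (h₄.trans_le (min_le_left _ _)))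
      (h₂ r₀ h₃ (h₄.trans_le (min_le_right _ _)))
    rwa [← val_le_val, val_add, val_abs, val_sub] at this
  have hex : ∀ (p : Q M) (k : M), 0 ≤ p → p ≤ 1 →
      ∃ b r s : Q M, CodeRelQ Φ p r b s ∧ s ≤ tw (k + 1) := by
    intro p k h₀ h₁
    have hp := inUnit_qrep (S := S) h₀ h₁
    obtain ⟨ε, hε⟩ := val_surjective (tw (k + 1) : Q M)
    obtain ⟨a, r, b, s, h, hlt, hs⟩ := hΦ.total _ (rInUnit_rconst (S := S) hp) ε
      (val_lt_val.1 (by rw [hε, val_zero]; exact tw_pos S _))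
    rw [rLt_rconst_iff (q := |val (qrep p) - val a|)
      (fun k => by rw [val_rabs, val_rsub]; rfl)] at hlt
    obtain ⟨δ, hδ, h'⟩ := hshrink h hp hlt
    obtain ⟨r', hr'⟩ := val_surjective (δ / 2)
    have := h' r' (by rw [hr']; exact half_pos hδ) (by rw [hr']; exact half_lt_self hδ)
    rw [← codeRelQ_iff (S := S) hΦ, val_qrep S] at this
    refine ⟨_, _, _, this, ?_⟩
    rw [← val_lt_val, hε] at hs
    exact hs.le
  have hsigma : IsSigma S (fun e => 0 ≤ qdec (e 1) ∧ qdec (e 1) ≤ 1 → ∃ c d,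
      CodeRelQ Φ (qdec (e 1)) (qdec c) (qdec (e 0)) (qdec d) ∧ qdec d ≤ tw (e 2 + 1)) := by
    have h₁ : IsSigma S (fun e => ∃ c d, ((0 ≤ qdec (e 1) ∧ qdec (e 1) ≤ 1) ∧ 0 < qdec c ∧
        0 < qdec d ∧ ∃ n, pair n (pair (qrep (qdec (e 1))).code (pair (qrep (qdec c)).code
        (pair (qrep (qdec (e 0))).code (qrep (qdec d)).code))) ∈ Φ) ∧
          qdec d ≤ tw (e 2 + 1)) := inferInstance
    have h₂ : IsSigma S (fun e => ∃ c d, CodeRelQ Φ (qdec (e 1)) (qdec c) (qdec (e 0)) (qdec d) ∧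
        qdec d ≤ tw (e 2 + 1)) := by
      refine h₁.congr fun e => exists_congr fun c => exists_congr fun d => and_congr ?_ Iff.rfl
      unfold CodeRelQ CodeRel
      rw [inUnit_iff, ← val_lt_val, ← val_lt_val, val_qrep S, val_qrep S, val_qrep S, val_zero]
      rfl
    exact inferInstance
  obtain ⟨f, hf, hf'⟩ := exists_isDef₂ S (P := fun a c k => 0 ≤ qdec c ∧ qdec c ≤ 1 → ∃ r s,
      CodeRelQ Φ (qdec c) (qdec r) (qdec a) (qdec s) ∧ qdec s ≤ tw (k + 1)) (by
    intro c k
    by_cases h : 0 ≤ qdec c ∧ qdec c ≤ 1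
    · obtain ⟨b, r, s, h₁, h₂⟩ := hex _ k h.1 h.2
      refine ⟨qcode b, fun _ => ⟨qcode r, qcode s, ?_⟩⟩
      rw [qdec_qcode S, qdec_qcode S, qdec_qcode S]
      exact ⟨h₁, h₂⟩
    · exact ⟨0, fun h' => absurd h' h⟩)
  have := isDef_comp₂ hf
  obtain ⟨Y, hY⟩ : ∃ Y : Q M → M → Q M, Y = fun p k => qdec (f (qcode p) k) := ⟨_, rfl⟩
  have hYs : ∀ (p : Frac M) (k), p.InUnit →
      ∃ r b s, val b = Y (val p) k ∧ 0 < val r ∧ CodeRel Φ p r b s ∧ val s ≤ tw (k + 1) := by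
    intro p k hp
    have hp' := inUnit_iff.1 hp
    have := hf' (qcode (val p)) k
    rw [qdec_qcode S] at this
    obtain ⟨r, s, h₁, h₂⟩ := this hp'
    obtain ⟨r', hr'⟩ := val_surjective (qdec r)
    obtain ⟨s', hs'⟩ := val_surjective (qdec s)
    obtain ⟨b', hb'⟩ := val_surjective (qdec (f (qcode (val p)) k))
    rw [← hr', ← hs', ← hb', codeRelQ_iff (S := S) hΦ] at h₁
    refine ⟨r', b', s', ?_, val_lt_val.2 h₁.2.1, h₁, by rwa [hs']⟩
    rw [hb', hY]
  have hYd : IsDefQ S (fun e => Y (qdec (e 0)) (e 1)) := by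
    rw [hY]
    infer_instance
  have hYd' := isDefQ_compQ hYd
  have hself : ∀ {p r : Frac M}, 0 < val r → |val p - val p| < val r := fun h => by
    rwa [sub_self, abs_zero]
  have hY₁ : ∀ p k i, 0 ≤ p → p ≤ 1 → |Y p k - Y p (k + i)| ≤ tw k := by
    intro p k i h₀ h₁
    have hp := inUnit_qrep (S := S) h₀ h₁
    obtain ⟨r, b, s, h₂, h₃, h₄, h₅⟩ := hYs _ k hp
    obtain ⟨r', b', s', h₂', h₃', h₄', h₅'⟩ := hYs _ (k + i) hp
    rw [val_qrep S] at h₂ h₂'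
    rw [← h₂, ← h₂']
    refine (hcompat h₄ h₄' hp (hself h₃) (hself h₃')).trans ?_
    have h₆ := tw_le_tw S (add_le_add_left (le_self_add : k ≤ k + i) 1)
    have h₇ : tw (k + 1) = tw k / 2 := tw_succ S k
    linarith
  refine hasJordan_of_isBVRat hW hYd hY₁ hbv.isBVRat (fun p hp => ?_)
    fun p y hp hy => ⟨hy.2.1, fun k => ?_⟩
  · have hp' := inUnit_iff.1 hp
    have hreal : IsReal S (fun k => qrep (Y (val p) k)) := isReal_of_isDefQ inferInstance
      fun k l => hY₁ _ k l hp'.1 hp'.2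
    refine ⟨rInUnit_rconst hp, hreal, fun a r b s h hlt => ?_⟩
    rw [rLt_rconst_iff (q := |val p - val a|) (fun k => by rw [val_rabs, val_rsub]; rfl)] at hlt
    rw [rLe_iff]
    intro k
    rw [val_rabs, val_rsub, val_rconst, val_rconst, val_qrep S]
    obtain ⟨r', b', s', h₂', h₃', h₄', h₅'⟩ := hYs p (k + 1) hp
    have h₁ := hcompat h₄' h hp (hself h₃') hlt
    rw [h₂'] at h₁
    have h₇ : tw (k + 1 + 1) ≤ tw k := tw_le_tw S (le_self_add.trans le_self_add)
    linarith [tw_pos S k]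
  · obtain ⟨r, b, s, h₂, h₃, h₄, h₅⟩ := hYs p k hp
    have := hy.2.2 _ _ _ _ h₄ (by
      rw [rLt_rconst_iff (q := 0) (fun k => by
        rw [val_rabs, val_rsub, val_rconst, sub_self, abs_zero])]
      exact h₃)
    have h₆ := rLe_iff.1 this k
    rw [val_rabs, val_rsub, val_rconst, val_rconst, h₂] at h₆
    have h₇ := abs_le.1 (hy.2.1.abs_sub_le (le_self_add : k ≤ k + 1))
    have h₈ := abs_le.1 h₆
    have h₉ : tw (k + 1) = tw k / 2 := tw_succ S k
    have := tw_pos S k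
    exact abs_le.2 ⟨by linarith [h₇.1, h₈.1], by linarith [h₇.2, h₈.2]⟩

end Variation

/-! ### Polygonal functions at rational points -/

section Polygon

open Filter

variable {M : Type u} [Numbers M] {S : Set (Set M)}

theorem eventually_tw_lt (S : Set (Set M)) [Model S] {ε : Q M} (hε : 0 < ε) :
    ∀ᶠ k in atTop, tw k < ε := by
  obtain ⟨n, hn⟩ := exists_tw_lt S hε
  filter_upwards [eventually_ge_atTop n] with k hk
  exact (tw_le_tw S hk).trans_lt hn

/-- Two real numbers are compared through their late approximations. -/
theorem rLe_of_eventually [Model S] {x y : M → Frac M} (hx : IsReal S x) (hy : IsReal S y)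
    (h : ∀ ε : Q M, 0 < ε → ∀ᶠ k in atTop, val (x k) ≤ val (y k) + ε) : RLe S x y := by
  refine rLe_of_approx (C := 1) hx hy zero_le_one fun k => ?_
  obtain ⟨l, hl, hl'⟩ := ((h (tw k) (tw_pos S k)).and (eventually_ge_atTop k)).exists
  exact ⟨l, hl', by rwa [one_mul]⟩

theorem IsReal.eventually_abs_sub [Model S] {x : M → Frac M} (hx : IsReal S x) {ε : Q M}
    (hε : 0 < ε) : ∀ᶠ k in atTop, |val (x k) - val (x (k + 1))| ≤ ε := by
  filter_upwards [eventually_tw_lt S hε] with k hk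
  exact (hx.abs_sub_le le_self_add).trans hk.le

/-- The truncation of `a` to the unit interval. -/
noncomputable def clamp (a : Q M) : Q M := max 0 (min 1 a)

instance IsDefQ.clamp [Model S] {F : (ℕ → M) → Q M} [hF : IsDefQ S F] :
    IsDefQ S (fun e => clamp (F e)) := by
  unfold SOA.clamp
  infer_instance

theorem clamp_nonneg (a : Q M) : 0 ≤ clamp a := le_max_left _ _

theorem clamp_le_one (a : Q M) : clamp a ≤ 1 := max_le zero_le_one (min_le_left _ _)

theorem clamp_eq {a : Q M} (h₀ : 0 ≤ a) (h₁ : a ≤ 1) : clamp a = a := by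
  rw [clamp, min_eq_right h₁, max_eq_right h₀]

theorem clamp_of_nonpos {a : Q M} (h : a ≤ 0) : clamp a = 0 :=
  max_eq_left ((min_le_right _ _).trans h)

theorem clamp_of_one_le {a : Q M} (h : 1 ≤ a) : clamp a = 1 := by
  rw [clamp, min_eq_left h, max_eq_right zero_le_one]

theorem clamp_mono {a b : Q M} (h : a ≤ b) : clamp a ≤ clamp b :=
  max_le_max le_rfl (min_le_min le_rfl h)

theorem clamp_sub_le {a b : Q M} (h : a ≤ b) : clamp b - clamp a ≤ b - a := by
  rcases le_total a 0 with ha | ha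
  · rw [clamp_of_nonpos ha]
    rcases le_total b 0 with hb | hb
    · rw [clamp_of_nonpos hb]
      linarith
    · have : clamp b ≤ b := max_le hb (min_le_right _ _)
      linarith
  · rcases le_total a 1 with ha' | ha'
    · rw [clamp_eq ha ha']
      have : clamp b ≤ b := max_le (ha.trans h) (min_le_right _ _)
      linarith
    · rw [clamp_of_one_le ha', clamp_of_one_le (ha'.trans h)]
      linarith

theorem RInUnit.abs_sub_clamp_le [Model S] {x : M → Frac M} (hx : RInUnit S x) (k : M) :
    |val (x k) - clamp (val (x k))| ≤ tw k := by
  have h₀ := (rconst_rLe_iff hx.1 _).1 hx.2.1 k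
  have h₁ := (rLe_rconst_iff hx.1 _).1 hx.2.2 k
  rw [val_zero] at h₀
  rw [val_one] at h₁
  have := tw_pos S k
  rcases le_total (val (x k)) 0 with h | h
  · rw [clamp_of_nonpos h, abs_le]
    constructor <;> linarith
  · rcases le_total (val (x k)) 1 with h' | h'
    · rw [clamp_eq h h', sub_self, abs_zero]
      exact this.le
    · rw [clamp_of_one_le h', abs_le]
      constructor <;> linarith

namespace PolygonSeq

/-- The breakpoint number `i` of the polygonal function number `s`. -/
def X (P : PolygonSeq M) (s i : M) : Q M := val (P.node s i)

/-- The value at the breakpoint number `i` of the polygonal function number `s`. -/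
def H (P : PolygonSeq M) (s i : M) : Q M := val (P.height s i)

/-- The position of `a` relative to the interval number `i` of the polygonal function number `s`:
it is `0` to the left of the interval, `1` to the right of it, and affine on it. -/
noncomputable def pos (P : PolygonSeq M) (s i : M) (a : Q M) : Q M :=
  clamp ((a - P.X s i) / (P.X s (i + 1) - P.X s i))

/-- The value at the rational number `a` of the polygonal function number `s`. -/
noncomputable def eval (P : PolygonSeq M) (s : M) (a : Q M) : Q M :=
  P.H s 0 + sumQ (P.len s) (fun i => (P.H s (i + 1) - P.H s i) * P.pos s i a)

/-- The variation on `[0, a]` of the polygonal function number `s`. -/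
noncomputable def variation (P : PolygonSeq M) (s : M) (a : Q M) : Q M :=
  sumQ (P.len s) (fun i => |P.H s (i + 1) - P.H s i| * P.pos s i a)

/-- A Lipschitz constant of the polygonal function number `s`. -/
noncomputable def lip (P : PolygonSeq M) (s : M) : Q M :=
  sumQ (P.len s) (fun i => |P.H s (i + 1) - P.H s i| * (P.X s (i + 1) - P.X s i)⁻¹)

end PolygonSeq

variable {P : PolygonSeq M}

theorem isDefQ_X [Model S] (hP : IsPolygonSeq S P) (f g : (ℕ → M) → M) [IsDef S f] [IsDef S g] :
    IsDefQ S (fun e => P.X (f e) (g e)) :=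
  isDefQ_comp₂ (F := P.X) (isDefQ_of_isFun₂ hP.node_mem) f g

theorem isDefQ_H [Model S] (hP : IsPolygonSeq S P) (f g : (ℕ → M) → M) [IsDef S f] [IsDef S g] :
    IsDefQ S (fun e => P.H (f e) (g e)) :=
  isDefQ_comp₂ (F := P.H) (isDefQ_of_isFun₂ hP.height_mem) f g

theorem isDef_len [Model S] (hP : IsPolygonSeq S P) (f : (ℕ → M) → M) [IsDef S f] :
    IsDef S (fun e => P.len (f e)) := isDef_comp₁ (F := P.len) (isFun_iff.1 hP.len_mem) f

theorem isDefQ_pos [Model S] (hP : IsPolygonSeq S P) (f g : (ℕ → M) → M) (F : (ℕ → M) → Q M)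
    [IsDef S f] [IsDef S g] [IsDefQ S F] : IsDefQ S (fun e => P.pos (f e) (g e) (F e)) := by
  have := isDefQ_X hP
  unfold PolygonSeq.pos
  infer_instance

theorem isDefQ_eval [Model S] (hP : IsPolygonSeq S P) (f : (ℕ → M) → M) (F : (ℕ → M) → Q M)
    [hf : IsDef S f] [hF : IsDefQ S F] : IsDefQ S (fun e => P.eval (f e) (F e)) := by
  have := isDefQ_H hP
  have := isDefQ_pos hP
  have := isDef_len hP
  have := hf.comp (σ := fun e n => e (n + 1)) (fun i => .var (i + 1))
  have := hF.comp (σ := fun e n => e (n + 1)) (fun i => .var (i + 1))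
  unfold PolygonSeq.eval
  infer_instance

theorem isDefQ_variation [Model S] (hP : IsPolygonSeq S P) (f : (ℕ → M) → M) (F : (ℕ → M) → Q M)
    [hf : IsDef S f] [hF : IsDefQ S F] : IsDefQ S (fun e => P.variation (f e) (F e)) := by
  have := isDefQ_H hP
  have := isDefQ_pos hP
  have := isDef_len hP
  have := hf.comp (σ := fun e n => e (n + 1)) (fun i => .var (i + 1))
  have := hF.comp (σ := fun e n => e (n + 1)) (fun i => .var (i + 1))
  unfold PolygonSeq.variation
  infer_instance

theorem isDefQ_lip [Model S] (hP : IsPolygonSeq S P) (f : (ℕ → M) → M) [hf : IsDef S f] :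
    IsDefQ S (fun e => P.lip (f e)) := by
  have := isDefQ_H hP
  have := isDefQ_X hP
  have := isDef_len hP
  have := hf.comp (σ := fun e n => e (n + 1)) (fun i => .var (i + 1))
  unfold PolygonSeq.lip
  infer_instance

theorem IsPolygonSeq.X_lt (hP : IsPolygonSeq S P) {s i : M} (hi : i < P.len s) :
    P.X s i < P.X s (i + 1) := val_lt_val.2 (hP.node_lt s i hi)

theorem IsPolygonSeq.X_zero (hP : IsPolygonSeq S P) (s : M) : P.X s 0 = 0 :=
  val_eq_val.2 (hP.node_zero s)

theorem IsPolygonSeq.X_len (hP : IsPolygonSeq S P) (s : M) : P.X s (P.len s) = 1 :=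
  val_eq_val.2 (hP.node_len s)

theorem IsPolygonSeq.len_pos (hP : IsPolygonSeq S P) (s : M) : 0 < P.len s := by
  rw [pos_iff_ne_zero]
  intro h
  have := hP.X_len s
  rw [h, hP.X_zero s] at this
  exact zero_ne_one this

theorem IsPolygonSeq.X_le [Model S] (hP : IsPolygonSeq S P) {s i j : M} (hij : i ≤ j)
    (hj : j ≤ P.len s) : P.X s i ≤ P.X s j := by
  have := isDefQ_X hP
  obtain ⟨d, rfl⟩ := exists_add_of_le hij
  revert hj
  refine delta_induction S (P := fun d => i + d ≤ P.len s → P.X s i ≤ P.X s (i + d))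
    (fun _ => by rw [add_zero]) (fun d ih hd => ?_) d
  rw [← add_assoc] at hd ⊢
  have h := (lt_succ_self _).trans_le hd
  exact (ih h.le).trans (hP.X_lt h).le

theorem IsPolygonSeq.abs_pos_sub_le (hP : IsPolygonSeq S P) {s i : M} (hi : i < P.len s)
    {a b : Q M} (hab : a ≤ b) : 0 ≤ P.pos s i b - P.pos s i a ∧
      P.pos s i b - P.pos s i a ≤ (P.X s (i + 1) - P.X s i)⁻¹ * (b - a) := by
  have h := sub_pos.2 (hP.X_lt hi)
  have h₁ : (a - P.X s i) / (P.X s (i + 1) - P.X s i) ≤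
      (b - P.X s i) / (P.X s (i + 1) - P.X s i) := by gcongr
  refine ⟨sub_nonneg.2 (clamp_mono h₁), (clamp_sub_le h₁).trans (le_of_eq ?_)⟩
  field_simp
  ring

/-- The variation of a polygonal function on an interval lies between the increment of the function
and the increment allowed by the Lipschitz constant. -/
theorem IsPolygonSeq.variation_sub [Model S] (hP : IsPolygonSeq S P) (s : M) {a b : Q M}
    (hab : a ≤ b) : |P.eval s b - P.eval s a| ≤ P.variation s b - P.variation s a ∧
      P.variation s b - P.variation s a ≤ P.lip s * (b - a) := by
  have := isDefQ_H hP
  have := isDefQ_pos hP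
  have := isDefQ_X hP
  have h₁ : P.eval s b - P.eval s a = sumQ (P.len s)
      (fun i => (P.H s (i + 1) - P.H s i) * (P.pos s i b - P.pos s i a)) := by
    have := sumQ_add (S := S)
      (F := fun i => (P.H s (i + 1) - P.H s i) * (P.pos s i b - P.pos s i a))
      (G := fun i => (P.H s (i + 1) - P.H s i) * P.pos s i a) inferInstance inferInstance (P.len s)
    simp only [← mul_add, sub_add_cancel] at this
    rw [PolygonSeq.eval, PolygonSeq.eval, this]
    ring
  have h₂ : P.variation s b - P.variation s a = sumQ (P.len s)
      (fun i => |P.H s (i + 1) - P.H s i| * (P.pos s i b - P.pos s i a)) := by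
    have := sumQ_add (S := S)
      (F := fun i => |P.H s (i + 1) - P.H s i| * (P.pos s i b - P.pos s i a))
      (G := fun i => |P.H s (i + 1) - P.H s i| * P.pos s i a) inferInstance inferInstance (P.len s)
    simp only [← mul_add, sub_add_cancel] at this
    rw [PolygonSeq.variation, PolygonSeq.variation, this]
    ring
  rw [h₁, h₂]
  constructor
  · refine (abs_sumQ_le (S := S) inferInstance _).trans
      (sumQ_le_sumQ (S := S) inferInstance inferInstance _ fun i hi => ?_)
    rw [abs_mul, abs_of_nonneg (hP.abs_pos_sub_le hi hab).1]
  · rw [PolygonSeq.lip, ← sumQ_mul (S := S) inferInstance]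
    refine sumQ_le_sumQ (S := S) inferInstance inferInstance _ fun i hi => ?_
    rw [mul_assoc]
    exact mul_le_mul_of_nonneg_left (hP.abs_pos_sub_le hi hab).2 (abs_nonneg _)

theorem IsPolygonSeq.lip_nonneg [Model S] (hP : IsPolygonSeq S P) (s : M) : 0 ≤ P.lip s := by
  have h := hP.variation_sub s (zero_le_one : (0 : Q M) ≤ 1)
  have := (abs_nonneg _).trans (h.1.trans h.2)
  simpa using this

theorem IsPolygonSeq.abs_eval_sub_le [Model S] (hP : IsPolygonSeq S P) (s : M) (a b : Q M) :
    |P.eval s b - P.eval s a| ≤ P.lip s * |b - a| := by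
  rcases le_total a b with h | h
  · rw [abs_of_nonneg (sub_nonneg.2 h)]
    exact (hP.variation_sub s h).1.trans (hP.variation_sub s h).2
  · rw [abs_sub_comm, abs_sub_comm b, abs_of_nonneg (sub_nonneg.2 h)]
    exact (hP.variation_sub s h).1.trans (hP.variation_sub s h).2

theorem IsPolygonSeq.abs_variation_sub_le [Model S] (hP : IsPolygonSeq S P) (s : M) (a b : Q M) :
    |P.variation s b - P.variation s a| ≤ P.lip s * |b - a| := by
  rcases le_total a b with h | h
  · have := hP.variation_sub s h
    rw [abs_of_nonneg (sub_nonneg.2 h), abs_of_nonneg ((abs_nonneg _).trans this.1)]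
    exact this.2
  · have := hP.variation_sub s h
    rw [abs_sub_comm, abs_sub_comm b, abs_of_nonneg (sub_nonneg.2 h),
      abs_of_nonneg ((abs_nonneg _).trans this.1)]
    exact this.2

theorem IsPolygonSeq.variation_le [Model S] (hP : IsPolygonSeq S P) (s : M) (a : Q M) :
    P.variation s a ≤ sumQ (P.len s) (fun i => |P.H s (i + 1) - P.H s i|) := by
  have := isDefQ_H hP
  have := isDefQ_pos hP
  exact sumQ_le_sumQ (S := S) inferInstance inferInstance _ fun i _ =>
    mul_le_of_le_one_right (abs_nonneg _) (clamp_le_one _)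

theorem IsPolygonSeq.variation_nonneg [Model S] (hP : IsPolygonSeq S P) (s : M) (a : Q M) :
    0 ≤ P.variation s a := by
  have := isDefQ_H hP
  have := isDefQ_pos hP
  exact sumQ_nonneg (S := S) inferInstance _ fun i _ => mul_nonneg (abs_nonneg _) (clamp_nonneg _)

/-- The values of a polygonal function on one of its intervals. -/
theorem IsPolygonSeq.eval_eq [Model S] (hP : IsPolygonSeq S P) {s i : M} (hi : i < P.len s)
    {a : Q M} (h₀ : P.X s i ≤ a) (h₁ : a ≤ P.X s (i + 1)) :
    P.eval s a * (P.X s (i + 1) - P.X s i) =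
      P.H s i * (P.X s (i + 1) - a) + P.H s (i + 1) * (a - P.X s i) := by
  have := isDefQ_H hP
  have := isDefQ_pos hP
  have hpos := sub_pos.2 (hP.X_lt hi)
  obtain ⟨F, hF⟩ : ∃ F : M → Q M, F = fun i => (P.H s (i + 1) - P.H s i) * P.pos s i a := ⟨_, rfl⟩
  have hFd : IsDefQ S (fun e => F (e 0)) := by
    rw [hF]
    infer_instance
  have := isDefQ_comp₁ hFd
  have hleft : ∀ n, n ≤ i → sumQ n F = P.H s n - P.H s 0 := by
    refine delta_induction S (fun _ => by rw [sumQ_zero hFd, sub_self]) fun n ih hn => ?_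
    have hn' := (lt_succ_self n).trans_le hn
    have hX : P.X s (n + 1) ≤ a := (hP.X_le hn hi.le).trans h₀
    rw [sumQ_succ hFd, ih hn'.le, hF]
    have hXn := hP.X_lt (hn'.trans hi)
    have : P.pos s n a = 1 := clamp_of_one_le (by
      rw [one_le_div (sub_pos.2 hXn)]
      linarith)
    dsimp only
    rw [this]
    ring
  have hmid : P.pos s i a = (a - P.X s i) / (P.X s (i + 1) - P.X s i) := by
    refine clamp_eq (div_nonneg (sub_nonneg.2 h₀) hpos.le) ?_
    rw [div_le_one hpos]
    linarith
  have hright : ∀ d, i + 1 + d ≤ P.len s → sumQ (i + 1 + d) F = sumQ (i + 1) F := by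
    refine delta_induction S (fun _ => by rw [add_zero]) fun d ih hd => ?_
    rw [← add_assoc] at hd ⊢
    have hd' := (lt_succ_self _).trans_le hd
    have hX : a ≤ P.X s (i + 1 + d) := h₁.trans (hP.X_le le_self_add hd'.le)
    rw [sumQ_succ hFd, ih hd'.le, hF]
    have hXn := hP.X_lt hd'
    have : P.pos s (i + 1 + d) a = 0 := clamp_of_nonpos
      (div_nonpos_of_nonpos_of_nonneg (sub_nonpos.2 hX) (sub_nonneg.2 hXn.le))
    dsimp only
    rw [this]
    ring
  obtain ⟨d, hd⟩ := exists_add_of_le (succ_le_of_lt hi)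
  have heval : P.eval s a = P.H s 0 + sumQ (P.len s) F := by
    rw [hF]
    rfl
  have h₂ := hright d hd.ge
  rw [← hd, sumQ_succ hFd, hleft i le_rfl] at h₂
  have h₃ : F i = (P.H s (i + 1) - P.H s i) * ((a - P.X s i) / (P.X s (i + 1) - P.X s i)) := by
    rw [hF, ← hmid]
  rw [heval, h₂, h₃]
  have := hpos.ne'
  field_simp
  ring

end Polygon

/-! ### Polygonal functions at real points -/

section PolygonReal

open Filter

variable {M : Type u} [Numbers M] {S : Set (Set M)} {P : PolygonSeq M}

theorem asympEq_iff [Model S] {a b : M → Frac M} : AsympEq S a b ↔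
    ∀ ε : Q M, 0 < ε → ∀ᶠ k in atTop, |val (a k) - val (b k)| ≤ ε := by
  have h : AsympEq S a b ↔ ∀ j, ∃ m, ∀ k, m < k → |val (a k) - val (b k)| ≤ tw j := by
    refine forall_congr' fun j => exists_congr fun m => forall_congr' fun k => ?_
    rw [← val_le_val, val_abs, val_sub, val_twoNegPow]
  rw [h]
  constructor
  · intro h ε hε
    obtain ⟨j, hj⟩ := exists_tw_lt S hε
    obtain ⟨m, hm⟩ := h j
    filter_upwards [eventually_ge_atTop (m + 1)] with k hk
    exact (hm k ((lt_succ_self m).trans_le hk)).trans hj.le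
  · intro h j
    obtain ⟨m, hm⟩ := eventually_atTop.1 (h _ (tw_pos S j))
    exact ⟨m, fun k hk => hm k hk.le⟩

/-- If `g` stays between `l` and `u` in the limit, its approximations are close to `[l, u]`. -/
theorem abs_sub_proj_le [Model S] {x : M → Frac M} (hx : IsReal S x) {l u : Frac M}
    (hlu : val l ≤ val u) (h₀ : RLe S (rconst l) x) (h₁ : RLe S x (rconst u)) (k : M) :
    ∃ a, val l ≤ a ∧ a ≤ val u ∧ |val (x k) - a| ≤ tw k := by
  have h₂ := (rconst_rLe_iff hx _).1 h₀ k
  have h₃ := (rLe_rconst_iff hx _).1 h₁ k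
  have := tw_pos S k
  rcases le_total (val (x k)) (val l) with h | h
  · exact ⟨_, le_rfl, hlu, by rw [abs_le]; constructor <;> linarith⟩
  · rcases le_total (val (x k)) (val u) with h' | h'
    · exact ⟨_, h, h', by rw [sub_self, abs_zero]; exact this.le⟩
    · exact ⟨_, hlu, le_rfl, by rw [abs_le]; constructor <;> linarith⟩

/-- On an interval of the polygon, the equation that defines the value is a limit of the
approximations. -/
theorem IsPolygonSeq.abs_eval_mul_sub_le [Model S] (hP : IsPolygonSeq S P) {s i : M}
    (hi : i < P.len s) {x : M → Frac M} (hx : IsReal S x) (h₀ : RLe S (rconst (P.node s i)) x)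
    (h₁ : RLe S x (rconst (P.node s (i + 1)))) (k : M) :
    |P.eval s (val (x k)) * (P.X s (i + 1) - P.X s i) -
      (P.H s i * (P.X s (i + 1) - val (x k)) + P.H s (i + 1) * (val (x k) - P.X s i))| ≤
      (P.lip s * (P.X s (i + 1) - P.X s i) + |P.H s (i + 1) - P.H s i|) * tw k := by
  obtain ⟨a, ha₀, ha₁, ha⟩ := abs_sub_proj_le hx (hP.X_lt hi).le h₀ h₁ k
  have h₂ := hP.eval_eq hi ha₀ ha₁
  have h₃ := hP.abs_eval_sub_le s a (val (x k))
  have hD := (sub_pos.2 (hP.X_lt hi)).le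
  have h₄ : P.eval s (val (x k)) * (P.X s (i + 1) - P.X s i) -
      (P.H s i * (P.X s (i + 1) - val (x k)) + P.H s (i + 1) * (val (x k) - P.X s i)) =
      (P.eval s (val (x k)) - P.eval s a) * (P.X s (i + 1) - P.X s i) -
      (P.H s (i + 1) - P.H s i) * (val (x k) - a) := by
    linear_combination h₂
  rw [h₄]
  refine (abs_sub _ _).trans ?_
  rw [abs_mul, abs_mul, abs_of_nonneg hD, add_mul]
  have h₅ : P.lip s * |val (x k) - a| ≤ P.lip s * tw k :=
    mul_le_mul_of_nonneg_left ha (hP.lip_nonneg s)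
  refine add_le_add ?_ (mul_le_mul_of_nonneg_left ha (abs_nonneg _))
  calc _ ≤ P.lip s * tw k * (P.X s (i + 1) - P.X s i) :=
        mul_le_mul_of_nonneg_right (h₃.trans h₅) hD
    _ = _ := by ring

theorem eventually_mul_tw_le (S : Set (Set M)) [Model S] (C : Q M) {ε : Q M} (hε : 0 < ε) :
    ∀ᶠ k in atTop, C * tw k ≤ ε := by
  have hC : 0 < |C| + 1 := by positivity
  filter_upwards [eventually_tw_lt S (div_pos hε hC)] with k hk
  rw [lt_div_iff₀ hC] at hk
  have := tw_pos S k
  have := mul_le_mul_of_nonneg_right (le_abs_self C) (tw_pos S k).le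
  nlinarith

/-- Every real number in the unit interval lies in some interval of the polygon. -/
theorem IsPolygonSeq.exists_interval [Model S] (hP : IsPolygonSeq S P) (s : M) {x : M → Frac M}
    (hx : RInUnit S x) : ∃ i, i < P.len s ∧ RLe S (rconst (P.node s i)) x ∧
      RLe S x (rconst (P.node s (i + 1))) := by
  have := isDefQ_X hP
  have := isDefQ_comp₁ (F := fun k => val (x k)) hx.1.isDefQ
  obtain ⟨m, hm⟩ := (eq_zero_or_succ S (P.len s)).resolve_left (hP.len_pos s).ne'
  have hlast : ∀ k, val (x k) ≤ P.X s (m + 1) + tw k := fun k => by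
    rw [← hm, hP.X_len]
    have := (rLe_rconst_iff hx.1 _).1 hx.2.2 k
    rwa [val_one] at this
  -- the leftmost interval whose right end is not to the left of `x`
  have hsig : IsSigma S (fun e : ℕ → M => ¬ ∀ k, val (x k) ≤ P.X s (e 0 + 1) + tw k) :=
    IsSigma.congr (P := fun e => ∃ k, ¬ val (x k) ≤ P.X s (e 0 + 1) + tw k) inferInstance
      fun e => not_forall
  obtain ⟨i, hi, hmin⟩ := exists_least_pi S (P := fun i => ∀ k, val (x k) ≤ P.X s (i + 1) + tw k)
    ⟨m, hlast⟩
  have him : i ≤ m := not_lt.1 fun h => hmin m h hlast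
  refine ⟨i, by rw [hm]; exact Numbers.lt_succ_iff.2 him, ?_, (rLe_rconst_iff hx.1 _).2 hi⟩
  rw [rconst_rLe_iff hx.1]
  intro k
  change P.X s i ≤ _
  rcases eq_zero_or_succ S i with rfl | ⟨j, rfl⟩
  · have := (rconst_rLe_iff hx.1 _).1 hx.2.1 k
    rw [val_zero] at this
    rwa [hP.X_zero]
  · have h := hmin j (lt_succ_self j)
    push Not at h
    obtain ⟨l, hl⟩ := h
    refine le_of_forall_tw S 1 fun n => ?_
    have h₁ := hx.1.abs_sub_le (le_max_left k l)
    have h₂ := hx.1.abs_sub_le (le_max_right k l)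
    have h₃ := abs_le.1 h₁
    have h₄ := abs_le.1 h₂
    have := tw_pos S n
    linarith [h₃.1, h₄.2]

/-- The values of the polygonal functions at real numbers are the limits of the values at rational
approximations. -/
theorem IsPolygonSeq.polyVal_iff [Model S] (hP : IsPolygonSeq S P) {s : M} {x w : M → Frac M}
    (hx : RInUnit S x) : PolyVal S P s x w ↔ IsReal S w ∧
      ∀ ε : Q M, 0 < ε → ∀ᶠ k in atTop, |val (w k) - P.eval s (val (x k))| ≤ ε := by
  constructor
  · rintro ⟨-, hw, i, hi, h₀, h₁, h⟩
    refine ⟨hw, fun ε hε => ?_⟩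
    have hD := sub_pos.2 (hP.X_lt hi)
    rw [asympEq_iff] at h
    have hε' : 0 < ε * (P.X s (i + 1) - P.X s i) / 2 := by positivity
    filter_upwards [h _ hε', eventually_mul_tw_le S
      (P.lip s * (P.X s (i + 1) - P.X s i) + |P.H s (i + 1) - P.H s i|) hε'] with k h₂ h₃
    have h₄ := (hP.abs_eval_mul_sub_le hi hx.1 h₀ h₁ k).trans h₃
    simp only [val_add, val_mul, val_sub] at h₂
    change |val (w k) * (P.X s (i + 1) - P.X s i) -
      (P.H s i * (P.X s (i + 1) - val (x k)) + P.H s (i + 1) * (val (x k) - P.X s i))| ≤ _ at h₂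
    refine le_of_mul_le_mul_right ?_ hD
    nth_rewrite 1 [← abs_of_pos hD]
    rw [← abs_mul, sub_mul]
    have h₅ := abs_le.1 h₂
    have h₆ := abs_le.1 h₄
    exact abs_le.2 ⟨by linarith [h₅.1, h₆.2], by linarith [h₅.2, h₆.1]⟩
  · rintro ⟨hw, h⟩
    obtain ⟨i, hi, h₀, h₁⟩ := hP.exists_interval s hx
    refine ⟨hx.1, hw, i, hi, h₀, h₁, ?_⟩
    rw [asympEq_iff]
    intro ε hε
    have hD := sub_pos.2 (hP.X_lt hi)
    filter_upwards [h (ε / 2 / (P.X s (i + 1) - P.X s i)) (by positivity), eventually_mul_tw_le S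
      (P.lip s * (P.X s (i + 1) - P.X s i) + |P.H s (i + 1) - P.H s i|) (half_pos hε)] with k h₂ h₃
    have h₄ := (hP.abs_eval_mul_sub_le hi hx.1 h₀ h₁ k).trans h₃
    simp only [val_add, val_mul, val_sub]
    change |val (w k) * (P.X s (i + 1) - P.X s i) -
      (P.H s i * (P.X s (i + 1) - val (x k)) + P.H s (i + 1) * (val (x k) - P.X s i))| ≤ _
    rw [le_div_iff₀ hD] at h₂
    nth_rewrite 1 [← abs_of_pos hD] at h₂
    rw [← abs_mul, sub_mul] at h₂
    have h₅ := abs_le.1 h₂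
    have h₆ := abs_le.1 h₄
    exact abs_le.2 ⟨by linarith [h₅.1, h₆.1], by linarith [h₅.2, h₆.2]⟩

/-- The value of a polygonal function at a real number `x` is the limit of its values at the rational
approximations of `x`, by Lipschitz continuity. -/
theorem IsPolygonSeq.exists_polyVal [Model S] (hP : IsPolygonSeq S P) (s : M) {x : M → Frac M}
    (hx : RInUnit S x) : ∃ w, PolyVal S P s x w := by
  have := isDefQ_eval hP
  have := isDefQ_comp₁ (F := fun k => val (x k)) hx.1.isDefQ
  obtain ⟨N, hN⟩ := exists_lt_toQ (P.lip s)
  have hN' : P.lip s * tw N ≤ 1 := by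
    rw [tw, ← div_eq_mul_inv, div_le_one (toQ_pos.2 (pw_pos S N))]
    exact hN.le.trans (toQ_le.2 (lt_pw S N).le)
  have hlip := hP.lip_nonneg s
  refine ⟨fun k => qrep (P.eval s (val (x (k + N)))), (hP.polyVal_iff hx).2
    ⟨isReal_of_isDefQ inferInstance fun k i => ?_, fun ε hε => ?_⟩⟩
  · refine (hP.abs_eval_sub_le s _ _).trans ?_
    have h₁ : k + N ≤ k + i + N := by
      gcongr
      exact le_self_add
    have h₂ := mul_le_mul_of_nonneg_left (hx.1.abs_sub_le h₁) hlip
    rw [tw_add S] at h₂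
    have h₃ := mul_le_mul_of_nonneg_left hN' (tw_pos S k).le
    linarith
  · filter_upwards [eventually_mul_tw_le S (P.lip s) hε] with k hk
    rw [val_qrep S]
    refine (hP.abs_eval_sub_le s _ _).trans (le_trans ?_ hk)
    rw [abs_sub_comm]
    exact mul_le_mul_of_nonneg_left (hx.1.abs_sub_le le_self_add) hlip

/-- Closeness of polygonal functions at rational points gives closeness at real points. -/
theorem isCauchyName_of_rational [Model S] (hP : IsPolygonSeq S P)
    (h : ∀ s r, s < r → ∀ a, 0 ≤ a → a ≤ 1 → |P.eval s a - P.eval r a| ≤ tw s) :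
    IsCauchyName S P := by
  refine ⟨hP, fun s r hsr x hx w w' hw hw' => ?_⟩
  obtain ⟨hw, h₁⟩ := (hP.polyVal_iff hx).1 hw
  obtain ⟨hw', h₂⟩ := (hP.polyVal_iff hx).1 hw'
  refine rLe_of_eventually (isReal_rabs (isReal_rsub hw hw')) (isReal_rconst _) fun ε hε => ?_
  have hε' : 0 < ε / 6 := by positivity
  filter_upwards [h₁ _ hε', h₂ _ hε', eventually_mul_tw_le S (P.lip s) hε',
    eventually_mul_tw_le S (P.lip r) hε', hw.eventually_abs_sub hε', hw'.eventually_abs_sub hε']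
    with k h₃ h₄ h₅ h₆ h₇ h₈
  rw [val_rabs, val_rsub, val_rconst, val_twoNegPow]
  have h₉ := hx.abs_sub_clamp_le k
  have h₁₀ := h s r hsr _ (clamp_nonneg (val (x k))) (clamp_le_one _)
  have h₁₁ := (hP.abs_eval_sub_le s (clamp (val (x k))) (val (x k))).trans
    ((mul_le_mul_of_nonneg_left h₉ (hP.lip_nonneg s)).trans h₅)
  have h₁₂ := (hP.abs_eval_sub_le r (clamp (val (x k))) (val (x k))).trans
    ((mul_le_mul_of_nonneg_left h₉ (hP.lip_nonneg r)).trans h₆)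
  rw [abs_le] at *
  constructor <;> linarith [h₃.1, h₃.2, h₄.1, h₄.2, h₇.1, h₇.2, h₈.1, h₈.2, h₁₀.1, h₁₀.2, h₁₁.1,
    h₁₁.2, h₁₂.1, h₁₂.2]

theorem IsCauchyName.abs_eval_sub_le [Model S] (h : IsCauchyName S P) {s r : M} (hsr : s ≤ r)
    {a : Q M} (h₀ : 0 ≤ a) (h₁ : a ≤ 1) : |P.eval s a - P.eval r a| ≤ tw s := by
  rcases hsr.lt_or_eq with hlt | rfl
  · have hx := rInUnit_rconst (S := S) (inUnit_qrep (S := S) h₀ h₁)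
    have hval : ∀ s, PolyVal S P s (rconst (qrep a)) (rconst (qrep (P.eval s a))) := fun s => by
      rw [h.1.polyVal_iff hx]
      refine ⟨isReal_rconst _, fun ε hε => Eventually.of_forall fun k => ?_⟩
      rw [val_rconst, val_rconst, val_qrep S, val_qrep S, sub_self, abs_zero]
      exact hε.le
    have := rLe_iff.1 (h.2 s r hlt _ hx _ _ (hval s) (hval r))
    simp only [val_rabs, val_rsub, val_rconst, val_qrep S, val_twoNegPow] at this
    exact le_of_forall_tw S 2 this
  · rw [sub_self, abs_zero]
    exact (tw_pos S s).le

/-- The values of the limit of the polygonal functions, through rational approximations. -/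
theorem cauchyVal_iff [Model S] (h : IsCauchyName S P) {x y : M → Frac M} :
    CauchyVal S P x y ↔ RInUnit S x ∧ IsReal S y ∧ ∀ s, ∀ ε : Q M, 0 < ε →
      ∀ᶠ k in atTop, |P.eval s (val (x k)) - val (y k)| ≤ tw s + ε := by
  constructor
  · rintro ⟨hx, hy, hxy⟩
    refine ⟨hx, hy, fun s ε hε => ?_⟩
    obtain ⟨w, hw⟩ := h.1.exists_polyVal s hx
    have h₁ := rLe_iff.1 (hxy s w hw)
    obtain ⟨hw, h₂⟩ := (h.1.polyVal_iff hx).1 hw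
    have hε' : 0 < ε / 5 := by positivity
    filter_upwards [h₂ _ hε', eventually_tw_lt S hε', hw.eventually_abs_sub hε',
      hy.eventually_abs_sub hε'] with k h₃ h₄ h₅ h₆
    have h₇ := h₁ k
    rw [val_rabs, val_rsub, val_rconst, val_twoNegPow] at h₇
    rw [abs_le] at *
    constructor <;> linarith [h₃.1, h₃.2, h₅.1, h₅.2, h₆.1, h₆.2, h₇.1, h₇.2]
  · rintro ⟨hx, hy, hxy⟩
    refine ⟨hx, hy, fun s w hw => ?_⟩
    obtain ⟨hw, h₂⟩ := (h.1.polyVal_iff hx).1 hw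
    refine rLe_of_eventually (isReal_rabs (isReal_rsub hw hy)) (isReal_rconst _) fun ε hε => ?_
    have hε' : 0 < ε / 4 := by positivity
    filter_upwards [h₂ _ hε', hxy s _ hε', hw.eventually_abs_sub hε', hy.eventually_abs_sub hε']
      with k h₃ h₄ h₅ h₆
    rw [val_rabs, val_rsub, val_rconst, val_twoNegPow]
    rw [abs_le] at *
    constructor <;> linarith [h₃.1, h₃.2, h₄.1, h₄.2, h₅.1, h₅.2, h₆.1, h₆.2]

end PolygonReal

/-! ### Limits of polygonal functions as presented and as coded functions -/

section EffectivelyContinuous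

open Filter

variable {M : Type u} [Numbers M] {S : Set (Set M)} {P : PolygonSeq M}

theorem HasJordan.mono {V W : Frac M → (M → Frac M) → Prop} (h : HasJordan S W)
    (hVW : ∀ p y, p.InUnit → V p y → W p y) : HasJordan S V := by
  obtain ⟨G, hG, h₁, h₂, h₃⟩ := h
  exact ⟨G, hG, h₁, h₂, fun x y hx hy hxy a b c d ha hb =>
    h₃ x y hx hy hxy a b c d (hVW _ _ hx ha) (hVW _ _ hy hb)⟩

theorem IsBV.mono {V W : (M → Frac M) → (M → Frac M) → Prop} (h : IsBV S W)
    (hVW : ∀ x y, V x y → W x y) : IsBV S V := by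
  obtain ⟨k, h⟩ := h
  exact ⟨k, fun n t y h₁ h₂ h₃ h₄ h₅ h₆ => h n t y h₁ h₂ h₃ h₄ h₅ fun i hi => hVW _ _ (h₆ i hi)⟩

theorem IsBVRat.mono {V W : Frac M → (M → Frac M) → Prop} (h : IsBVRat S W)
    (hVW : ∀ p y, V p y → W p y) : IsBVRat S V := by
  obtain ⟨k, h⟩ := h
  exact ⟨k, fun n t y h₁ h₂ h₃ h₄ h₅ h₆ => h n t y h₁ h₂ h₃ h₄ h₅ fun i hi => hVW _ _ (h₆ i hi)⟩

theorem IsCauchyName.cauchyVal_rconst [Model S] (h : IsCauchyName S P) {p : Frac M}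
    (hp : p.InUnit) : CauchyVal S P (rconst p) (fun k => qrep (P.eval k (val p))) := by
  have hp' := inUnit_iff.1 hp
  have := isDefQ_eval h.1
  refine (cauchyVal_iff h).2 ⟨rInUnit_rconst hp, isReal_of_isDefQ inferInstance
    fun k i => h.abs_eval_sub_le le_self_add hp'.1 hp'.2, fun s ε hε => ?_⟩
  filter_upwards [eventually_ge_atTop s] with k hk
  rw [val_qrep S, val_rconst]
  linarith [h.abs_eval_sub_le hk hp'.1 hp'.2]

theorem RatVal.le_add [Model S] {Z : Set M} (hZ : IsRatPres Z) {p : Frac M} {y z : M → Frac M}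
    (hy : RatVal S Z p y) (hz : RatVal S Z p z) (k : M) : val (y k) ≤ val (z k) + 3 * tw k := by
  have h : QMem Z (val p) (val (z k) + 2 * tw k) := by
    by_contra h
    have := hz.le_of_not_qMem hZ h k
    linarith [tw_pos S k]
  linarith [hy.le_of_qMem hZ h k]

theorem Presents.cauchyVal [Model S] (h : IsCauchyName S P) {Z : Set M}
    (hZ : Presents S Z (CauchyVal S P)) {p : Frac M} {y : M → Frac M} (hy : RatVal S Z p y) :
    CauchyVal S P (rconst p) y := by
  have h₁ := h.cauchyVal_rconst hy.1
  have hz := hZ.2 p hy.1 _ h₁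
  rw [cauchyVal_iff h] at h₁ ⊢
  refine ⟨h₁.1, hy.2.1, fun s ε hε => ?_⟩
  filter_upwards [h₁.2.2 s _ (half_pos hε), eventually_mul_tw_le S 3 (half_pos hε)] with k h₂ h₃
  have h₄ := hy.le_add hZ.1 hz k
  have h₅ := hz.le_add hZ.1 hy k
  rw [abs_le] at *
  constructor <;> linarith [h₂.1, h₂.2]

/-- The values of a function at rational points determine both forms of the conclusion, so that the
presentation of the function on the rational points suffices. -/
theorem jordanQEffCont_of_jordanQ [Model S] (h : JordanQ S) : JordanQEffCont S := by
  rintro P hP hbv ⟨Z, hZ, hpres⟩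
  refine (h Z hZ hpres.1 (hbv.isBVRat.mono fun p y hy => ?_)).mono
    fun p y hp hy => hpres.2 p hp y hy
  exact hpres.cauchyVal hP hy

/-- The limit of a Cauchy name has a code as a continuous function: the ball of radius `r` around `a`
is sent into the ball of radius `s` around `b` if some polygonal function of the name and its
Lipschitz constant guarantee this with a margin. -/
theorem jordanQEffCont_of_jordanQCont [Model S] (h : JordanQCont S) : JordanQEffCont S := by
  rintro P hP hbv -
  have := isDefQ_eval hP.1
  have := isDefQ_lip hP.1
  obtain ⟨Φ, hΦ⟩ : ∃ Φ : Set M, Φ = {z | |P.eval (pfst z) (qdec (pfst (psnd z))) -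
      qdec (pfst (psnd (psnd (psnd z))))| + P.lip (pfst z) * qdec (pfst (psnd (psnd z))) +
      3 * tw (pfst z) < qdec (psnd (psnd (psnd (psnd z))))} := ⟨_, rfl⟩
  have hΦS : Φ ∈ S := by
    rw [hΦ]
    exact comprehension S
  have hmem : ∀ n a r b s, QuintMem Φ n a r b s ↔
      |P.eval n (val a) - val b| + P.lip n * val r + 3 * tw n < val s := by
    intro n a r b s
    rw [QuintMem, hΦ, Set.mem_ofPred_eq]
    simp only [pfst_pair S, psnd_pair S, qdec_code S]
  -- a ball of small radius around a rational approximation of a real number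
  have hball : ∀ (x : M → Frac M), RInUnit S x → ∀ r : Frac M, 0 < val r → ∃ a : Frac M,
      a.InUnit ∧ RLt S (rabs (rsub x (rconst a))) (rconst r) ∧
      ∀ᶠ k in atTop, |val (x k) - val a| ≤ val r := by
    intro x hx r hr
    obtain ⟨k, hk⟩ := (eventually_mul_tw_le S 4 (half_pos hr)).exists
    have hk' := tw_pos S k
    have h₁ : tw (k + 1) ≤ tw k := tw_le_tw S le_self_add
    refine ⟨qrep (clamp (val (x (k + 1)))),
      inUnit_qrep (S := S) (clamp_nonneg _) (clamp_le_one _), ?_, ?_⟩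
    · rw [rLt_iff]
      refine ⟨k, ?_⟩
      rw [val_rabs, val_rsub, val_rconst, val_rconst, val_qrep S]
      linarith [hx.abs_sub_clamp_le (k + 1)]
    · filter_upwards [eventually_ge_atTop (k + 1)] with l hl
      rw [val_qrep S]
      have h₂ := abs_le.1 (hx.1.abs_sub_le hl)
      have h₃ := abs_le.1 (hx.abs_sub_clamp_le (k + 1))
      exact abs_le.2 ⟨by linarith [h₂.2, h₃.1], by linarith [h₂.1, h₃.2]⟩
  have hcode : IsContCode S Φ := by
    refine ⟨?_, ?_, ?_, ?_, ?_⟩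
    · intro n a a' r r' b b' s s' ha hr hb hs
      rw [hmem, hmem, val_eq_val.2 ha, val_eq_val.2 hr, val_eq_val.2 hb, val_eq_val.2 hs]
      exact id
    · rintro a r b s b' s' ⟨ha, hr, -, n, hn⟩ ⟨-, -, -, n', hn'⟩
      rw [hmem] at hn hn'
      rw [← val_le_val, val_add, val_abs, val_sub]
      have ha' := inUnit_iff.1 ha
      have hr' := val_lt_val.2 hr
      rw [val_zero] at hr'
      have h₁ := mul_nonneg (hP.1.lip_nonneg n) hr'.le
      have h₂ := mul_nonneg (hP.1.lip_nonneg n') hr'.le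
      have h₃ : |P.eval n (val a) - P.eval n' (val a)| ≤ tw n + tw n' := by
        rcases le_total n n' with h | h
        · exact (hP.abs_eval_sub_le h ha'.1 ha'.2).trans (by linarith [tw_pos S n'])
        · rw [abs_sub_comm]
          exact (hP.abs_eval_sub_le h ha'.1 ha'.2).trans (by linarith [tw_pos S n])
      have h₄ := abs_le.1 (le_refl |P.eval n (val a) - val b|)
      have h₅ := abs_le.1 (le_refl |P.eval n' (val a) - val b'|)
      have h₆ := tw_pos S n
      have h₇ := tw_pos S n'
      have h₈ := abs_le.1 h₃
      exact abs_le.2 ⟨by linarith [h₄.2, h₅.1, h₈.1], by linarith [h₄.1, h₅.2, h₈.2]⟩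
    · rintro a r b s a' r' ⟨ha, hr, hs, n, hn⟩ ha' hr' hlt
      refine ⟨ha', hr', hs, n, ?_⟩
      rw [hmem] at hn ⊢
      rw [← val_lt_val, val_add, val_abs, val_sub] at hlt
      have h₁ := mul_le_mul_of_nonneg_left hlt.le (hP.1.lip_nonneg n)
      have h₂ := hP.1.abs_eval_sub_le n (val a) (val a')
      rw [abs_sub_comm (val a')] at h₂
      have h₃ := abs_add_le (P.eval n (val a') - P.eval n (val a)) (P.eval n (val a) - val b)
      rw [sub_add_sub_cancel] at h₃
      linarith
    · rintro a r b s b' s' ⟨ha, hr, hs, n, hn⟩ hlt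
      rw [← val_lt_val, val_add, val_abs, val_sub] at hlt
      have hs' := val_lt_val.2 hs
      rw [val_zero] at hs'
      refine ⟨ha, hr, val_lt_val.1 ?_, n, ?_⟩
      · rw [val_zero]
        linarith [abs_nonneg (val b - val b')]
      · rw [hmem] at hn ⊢
        have h₃ := abs_add_le (P.eval n (val a) - val b) (val b - val b')
        rw [sub_add_sub_cancel] at h₃
        linarith
    · intro x hx ε hε
      have hε' := val_lt_val.2 hε
      rw [val_zero] at hε'
      obtain ⟨n, hn⟩ := (eventually_mul_tw_le S 3 (ε := val ε / 4) (by positivity)).exists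
      have hlip := hP.1.lip_nonneg n
      have hr : 0 < val ε / 4 / (P.lip n + 1) := by positivity
      have hr' : P.lip n * (val ε / 4 / (P.lip n + 1)) ≤ val ε / 4 := by
        rw [mul_div_assoc', div_le_iff₀ (by positivity)]
        linarith
      obtain ⟨r, hr₀⟩ := val_surjective (val ε / 4 / (P.lip n + 1))
      rw [← hr₀] at hr hr'
      obtain ⟨a, ha, hlt, -⟩ := hball x hx r hr
      refine ⟨a, r, qrep (P.eval n (val a)), qrep (val ε / 4 * 3), ⟨ha, ?_, ?_, n, ?_⟩, hlt, ?_⟩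
      · rwa [← val_lt_val, val_zero]
      · rw [← val_lt_val, val_zero, val_qrep S]
        positivity
      · rw [hmem, val_qrep S, val_qrep S, sub_self, abs_zero]
        linarith
      · rw [← val_lt_val, val_qrep S]
        linarith
  refine (h Φ hΦS hcode (hbv.mono ?_)).mono ?_
  · rintro x y ⟨hx, hy, hxy⟩
    refine (cauchyVal_iff hP).2 ⟨hx, hy, fun s ε hε => ?_⟩
    obtain ⟨n, hn, hsn⟩ := ((eventually_mul_tw_le S 3 (ε := ε / 8) (by positivity)).and
      (eventually_ge_atTop s)).exists
    have hlip := hP.1.lip_nonneg n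
    have hlip' := hP.1.lip_nonneg s
    obtain ⟨r, hr⟩ := val_surjective (ε / 8 / (P.lip n + P.lip s + 1))
    have hr₀ : 0 < val r := by
      rw [hr]
      positivity
    have hr₁ : (P.lip n + P.lip s) * val r ≤ ε / 8 := by
      rw [hr, mul_div_assoc', div_le_iff₀ (by positivity)]
      linarith
    have h₁ := mul_nonneg hlip hr₀.le
    have h₂ := mul_nonneg hlip' hr₀.le
    obtain ⟨a, ha, hlt, hnear⟩ := hball x hx r hr₀
    have ha' := inUnit_iff.1 ha
    have h₃ := rLe_iff.1 (hxy a r (qrep (P.eval n (val a))) (qrep (ε / 8 * 3))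
      ⟨ha, val_lt_val.1 (by rwa [val_zero]), val_lt_val.1 (by
        rw [val_zero, val_qrep S]
        positivity), n, by
        rw [hmem, val_qrep S, val_qrep S, sub_self, abs_zero]
        linarith⟩ hlt)
    filter_upwards [hnear, eventually_mul_tw_le S 2 (ε := ε / 8) (by positivity),
      hy.eventually_abs_sub (ε := ε / 8) (by positivity)] with k h₄ h₅ h₆
    have h₇ := h₃ k
    rw [val_rabs, val_rsub, val_rconst, val_rconst, val_qrep S, val_qrep S] at h₇
    have h₈ := (hP.1.abs_eval_sub_le s (val a) (val (x k))).trans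
      (mul_le_mul_of_nonneg_left h₄ hlip')
    have h₉ := hP.abs_eval_sub_le hsn ha'.1 ha'.2
    rw [abs_le] at *
    constructor <;> linarith [h₆.1, h₆.2, h₇.1, h₇.2, h₈.1, h₈.2, h₉.1, h₉.2]
  · intro p y hp hy
    obtain ⟨hx, hy, hxy⟩ := (cauchyVal_iff hP).1 hy
    refine ⟨hx, hy, ?_⟩
    rintro a r b s ⟨ha, hr, hs, n, hn⟩ hlt
    rw [hmem] at hn
    rw [rLt_rconst_iff (q := |val p - val a|) (fun k => by rw [val_rabs, val_rsub]; rfl)] at hlt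
    refine rLe_of_eventually (isReal_rabs (isReal_rsub hy (isReal_rconst b))) (isReal_rconst s)
      fun ε hε => ?_
    filter_upwards [hxy n _ (half_pos hε), hy.eventually_abs_sub (half_pos hε)] with k h₁ h₂
    rw [val_rabs, val_rsub, val_rconst, val_rconst]
    rw [val_rconst] at h₁
    have h₃ := (hP.1.abs_eval_sub_le n (val a) (val p)).trans
      (mul_le_mul_of_nonneg_left hlt.le (hP.1.lip_nonneg n))
    have h₄ := abs_le.1 (le_refl |P.eval n (val a) - val b|)
    have h₅ := tw_pos S n
    rw [abs_le] at *
    constructor <;> linarith [h₁.1, h₁.2, h₂.1, h₂.2, h₃.1, h₃.2, h₄.1, h₄.2]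

/-- A uniform bound for the variations of the polygonal functions bounds the variation of their
limit. -/
theorem isBV_cauchyVal [Model S] (hP : IsCauchyName S P) (c : M)
    (h : ∀ s, sumQ (P.len s) (fun i => |P.H s (i + 1) - P.H s i|) ≤ toQ c) :
    IsBV S (CauchyVal S P) := by
  refine ⟨c, fun n t y ht hy _ _ hlt hV v hv h₀ hstep => ?_⟩
  have := isDefQ_variation hP.1
  have := isDefQ_lip hP.1
  have := isDefQ_comp₂ (F := fun i k => val (v i k)) (isDefQ_of_isFun₂ hv.1)
  have := isDefQ_comp₂ (F := fun i k => val (t i k)) (isDefQ_of_isFun₂ ht.1)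
  -- the partial sums are compared with the variation of the polygonal function number `s`
  have key : ∀ s i, i ≤ n → ∀ k, val (v i k) ≤
      P.variation s (val (t i k)) + 2 * toQ i * tw s + (P.lip s + 1) * tw k := by
    intro s
    have hsig : IsSigma S (fun e : ℕ → M => ¬ (e 0 ≤ n → ∀ k, val (v (e 0) k) ≤
        P.variation s (val (t (e 0) k)) + 2 * toQ (e 0) * tw s + (P.lip s + 1) * tw k)) :=
      IsSigma.congr (P := fun e => e 0 ≤ n ∧ ∃ k, ¬ val (v (e 0) k) ≤
        P.variation s (val (t (e 0) k)) + 2 * toQ (e 0) * tw s + (P.lip s + 1) * tw k)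
        inferInstance fun e => by push Not; rfl
    refine pi_induction S (P := fun i => i ≤ n → ∀ k, val (v i k) ≤
      P.variation s (val (t i k)) + 2 * toQ i * tw s + (P.lip s + 1) * tw k) ?_ fun i ih hi k => ?_
    · intro _ k
      have h₁ := (rLe_rconst_iff (hv.2 0) _).1 h₀.1 k
      rw [val_zero] at h₁
      have h₂ := hP.1.variation_nonneg s (val (t 0 k))
      have h₃ := mul_nonneg (hP.1.lip_nonneg s) (tw_pos S k).le
      rw [map_zero]
      linarith
    · have hi' := (lt_succ_self i).trans_le hi
      have ih := ih hi'.le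
      have hlip := hP.1.lip_nonneg s
      refine le_of_forall_pos_le_add fun ε hε => ?_
      have hε' : 0 < ε / 9 := by positivity
      obtain ⟨hx, hy₀, h₁⟩ := (cauchyVal_iff hP).1 (hV i (Or.inl hi'))
      obtain ⟨hx', hy₁, h₂⟩ := (cauchyVal_iff hP).1 (hV (i + 1) (lt_or_eq_of_le hi))
      obtain ⟨m, hm⟩ := rLt_iff.1 (hlt i hi')
      have hm' : ∀ᶠ l in atTop, val (t i l) ≤ val (t (i + 1) l) := by
        filter_upwards [eventually_ge_atTop m] with l hl
        linarith [hx.1.sub_le hl, hx'.1.le_add hl]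
      obtain ⟨l, ⟨⟨⟨⟨e₁, e₂⟩, e₃⟩, e₄⟩, e₅⟩, hkl⟩ := (((((h₁ s _ hε').and (h₂ s _ hε')).and
        hm').and (eventually_mul_tw_le S (P.lip s + 1) hε')).and (eventually_tw_lt S hε')).and
        (eventually_ge_atTop k) |>.exists
      have h₃ := rLe_iff.1 (hstep i hi').1 l
      rw [val_radd, val_rabs, val_rsub] at h₃
      have h₄ := ih l
      have h₅ := (hP.1.variation_sub s e₃).1
      have h₆ := hP.1.abs_variation_sub_le s (val (t (i + 1) k)) (val (t (i + 1) l))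
      have h₇ := mul_le_mul_of_nonneg_left (hx'.1.abs_sub_le hkl) hlip
      rw [abs_sub_comm] at h₇
      have h₈ := (hv.2 (i + 1)).le_add hkl
      have h₉ := abs_le.1 (h₆.trans h₇)
      have h₁₀ : |val (y (i + 1) (l + 1 + 1)) - val (y i (l + 1 + 1))| ≤
          |P.eval s (val (t (i + 1) l)) - P.eval s (val (t i l))| + 2 * tw s + 4 * (ε / 9) := by
        have g₁ := abs_le.1 (le_refl |P.eval s (val (t (i + 1) l)) - P.eval s (val (t i l))|)
        have hl : l ≤ l + 1 + 1 := le_self_add.trans le_self_add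
        have g₂ := abs_le.1 ((hy.2 i).abs_sub_le hl)
        have g₃ := abs_le.1 ((hy.2 (i + 1)).abs_sub_le hl)
        rw [abs_le] at e₁ e₂
        exact abs_le.2 ⟨by linarith [g₁.1, e₁.1, e₂.2, g₂.1, g₃.2],
          by linarith [g₁.2, e₁.2, e₂.1, g₂.2, g₃.1]⟩
      have h₁₁ := (hv.2 i).sub_le (le_self_add : l ≤ l + 1)
      rw [map_add, map_one]
      linarith [h₉.2]
  rw [rLe_rconst_iff (hv.2 n), val_ofNum]
  intro k
  refine le_of_forall_tw S (2 * toQ n) fun s => le_of_forall_tw S (P.lip s + 1) fun l => ?_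
  have h₁ := key s n le_rfl (k + l)
  have h₂ := (hv.2 n).le_add (le_self_add : k ≤ k + l)
  have h₃ := (hP.1.variation_le s (val (t n (k + l)))).trans (h s)
  have h₄ := mul_le_mul_of_nonneg_left (tw_le_tw S (le_add_self : l ≤ k + l))
    (add_nonneg (hP.1.lip_nonneg s) zero_le_one)
  linarith

end EffectivelyContinuous

/-! ### Paths through binary trees -/

section Paths

variable {M : Type u} [Numbers M] {S : Set (Set M)}

theorem exists_upper_bound [Model S] {w : M → M} (hw : IsDef S (fun e => w (e 0))) (n : M) :
    ∃ u, ∀ i, i < n → w i ≤ u := by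
  have := isDef_comp₁ hw
  refine sigma_induction S (P := fun n => ∃ u, ∀ i, i < n → w i ≤ u) ⟨0, by simp⟩ ?_ n
  rintro n ⟨u, hu⟩
  refine ⟨max u (w n), fun i hi => ?_⟩
  rcases lt_succ_cases hi with hi | rfl
  · exact le_max_of_le_left (hu i hi)
  · exact le_max_right _ _

variable {T : Set M}

theorem IsBinTree.drop_mem [Model S] (hT : IsBinTree T) (hTS : T ∈ S) {τ d : M} (hτ : τ ∈ T)
    (hd : d ≤ len τ) : drop d τ ∈ T := by
  have := Fact.mk hTS
  have h0 := hT.1 τ hτ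
  revert hd
  refine delta_induction S (P := fun d => d ≤ len τ → drop d τ ∈ T) (fun _ => ?_)
    (fun d ih hd => ?_) d
  · rwa [drop_zero S]
  · have h₁ := ih ((lt_succ_self d).le.trans hd)
    have h₂ := drop_ne_zero S h0 hd
    rw [← drop_drop S] at h₂ ⊢
    refine hT.2 _ h₂ ?_
    rcases eq_double_drop S (drop d τ) with h | h
    · left
      rwa [← h]
    · right
      rwa [← h]

theorem IsBinTree.exists_len [Model S] (hT : IsBinTree T) (hTS : T ∈ S) (hinf : IsInfinite T)
    (n : M) : ∃ τ ∈ T, len τ = n := by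
  obtain ⟨σ, hσ, hlt⟩ := hinf (pw (n + 1))
  have h₁ : n ≤ len σ := by
    have h₂ := (pw_lt_pw S (lt_succ_self n)).trans (hlt.trans (lt_pw_len S σ))
    exact le_of_lt_succ (lt_of_pw_lt_pw S h₂)
  obtain ⟨d, hd⟩ := exists_add_of_le h₁
  have hd' : d ≤ len σ := hd ▸ le_add_self
  refine ⟨drop d σ, hT.drop_mem hTS hσ hd', ?_⟩
  have := len_drop S (hT.1 σ hσ) hd'
  rw [hd] at this
  exact add_right_cancel this

/-- A definable branch of a tree is a path. -/
theorem exists_path_of_branch [Model S] {c : M → M} (hc : IsDef S (fun e => c (e 0)))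
    (h₀ : c 0 = 1) (h₁ : ∀ n, drop 1 (c (n + 1)) = c n) (h₂ : ∀ n, c n ∈ T) :
    ∃ Z ∈ S, IsPath S T Z := by
  have := isDef_comp₁ hc
  have : IsDelta S (fun e => IsOdd (c (e 0 + 1))) := IsDelta.isOdd (f := fun e => c (e 0 + 1))
  refine ⟨{n | IsOdd (c (n + 1))}, comprehension S, c, isFun_iff.2 hc, ⟨h₀, fun n => ?_⟩, h₂⟩
  have h := eq_double_drop S (c (n + 1))
  simp only [Set.mem_ofPred_eq, IsOdd]
  rw [h₁] at h ⊢
  exact ⟨fun h' => h.resolve_right h', id⟩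

/-- The string `σ` has an extension of length `s` in `T`. -/
def Ext (T : Set M) (σ s : M) : Prop :=
  ∃ τ, τ < pw (s + 1) ∧ τ ∈ T ∧ len τ = s ∧ drop (msub s (len σ)) τ = σ

instance IsDelta.ext [Model S] [hT : Fact (T ∈ S)] {f g : (ℕ → M) → M} [hf : IsDef S f]
    [hg : IsDef S g] : IsDelta S (fun e => Ext T (f e) (g e)) := by
  have hf' := hf.comp (σ := fun e n => e (n + 1)) (fun i => .var (i + 1))
  have hg' := hg.comp (σ := fun e n => e (n + 1)) (fun i => .var (i + 1))
  unfold SOA.Ext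
  infer_instance

theorem ext_add_iff [Model S] {σ d : M} :
    Ext T σ (len σ + d) ↔ ∃ τ ∈ T, len τ = len σ + d ∧ drop d τ = σ := by
  have : msub (len σ + d) (len σ) = d := by rw [add_comm, add_msub S]
  rw [Ext, this]
  exact exists_congr fun τ =>
    ⟨fun h => h.2, fun h => ⟨by rw [← h.2.1]; exact lt_pw_len S τ, h⟩⟩

theorem Ext.of_le [Model S] (hT : IsBinTree T) (hTS : T ∈ S) {σ s s' : M} (h : Ext T σ s')
    (hs : s ≤ s') (hσ : len σ ≤ s) : Ext T σ s := by
  obtain ⟨d, rfl⟩ := exists_add_of_le hσ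
  obtain ⟨d', rfl⟩ := exists_add_of_le hs
  rw [add_assoc, ext_add_iff (S := S)] at h
  rw [ext_add_iff (S := S)]
  obtain ⟨τ, hτ, hlen, hdrop⟩ := h
  have hd : d' ≤ len τ := by
    rw [hlen, ← add_assoc]
    exact le_add_self
  refine ⟨drop d' τ, hT.drop_mem hTS hτ hd, ?_, ?_⟩
  · have := len_drop S (hT.1 τ hτ) hd
    rw [hlen, ← add_assoc] at this
    exact add_right_cancel this
  · rw [drop_drop S, add_comm, hdrop]

theorem len_le_self (S : Set (Set M)) [Model S] (σ : M) : len σ ≤ σ :=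
  least_le S (P := fun ℓ => σ < pw (ℓ + 1)) ((lt_pw S σ).trans (pw_lt_pw S (lt_succ_self σ)))

theorem len_double (S : Set (Set M)) [Model S] {σ : M} (hσ : σ ≠ 0) :
    len (σ + σ) = len σ + 1 ∧ len (σ + σ + 1) = len σ + 1 := by
  have h₁ := pw_len_le S hσ
  have h₂ := lt_pw_len S σ
  have h₃ := add_le_add h₁ h₁
  have h₄ := add_le_add (succ_le_of_lt h₂) (succ_le_of_lt h₂)
  rw [← pw_succ S] at h₃ h₄
  have h₅ : σ + 1 + (σ + 1) = σ + σ + 1 + 1 := by ring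
  rw [h₅] at h₄
  have h₆ := (lt_succ_self _).trans_le h₄
  exact ⟨len_eq S h₃ ((lt_succ_self _).trans h₆), len_eq S (h₃.trans le_self_add) h₆⟩

/-- If it can be decided which strings have extensions of all lengths, the tree has a path. -/
theorem exists_path_of_decidable [Model S] (hT : IsBinTree T) (hTS : T ∈ S) (hinf : IsInfinite T)
    {h : M → M} (hh : IsDef S (fun e => h (e 0)))
    (hext : ∀ σ s, σ < s → h σ ≤ s → Ext T σ s → Ext T σ (s + 1)) : ∃ Z ∈ S, IsPath S T Z := by
  classical
  have := Fact.mk hTS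
  have := isDef_comp₁ hh
  -- `E σ` says that `σ` has extensions of all lengths
  obtain ⟨E, hE⟩ : ∃ E : M → Prop, E = fun σ => Ext T σ (h σ + (σ + 1)) := ⟨_, rfl⟩
  have hEd : IsDelta S (fun e => E (e 0)) := by
    rw [hE]
    infer_instance
  have := isDelta_comp₁ hEd
  have hlast : ∀ σ s, h σ + (σ + 1) ≤ s → Ext T σ s → E σ := fun σ s hs hσ => by
    rw [hE]
    exact hσ.of_le hT hTS hs ((len_le_self S σ).trans ((lt_succ_self σ).le.trans le_add_self))
  have hall : ∀ σ, E σ → ∀ s, len σ ≤ s → Ext T σ s := by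
    intro σ hσ s hs
    rw [hE] at hσ
    have key : ∀ d, Ext T σ (h σ + (σ + 1) + d) := by
      refine delta_induction S (by rwa [add_zero]) fun d ih => ?_
      rw [← add_assoc]
      refine hext _ _ ?_ ?_ ih
      · exact (lt_succ_self σ).trans_le (le_add_self.trans le_self_add)
      · exact le_self_add.trans le_self_add
    exact (key s).of_le hT hTS le_add_self hs
  have hone : E 1 := by
    rw [hE]
    obtain ⟨τ, hτ, hlen⟩ := hT.exists_len hTS hinf (h 1 + (1 + 1))
    have h1 : len (1 : M) = 0 := len_eq S (by rw [pw_zero S])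
      (by rw [zero_add, ← zero_add (1 : M), pw_succ S, pw_zero S, zero_add]; exact lt_succ_self _)
    have : Ext T 1 (len 1 + (h 1 + (1 + 1))) := by
      rw [ext_add_iff (S := S), h1, zero_add]
      refine ⟨τ, hτ, hlen, le_antisymm (le_of_lt_succ ?_) ?_⟩
      · have h2 := lt_pw_len S τ
        rw [hlen, add_comm _ (1 : M)] at h2
        have := drop_lt_pw S h2
        rwa [← zero_add (1 : M), pw_succ S, pw_zero S, zero_add] at this
      · have h2 := pw_len_le S (hT.1 τ hτ)
        rw [hlen, ← zero_add (h 1 + _)] at h2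
        have := pw_le_drop S h2
        rwa [pw_zero S] at this
    rwa [h1, zero_add] at this
  have hstep : ∀ σ, σ ≠ 0 → E σ → E (σ + σ) ∨ E (σ + σ + 1) := by
    intro σ hσ0 hσ
    obtain ⟨s, hs⟩ : ∃ s, s = (h (σ + σ) + (σ + σ + 1)) + (h (σ + σ + 1) + (σ + σ + 1 + 1)) :=
      ⟨_, rfl⟩
    have h₁ := hall σ hσ (len σ + (1 + s)) le_self_add
    rw [ext_add_iff (S := S)] at h₁
    obtain ⟨τ, hτ, hlen, hdrop⟩ := h₁
    have h₂ := eq_double_drop S (drop s τ)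
    rw [drop_drop S, add_comm s, hdrop] at h₂
    have key : ∀ ρ, drop s τ = ρ → len ρ = len σ + 1 → h ρ + (ρ + 1) ≤ s → E ρ := by
      intro ρ h₃ h₄ h₅
      refine hlast ρ (len ρ + s) (h₅.trans le_add_self) ?_
      rw [ext_add_iff (S := S), h₄]
      exact ⟨τ, hτ, by rw [hlen, add_assoc], h₃⟩
    obtain ⟨h₅, h₆⟩ := len_double S hσ0
    rcases h₂ with h₂ | h₂
    · exact Or.inl (key _ h₂ h₅ (hs ▸ le_self_add))
    · exact Or.inr (key _ h₂ h₆ (hs ▸ le_add_self))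
  have hrec : IsDef S (fun e : ℕ → M =>
      if E (e 1 + e 1) then e 1 + e 1 else e 1 + e 1 + 1) := inferInstance
  obtain ⟨c, hc⟩ : ∃ c : M → M,
      c = recVal 1 (fun _ v => if E (v + v) then v + v else v + v + 1) := ⟨_, rfl⟩
  have hcd : IsDef S (fun e => c (e 0)) := by
    rw [hc]
    exact IsDef.recVal (a := fun _ => 1) (n := fun e => e 0)
      (h := fun _ v _ => if E (v + v) then v + v else v + v + 1)
  have hc0 : c 0 = 1 := by
    rw [hc]
    exact recVal_zero (S := S) _ hrec
  have hcs : ∀ n, c (n + 1) = if E (c n + c n) then c n + c n else c n + c n + 1 := fun n => by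
    rw [hc, recVal_succ (S := S) _ hrec]
  have := isDef_comp₁ hcd
  have hcE : ∀ n, c n ≠ 0 ∧ E (c n) := by
    refine delta_induction S ⟨by rw [hc0]; exact one_ne_zero, by rwa [hc0]⟩ fun n ih => ?_
    rw [hcs]
    split_ifs with h'
    · exact ⟨(pos_of_gt ((pos_iff_ne_zero.2 ih.1).trans_le le_self_add)).ne', h'⟩
    · exact ⟨(succ_pos' _).ne', (hstep _ ih.1 ih.2).resolve_left h'⟩
  refine exists_path_of_branch hcd hc0 (fun n => ?_) fun n => ?_
  · rw [hcs]
    split_ifs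
    · exact drop_one_double S _
    · exact drop_one_double_succ S _
  · have := hall _ (hcE n).2 (len (c n) + 0) le_self_add
    rw [ext_add_iff (S := S)] at this
    obtain ⟨τ, hτ, -, hdrop⟩ := this
    rw [drop_zero S] at hdrop
    rwa [← hdrop]

/-- Whole-number masses on the strings, given as differences `R τ - L τ`: the mass of a string is
the sum of the masses of its two extensions by one digit. -/
structure IsMass (L R : M → M) : Prop where
  left : ∀ τ, τ ≠ 0 → L (τ + τ) = L τ
  middle : ∀ τ, τ ≠ 0 → R (τ + τ) = L (τ + τ + 1)
  right : ∀ τ, τ ≠ 0 → R (τ + τ + 1) = R τ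
  le : ∀ τ, τ ≠ 0 → L τ ≤ R τ

/-- The interval of masses of a string is contained in that of each of its initial segments. -/
theorem IsMass.le_drop [Model S] {L R : M → M} (h : IsMass L R)
    (hL : IsDef S (fun e => L (e 0))) (hR : IsDef S (fun e => R (e 0))) {τ d : M} (hτ : τ ≠ 0)
    (hd : d ≤ len τ) : L (drop d τ) ≤ L τ ∧ R τ ≤ R (drop d τ) := by
  have := isDef_comp₁ hL
  have := isDef_comp₁ hR
  revert hd
  refine delta_induction S (P := fun d => d ≤ len τ → L (drop d τ) ≤ L τ ∧ R τ ≤ R (drop d τ))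
    (fun _ => ?_) (fun d ih hd => ?_) d
  · rw [drop_zero S]
    exact ⟨le_rfl, le_rfl⟩
  · obtain ⟨h₁, h₂⟩ := ih ((lt_succ_self d).le.trans hd)
    have h₀ := drop_ne_zero S hτ hd
    have h₃ := eq_double_drop S (drop d τ)
    rw [drop_drop S] at h₃
    generalize drop (d + 1) τ = ρ at *
    have hρ₀ : ρ + ρ ≠ 0 := (pos_of_gt ((pos_iff_ne_zero.2 h₀).trans_le le_self_add)).ne'
    have hρ₁ : ρ + ρ + 1 ≠ 0 := (succ_pos' _).ne'
    have h₄ := h.left ρ h₀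
    have h₅ := h.middle ρ h₀
    have h₆ := h.right ρ h₀
    have h₇ := h.le _ hρ₀
    have h₈ := h.le _ hρ₁
    rcases h₃ with h₃ | h₃ <;> rw [h₃] at h₁ h₂
    · exact ⟨by rwa [h₄] at h₁, h₂.trans (by rw [h₅, ← h₆]; exact h₈)⟩
    · exact ⟨(by rw [← h₄]; exact h₇.trans h₅.le : L ρ ≤ L (ρ + ρ + 1)).trans h₁, by rwa [h₆] at h₂⟩

/-- A tree in which strings of positive mass occur on all levels has a path: the strings of maximal
mass among the masses that occur on all levels do not branch any more. -/
theorem exists_path_of_mass [Model S] (hT : IsBinTree T) (hTS : T ∈ S) {L R : M → M}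
    (h : IsMass L R) (hL : IsDef S (fun e => L (e 0))) (hR : IsDef S (fun e => R (e 0)))
    (hpos : ∀ n, ∃ τ ∈ T, len τ = n ∧ L τ < R τ) : ∃ Z ∈ S, IsPath S T Z := by
  have := Fact.mk hTS
  have := isDef_comp₁ hL
  have := isDef_comp₁ hR
  -- the largest mass `B` that occurs on all levels
  obtain ⟨B, hB₀, hB, hB'⟩ : ∃ B : M, 0 < B ∧ (∀ n, ∃ τ ∈ T, len τ = n ∧ L τ + B ≤ R τ) ∧
      ∃ n, ∀ τ ∈ T, len τ = n → ¬ L τ + (B + 1) ≤ R τ := by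
    by_contra! hcon
    have hsig : IsSigma S (fun e : ℕ → M => ¬ ∀ n, ∃ τ, τ < pw (n + 1) ∧ τ ∈ T ∧ len τ = n ∧
        L τ + (e 0 + 1) ≤ R τ) :=
      IsSigma.congr (P := fun e => ∃ n, ¬ ∃ τ, τ < pw (n + 1) ∧ τ ∈ T ∧ len τ = n ∧
        L τ + (e 0 + 1) ≤ R τ) inferInstance fun e => not_forall
    have key : ∀ i n : M, ∃ τ, τ < pw (n + 1) ∧ τ ∈ T ∧ len τ = n ∧ L τ + (i + 1) ≤ R τ := by
      refine pi_induction S (fun n => ?_) fun i ih n => ?_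
      · obtain ⟨τ, hτ, hlen, hlt⟩ := hpos n
        exact ⟨τ, hlen ▸ lt_pw_len S τ, hτ, hlen, by rw [zero_add]; exact succ_le_of_lt hlt⟩
      · obtain ⟨τ, hτ, hlen, hle⟩ := hcon (i + 1) (succ_pos' i)
          (fun n => (ih n).imp fun τ hτ => hτ.2) n
        exact ⟨τ, hlen ▸ lt_pw_len S τ, hτ, hlen, hle⟩
    obtain ⟨τ, -, hτ, hlen, hle⟩ := key (R 1) 0
    have h1 : τ = 1 := by
      have h₁ := pw_len_le S (hT.1 τ hτ)
      have h₂ := lt_pw_len S τ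
      rw [hlen, pw_zero S] at h₁
      rw [hlen, pw_succ S, pw_zero S] at h₂
      exact le_antisymm (le_of_lt_succ h₂) h₁
    rw [h1] at hle
    exact absurd ((lt_succ_self (R 1)).trans_le (le_add_self.trans hle)) (lt_irrefl _)
  obtain ⟨n₀, hn₀⟩ := hB'
  have hmax : ∀ τ ∈ T, n₀ ≤ len τ → ¬ L τ + (B + 1) ≤ R τ := by
    intro τ hτ hlen hle
    obtain ⟨d, hd⟩ := exists_add_of_le hlen
    have hd' : d ≤ len τ := hd ▸ le_add_self
    have h₁ := h.le_drop hL hR (hT.1 τ hτ) hd'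
    have h₂ := len_drop S (hT.1 τ hτ) hd'
    rw [hd] at h₂
    exact hn₀ _ (hT.drop_mem hTS hτ hd') (add_right_cancel h₂)
      ((add_le_add h₁.1 le_rfl).trans (hle.trans h₁.2))
  obtain ⟨T', hT'⟩ : ∃ T' : M → Prop, T' = fun τ => τ ∈ T ∧ L τ + B ≤ R τ := ⟨_, rfl⟩
  have hT'd : IsDelta S (fun e => T' (e 0)) := by
    rw [hT']
    infer_instance
  have := isDelta_comp₁ hT'd
  have hT'T : ∀ {τ}, T' τ → τ ∈ T := fun hτ => by
    rw [hT'] at hτ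
    exact hτ.1
  have hdrop : ∀ {τ d}, T' τ → d ≤ len τ → T' (drop d τ) := by
    intro τ d hτ hd
    have h₁ := h.le_drop hL hR (hT.1 τ (hT'T hτ)) hd
    rw [hT'] at hτ ⊢
    exact ⟨hT.drop_mem hTS hτ.1 hd, (add_le_add h₁.1 le_rfl).trans (hτ.2.trans h₁.2)⟩
  have hsplit : ∀ π, π ≠ 0 → n₀ ≤ len π → T' π → T' (π + π) → T' (π + π + 1) → False := by
    intro π hπ hlen h₀ h₁ h₂
    have h₃ := hmax π (hT'T h₀) hlen
    rw [hT'] at h₁ h₂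
    refine h₃ ?_
    have h₄ := h₁.2
    have h₅ := h₂.2
    rw [h.left π hπ, h.middle π hπ] at h₄
    rw [h.right π hπ] at h₅
    calc L π + (B + 1) ≤ L π + (B + B) := by
          gcongr
          simpa using succ_le_of_lt hB₀
      _ = L π + B + B := (add_assoc _ _ _).symm
      _ ≤ _ := (add_le_add h₄ le_rfl).trans h₅
  -- a string on the level `n₀` with extensions of mass `B` on all levels
  obtain ⟨ρ, hρ⟩ : ∃ ρ, ∀ n, ∃ τ, T' τ ∧ len τ = n₀ + n ∧ drop n τ = ρ := by
    by_contra! hcon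
    have hcon' : ∀ ρ, ∃ n, ∀ τ, τ < pw (n₀ + n + 1) → T' τ → len τ = n₀ + n → ¬ drop n τ = ρ :=
      fun ρ => (hcon ρ).imp fun n hn τ _ => hn τ
    obtain ⟨w, hw, hw'⟩ := exists_isDef₁ S (P := fun n ρ => ∀ τ, τ < pw (n₀ + n + 1) → T' τ →
      len τ = n₀ + n → ¬ drop n τ = ρ) hcon'
    obtain ⟨N, hN⟩ := exists_upper_bound hw (pw (n₀ + 1))
    obtain ⟨τ, hτ, hlen, hle⟩ := hB (n₀ + N)
    have hτ' : T' τ := by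
      rw [hT']
      exact ⟨hτ, hle⟩
    have h0 := hT.1 τ hτ
    have hN' : N ≤ len τ := hlen ▸ le_add_self
    have h₁ := len_drop S h0 hN'
    rw [hlen] at h₁
    have h₂ := lt_pw_len S (drop N τ)
    rw [add_right_cancel h₁] at h₂
    obtain ⟨d, hd⟩ := exists_add_of_le (hN _ h₂)
    have hd' : d ≤ len τ := (hd ▸ le_add_self : d ≤ N).trans hN'
    have h₃ := len_drop S h0 hd'
    have h₄ : len (drop d τ) = n₀ + w (drop N τ) := by
      have h₅ : n₀ + N = n₀ + w (drop N τ) + d := by rw [add_assoc, ← hd]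
      rw [hlen, h₅] at h₃
      exact add_right_cancel h₃
    refine hw' (drop N τ) (drop d τ) (by rw [← h₄]; exact lt_pw_len S _) (hdrop hτ' hd') h₄ ?_
    rw [drop_drop S, add_comm, ← hd]
  have huniq : ∀ n : M, ∀ τ, τ < pw (n₀ + n + 1) → ∀ τ', τ' < pw (n₀ + n + 1) →
      T' τ ∧ len τ = n₀ + n ∧ drop n τ = ρ → T' τ' ∧ len τ' = n₀ + n ∧ drop n τ' = ρ → τ = τ' := by
    refine delta_induction S ?_ ?_
    · rintro τ - τ' - ⟨-, -, h₁⟩ ⟨-, -, h₂⟩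
      rw [drop_zero S] at h₁ h₂
      rw [h₁, h₂]
    · rintro n ih τ - τ' - ⟨h₁, h₂, h₃⟩ ⟨h₁', h₂', h₃'⟩
      have hone : ∀ {τ}, T' τ → len τ = n₀ + (n + 1) → 1 ≤ len τ := fun _ h' => by
        rw [h', ← add_assoc]
        exact le_add_self
      have hlen : ∀ {τ}, T' τ → len τ = n₀ + (n + 1) → len (drop 1 τ) = n₀ + n := fun hτ h' => by
        have := len_drop S (hT.1 _ (hT'T hτ)) (hone hτ h')
        rw [h', ← add_assoc] at this
        exact add_right_cancel this
      have key : drop 1 τ = drop 1 τ' := by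
        refine ih _ ?_ _ ?_ ⟨hdrop h₁ (hone h₁ h₂), hlen h₁ h₂, ?_⟩
          ⟨hdrop h₁' (hone h₁' h₂'), hlen h₁' h₂', ?_⟩
        · rw [← hlen h₁ h₂]
          exact lt_pw_len S _
        · rw [← hlen h₁' h₂']
          exact lt_pw_len S _
        · rw [drop_drop S, add_comm, h₃]
        · rw [drop_drop S, add_comm, h₃']
      have hne := drop_ne_zero S (hT.1 _ (hT'T h₁)) (hone h₁ h₂)
      have hmem := hdrop h₁ (hone h₁ h₂)
      have hlev : n₀ ≤ len (drop 1 τ) := by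
        rw [hlen h₁ h₂]
        exact le_self_add
      have h₄ := eq_double_drop S τ
      have h₅ := eq_double_drop S τ'
      rw [← key] at h₅
      generalize drop 1 τ = π at *
      rcases h₄ with h₄ | h₄ <;> rcases h₅ with h₅ | h₅
      · rw [h₄, h₅]
      · exact (hsplit π hne hlev hmem (h₄ ▸ h₁) (h₅ ▸ h₁')).elim
      · exact (hsplit π hne hlev hmem (h₅ ▸ h₁') (h₄ ▸ h₁)).elim
      · rw [h₄, h₅]
  obtain ⟨b, hb, hb'⟩ := exists_isDef₁ S
    (P := fun τ n => T' τ ∧ len τ = n₀ + n ∧ drop n τ = ρ) hρ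
  have := isDef_comp₁ hb
  have hbdrop : ∀ n, drop 1 (b (n + 1)) = b n := by
    intro n
    obtain ⟨h₁, h₂, h₃⟩ := hb' (n + 1)
    obtain ⟨h₁', h₂', h₃'⟩ := hb' n
    have hone : 1 ≤ len (b (n + 1)) := by
      rw [h₂, ← add_assoc]
      exact le_add_self
    have h₄ := len_drop S (hT.1 _ (hT'T h₁)) hone
    rw [h₂, ← add_assoc] at h₄
    have h₅ := add_right_cancel h₄
    refine huniq n _ ?_ _ ?_ ⟨hdrop h₁ hone, h₅, ?_⟩ (hb' n)
    · rw [← h₅]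
      exact lt_pw_len S _
    · rw [← h₂']
      exact lt_pw_len S _
    · rw [drop_drop S, add_comm, h₃]
  refine exists_path_of_branch (c := fun n => drop n₀ (b n)) inferInstance ?_ (fun n => ?_)
    fun n => ?_
  · obtain ⟨h₁, h₂, -⟩ := hb' 0
    rw [add_zero] at h₂
    have h0 := hT.1 _ (hT'T h₁)
    have h₃ := len_drop S h0 (d := n₀) h₂.ge
    rw [h₂] at h₃
    have h₃ : len (drop n₀ (b 0)) = 0 := add_right_cancel (h₃.trans (zero_add _).symm)
    have h₄ := pw_len_le S (drop_ne_zero S h0 (d := n₀) h₂.ge)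
    have h₅ := lt_pw_len S (drop n₀ (b 0))
    rw [h₃, pw_zero S] at h₄
    rw [h₃, pw_succ S, pw_zero S] at h₅
    exact le_antisymm (le_of_lt_succ h₅) h₄
  · rw [← hbdrop n, drop_drop S, drop_drop S, add_comm]
  · obtain ⟨h₁, h₂, -⟩ := hb' n
    exact hT.drop_mem hTS (hT'T h₁) (h₂ ▸ le_self_add)

/-- A tree has a path if, for every string `σ`, there are masses such that the maximal length of
the extensions of `σ` is, if it exists and is not small, witnessed by a string of positive mass. -/
theorem exists_path_of_masses [Model S] (hT : IsBinTree T) (hTS : T ∈ S) (hinf : IsInfinite T)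
    {L R : M → M → M} (h : ∀ σ, IsMass (L σ) (R σ)) (hL : IsDef S (fun e => L (e 0) (e 1)))
    (hR : IsDef S (fun e => R (e 0) (e 1)))
    (hdeath : ∀ σ s, σ < s → Ext T σ s → ¬ Ext T σ (s + 1) →
      ∃ τ ∈ T, s ≤ len τ ∧ L σ τ < R σ τ) : ∃ Z ∈ S, IsPath S T Z := by
  have := Fact.mk hTS
  have := isDef_comp₂ hL
  have := isDef_comp₂ hR
  by_cases hcase : ∀ σ, ∃ n, ∀ τ, τ < pw (n + 1) → τ ∈ T → len τ = n → ¬ L σ τ < R σ τ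
  · obtain ⟨w, hw, hw'⟩ := exists_isDef₁ S (P := fun n σ => ∀ τ, τ < pw (n + 1) → τ ∈ T →
      len τ = n → ¬ L σ τ < R σ τ) hcase
    refine exists_path_of_decidable hT hTS hinf hw fun σ s hσ hs hext => ?_
    by_contra hnext
    obtain ⟨τ, hτ, hlen, hlt⟩ := hdeath σ s hσ hext hnext
    obtain ⟨d, hd⟩ := exists_add_of_le (hs.trans hlen)
    have hd' : d ≤ len τ := hd ▸ le_add_self
    have h₁ := (h σ).le_drop (S := S) inferInstance inferInstance (hT.1 τ hτ) hd'
    have h₂ := len_drop S (hT.1 τ hτ) hd'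
    rw [hd] at h₂
    have h₃ := add_right_cancel h₂
    refine hw' σ _ ?_ (hT.drop_mem hTS hτ hd') h₃ (h₁.1.trans_lt (hlt.trans_le h₁.2))
    rw [← h₃]
    exact lt_pw_len S _
  · push Not at hcase
    obtain ⟨σ, hσ⟩ := hcase
    refine exists_path_of_mass hT hTS (h σ) (S := S) inferInstance inferInstance fun n => ?_
    obtain ⟨τ, -, hτ, hlen, hlt⟩ := hσ n
    exact ⟨τ, hτ, hlen, hlt⟩

end Paths

/-! ### Sawtooth functions -/

section Sawtooth

variable {M : Type u} [Numbers M] {S : Set (Set M)}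

/-- The distance from `x` to the nearest integer, for `x ≥ 0`. -/
noncomputable def tooth (x : Q M) : Q M := min (x - toQ (floorQ x)) (toQ (floorQ x) + 1 - x)

instance IsDefQ.tooth [Model S] {F : (ℕ → M) → Q M} [hF : IsDefQ S F] :
    IsDefQ S (fun e => tooth (F e)) := by
  unfold SOA.tooth
  infer_instance

theorem tooth_nonneg (S : Set (Set M)) [Model S] {x : Q M} (hx : 0 ≤ x) : 0 ≤ tooth x :=
  le_min (sub_nonneg.2 (floorQ_le S hx)) (sub_nonneg.2 (lt_floorQ_add_one S x).le)

theorem tooth_le (x : Q M) : tooth x ≤ 1 / 2 := by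
  have h₁ : tooth x ≤ x - toQ (floorQ x) := min_le_left _ _
  have h₂ : tooth x ≤ toQ (floorQ x) + 1 - x := min_le_right _ _
  linarith

theorem tooth_toQ (S : Set (Set M)) [Model S] (n : M) : tooth (toQ n) = 0 := by
  rw [tooth, floorQ_eq S le_rfl (lt_add_one _), sub_self]
  exact min_eq_left (by linarith)

theorem tooth_of_le_half (S : Set (Set M)) [Model S] {n : M} {x : Q M} (h : toQ n ≤ x)
    (h' : x ≤ toQ n + 1 / 2) : tooth x = x - toQ n := by
  rw [tooth, floorQ_eq S h (by linarith)]
  exact min_eq_left (by linarith)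

theorem tooth_of_half_le (S : Set (Set M)) [Model S] {n : M} {x : Q M} (h : toQ n + 1 / 2 ≤ x)
    (h' : x ≤ toQ n + 1) : tooth x = toQ n + 1 - x := by
  rcases h'.lt_or_eq with hlt | rfl
  · rw [tooth, floorQ_eq S (by linarith) hlt]
    exact min_eq_right (by linarith)
  · have := tooth_toQ S (n + 1)
    rw [map_add, map_one] at this
    rw [this, sub_self]

/-- The width of the interval that carries the sawtooth number `s` is `2 ^ (-level s)`. -/
def level (s : M) : M := (s + 1) * (s + 1)

/-- The teeth of the sawtooth number `s` have the width `1 / mesh s`. -/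
noncomputable def mesh (s : M) : M := pw ((s + 1) * (s + 1 + 1)) * fac s

instance IsDef.level {f : (ℕ → M) → M} [hf : IsDef S f] : IsDef S (fun e => level (f e)) := by
  unfold SOA.level
  infer_instance

instance IsDef.mesh [Model S] {f : (ℕ → M) → M} [hf : IsDef S f] :
    IsDef S (fun e => mesh (f e)) := by
  unfold SOA.mesh
  infer_instance

theorem mesh_pos (S : Set (Set M)) [Model S] (s : M) : 0 < mesh s :=
  mul_pos (pw_pos S _) (fac_pos S s)

theorem mesh_eq (S : Set (Set M)) [Model S] (s : M) :
    mesh s = pw (s + 1) * fac s * pw (level s) := by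
  have : (s + 1) * (s + 1 + 1) = level s + (s + 1) := by
    unfold level
    ring
  rw [mesh, this, pw_add S]
  ring

theorem exists_mesh_eq (S : Set (Set M)) [Model S] {r s : M} (h : r < s) :
    ∃ d, mesh s = d * (mesh r + mesh r) := by
  obtain ⟨d, rfl⟩ := exists_add_of_le (succ_le_of_lt h)
  obtain ⟨c, hc⟩ := fac_dvd_fac S (h.le)
  have : (r + 1 + d + 1) * (r + 1 + d + 1 + 1) =
      (r + 1) * (r + 1 + 1) + 1 + (r + r + 1 + 1 + 1 + (r + r + 1 + 1 + 1 + 1 + 1 + d) * d) := by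
    ring
  refine ⟨pw (r + r + 1 + 1 + 1 + (r + r + 1 + 1 + 1 + 1 + 1 + d) * d) * c, ?_⟩
  rw [mesh, mesh, this, pw_add S, pw_succ S, hc]
  ring

/-- Data for a sum of sawtooth functions: the sawtooth number `s` lives on the interval of the
length `2 ^ (-level s)` with the left end `place s * 2 ^ (-level s)` and rises by `mass s / 2` in
total. -/
structure IsSaw (S : Set (Set M)) (mass : M → Q M) (place : M → M) : Prop where
  mass_def : IsDefQ S (fun e => mass (e 0))
  place_def : IsDef S (fun e => place (e 0))
  nonneg : ∀ s, 0 ≤ mass s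
  sum_le : ∀ n, sumQ n mass ≤ 2
  lt : ∀ s, place s < pw (level s)

variable (mass : M → Q M) (place : M → M)

/-- The slope of the teeth of the sawtooth number `s`. -/
noncomputable def slope (s : M) : Q M := mass s * toQ (pw (level s))

/-- The left end of the interval that carries the sawtooth number `s`. -/
noncomputable def left (s : M) : Q M := toQ (place s) * tw (level s)

open Classical in
/-- The sawtooth function number `s`. -/
noncomputable def saw (s : M) (x : Q M) : Q M :=
  if left place s ≤ x ∧ x ≤ left place s + tw (level s) then
    slope mass s / toQ (mesh s) * tooth (toQ (mesh s) * x) else 0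

/-- The variation on `[0, x]` of the sawtooth function number `s`. -/
noncomputable def sawVar (s : M) (x : Q M) : Q M :=
  slope mass s * max 0 (min (x - left place s) (tw (level s)))

/-- The sum of the first `n` sawtooth functions. -/
noncomputable def sawSum (n : M) (x : Q M) : Q M := sumQ n (fun r => saw mass place r x)

/-- The sum of all sawtooth functions at a rational point; only finitely many of them contribute. -/
noncomputable def sawLim (x : Q M) : Q M := sawSum mass place (qcode x + 1) x

variable {mass place}

theorem isDefQ_slope [Model S] (h : IsSaw S mass place) (f : (ℕ → M) → M) [hf : IsDef S f] :
    IsDefQ S (fun e => slope mass (f e)) := by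
  have := isDefQ_comp₁ h.mass_def
  unfold slope
  infer_instance

theorem isDefQ_left [Model S] (h : IsSaw S mass place) (f : (ℕ → M) → M) [hf : IsDef S f] :
    IsDefQ S (fun e => left place (f e)) := by
  have := isDef_comp₁ h.place_def
  unfold left
  infer_instance

theorem isDefQ_saw [Model S] (h : IsSaw S mass place) (f : (ℕ → M) → M) (F : (ℕ → M) → Q M)
    [hf : IsDef S f] [hF : IsDefQ S F] : IsDefQ S (fun e => saw mass place (f e) (F e)) := by
  have := isDefQ_slope h
  have := isDefQ_left h
  unfold saw
  infer_instance

theorem isDefQ_sawVar [Model S] (h : IsSaw S mass place) (f : (ℕ → M) → M) (F : (ℕ → M) → Q M)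
    [hf : IsDef S f] [hF : IsDefQ S F] : IsDefQ S (fun e => sawVar mass place (f e) (F e)) := by
  have := isDefQ_slope h
  have := isDefQ_left h
  unfold sawVar
  infer_instance

theorem isDefQ_sawSum [Model S] (h : IsSaw S mass place) (f : (ℕ → M) → M) (F : (ℕ → M) → Q M)
    [hf : IsDef S f] [hF : IsDefQ S F] : IsDefQ S (fun e => sawSum mass place (f e) (F e)) := by
  have := isDefQ_saw h
  have := hF.comp (σ := fun e n => e (n + 1)) (fun i => .var (i + 1))
  unfold sawSum
  infer_instance

theorem isDefQ_sawLim [Model S] (h : IsSaw S mass place) (F : (ℕ → M) → Q M)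
    [hF : IsDefQ S F] : IsDefQ S (fun e => sawLim mass place (F e)) :=
  isDefQ_sawSum h _ _

theorem IsSaw.slope_nonneg [Model S] (h : IsSaw S mass place) (s : M) : 0 ≤ slope mass s :=
  mul_nonneg (h.nonneg s) (toQ_nonneg _)

theorem slope_mul_tw (S : Set (Set M)) [Model S] (s : M) :
    slope mass s * tw (level s) = mass s := by
  have := (toQ_pos.2 (pw_pos S (level s))).ne'
  rw [slope, tw, mul_assoc, mul_inv_cancel₀ this, mul_one]

theorem IsSaw.mass_le [Model S] (h : IsSaw S mass place) (s : M) : mass s ≤ 2 := by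
  have h₁ := h.sum_le (s + 1)
  rw [sumQ_succ h.mass_def] at h₁
  linarith [sumQ_nonneg h.mass_def s fun i _ => h.nonneg i]

theorem saw_of_int (S : Set (Set M)) [Model S] {s n : M} {x : Q M}
    (hx : toQ (mesh s) * x = toQ n) : saw mass place s x = 0 := by
  rw [saw, hx, tooth_toQ S, mul_zero, ite_self]

/-- The ends of the interval that carries a sawtooth function are multiples of the width of the
teeth. -/
theorem exists_mesh_mul_left (S : Set (Set M)) [Model S] (place : M → M) (s : M) : ∃ A C : M,
    toQ (mesh s) * left place s = toQ A ∧ toQ (mesh s) * tw (level s) = toQ C := by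
  have := (toQ_pos.2 (pw_pos S (level s))).ne'
  refine ⟨place s * (pw (s + 1) * fac s), pw (s + 1) * fac s, ?_, ?_⟩ <;>
    rw [mesh_eq S, map_mul _ _ (pw (level s))]
  · rw [left, tw, map_mul _ (place s)]
    field_simp
  · rw [tw, mul_assoc, mul_inv_cancel₀ this, mul_one]

/-- On every cell of its mesh, a sawtooth function either is zero or consists of one tooth. -/
theorem saw_cell (S : Set (Set M)) [Model S] (mass : M → Q M) (place : M → M) (s n : M) :
    (∀ x, toQ n ≤ toQ (mesh s) * x → toQ (mesh s) * x ≤ toQ n + 1 → saw mass place s x = 0) ∨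
    ∀ x, toQ n ≤ toQ (mesh s) * x → toQ (mesh s) * x ≤ toQ n + 1 →
      left place s ≤ x ∧ x ≤ left place s + tw (level s) := by
  have hB := toQ_pos.2 (mesh_pos S s)
  obtain ⟨A, C, hA, hC⟩ := exists_mesh_mul_left S place s
  rcases lt_or_ge n A with h₁ | h₁
  · refine Or.inl fun x hx hx' => ?_
    by_cases hl : left place s ≤ x
    · have h₂ := mul_le_mul_of_nonneg_left hl hB.le
      rw [hA] at h₂
      have h₃ := toQ_le.2 (succ_le_of_lt h₁)
      rw [map_add, map_one] at h₃
      exact saw_of_int S (n := A) (by linarith)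
    · exact if_neg fun h => hl h.1
  rcases lt_or_ge n (A + C) with h₂ | h₂
  · refine Or.inr fun x hx hx' => ?_
    have h₃ := toQ_le.2 h₁
    have h₄ := toQ_le.2 (succ_le_of_lt h₂)
    rw [map_add, map_add, map_one] at h₄
    constructor
    · refine le_of_mul_le_mul_left ?_ hB
      linarith
    · refine le_of_mul_le_mul_left ?_ hB
      rw [mul_add]
      linarith
  · refine Or.inl fun x hx hx' => ?_
    by_cases hl : x ≤ left place s + tw (level s)
    · have h₃ := mul_le_mul_of_nonneg_left hl hB.le
      rw [mul_add, hA, hC] at h₃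
      have h₄ := toQ_le.2 h₂
      rw [map_add] at h₄
      exact saw_of_int S (n := A + C) (by rw [map_add]; linarith)
    · exact if_neg fun h => hl h.2

theorem IsSaw.sawVar_sub [Model S] (h : IsSaw S mass place) (s : M) {x y : Q M} (hxy : x ≤ y) :
    0 ≤ sawVar mass place s y - sawVar mass place s x ∧
      sawVar mass place s y - sawVar mass place s x ≤ slope mass s * (y - x) := by
  have hs := h.slope_nonneg s
  rw [sawVar, sawVar, ← mul_sub]
  refine ⟨mul_nonneg hs ?_, mul_le_mul_of_nonneg_left ?_ hs⟩
  · rw [sub_nonneg]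
    gcongr
  · generalize left place s = l
    have := tw_pos S (level s)
    generalize tw (level s) = w at *
    simp only [max_def, min_def]
    split_ifs <;> linarith

/-- On every half of a cell of its mesh, a sawtooth function is affine. -/
theorem IsSaw.saw_half_cell [Model S] (h : IsSaw S mass place) {s k : M} {x y : Q M} (hxy : x ≤ y)
    (hx : toQ k ≤ 2 * (toQ (mesh s) * x)) (hy : 2 * (toQ (mesh s) * y) ≤ toQ k + 1) :
    ∃ β, |β| * (y - x) ≤ sawVar mass place s y - sawVar mass place s x ∧
      ∀ z, x ≤ z → z ≤ y → saw mass place s z = saw mass place s x + β * (z - x) := by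
  have hB := toQ_pos.2 (mesh_pos S s)
  have hle : ∀ {a b}, a ≤ b → toQ (mesh s) * a ≤ toQ (mesh s) * b := fun h =>
    mul_le_mul_of_nonneg_left h hB.le
  obtain ⟨n, hn⟩ : ∃ n, k = n + n ∨ k = n + n + 1 := ⟨_, eq_double_drop S k⟩
  have hk : toQ k = 2 * toQ n ∨ toQ k = 2 * toQ n + 1 := by
    rcases hn with rfl | rfl
    · left
      rw [map_add]
      ring
    · right
      rw [map_add, map_add, map_one]
      ring
  have hcell : ∀ z, x ≤ z → z ≤ y → toQ n ≤ toQ (mesh s) * z ∧ toQ (mesh s) * z ≤ toQ n + 1 := by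
    intro z h₁ h₂
    have h₃ := hle h₁
    have h₄ := hle h₂
    rcases hk with hk | hk <;> rw [hk] at hx hy <;> constructor <;> linarith
  rcases saw_cell S mass place s n with h₁ | h₁
  · refine ⟨0, ?_, fun z hz hz' => ?_⟩
    · rw [abs_zero, zero_mul]
      exact (h.sawVar_sub s hxy).1
    · rw [h₁ z (hcell z hz hz').1 (hcell z hz hz').2,
        h₁ x (hcell x le_rfl hxy).1 (hcell x le_rfl hxy).2]
      ring
  · have h₂ : ∀ z, x ≤ z → z ≤ y → left place s ≤ z ∧ z ≤ left place s + tw (level s) :=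
      fun z hz hz' => h₁ z (hcell z hz hz').1 (hcell z hz hz').2
    have hvar : ∀ z, x ≤ z → z ≤ y → sawVar mass place s z = slope mass s * (z - left place s) := by
      intro z hz hz'
      have := h₂ z hz hz'
      rw [sawVar, min_eq_left (by linarith), max_eq_right (by linarith)]
    have hsaw : ∀ z, x ≤ z → z ≤ y → saw mass place s z =
        slope mass s / toQ (mesh s) * tooth (toQ (mesh s) * z) := fun z hz hz' =>
      if_pos (h₂ z hz hz')
    have habs : |slope mass s| * (y - x) = sawVar mass place s y - sawVar mass place s x := by
      rw [hvar y hxy le_rfl, hvar x le_rfl hxy, abs_of_nonneg (h.slope_nonneg s)]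
      ring
    have hB' := hB.ne'
    rcases hk with hk | hk
    · refine ⟨slope mass s, habs.le, fun z hz hz' => ?_⟩
      have htooth : ∀ z, x ≤ z → z ≤ y → tooth (toQ (mesh s) * z) = toQ (mesh s) * z - toQ n :=
        fun z hz hz' => tooth_of_le_half S (hcell z hz hz').1 (by linarith [hle hz'])
      rw [hsaw z hz hz', hsaw x le_rfl hxy, htooth z hz hz', htooth x le_rfl hxy]
      field_simp
      ring
    · refine ⟨-slope mass s, by rw [abs_neg]; exact habs.le, fun z hz hz' => ?_⟩
      have htooth : ∀ z, x ≤ z → z ≤ y → tooth (toQ (mesh s) * z) = toQ n + 1 - toQ (mesh s) * z :=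
        fun z hz hz' => tooth_of_half_le S (by linarith [hle hz]) (hcell z hz hz').2
      rw [hsaw z hz hz', hsaw x le_rfl hxy, htooth z hz hz', htooth x le_rfl hxy]
      field_simp
      ring

theorem IsSaw.saw_nonneg [Model S] (h : IsSaw S mass place) (s : M) {x : Q M} (hx : 0 ≤ x) :
    0 ≤ saw mass place s x := by
  rw [saw]
  split_ifs
  · exact mul_nonneg (div_nonneg (h.slope_nonneg s) (toQ_nonneg _))
      (tooth_nonneg S (mul_nonneg (toQ_nonneg _) hx))
  · exact le_rfl

theorem IsSaw.saw_le [Model S] (h : IsSaw S mass place) (s : M) (x : Q M) :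
    saw mass place s x ≤ tw (s + 1) := by
  have htw := tw_pos S (s + 1)
  rw [saw]
  split_ifs
  · have hB := toQ_pos.2 (mesh_pos S s)
    have h₁ : slope mass s / toQ (mesh s) ≤ 2 * tw (s + 1) := by
      have hpw := toQ_pos.2 (pw_pos S (level s))
      have hpw' := (toQ_pos.2 (pw_pos S (s + 1))).ne'
      rw [div_le_iff₀ hB, slope, mesh_eq S, map_mul, map_mul, tw]
      have h₂ : (1 : Q M) ≤ toQ (fac s) := by
        rw [← map_one toQ, toQ_le]
        have := succ_le_of_lt (fac_pos S s)
        rwa [zero_add] at this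
      have h₃ : 2 * (toQ (pw (s + 1)))⁻¹ * (toQ (pw (s + 1)) * toQ (fac s) * toQ (pw (level s))) =
          2 * toQ (fac s) * toQ (pw (level s)) := by
        field_simp
      rw [h₃]
      refine mul_le_mul_of_nonneg_right ?_ hpw.le
      linarith [h.mass_le s]
    have h₂ := mul_le_mul h₁ (tooth_le (toQ (mesh s) * x)) ?_ (by linarith)
    · linarith
    · by_contra! hlt
      rename_i hx
      have := tooth_nonneg S (x := toQ (mesh s) * x) (mul_nonneg hB.le
        ((mul_nonneg (toQ_nonneg _) (tw_pos S _).le).trans hx.1))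
      linarith
  · exact htw.le

end Sawtooth

/-! ### Sums of sawtooth functions -/

section SawSum

open Filter

variable {M : Type u} [Numbers M] {S : Set (Set M)} {mass : M → Q M} {place : M → M}

theorem IsSaw.sawSum_succ [Model S] (h : IsSaw S mass place) (n : M) (x : Q M) :
    sawSum mass place (n + 1) x = sawSum mass place n x + saw mass place n x := by
  have := isDefQ_saw h
  exact sumQ_succ (S := S) inferInstance n

theorem IsSaw.sawSum_sub [Model S] (h : IsSaw S mass place) {m n : M} (hmn : m ≤ n) {x : Q M}
    (hx : 0 ≤ x) : 0 ≤ sawSum mass place n x - sawSum mass place m x ∧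
      sawSum mass place n x - sawSum mass place m x ≤ tw m - tw n := by
  have := isDefQ_sawSum h
  obtain ⟨d, rfl⟩ := exists_add_of_le hmn
  refine delta_induction S (P := fun d =>
    0 ≤ sawSum mass place (m + d) x - sawSum mass place m x ∧
      sawSum mass place (m + d) x - sawSum mass place m x ≤ tw m - tw (m + d)) ?_ (fun d ih => ?_) d
  · rw [add_zero]
    simp
  · have h₁ := h.saw_nonneg (m + d) hx
    have h₂ := h.saw_le (m + d) x
    have h₃ := tw_succ S (m + d)
    rw [← add_assoc, h.sawSum_succ]
    constructor <;> linarith [ih.1, ih.2]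

theorem IsSaw.sawSum_eq_of_zero [Model S] (h : IsSaw S mass place) {m n : M} (hmn : m ≤ n) {x : Q M}
    (hx : ∀ u, m ≤ u → saw mass place u x = 0) :
    sawSum mass place n x = sawSum mass place m x := by
  have := isDefQ_sawSum h
  obtain ⟨d, rfl⟩ := exists_add_of_le hmn
  refine delta_induction S (P := fun d => sawSum mass place (m + d) x = sawSum mass place m x) ?_
    (fun d ih => ?_) d
  · rw [add_zero]
  · rw [← add_assoc, h.sawSum_succ, ih, hx _ le_self_add, add_zero]

theorem IsSaw.sawLim_eq [Model S] (h : IsSaw S mass place) {x : Q M} (h₀ : 0 ≤ x) {n : M}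
    (hn : qcode x + 1 ≤ n) : sawSum mass place n x = sawLim mass place x := by
  refine h.sawSum_eq_of_zero hn fun u hu => ?_
  obtain ⟨i, hi⟩ := exists_eq_div_fac S (c := qcode x) (n := u) ((lt_succ_self _).trans_le hu)
    (by rwa [qdec_qcode S])
  rw [qdec_qcode S] at hi
  refine saw_of_int S (n := pw ((u + 1) * (u + 1 + 1)) * i) ?_
  have := (toQ_pos.2 (fac_pos S u)).ne'
  rw [hi, mesh, map_mul _ _ (fac u), map_mul _ _ i]
  field_simp

/-- The points of the half mesh are zeros of all finer sawtooth functions. -/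
theorem IsSaw.sawLim_eq_of_int [Model S] (h : IsSaw S mass place) {s k : M} {x : Q M} (h₀ : 0 ≤ x)
    (hx : 2 * (toQ (mesh s) * x) = toQ k) : sawLim mass place x = sawSum mass place (s + 1) x := by
  rw [← h.sawLim_eq h₀ (le_max_left _ (s + 1))]
  refine h.sawSum_eq_of_zero (le_max_right _ _) fun u hu => ?_
  obtain ⟨d, hd⟩ := exists_mesh_eq S ((lt_succ_self s).trans_le hu)
  refine saw_of_int S (n := d * k) ?_
  rw [hd, map_mul, map_add, map_mul, ← hx]
  ring

theorem exists_half_cell (S : Set (Set M)) [Model S] {r s n : M} (hrs : r < s) {x y : Q M}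
    (hx : toQ n ≤ toQ (mesh s) * x) (hy : toQ (mesh s) * y ≤ toQ n + 1) :
    ∃ k, toQ k ≤ 2 * (toQ (mesh r) * x) ∧ 2 * (toQ (mesh r) * y) ≤ toQ k + 1 := by
  obtain ⟨d, hd⟩ := exists_mesh_eq S hrs
  have hd₀ : 0 < d := by
    rw [pos_iff_ne_zero]
    rintro rfl
    rw [zero_mul] at hd
    exact (mesh_pos S s).ne' hd
  have h₁ := toQ_le.2 (quo_mul_le (S := S) n hd₀)
  have h₂ := toQ_le.2 (succ_le_of_lt (lt_quo_succ_mul (S := S) n hd₀))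
  have hd' := toQ_pos.2 hd₀
  rw [map_mul] at h₁
  rw [map_mul, map_add, map_add, map_one] at h₂
  rw [hd, map_mul, map_add] at hx hy
  refine ⟨quo n d, le_of_mul_le_mul_left ?_ hd', le_of_mul_le_mul_left ?_ hd'⟩ <;> linarith

/-- On the cells of the mesh of the next sawtooth function, a sum of sawtooth functions is
affine. -/
theorem IsSaw.sawSum_affine [Model S] (h : IsSaw S mass place) {s n : M} {x y z : Q M}
    (hx : toQ n ≤ toQ (mesh s) * x) (hy : toQ (mesh s) * y ≤ toQ n + 1) (hxz : x ≤ z) (hzy : z ≤ y) :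
    sawSum mass place s z * (y - x) =
      sawSum mass place s x * (y - z) + sawSum mass place s y * (z - x) := by
  have := isDefQ_sawSum h
  have key : ∀ m, m ≤ s → sawSum mass place m z * (y - x) =
      sawSum mass place m x * (y - z) + sawSum mass place m y * (z - x) := by
    refine delta_induction S (fun _ => ?_) fun m ih hm => ?_
    · have := isDefQ_saw h
      have h0 : ∀ x, sawSum mass place 0 x = 0 := fun x => sumQ_zero (S := S) inferInstance
      rw [h0, h0, h0]
      ring
    · have hm' := (lt_succ_self m).trans_le hm
      obtain ⟨k, hk, hk'⟩ := exists_half_cell S hm' hx hy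
      obtain ⟨β, -, hβ⟩ := h.saw_half_cell (hxz.trans hzy) hk hk'
      rw [h.sawSum_succ, h.sawSum_succ, h.sawSum_succ, hβ z hxz hzy, hβ y (hxz.trans hzy) le_rfl,
        add_mul, ih hm'.le]
      ring
  exact key s le_rfl

/-- On a cell of the mesh of the next sawtooth function, a sum of sawtooth functions varies no more
than the masses and the slopes allow. -/
theorem IsSaw.abs_sawSum_sub_le [Model S] (h : IsSaw S mass place) {s n : M} {x y : Q M}
    (hx : toQ n ≤ toQ (mesh s) * x) (hy : toQ (mesh s) * y ≤ toQ n + 1) (hxy : x ≤ y) :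
    |sawSum mass place s y - sawSum mass place s x| ≤
      sumQ s (fun r => sawVar mass place r y) - sumQ s (fun r => sawVar mass place r x) ∧
    sumQ s (fun r => sawVar mass place r y) - sumQ s (fun r => sawVar mass place r x) ≤
      sumQ s (slope mass) * (y - x) := by
  have := isDefQ_sawSum h
  have := isDefQ_sawVar h
  have := isDefQ_slope h
  have key : ∀ m, m ≤ s → |sawSum mass place m y - sawSum mass place m x| ≤
      sumQ m (fun r => sawVar mass place r y) - sumQ m (fun r => sawVar mass place r x) ∧
      sumQ m (fun r => sawVar mass place r y) - sumQ m (fun r => sawVar mass place r x) ≤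
        sumQ m (fun r => slope mass r) * (y - x) := by
    refine delta_induction S (fun _ => ?_) fun m ih hm => ?_
    · have := isDefQ_saw h
      have h0 : ∀ x, sawSum mass place 0 x = 0 := fun x => sumQ_zero (S := S) inferInstance
      rw [h0, h0, sumQ_zero (S := S) inferInstance, sumQ_zero (S := S) inferInstance,
        sumQ_zero (S := S) inferInstance]
      simp
    · have hm' := (lt_succ_self m).trans_le hm
      obtain ⟨k, hk, hk'⟩ := exists_half_cell S hm' hx hy
      obtain ⟨β, hβ', hβ⟩ := h.saw_half_cell hxy hk hk'
      rw [h.sawSum_succ, h.sawSum_succ, sumQ_succ (S := S) inferInstance,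
        sumQ_succ (S := S) inferInstance, sumQ_succ (S := S) inferInstance, hβ y hxy le_rfl]
      obtain ⟨h₁, h₂⟩ := ih hm'.le
      have h₃ := (h.sawVar_sub m hxy).2
      have h₄ : |β * (y - x)| ≤ sawVar mass place m y - sawVar mass place m x := by
        rwa [abs_mul, abs_of_nonneg (sub_nonneg.2 hxy)]
      rw [abs_le] at h₁ h₄ ⊢
      refine ⟨⟨?_, ?_⟩, ?_⟩ <;> linarith [h₁.1, h₁.2, h₄.1, h₄.2]
  exact key s le_rfl

/-! ### The sum of all sawtooth functions as a function of bounded variation -/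

/-- The finite sums of sawtooth functions as polygonal functions. -/
noncomputable def sawPoly (mass : M → Q M) (place : M → M) : PolygonSeq M where
  len := mesh
  node s i := qrep (toQ i / toQ (mesh s))
  height s i := qrep (sawSum mass place s (toQ i / toQ (mesh s)))

theorem sawPoly_X (S : Set (Set M)) [Model S] (s i : M) :
    (sawPoly mass place).X s i = toQ i / toQ (mesh s) := val_qrep S _

theorem sawPoly_H (S : Set (Set M)) [Model S] (s i : M) :
    (sawPoly mass place).H s i = sawSum mass place s (toQ i / toQ (mesh s)) := val_qrep S _

theorem IsSaw.isPolygonSeq [Model S] (h : IsSaw S mass place) :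
    IsPolygonSeq S (sawPoly mass place) := by
  have := isDefQ_sawSum h
  have hB : ∀ s : M, 0 < toQ (mesh s) := fun s => toQ_pos.2 (mesh_pos S s)
  refine ⟨isFun_iff.2 (IsDef.mesh (f := fun e => e 0)),
    isFun₂_qrep (F := fun s i => toQ i / toQ (mesh s)) inferInstance,
    isFun₂_qrep (F := fun s i => sawSum mass place s (toQ i / toQ (mesh s))) inferInstance,
    fun s => ?_, fun s => ?_, fun s i _ => ?_⟩
  · rw [← val_eq_val, val_zero]
    exact (sawPoly_X S s 0).trans (by rw [map_zero, zero_div])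
  · rw [← val_eq_val, val_one]
    exact (sawPoly_X S s (mesh s)).trans (div_self (hB s).ne')
  · rw [← val_lt_val]
    change (sawPoly mass place).X s i < (sawPoly mass place).X s (i + 1)
    rw [sawPoly_X S, sawPoly_X S, div_lt_div_iff_of_pos_right (hB s), toQ_lt]
    exact lt_succ_self i

theorem exists_cell (S : Set (Set M)) [Model S] {n : M} (hn : 0 < n) {x : Q M} (h₀ : 0 ≤ x)
    (h₁ : x ≤ 1) : ∃ i, i < n ∧ toQ i ≤ toQ n * x ∧ toQ n * x ≤ toQ i + 1 := by
  have hn' := toQ_pos.2 hn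
  rcases h₁.lt_or_eq with hlt | rfl
  · have h₂ := floorQ_le S (mul_nonneg hn'.le h₀)
    refine ⟨_, ?_, h₂, (lt_floorQ_add_one S _).le⟩
    rw [← toQ_lt]
    exact h₂.trans_lt (by nlinarith)
  · obtain ⟨m, rfl⟩ := (eq_zero_or_succ S n).resolve_left hn.ne'
    refine ⟨m, lt_succ_self m, ?_, ?_⟩ <;> rw [mul_one, map_add, map_one]
    linarith

theorem IsSaw.eval_eq [Model S] (h : IsSaw S mass place) (s : M) {x : Q M} (h₀ : 0 ≤ x)
    (h₁ : x ≤ 1) : (sawPoly mass place).eval s x = sawSum mass place s x := by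
  have hB := toQ_pos.2 (mesh_pos S s)
  obtain ⟨i, hi, h₂, h₃⟩ := exists_cell S (mesh_pos S s) h₀ h₁
  have hP := h.isPolygonSeq
  have hlt := sub_pos.2 (hP.X_lt (s := s) (i := i) hi)
  have h₄ : toQ i / toQ (mesh s) ≤ x := by rwa [div_le_iff₀' hB]
  have h₅ : x ≤ toQ (i + 1) / toQ (mesh s) := by rwa [le_div_iff₀' hB, map_add, map_one]
  have h₆ := hP.eval_eq (s := s) hi (a := x) (by rwa [sawPoly_X S]) (by rwa [sawPoly_X S])
  have h₇ := h.sawSum_affine (s := s) (n := i) (x := toQ i / toQ (mesh s))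
    (y := toQ (i + 1) / toQ (mesh s)) (z := x) (by rw [mul_div_cancel₀ _ hB.ne'])
    (by rw [mul_div_cancel₀ _ hB.ne', map_add, map_one]) h₄ h₅
  rw [sawPoly_X S, sawPoly_X S] at hlt
  rw [sawPoly_X S, sawPoly_X S, sawPoly_H S, sawPoly_H S, ← h₇] at h₆
  exact mul_right_cancel₀ hlt.ne' h₆

theorem IsSaw.isCauchyName [Model S] (h : IsSaw S mass place) :
    IsCauchyName S (sawPoly mass place) := by
  refine isCauchyName_of_rational h.isPolygonSeq fun s r hsr a h₀ h₁ => ?_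
  rw [h.eval_eq s h₀ h₁, h.eval_eq r h₀ h₁, abs_sub_comm]
  have h₂ := h.sawSum_sub hsr.le h₀
  rw [abs_of_nonneg h₂.1]
  linarith [tw_pos S r]

/-- The variation of the sum of all sawtooth functions is bounded by the sum of the masses. -/
theorem IsSaw.isBV [Model S] (h : IsSaw S mass place) :
    IsBV S (CauchyVal S (sawPoly mass place)) := by
  refine isBV_cauchyVal h.isCauchyName (1 + 1) fun s => ?_
  have hB := toQ_pos.2 (mesh_pos S s)
  have := isDefQ_sawSum h
  have := isDefQ_sawVar h
  have hm := isDefQ_comp₁ h.mass_def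
  simp only [sawPoly_H S]
  change sumQ (mesh s) _ ≤ _
  have key : ∀ n, n ≤ mesh s → sumQ n (fun i => |sawSum mass place s (toQ (i + 1) / toQ (mesh s)) -
      sawSum mass place s (toQ i / toQ (mesh s))|) ≤
      sumQ s (fun r => sawVar mass place r (toQ n / toQ (mesh s))) -
        sumQ s (fun r => sawVar mass place r 0) := by
    refine delta_induction S (fun _ => ?_) fun n ih hn => ?_
    · rw [sumQ_zero (S := S) inferInstance, map_zero, zero_div, sub_self]
    · rw [sumQ_succ (S := S) inferInstance]
      have h₁ := ih ((lt_succ_self n).le.trans hn)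
      have h₂ := (h.abs_sawSum_sub_le (s := s) (n := n) (x := toQ n / toQ (mesh s))
        (y := toQ (n + 1) / toQ (mesh s)) (by rw [mul_div_cancel₀ _ hB.ne'])
        (by rw [mul_div_cancel₀ _ hB.ne', map_add, map_one])
        ((div_le_div_iff_of_pos_right hB).2 (toQ_le.2 (lt_succ_self n).le))).1
      linarith
  refine (key _ le_rfl).trans ?_
  have h₁ : sumQ s (fun r => sawVar mass place r (toQ (mesh s) / toQ (mesh s))) ≤ sumQ s mass := by
    refine sumQ_le_sumQ (S := S) inferInstance h.mass_def s fun i _ => ?_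
    rw [← slope_mul_tw (mass := mass) S i]
    exact mul_le_mul_of_nonneg_left (max_le (tw_pos S _).le (min_le_right _ _)) (h.slope_nonneg i)
  have h₂ : 0 ≤ sumQ s (fun r => sawVar mass place r 0) :=
    sumQ_nonneg (S := S) inferInstance s fun i _ =>
      mul_nonneg (h.slope_nonneg i) (le_max_left _ _)
  have h₃ := h.sum_le s
  rw [map_add, map_one]
  linarith

theorem IsSaw.cauchyVal_rconst [Model S] (h : IsSaw S mass place) {p : Frac M} (hp : p.InUnit) :
    CauchyVal S (sawPoly mass place) (rconst p) (rconst (qrep (sawLim mass place (val p)))) := by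
  have hp' := inUnit_iff.1 hp
  refine (cauchyVal_iff h.isCauchyName).2 ⟨rInUnit_rconst hp, isReal_rconst _, fun s ε hε =>
    Eventually.of_forall fun k => ?_⟩
  rw [val_rconst, val_rconst, val_qrep S, h.eval_eq s hp'.1 hp'.2,
    ← h.sawLim_eq hp'.1 (le_max_right s _), abs_sub_comm]
  have h₂ := h.sawSum_sub (le_max_left s (qcode (val p) + 1)) hp'.1
  rw [abs_of_nonneg h₂.1]
  linarith [tw_pos S (max s (qcode (val p) + 1))]

theorem IsSaw.abs_cauchyVal_sub_le [Model S] (h : IsSaw S mass place) {p : Frac M} (hp : p.InUnit)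
    {y : M → Frac M} (hy : CauchyVal S (sawPoly mass place) (rconst p) y) (k : M) :
    |val (y k) - sawLim mass place (val p)| ≤ tw k := by
  have hp' := inUnit_iff.1 hp
  obtain ⟨-, hy, hy'⟩ := (cauchyVal_iff h.isCauchyName).1 hy
  refine le_of_forall_tw S 2 fun j => ?_
  obtain ⟨l, hl, hkl⟩ := ((hy' (max j (qcode (val p) + 1)) (tw j) (tw_pos S j)).and
    (eventually_ge_atTop k)).exists
  rw [val_rconst, h.eval_eq _ hp'.1 hp'.2, h.sawLim_eq hp'.1 (le_max_right _ _)] at hl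
  have h₁ := hy.abs_sub_le hkl
  have h₂ := tw_le_tw S (le_max_left j (qcode (val p) + 1))
  rw [abs_le] at *
  constructor <;> linarith [h₁.1, h₁.2, hl.1, hl.2]

/-- The sum of all sawtooth functions has rational values at rational points, as only finitely many
sawtooth functions do not vanish there. Hence the cuts of its values are decidable. -/
theorem IsSaw.exists_presents [Model S] (h : IsSaw S mass place) :
    ∃ Z ∈ S, Presents S Z (CauchyVal S (sawPoly mass place)) := by
  have := isDefQ_sawLim h
  obtain ⟨Z, hZ⟩ : ∃ Z : Set M, Z = {z | sawLim mass place (qdec (pfst z)) ≤ qdec (psnd z)} :=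
    ⟨_, rfl⟩
  have hZS : Z ∈ S := by
    rw [hZ]
    exact comprehension S
  have hmem : ∀ p q : Frac M, PairMem Z p q ↔ sawLim mass place (val p) ≤ val q := fun p q => by
    rw [PairMem, hZ, Set.mem_ofPred_eq, pfst_pair S, psnd_pair S, qdec_code S, qdec_code S]
  have hpres : IsRatPres Z := by
    refine ⟨fun p p' q q' _ h₁ h₂ h₃ => ?_, fun p _ => ⟨⟨qrep (sawLim mass place (val p)), ?_⟩,
      qrep (sawLim mass place (val p) - 1), ?_⟩, fun p q q' _ h₁ h₂ => ?_⟩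
    · rw [hmem] at h₃ ⊢
      rwa [← val_eq_val.2 h₁, ← val_eq_val.2 h₂]
    · rw [hmem, val_qrep S]
    · rw [hmem, val_qrep S]
      linarith
    · rw [hmem] at h₂ ⊢
      exact h₂.trans (val_lt_val.2 h₁).le
  refine ⟨Z, hZS, hpres, fun p hp y hy => ?_⟩
  have h₁ := h.abs_cauchyVal_sub_le hp hy
  refine ratVal_of_approx hpres hp hy.2.1 (fun q k hq => ?_)
    fun k => ⟨sawLim mass place (val p), ?_, ?_⟩
  · have h₂ := abs_le.1 (h₁ k)
    rw [QMem, hmem, val_qrep S, val_qrep S] at hq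
    linarith [tw_pos S k, h₂.2]
  · rw [QMem, hmem, val_qrep S, val_qrep S]
  · have h₂ := abs_le.1 (h₁ k)
    linarith [tw_pos S k, h₂.1]

/-! ### Lower bounds for non-decreasing majorants -/

/-- A sawtooth function that is steep in comparison with its predecessors makes the sum of all
sawtooth functions grow on the left halves of its teeth. -/
theorem IsSaw.le_sawLim_sub [Model S] (h : IsSaw S mass place) {s n : M}
    (hs : 2 * sumQ s (slope mass) ≤ slope mass s) (h₀ : left place s ≤ toQ n / toQ (mesh s))
    (h₁ : (toQ n + 1 / 2) / toQ (mesh s) ≤ left place s + tw (level s)) :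
    slope mass s / (4 * toQ (mesh s)) ≤ sawLim mass place ((toQ n + 1 / 2) / toQ (mesh s)) -
      sawLim mass place (toQ n / toQ (mesh s)) := by
  have hB := toQ_pos.2 (mesh_pos S s)
  obtain ⟨x, hx⟩ : ∃ x, x = toQ n / toQ (mesh s) := ⟨_, rfl⟩
  obtain ⟨y, hy⟩ : ∃ y, y = (toQ n + 1 / 2) / toQ (mesh s) := ⟨_, rfl⟩
  rw [← hx] at h₀ ⊢
  rw [← hy] at h₁ ⊢
  have hBx : toQ (mesh s) * x = toQ n := by rw [hx, mul_div_cancel₀ _ hB.ne']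
  have hBy : toQ (mesh s) * y = toQ n + 1 / 2 := by rw [hy, mul_div_cancel₀ _ hB.ne']
  have hx₀ : 0 ≤ x := by
    rw [hx]
    exact div_nonneg (toQ_nonneg n) hB.le
  have hxy : x ≤ y := le_of_mul_le_mul_left (by linarith) hB
  have h₂ : sawLim mass place x = sawSum mass place (s + 1) x :=
    h.sawLim_eq_of_int (k := n + n) hx₀ (by rw [hBx, map_add]; ring)
  have h₃ : sawLim mass place y = sawSum mass place (s + 1) y :=
    h.sawLim_eq_of_int (k := n + n + 1) (hx₀.trans hxy) (by rw [hBy, map_add, map_add, map_one]; ring)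
  obtain ⟨h₄, h₅⟩ := h.abs_sawSum_sub_le (s := s) (n := n) hBx.ge (by linarith) hxy
  have h₆ := neg_le_of_abs_le (h₄.trans h₅)
  have h₇ : saw mass place s x = 0 := saw_of_int S hBx
  have h₈ : saw mass place s y = slope mass s / toQ (mesh s) * (1 / 2) := by
    rw [saw, if_pos ⟨h₀.trans hxy, h₁⟩, tooth_of_le_half S (n := n) (by linarith) hBy.le, hBy]
    ring
  rw [h₂, h₃, h.sawSum_succ, h.sawSum_succ, h₇, h₈]
  have h₉ : y - x = 1 / (2 * toQ (mesh s)) := by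
    rw [hx, hy]
    field_simp
    ring
  rw [h₉] at h₆
  have hB' : 0 < 1 / (2 * toQ (mesh s)) := by positivity
  have h₁₀ := mul_le_mul_of_nonneg_right hs hB'.le
  have h₁₁ : slope mass s / (4 * toQ (mesh s)) = slope mass s * (1 / (2 * toQ (mesh s))) / 2 := by
    field_simp
    norm_num
  have h₁₂ : slope mass s / toQ (mesh s) * (1 / 2) = slope mass s * (1 / (2 * toQ (mesh s))) := by
    field_simp
  rw [h₁₁, h₁₂]
  linarith

/-- Let `R p` be the upper cut of the value at `p` of a non-decreasing function which majorizes the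
slopes of the sum of all sawtooth functions. If the sawtooth function number `s` is steep, this
function increases on the interval which carries it by a quarter of its mass at least. -/
theorem IsSaw.mass_bound [Model S] (h : IsSaw S mass place) {R : Q M → Q M → Prop}
    (hR : ∀ F G : (ℕ → M) → Q M, IsDefQ S F → IsDefQ S G → IsDelta S (fun e => R (F e) (G e)))
    (hmono : ∀ p p' q, 0 ≤ p → p < p' → p' ≤ 1 → R p' q → R p q)
    (hslope : ∀ p p' q d, 0 ≤ p → p < p' → p' ≤ 1 →
      d ≤ sawLim mass place p' - sawLim mass place p → R p' q → R p (q - d))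
    {s : M} (hs : 2 * sumQ s (slope mass) ≤ slope mass s) {q : Q M}
    (hq : R (left place s + tw (level s)) q) : R (left place s) (q - mass s / 4) := by
  have hB := toQ_pos.2 (mesh_pos S s)
  have hB' := hB.ne'
  obtain ⟨A, C, hA, hC⟩ := exists_mesh_mul_left S place s
  have hA' : left place s = toQ A / toQ (mesh s) := by rw [← hA, mul_div_cancel_left₀ _ hB']
  have hC' : tw (level s) = toQ C / toQ (mesh s) := by rw [← hC, mul_div_cancel_left₀ _ hB']
  have hone : left place s + tw (level s) ≤ 1 := by
    have h₁ := toQ_le.2 (succ_le_of_lt (h.lt s))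
    rw [map_add, map_one] at h₁
    have h₂ := toQ_pos.2 (pw_pos S (level s))
    rw [left, tw, ← div_eq_mul_inv, ← one_div, ← add_div, div_le_one h₂]
    exact h₁
  have := hR
  -- the teeth are passed from the right to the left
  have key : ∀ j, j ≤ C → R ((toQ (A + C) - toQ j) / toQ (mesh s))
      (q - toQ j * (slope mass s / (4 * toQ (mesh s)))) := by
    have hδ : IsDefQ S (fun _ => slope mass s / (4 * toQ (mesh s))) := .const _
    have := hR (fun e => (toQ (A + C) - toQ (e 0)) / toQ (mesh s))
      (fun e => q - toQ (e 0) * (slope mass s / (4 * toQ (mesh s)))) inferInstance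
      (IsDefQ.sub (hG := IsDefQ.mul (hG := hδ)))
    refine delta_induction S (fun _ => ?_) fun j ih hj => ?_
    · rwa [map_zero, sub_zero, zero_mul, sub_zero, map_add, add_div, ← hA', ← hC']
    · have ih := ih ((lt_succ_self j).le.trans hj)
      obtain ⟨d, rfl⟩ := exists_add_of_le hj
      have e₁ : toQ (A + (j + 1 + d)) - toQ j = toQ (A + d) + 1 := by
        simp only [map_add, map_one]
        ring
      have e₂ : toQ (A + (j + 1 + d)) - toQ (j + 1) = toQ (A + d) := by
        simp only [map_add, map_one]
        ring
      have e₃ : q - toQ (j + 1) * (slope mass s / (4 * toQ (mesh s))) =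
          q - toQ j * (slope mass s / (4 * toQ (mesh s))) - slope mass s / (4 * toQ (mesh s)) := by
        rw [map_add, map_one]
        ring
      rw [e₁] at ih
      rw [e₂, e₃]
      have h₁ : toQ (A + d) / toQ (mesh s) < (toQ (A + d) + 1 / 2) / toQ (mesh s) :=
        (div_lt_div_iff_of_pos_right hB).2 (by linarith)
      have h₂ : (toQ (A + d) + 1 / 2) / toQ (mesh s) < (toQ (A + d) + 1) / toQ (mesh s) :=
        (div_lt_div_iff_of_pos_right hB).2 (by linarith)
      have h₃ : (toQ (A + d) + 1) / toQ (mesh s) ≤ left place s + tw (level s) := by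
        rw [hA', hC', ← add_div, div_le_div_iff_of_pos_right hB]
        simp only [map_add, map_one]
        linarith [toQ_nonneg j]
      have h₄ : 0 ≤ toQ (A + d) / toQ (mesh s) := div_nonneg (toQ_nonneg _) hB.le
      have h₅ : left place s ≤ toQ (A + d) / toQ (mesh s) := by
        rw [hA', div_le_div_iff_of_pos_right hB, toQ_le]
        exact le_self_add
      exact hslope _ _ _ _ h₄ h₁ (h₂.le.trans (h₃.trans hone))
        (h.le_sawLim_sub hs h₅ (h₂.le.trans h₃))
        (hmono _ _ _ (h₄.trans h₁.le) h₂ (h₃.trans hone) ih)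
  have h₁ := key C le_rfl
  have h₂ : toQ C * (slope mass s / (4 * toQ (mesh s))) = mass s / 4 := by
    rw [← slope_mul_tw (mass := mass) S s, hC']
    field_simp
  rwa [h₂, map_add, add_sub_cancel_right, ← hA'] at h₁

end SawSum

/-! ### The sawtooth functions of a tree -/

section TreeSaw

variable {M : Type u} [Numbers M] {S : Set (Set M)} {mass : M → Q M} {place : M → M}

/-- Sufficiently large masses make the sawtooth functions steep, as the widths of the intervals
decrease rapidly. -/
theorem IsSaw.two_mul_sumQ_slope_le [Model S] (h : IsSaw S mass place) {s : M} (hs : 0 < s)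
    (hm : tw s ≤ mass s) : 2 * sumQ s (slope mass) ≤ slope mass s := by
  have := isDefQ_slope h
  have h₁ : sumQ s (slope mass) ≤ sumQ s mass * toQ (pw (s * s)) := by
    have := isDefQ_comp₁ h.mass_def
    rw [← sumQ_mul h.mass_def]
    refine sumQ_le_sumQ (S := S) inferInstance inferInstance s fun i hi => ?_
    refine mul_le_mul_of_nonneg_left (toQ_le.2 (pw_le_pw S ?_)) (h.nonneg i)
    have := succ_le_of_lt hi
    exact mul_le_mul this this zero_le zero_le
  have hpw := toQ_pos.2 (pw_pos S (s * s))
  have h₂ := mul_le_mul_of_nonneg_right (h.sum_le s) hpw.le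
  have h₃ : 4 * toQ (pw (s * s)) ≤ tw s * toQ (pw (level s)) := by
    obtain ⟨t, rfl⟩ := (eq_zero_or_succ S s).resolve_left hs.ne'
    have h₄ : level (t + 1) = (t + 1) * (t + 1) + (t + 1) + (t + 1 + 1) := by
      unfold level
      ring
    have h₅ := (toQ_pos.2 (pw_pos S (t + 1))).ne'
    have h₆ : (1 : Q M) ≤ toQ (pw t) := by
      rw [← map_one toQ, toQ_le]
      have := succ_le_of_lt (pw_pos S t)
      rwa [zero_add] at this
    have h₇ : toQ (pw (t + 1 + 1)) = 4 * toQ (pw t) := by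
      rw [pw_succ S, pw_succ S]
      simp only [map_add]
      ring
    rw [h₄, pw_add S, pw_add S, map_mul, map_mul, h₇, tw]
    have h₈ : (toQ (pw (t + 1)))⁻¹ * (toQ (pw ((t + 1) * (t + 1))) * toQ (pw (t + 1)) *
        (4 * toQ (pw t))) = 4 * toQ (pw ((t + 1) * (t + 1))) * toQ (pw t) := by
      field_simp
    rw [h₈]
    exact le_mul_of_one_le_right (by positivity) h₆
  have h₄ := mul_le_mul_of_nonneg_right hm (toQ_nonneg (pw (level s)))
  rw [slope]
  linarith

theorem le_sumQ [Model S] {F : M → Q M} (hF : IsDefQ S (fun e => F (e 0))) (h : ∀ i, 0 ≤ F i)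
    {i n : M} (hi : i < n) : F i ≤ sumQ n F := by
  have h₁ := sumQ_mono hF (succ_le_of_lt hi) fun j _ _ => h j
  rw [sumQ_succ hF] at h₁
  linarith [sumQ_nonneg hF i fun j _ => h j]

theorem sumQ_tw_le [Model S] (n : M) : sumQ n tw ≤ 2 - 2 * tw n := by
  refine delta_induction S (P := fun n : M => sumQ n tw ≤ 2 - 2 * tw n) ?_ (fun n ih => ?_) n
  · rw [sumQ_zero (S := S) inferInstance, tw_zero S]
    norm_num
  · rw [sumQ_succ (S := S) inferInstance, tw_succ S]
    linarith

variable {T : Set M}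

open Classical in
/-- The sum of the weights `2 ^ (-σ)` of those strings `σ < s` whose extensions in the tree `T` have
the maximal length `s`. -/
noncomputable def deathMass (T : Set M) (s : M) : Q M :=
  sumQ s (fun σ => if Ext T σ s ∧ ¬ Ext T σ (s + 1) then tw σ else 0)

/-- The least string of the length `level s` in the tree `T`. -/
noncomputable def levelString (T : Set M) (s : M) : M :=
  bleast (pw (level s + 1)) (fun τ => τ ∈ T ∧ len τ = level s)

theorem isDefQ_deathMass [Model S] (hTS : T ∈ S) (f : (ℕ → M) → M) [hf : IsDef S f] :
    IsDefQ S (fun e => deathMass T (f e)) := by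
  have := Fact.mk hTS
  have := hf.comp (σ := fun e n => e (n + 1)) (fun i => .var (i + 1))
  unfold deathMass
  infer_instance

theorem isDef_levelString [Model S] (hTS : T ∈ S) (f : (ℕ → M) → M) [hf : IsDef S f] :
    IsDef S (fun e => levelString T (f e)) := by
  have := Fact.mk hTS
  have := hf.comp (σ := fun e n => e (n + 1)) (fun i => .var (i + 1))
  unfold levelString
  infer_instance

theorem IsBinTree.levelString_spec [Model S] (hT : IsBinTree T) (hTS : T ∈ S)
    (hinf : IsInfinite T) (s : M) : levelString T s ∈ T ∧ len (levelString T s) = level s := by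
  have := Fact.mk hTS
  obtain ⟨τ, hτ, hlen⟩ := hT.exists_len hTS hinf (level s)
  have h := lt_pw_len S τ
  rw [hlen] at h
  exact (bleast_spec S (P := fun τ => τ ∈ T ∧ len τ = level s) (a := τ) ⟨hτ, hlen⟩ h.le).1

theorem le_deathMass [Model S] (hTS : T ∈ S) {σ s : M} (hσ : σ < s) (h : Ext T σ s)
    (h' : ¬ Ext T σ (s + 1)) : tw σ ≤ deathMass T s := by
  classical
  have := Fact.mk hTS
  have h₁ := le_sumQ (S := S) (F := fun σ => if Ext T σ s ∧ ¬ Ext T σ (s + 1) then tw σ else 0)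
    (by infer_instance) (fun i => by
      split_ifs
      exacts [(tw_pos S i).le, le_rfl]) hσ
  rw [if_pos ⟨h, h'⟩] at h₁
  rw [deathMass]
  convert h₁

/-- The masses of the levels of an infinite tree together with the least strings on these levels
satisfy the requirements on the masses and places of sawtooth functions. The sum of the masses is
bounded since every string dies at most once. -/
theorem IsBinTree.isSaw [Model S] (hT : IsBinTree T) (hTS : T ∈ S) (hinf : IsInfinite T) :
    IsSaw S (deathMass T) (fun s => msub (levelString T s) (pw (level s))) := by
  classical
  have := Fact.mk hTS
  have := isDefQ_deathMass hTS
  have := isDef_levelString hTS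
  refine ⟨inferInstance, inferInstance, fun s => ?_, fun n => ?_, fun s => ?_⟩
  · refine sumQ_nonneg (S := S) inferInstance s fun i _ => ?_
    split_ifs
    exacts [(tw_pos S i).le, le_rfl]
  · -- every string contributes at most once
    have key : sumQ n (deathMass T) ≤ sumQ n (fun σ => if Ext T σ n then 0 else tw σ) := by
      refine delta_induction S (P := fun n => sumQ n (deathMass T) ≤
        sumQ n (fun σ => if Ext T σ n then 0 else tw σ)) ?_ (fun n ih => ?_) n
      · rw [sumQ_zero (S := S) inferInstance, sumQ_zero (S := S) inferInstance]
      · rw [sumQ_succ (S := S) inferInstance, sumQ_succ (S := S) inferInstance]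
        have h₁ : 0 ≤ if Ext T n (n + 1) then 0 else tw n := by
          split_ifs
          exacts [le_rfl, (tw_pos S n).le]
        have h₂ := sumQ_le_sumQ (S := S)
          (F := fun σ => (if Ext T σ n then 0 else tw σ) +
            if Ext T σ n ∧ ¬ Ext T σ (n + 1) then tw σ else 0)
          (G := fun σ => if Ext T σ (n + 1) then 0 else tw σ) (by infer_instance)
          (by infer_instance) n fun σ hσ => ?_
        · rw [sumQ_add (S := S) inferInstance inferInstance] at h₂
          have h₃ : deathMass T n =
            sumQ n (fun σ => if Ext T σ n ∧ ¬ Ext T σ (n + 1) then tw σ else 0) := by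
            rw [deathMass]
          linarith
        · have h₃ : Ext T σ (n + 1) → Ext T σ n := fun h => h.of_le hT hTS (lt_succ_self n).le
            ((len_le_self S σ).trans hσ.le)
          by_cases h₄ : Ext T σ n <;> by_cases h₅ : Ext T σ (n + 1)
          · simp [h₄, h₅]
          · simp [h₄, h₅]
          · exact absurd (h₃ h₅) h₄
          · simp [h₄, h₅]
    have h₁ := sumQ_le_sumQ (S := S) (F := fun σ => if Ext T σ n then 0 else tw σ) (G := tw)
      (by infer_instance) (by infer_instance) n fun i _ => by
        split_ifs
        exacts [(tw_pos S i).le, le_rfl]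
    linarith [sumQ_tw_le (S := S) n, tw_pos S n]
  · obtain ⟨h₁, h₂⟩ := hT.levelString_spec hTS hinf s
    have h₃ := lt_pw_len S (levelString T s)
    have h₄ := pw_len_le S (hT.1 _ h₁)
    rw [h₂] at h₃ h₄
    obtain ⟨d, hd⟩ := exists_add_of_le h₄
    rw [hd] at h₃ ⊢
    rw [pw_succ S] at h₃
    rw [add_comm, add_msub S]
    exact lt_of_add_lt_add_left h₃

/-! ### The intervals of strings -/

/-- The left end of the dyadic interval that belongs to the string `τ`. -/
noncomputable def leftEnd (τ : M) : Q M := toQ τ * tw (len τ) - 1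

/-- The right end of the dyadic interval that belongs to the string `τ`. -/
noncomputable def rightEnd (τ : M) : Q M := (toQ τ + 1) * tw (len τ) - 1

instance IsDefQ.leftEnd [Model S] {f : (ℕ → M) → M} [hf : IsDef S f] :
    IsDefQ S (fun e => leftEnd (f e)) := by
  unfold SOA.leftEnd
  infer_instance

instance IsDefQ.rightEnd [Model S] {f : (ℕ → M) → M} [hf : IsDef S f] :
    IsDefQ S (fun e => rightEnd (f e)) := by
  unfold SOA.rightEnd
  infer_instance

theorem leftEnd_nonneg (S : Set (Set M)) [Model S] {τ : M} (hτ : τ ≠ 0) : 0 ≤ leftEnd τ := by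
  have h := toQ_le.2 (pw_len_le S hτ)
  rw [leftEnd, sub_nonneg, tw, ← div_eq_mul_inv, one_le_div (toQ_pos.2 (pw_pos S _))]
  exact h

theorem rightEnd_le (S : Set (Set M)) [Model S] (τ : M) : rightEnd τ ≤ 1 := by
  have h := toQ_le.2 (succ_le_of_lt (lt_pw_len S τ))
  rw [pw_succ S, map_add, map_add, map_one] at h
  rw [rightEnd, tw, ← div_eq_mul_inv, sub_le_iff_le_add, div_le_iff₀ (toQ_pos.2 (pw_pos S _))]
  linarith

theorem leftEnd_lt_rightEnd (S : Set (Set M)) [Model S] (τ : M) : leftEnd τ < rightEnd τ := by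
  have := tw_pos S (len τ)
  rw [leftEnd, rightEnd]
  linarith

theorem rightEnd_eq (τ : M) : rightEnd τ = leftEnd τ + tw (len τ) := by
  rw [leftEnd, rightEnd]
  ring

theorem leftEnd_double (S : Set (Set M)) [Model S] {τ : M} (hτ : τ ≠ 0) :
    leftEnd (τ + τ) = leftEnd τ := by
  rw [leftEnd, leftEnd, (len_double S hτ).1, tw_succ S, map_add]
  ring

theorem rightEnd_double (S : Set (Set M)) [Model S] {τ : M} (hτ : τ ≠ 0) :
    rightEnd (τ + τ) = leftEnd (τ + τ + 1) := by
  rw [leftEnd, rightEnd, (len_double S hτ).1, (len_double S hτ).2, map_add _ (τ + τ), map_one]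

theorem rightEnd_double_succ (S : Set (Set M)) [Model S] {τ : M} (hτ : τ ≠ 0) :
    rightEnd (τ + τ + 1) = rightEnd τ := by
  rw [rightEnd, rightEnd, (len_double S hτ).2, tw_succ S, map_add, map_add, map_one]
  ring

/-- The sawtooth function number `s` lives on the interval of the string `levelString T s`. -/
theorem IsBinTree.left_eq [Model S] (hT : IsBinTree T) (hTS : T ∈ S) (hinf : IsInfinite T) (s : M) :
    left (fun s => msub (levelString T s) (pw (level s))) s = leftEnd (levelString T s) := by
  obtain ⟨h₁, h₂⟩ := hT.levelString_spec hTS hinf s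
  have h₄ := pw_len_le S (hT.1 _ h₁)
  have h₅ := (toQ_pos.2 (pw_pos S (level s))).ne'
  rw [left, leftEnd, h₂]
  rw [h₂] at h₄
  obtain ⟨d, hd⟩ := exists_add_of_le h₄
  rw [hd, add_comm, add_msub S, map_add, tw]
  field_simp
  ring

end TreeSaw

/-! ### From majorants to paths -/

section Reversal

variable {M : Type u} [Numbers M] {S : Set (Set M)} {T : Set M}

/-- The upper cuts of `g(p) + p`, where `g` is a non-decreasing function that majorizes the slopes
of `f`. Adding the identity makes the inclusions between the cuts exact, without an exception for
the infimum of a cut. -/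
theorem exists_cuts_of_hasJordan [Model S] {f : Q M → Q M} {V : Frac M → (M → Frac M) → Prop}
    (hV : ∀ p : Frac M, p.InUnit → V p (rconst (qrep (f (val p))))) (h : HasJordan S V) :
    ∃ R : Q M → Q M → Prop,
      (∀ F G : (ℕ → M) → Q M, IsDefQ S F → IsDefQ S G → IsDelta S (fun e => R (F e) (G e))) ∧
      (∀ p p' q, 0 ≤ p → p < p' → p' ≤ 1 → R p' q → R p q) ∧
      (∀ p p' q d, 0 ≤ p → p < p' → p' ≤ 1 → d ≤ f p' - f p → R p' q → R p (q - d)) ∧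
      (∀ p q q', 0 ≤ p → p ≤ 1 → q ≤ q' → R p q → R p q') ∧
      (∀ p, 0 ≤ p → p ≤ 1 → ∃ q, R p q) ∧ ∃ c, ∀ p, 0 ≤ p → p ≤ 1 → ¬ R p c := by
  obtain ⟨G, hG, hpres, hmono, hslope⟩ := h
  have := Fact.mk hG
  obtain ⟨Y, -, -, -, hY⟩ := hpres.exists_approx hG
  have hcut : ∀ p p' q q' d, 0 ≤ p → p < p' → p' ≤ 1 → (d ≤ 0 ∨ d ≤ f p' - f p) → QMem G p' q →
      ¬ QMem G p q' → q' + d ≤ q := by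
    intro p p' q q' d h₀ h₁ h₂ hd hq hq'
    have hp := inUnit_qrep (S := S) h₀ (h₁.le.trans h₂)
    have hp' := inUnit_qrep (S := S) (h₀.trans h₁.le) h₂
    have hlt : qrep p < qrep p' := by rwa [← val_lt_val, val_qrep S, val_qrep S]
    have h₃ := hY _ hp
    have h₄ := hY _ hp'
    refine le_of_forall_tw S 4 fun k => ?_
    have h₅ := h₃.le_of_not_qMem hpres (q := q') (by rwa [val_qrep S]) (k + 1)
    have h₆ := h₄.le_of_qMem hpres (q := q) (by rwa [val_qrep S]) (k + 1)
    have h₇ := tw_le_tw S (lt_succ_self k).le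
    have h₈ := tw_pos S k
    rcases hd with hd | hd
    · have h₉ := rLe_iff.1 (hmono _ _ hp hp' hlt _ _ h₃ h₄) (k + 1)
      linarith
    · have h₉ := rLe_iff.1 (hslope _ _ hp hp' hlt _ _ _ _ (hV _ hp) (hV _ hp') h₃ h₄) k
      rw [val_rsub, val_rsub, val_rconst, val_rconst] at h₉
      simp only [val_qrep S] at h₅ h₆ h₉
      linarith
  have hmono' : ∀ p p' q, 0 ≤ p → p < p' → p' ≤ 1 → QMem G p' (q - p') → QMem G p (q - p) := by
    intro p p' q h₀ h₁ h₂ h₃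
    by_contra h₄
    linarith [hcut p p' _ _ 0 h₀ h₁ h₂ (Or.inl le_rfl) h₃ h₄]
  refine ⟨fun p q => QMem G p (q - p), fun F G _ _ => inferInstance, hmono',
    fun p p' q d h₀ h₁ h₂ hd h₃ => ?_, fun p q q' h₀ h₁ hq h₂ => ?_, fun p h₀ h₁ => ?_, ?_⟩
  · by_contra h₄
    linarith [hcut p p' _ _ d h₀ h₁ h₂ (Or.inr hd) h₃ h₄]
  · exact hpres.qMem_of_le (S := S) h₀ h₁ (by linarith) h₂
  · obtain ⟨q, hq⟩ := (hpres.exists_qMem (S := S) h₀ h₁).1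
    exact ⟨q + p, by rwa [← add_sub_cancel_right q p] at hq⟩
  · obtain ⟨c, hc⟩ := (hpres.exists_qMem (S := S) le_rfl zero_le_one).2
    refine ⟨c, fun p h₀ h₁ h₂ => hc ?_⟩
    rcases h₀.lt_or_eq with hlt | rfl
    · have := hmono' 0 p c le_rfl hlt h₁ h₂
      rwa [sub_zero] at this
    · rwa [sub_zero] at h₂

/-- The increments of a majorant of the sum of the sawtooth functions of a tree, rounded to multiples
of `2 ^ (-σ - 2)`, are masses as required by `exists_path_of_masses`: where `σ` dies, the majorant
increases by `2 ^ (-σ) / 4` at least on the interval of a string of the tree. -/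
theorem exists_path_of_jordanQEffCont [Model S] (h : JordanQEffCont S) (hTS : T ∈ S)
    (hT : IsBinTree T) (hinf : IsInfinite T) : ∃ Z ∈ S, IsPath S T Z := by
  have hsaw := hT.isSaw hTS hinf
  obtain ⟨R, hRd, hmono, hslope, hup, hex, c, hc⟩ := exists_cuts_of_hasJordan
    (fun p hp => hsaw.cauchyVal_rconst hp) (h _ hsaw.isCauchyName hsaw.isBV hsaw.exists_presents)
  -- the values `g(p) + p - c` as multiples of `2 ^ (-σ - 2)`, rounded up
  obtain ⟨α, hα⟩ : ∃ α : M → Q M → M, α = fun σ p =>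
      least (fun a => R p (toQ a * tw (σ + 1 + 1) + c) ∨ ¬ (0 ≤ p ∧ p ≤ 1)) := ⟨_, rfl⟩
  have hαex : ∀ σ p, ∃ a, R p (toQ a * tw (σ + 1 + 1) + c) ∨ ¬ (0 ≤ p ∧ p ≤ 1) := by
    intro σ p
    by_cases hp : 0 ≤ p ∧ p ≤ 1
    · obtain ⟨q, hq⟩ := hex p hp.1 hp.2
      obtain ⟨a, ha⟩ := exists_lt_toQ ((q - c) / tw (σ + 1 + 1))
      rw [div_lt_iff₀ (tw_pos S _)] at ha
      exact ⟨a, Or.inl (hup p q _ hp.1 hp.2 (by linarith) hq)⟩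
    · exact ⟨0, Or.inr hp⟩
  have hαd : ∀ F : (ℕ → M) → Q M, IsDefQ S F → IsDef S (fun e => α (e 0) (F e)) := by
    intro F hF
    rw [hα]
    have hF' := hF.comp (σ := fun e n => e (n + 1)) (fun i => .var (i + 1))
    have := hRd _ (fun e => toQ (e 0) * tw (e 1 + 1 + 1) + c) hF' inferInstance
    exact IsDef.least (P := fun a e => R (F e) (toQ a * tw (e 0 + 1 + 1) + c) ∨
      ¬ (0 ≤ F e ∧ F e ≤ 1)) inferInstance fun e => hαex _ _
  have hRa : ∀ σ p, IsDelta S (fun e : ℕ → M => R p (toQ (e 0) * tw (σ + 1 + 1) + c)) :=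
    fun σ p => hRd _ _ inferInstance inferInstance
  have hα₁ : ∀ σ p, 0 ≤ p → p ≤ 1 → R p (toQ (α σ p) * tw (σ + 1 + 1) + c) := by
    intro σ p h₀ h₁
    have := hRa σ p
    rw [hα]
    exact (least_spec S (P := fun a => R p (toQ a * tw (σ + 1 + 1) + c) ∨ ¬ (0 ≤ p ∧ p ≤ 1))
      (hαex σ p)).resolve_right (not_not.2 ⟨h₀, h₁⟩)
  have hα₂ : ∀ σ p a, R p (toQ a * tw (σ + 1 + 1) + c) → α σ p ≤ a := by
    intro σ p a ha
    have := hRa σ p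
    rw [hα]
    exact least_le S (P := fun a => R p (toQ a * tw (σ + 1 + 1) + c) ∨ ¬ (0 ≤ p ∧ p ≤ 1))
      (Or.inl ha)
  refine exists_path_of_masses hT hTS hinf (L := fun σ τ => α σ (leftEnd τ))
    (R := fun σ τ => α σ (rightEnd τ)) (fun σ => ⟨fun τ hτ => ?_, fun τ hτ => ?_, fun τ hτ => ?_,
      fun τ hτ => ?_⟩) (hαd _ inferInstance) (hαd _ inferInstance) fun σ s hσ hext hext' => ?_
  · rw [leftEnd_double S hτ]
  · rw [rightEnd_double S hτ]
  · rw [rightEnd_double_succ S hτ]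
  · have h₀ := leftEnd_nonneg S hτ
    have h₁ := leftEnd_lt_rightEnd S τ
    have h₂ := rightEnd_le S τ
    exact hα₂ _ _ _ (hmono _ _ _ h₀ h₁ h₂ (hα₁ _ _ (h₀.trans h₁.le) h₂))
  · obtain ⟨hτ, hlen⟩ := hT.levelString_spec hTS hinf s
    have hleft := hT.left_eq hTS hinf s
    have hτ₀ := hT.1 _ hτ
    refine ⟨levelString T s, hτ, ?_, ?_⟩
    · rw [hlen, level, mul_add, mul_one]
      exact (lt_succ_self s).le.trans le_add_self
    · have h₀ := leftEnd_nonneg S hτ₀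
      have h₁ := leftEnd_lt_rightEnd S (levelString T s)
      have h₂ := rightEnd_le S (levelString T s)
      have h₃ := le_deathMass hTS hσ hext hext'
      have h₄ := hsaw.two_mul_sumQ_slope_le (pos_of_gt hσ) ((tw_le_tw S hσ.le).trans h₃)
      have h₅ := hα₁ σ _ (h₀.trans h₁.le) h₂
      have h₆ := hsaw.mass_bound hRd hmono hslope h₄
        (q := toQ (α σ (rightEnd (levelString T s))) * tw (σ + 1 + 1) + c) (by
          rwa [hleft, ← hlen, ← rightEnd_eq])
      rw [hleft] at h₆
      have h₇ : tw (σ + 1 + 1) = tw σ / 4 := by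
        rw [tw_succ S, tw_succ S]
        ring
      have h₈ := hup _ _ (toQ (α σ (rightEnd (levelString T s))) * tw (σ + 1 + 1) + c -
        tw (σ + 1 + 1)) h₀ (h₁.le.trans h₂) (by linarith) h₆
      rcases eq_zero_or_succ S (α σ (rightEnd (levelString T s))) with h₉ | ⟨b, h₉⟩
      · rw [h₉, map_zero, zero_mul, zero_add] at h₈
        exact absurd (hup _ _ c h₀ (h₁.le.trans h₂) (by linarith [tw_pos S (σ + 1 + 1)]) h₈)
          (hc _ h₀ (h₁.le.trans h₂))
      · rw [h₉] at h₈ ⊢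
        refine (hα₂ σ _ b ?_).trans_lt (lt_succ_self b)
        refine hup _ _ _ h₀ (h₁.le.trans h₂) (le_of_eq ?_) h₈
        rw [map_add, map_one]
        ring

end Reversal

end SOA

theorem mainTheorem2 {M : Type*} [Zero M] [One M] [Add M] [Mul M] [LT M] (S : Set (Set M))
    (hS : SOA.RCA0 S) :
    List.TFAE [SOA.WKL0 S, SOA.JordanQ S, SOA.JordanQCont S, SOA.JordanQEffCont S] := by
  let := hS.numbers
  have : SOA.Model S := ⟨hS⟩
  tfae_have 1 → 2 := fun h => SOA.jordanQ_of_wkl h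
  tfae_have 1 → 3 := fun h => SOA.jordanQCont_of_wkl h
  tfae_have 2 → 4 := fun h => SOA.jordanQEffCont_of_jordanQ h
  tfae_have 3 → 4 := fun h => SOA.jordanQEffCont_of_jordanQCont h
  tfae_have 4 → 1 := fun h =>
    ⟨hS, fun _ hT hbin hinf => SOA.exists_path_of_jordanQEffCont h hT hbin hinf⟩
  tfae_finish
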